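/- Let $p$ be a prime, $q$ a power of $p$ ($q>1$), and let $G$ be $\mathrm{GL}_2$ or $\mathrm{PGL}_2$ over $\overline{\mathbb F}_q$ with its standard (split) $\mathbb F_q$-structure and Frobenius $F$, so that $G^F$ is $\mathrm{GL}_2(\mathbb F_q)$, resp. $\mathrm{PGL}_2(\mathbb F_q)$. Let $T$ be the diagonal torus and $W$ the Weyl group of $G$ (so $|W|=2$), and let $U^F\cong\mathbb F_q$ be the upper triangular unipotent subgroup of $G^F$. Let $G^*$ be the dual group, so that $G^{*F^*}$ is $\mathrm{GL}_2(\mathbb F_q)$, resp. $\mathrm{SL}_2(\mathbb F_q)$, and let $T^\vee$ be the diagonal torus of the Langlands dual $G^\vee=\mathrm{GL}_2$, resp. $\mathrm{SL}_2$. Fix an isomorphism $\iota:\overline{\mathbb F}_q^\times\cong(\mathbb Q/\mathbb Z)_{p'}$, an injective homomorphism $(\mathbb Q/\mathbb Z)_{p'}\hookrightarrow\overline{\mathbb Q}^\times$ with composite $\kappa:\overline{\mathbb F}_q^\times\hookrightarrow\overline{\mathbb Q}^\times$, and a non-trivial character $\psi:U^F\to\overline{\mathbb Q}^\times$. Put: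 * $\mathsf E_G$ = the center of $\mathrm{End}_{\mathbb Z[G^F]}(\mathrm{Ind}_{U^F}^{G^F}\mathcal F_0)$, where $\mathcal F_0\subset\mathbb Z[U^F]$ is the module of functions $U^F\to\mathbb Z$ with sum $0$; * $\mathsf B_{G^\vee}=\mathbb Z[X(T^\vee)]^W/I$, where $I$ is the ideal generated by all $F^\vee f-f$, $f\in\mathbb Z[X(T^\vee)]^W$, with $F^\vee$ induced by multiplication by $q$ on $X(T^\vee)$; * $\mathsf K_{G^*}$ = the Grothendieck ring of finite-dimensional representations of $G^{*F^*}$ over $\overline{\mathbb F}_q$. For a commutative ring $\Lambda$ and a ring $A$ write $\Lambda A=\Lambda\otimes_{\mathbb Z}A$. For a semisimple (equivalently, $p$-regular) element $x\in G^{*F^*}$, let $\rho_{\psi,[x]}$ be the irreducible constituent of $\mathrm{Ind}_{U^F}^{G^F}\psi$ over $\overline{\mathbb Q}$ which lies in the rational Lusztig series of $[x]$. Then there are unique isomorphisms of $\mathbb Z[\frac1{p|W|}]$-algebras $$\mathbb Z[\tfrac1{p|W|}]\mathsf E_G\;\simeq\;\mathbb Z[\tfrac1{p|W|}]\mathsf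 B_{G^\vee}\;\simeq\;\mathbb Z[\tfrac1{p|W|}]\mathsf K_{G^*}$$ which over $\overline{\mathbb Q}$ are the canonical identifications with algebras of functions on semisimple classes, in the following sense. The class of $f\in\mathbb Z[X(T^\vee)]^W$ in $\mathsf B_{G^\vee}$ (resp. the class $[M]\in\mathsf K_{G^*}$) corresponds to the element of $\mathbb Z[\frac1{p|W|}]\mathsf E_G$ which, for every semisimple $x\in G^{*F^*}$, acts on the $\rho_{\psi,[x]}$-isotypic part of $\overline{\mathbb Q}\,\mathrm{Ind}_{U^F}^{G^F}\mathcal F_0$ as the scalar $f(x)$, the value of $f$ at the point of $(T^\vee/\!/W)(\overline{\mathbb Q})$ given via $\kappa$ by the eigenvalues of $x$ (resp. as the scalar $(\mathrm{br}\,M)(x)$, the Brauer character of $M$ at $x$ with respect to $\kappa$). Moreover, for $A=\mathsf E_G,\mathsf B_{G^\vee},\mathsf K_{G^*}$ the natural maps $\mathbb Z[\frac1p]A\to\mathbb Z[\frac1{p|W|}]A$ are injective, and the above isomorphisms restrict to isomorphisms of $\mathbb Z[\frac1p]$-algebras $$\mathbb Z[\tfrac1p]\mathsf E_G\;\simeq\;\mathbb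 Z[\tfrac1p]\mathsf B_{G^\vee}\;\simeq\;\mathbb Z[\tfrac1p]\mathsf K_{G^*}.$$ -/

import Mathlib

open CategoryTheory TensorProduct

noncomputable section

namespace GelfandGraevGLTwo

/-! ### Coefficients and roots of unity -/

/-- The field of algebraic numbers. -/
abbrev Qbar : Type := AlgebraicClosure ℚ

/-- The ring `ℤ[1/n]`, as a subring of `ℚ`. -/
def ZInv (n : ℕ) : Subalgebra ℤ ℚ := Algebra.adjoin ℤ {(n : ℚ)⁻¹}

theorem ZInv_le_ZInv_mul (n m : ℕ) (hm : m ≠ 0) : ZInv n ≤ ZInv (n * m) := by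
  have h : (n : ℚ)⁻¹ = (m : ℚ) * (((n * m : ℕ) : ℚ)⁻¹) := by
    have : (m : ℚ) ≠ 0 := by exact_mod_cast hm
    push_cast
    rw [mul_inv, mul_comm, mul_assoc, inv_mul_cancel₀ this, mul_one]
  refine Algebra.adjoin_le (Set.singleton_subset_iff.mpr ?_)
  rw [h]
  exact mul_mem (natCast_mem (ZInv (n * m)) m)
    (Algebra.subset_adjoin (Set.mem_singleton _))

/-- For a `ℤ`-algebra `A`, the canonical map `ℤ[1/n]A → ℤ[1/2n]A`, where `ΛA := Λ ⊗ A`. -/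
def enlarge (n : ℕ) (A : Type*) [Semiring A] [Algebra ℤ A] :
    (ZInv n ⊗[ℤ] A) →ₐ[ℤ] (ZInv (n * 2) ⊗[ℤ] A) :=
  Algebra.TensorProduct.map (Subalgebra.inclusion (ZInv_le_ZInv_mul n 2 two_ne_zero))
    (AlgHom.id ℤ A)

/-- The prime-to-`p` part `(ℚ/ℤ)_{p'}` of `ℚ/ℤ`. -/
def QModZ (p : ℕ) : AddSubgroup (AddCircle (1 : ℚ)) where
  carrier := {x | ∃ n : ℕ, n.Coprime p ∧ n • x = 0}
  zero_mem' := ⟨1, Nat.coprime_one_left p, smul_zero 1⟩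
  add_mem' := by
    rintro x y ⟨n, hn, hx⟩ ⟨m, hm, hy⟩
    refine ⟨n * m, Nat.Coprime.mul_left hn hm, ?_⟩
    rw [smul_add, mul_smul, mul_smul, smul_comm n m x, hx, hy, smul_zero, smul_zero, add_zero]
  neg_mem' := by
    rintro x ⟨n, hn, hx⟩
    exact ⟨n, hn, by rw [smul_neg, hx, neg_zero]⟩

/-- The embedding `κ = j ∘ ι : kˣ → Qbarˣ` obtained from an identification `ι` of `kˣ` with
`(ℚ/ℤ)_{p'}` and an embedding `j` of `(ℚ/ℤ)_{p'}` into `Qbarˣ`. -/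
def kappa {p : ℕ} {k : Type} [Field k] (ι : Additive kˣ ≃+ QModZ p)
    (j : QModZ p →+ Additive Qbarˣ) : kˣ →* Qbarˣ :=
  MonoidHom.toAdditive.symm (j.comp ι.toAddMonoidHom)

/-! ### The algebra `E` of a rank one group

`H` is the finite group `G^F`, and `u : F → H` parametrizes the group `U^F`, where `U` is the
root subgroup of the unique positive root (so `U_• = 1` and `U^F` is isomorphic to `𝔽_q`). -/

section GelfandGraev

variable {F : Type} [Field F] [Fintype F] {H : Type} [Group H]

/-- The `ℤ[G^F]`-module `Ind_{U^F}^{G^F} 𝓕₀`, where `𝓕₀ ⊆ ℤ[U^F]` is the `ℤ[U^F]`-module of the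
functions on `U^F` with sum zero. As `ℤ[G^F]` is a free right module over `ℤ[U^F]`, the
induced module is the left ideal of `ℤ[G^F]` generated by `𝓕₀`. -/
def indF0 (u : Multiplicative F →* H) : Submodule (MonoidAlgebra ℤ H) (MonoidAlgebra ℤ H) :=
  Submodule.span (MonoidAlgebra ℤ H)
    {f | ∃ c : F → ℤ, ∑ a, c a = 0 ∧
      f = ∑ a, c a • MonoidAlgebra.of ℤ H (u (Multiplicative.ofAdd a))}

/-- The `ℤ`-algebra `E_G`, for `G` with connected center `Z`: the center of
`End_{ℤ[G^F]}(Ind_{U^F}^{G^F} 𝓕₀)`. (In general one takes the invariants of this center under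
`H¹(F, Z)`, which is the trivial group when `Z` is connected.) -/
abbrev EAlg (u : Multiplicative F →* H) : Type :=
  ↥(Subalgebra.center ℤ (Module.End (MonoidAlgebra ℤ H) (indF0 u)))

/-- For `h ∈ ℤ[1/n]E_G` and `m ∈ Ind 𝓕₀`, the element `h(m)` of `Qbar[G^F]`. -/
def act (u : Multiplicative F →* H) (n : ℕ) (m : indF0 u) :
    (ZInv n ⊗[ℤ] EAlg u) →ₗ[ℤ] MonoidAlgebra Qbar H :=
  TensorProduct.lift <| LinearMap.mk₂ ℤ
    (fun (c : ZInv n) (θ : EAlg u) =>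
      algebraMap ℚ Qbar (c : ℚ) •
        MonoidAlgebra.mapRingHom H (Int.castRingHom Qbar) ((θ.1 m : indF0 u) : MonoidAlgebra ℤ H))
    (by intros; simp [add_smul])
    (by intros; simp [mul_smul, Int.cast_smul_eq_zsmul])
    (by intros; simp)
    (by intros; simp [smul_comm])

/-- The image of `m ∈ Ind 𝓕₀ ⊆ ℤ[G^F]` in `Qbar[G^F]`. -/
def toQbar (u : Multiplicative F →* H) (m : indF0 u) : MonoidAlgebra Qbar H :=
  MonoidAlgebra.mapRingHom H (Int.castRingHom Qbar) (m : MonoidAlgebra ℤ H)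

/-- The idempotent `e_ψ = |U^F|⁻¹ ∑ ψ(u⁻¹) u` of a linear character `ψ` of `U^F`. The
Gelfand-Graev representation is `Γ_ψ = Ind_{U^F}^{G^F} ψ ≅ Qbar[G^F] e_ψ`. -/
def idemPsi (u : Multiplicative F →* H) (ψ : AddChar F Qbar) : MonoidAlgebra Qbar H :=
  (Fintype.card F : Qbar)⁻¹ •
    ∑ a : F, ψ (-a) • MonoidAlgebra.of Qbar H (u (Multiplicative.ofAdd a))

/-- The element `e_χ = χ(1)/|G^F| ∑ χ(g⁻¹) g`, where `χ` is the character of `V`; it is the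
central primitive idempotent of `χ` when `V` is irreducible. -/
def idemChi [Finite H] (V : FDRep Qbar H) : MonoidAlgebra Qbar H :=
  (V.character 1 / (Nat.card H : Qbar)) •
    ∑ᶠ g : H, V.character g⁻¹ • MonoidAlgebra.of Qbar H g

/-- The pairing `⟨f₁, f₂⟩ = |H|⁻¹ ∑ f₁(h⁻¹) f₂(h)` of class functions. -/
def pairing (f₁ f₂ : H → Qbar) : Qbar :=
  (Nat.card H : Qbar)⁻¹ * ∑ᶠ h : H, f₁ h⁻¹ * f₂ h

end GelfandGraev

/-! ### The algebra `K`: the Grothendieck ring of modular representations -/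

section Grothendieck

/-- The Grothendieck ring of the category of finite-dimensional representations of `H` over `k`:
the free abelian group on isomorphism classes, with the product induced by `⊗`, modulo the
relations `[M₂] = [M₁] + [M₃]` for short exact sequences `0 → M₁ → M₂ → M₃ → 0`. (Tensoring
over `k` being exact, the subgroup generated by these relations is already an ideal.) -/
def grothendieckIdeal (k H : Type) [Field k] [Group H] :
    Ideal (FreeAbelianGroup (Skeleton (FDRep k H))) :=
  Ideal.span {r | ∃ (M₁ M₂ M₃ : FDRep k H) (f : M₁ ⟶ M₂) (g : M₂ ⟶ M₃),
    Function.Injective f ∧ Function.Exact f g ∧ Function.Surjective g ∧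
    r = FreeAbelianGroup.of (toSkeleton M₂) -
      (FreeAbelianGroup.of (toSkeleton M₁) + FreeAbelianGroup.of (toSkeleton M₃))}

/-- The Grothendieck ring `K` of `H` over `k`. -/
abbrev KAlg (k H : Type) [Field k] [Group H] : Type 1 :=
  FreeAbelianGroup (Skeleton (FDRep k H)) ⧸ grothendieckIdeal k H

/-- The class `[M]` of a representation in the Grothendieck ring. -/
def KAlg.mk {k H : Type} [Field k] [Group H] (M : FDRep k H) : KAlg k H :=
  Ideal.Quotient.mk (grothendieckIdeal k H) (FreeAbelianGroup.of (toSkeleton M))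

open Classical in
/-- The value at `x` of the Brauer character of `M`: the sum of the `κ(λ)`, where `λ` runs over
the eigenvalues (with multiplicity) of `x` on `M`. -/
def brauer {k H : Type} [Field k] [Group H] (κ : kˣ →* Qbarˣ) (M : FDRep k H) (x : H) : Qbar :=
  ((M.ρ x).charpoly.roots.map fun a =>
    if ha : a = 0 then 0 else ((κ (Units.mk0 a ha) : Qbarˣ) : Qbar)).sum

end Grothendieck

/-! ### The algebra `B`: functions on the fixed points of `T^∨ // W` -/

section Invariants

variable {X : Type} [AddCommGroup X]

/-- The ring of invariants `ℤ[X]^W`, where `W` is a (finite) group of automorphisms of the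
lattice `X`, given by its set of elements. -/
def invariants (W : Set (X →+ X)) : Subalgebra ℤ (AddMonoidAlgebra ℤ X) :=
  ⨅ w ∈ W, AlgHom.equalizer (AddMonoidAlgebra.mapDomainAlgHom ℤ ℤ w) (AlgHom.id ℤ _)

/-- The ideal of `ℤ[X]^W` generated by the `F^∨ f - f` for `f ∈ ℤ[X]^W`, where `F^∨` is
multiplication by `q` on `X` (the group is split). -/
def frobIdeal (W : Set (X →+ X)) (q : ℕ) : Ideal (invariants W) :=
  Ideal.span {g | ∃ f : invariants W, (g : AddMonoidAlgebra ℤ X) =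
    AddMonoidAlgebra.mapDomainAlgHom ℤ ℤ (nsmulAddMonoidHom q : X →+ X) f - f}

/-- The `ℤ`-algebra `B`: the ring of functions of the scheme of `F^∨`-fixed points of
`T^∨ // W = Spec ℤ[X]^W`. -/
abbrev BAlg (W : Set (X →+ X)) (q : ℕ) : Type := invariants W ⧸ frobIdeal W q

/-- The value of `f ∈ ℤ[X]` at a point `t ∈ T^∨(Qbar) = Hom(X, Qbarˣ)`. -/
def evalAt (t : Multiplicative X →* Qbarˣ) (f : AddMonoidAlgebra ℤ X) : Qbar :=
  AddMonoidAlgebra.lift ℤ Qbar X ((Units.coeHom Qbar).comp t) f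

end Invariants

/-! ### The canonical isomorphisms

In this section `H` is `G^F` and `Hd` is the finite group `(G^*)^(F^*)`. The relation
`IsRho x V` says that `x` is a `p`-regular (equivalently semisimple) element of `Hd` and that `V`
is the irreducible component `ρ_{ψ,[x]}` of the Gelfand-Graev representation. The relation
`IsPoint x t` says that the point `t` of `T^∨(Qbar)` represents the image of `[x]` in
`(T^∨ // W)^{F^∨}(Qbar)`. -/

section Canonical

variable {F : Type} [Field F] [Fintype F] {H Hd : Type} [Group H] [Finite H] [Group Hd]
  {X : Type} [AddCommGroup X]

/-- The isomorphism `ΛE ≃ ΛK` is the canonical one: over `Qbar` it becomes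
`Qbar E ≃ Qbar^{semisimple classes} ≃ Qbar K`, where the first map sends the idempotent of
`Qbar E` cut out by `ρ_{ψ,[x]}` to the characteristic function of `[x]`, and the second one is
inverse to the Brauer isomorphism. That is, `[M] ∈ K` corresponds to the element of `Qbar E`
which acts on the `ρ_{ψ,[x]}`-isotypic part of `Qbar Ind 𝓕₀ ⊆ Qbar[G^F]` by the scalar
`(br M)(x)`, for every `x`. -/
def IsCanonicalEK (u : Multiplicative F →* H) {k : Type} [Field k] (κ : kˣ →* Qbarˣ)
    (IsRho : Hd → FDRep Qbar H → Prop) (n : ℕ)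
    (e : (ZInv n ⊗[ℤ] EAlg u) ≃ₐ[ZInv n] (ZInv n ⊗[ℤ] KAlg k Hd)) : Prop :=
  ∀ (x : Hd) (V : FDRep Qbar H), IsRho x V → ∀ (M : FDRep k Hd) (m : indF0 u),
    idemChi V * act u n m (e.symm (1 ⊗ₜ KAlg.mk M)) =
      brauer κ M x • (idemChi V * toQbar u m)

/-- The isomorphism `ΛE ≃ ΛB` is the canonical one: over `Qbar` it becomes
`Qbar E ≃ Qbar^{semisimple classes} ≃ Qbar B`, where the second map is inverse to the restriction
of functions along the map from semisimple classes to `(T^∨ // W)^{F^∨}(Qbar)`. -/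
def IsCanonicalEB (u : Multiplicative F →* H) (W : Set (X →+ X)) (q : ℕ)
    (IsRho : Hd → FDRep Qbar H → Prop) (IsPoint : Hd → (Multiplicative X →* Qbarˣ) → Prop) (n : ℕ)
    (e : (ZInv n ⊗[ℤ] EAlg u) ≃ₐ[ZInv n] (ZInv n ⊗[ℤ] BAlg W q)) : Prop :=
  ∀ (x : Hd) (V : FDRep Qbar H) (t : Multiplicative X →* Qbarˣ), IsRho x V → IsPoint x t →
    ∀ (f : invariants W) (m : indF0 u),
      idemChi V * act u n m (e.symm (1 ⊗ₜ Ideal.Quotient.mk (frobIdeal W q) f)) =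
        evalAt t f • (idemChi V * toQbar u m)

/-- The canonical isomorphisms `ΛE ≃ ΛB ≃ ΛK` exist over `Λ = ℤ[1/(p|W|)]`, with `|W| = 2`, and
they restrict to isomorphisms of `ℤ[1/p]`-algebras `ℤ[1/p]E ≃ ℤ[1/p]B ≃ ℤ[1/p]K`. -/
def CanonicalIsosRestrict (p : ℕ) (u : Multiplicative F →* H) (W : Set (X →+ X)) (q : ℕ)
    {k : Type} [Field k] (κ : kˣ →* Qbarˣ)
    (IsRho : Hd → FDRep Qbar H → Prop) (IsPoint : Hd → (Multiplicative X →* Qbarˣ) → Prop) :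
    Prop :=
  ∃ (eEB : (ZInv (p * 2) ⊗[ℤ] EAlg u) ≃ₐ[ZInv (p * 2)] (ZInv (p * 2) ⊗[ℤ] BAlg W q))
    (eBK : (ZInv (p * 2) ⊗[ℤ] BAlg W q) ≃ₐ[ZInv (p * 2)] (ZInv (p * 2) ⊗[ℤ] KAlg k Hd)),
    -- `eEB` and `eBK ∘ eEB` are the unique canonical isomorphisms
    (∀ e, IsCanonicalEB u W q IsRho IsPoint (p * 2) e ↔ e = eEB) ∧
    (∀ e, IsCanonicalEK u κ IsRho (p * 2) e ↔ e = eEB.trans eBK) ∧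
    -- the `ℤ[1/p]`-forms are subrings of the `ℤ[1/(p|W|)]`-forms
    Function.Injective (enlarge p (EAlg u)) ∧
    Function.Injective (enlarge p (BAlg W q)) ∧
    Function.Injective (enlarge p (KAlg k Hd)) ∧
    -- and `eEB`, `eBK` restrict to isomorphisms between these
    ∃ (dEB : (ZInv p ⊗[ℤ] EAlg u) ≃ₐ[ZInv p] (ZInv p ⊗[ℤ] BAlg W q))
      (dBK : (ZInv p ⊗[ℤ] BAlg W q) ≃ₐ[ZInv p] (ZInv p ⊗[ℤ] KAlg k Hd)),
      (∀ h, enlarge p _ (dEB h) = eEB (enlarge p _ h)) ∧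
      (∀ b, enlarge p _ (dBK b) = eBK (enlarge p _ b))

end Canonical

/-! ### Deligne-Lusztig characters of `GL₂(𝔽_q)`

`T` is the diagonal torus of `GL₂` over `k`, an algebraic closure of `F = 𝔽_q`; its points are
the elements of `Fin 2 → kˣ`, its Weyl group is the group of permutations of `Fin 2`, and `F`
raises coordinates to the power `q`. -/

section DeligneLusztig

variable {F k : Type} [Field F] [Fintype F] [Field k] [Algebra F k]

/-- The finite torus `T^{wF}`, which is isomorphic to `(T_w)^F`. -/
def torus (F k : Type) [Fintype F] [Field k] (w : Equiv.Perm (Fin 2)) : Set (Fin 2 → kˣ) :=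
  {t | ∀ i, t (w i) ^ Fintype.card F = t i}

/-- The value at `t ∈ T` of the character `lam ∈ X(T) = ℤ²`. -/
def charVal {G : Type} [CommGroup G] (lam : Fin 2 → ℤ) (t : Fin 2 → G) : G := ∏ i, t i ^ lam i

/-- The matrix `g` over `F` has eigenvalues `y 0`, `y 1` (with multiplicity). -/
def HasEigenvalues (g : Matrix (Fin 2) (Fin 2) F) (y : Fin 2 → kˣ) : Prop :=
  (g.map (algebraMap F k)).charpoly = ∏ i, (Polynomial.X - Polynomial.C (y i : k))

open Classical in
/-- The Deligne-Lusztig character `R_{T_w}^G(θ)` of `GL₂(𝔽_q)`, for the character `θ = κ ∘ lam` of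
`T^{wF} ≅ (T_w)^F`, by the Deligne-Lusztig character formula
`R(su) = |C(s)^F|⁻¹ ∑_{h ∈ G^F, h⁻¹sh ∈ T_w} θ(h⁻¹sh) Q^{C(s)}(u)`. If `s` is not central then
`C(s)` is a torus, and the formula is the sum of the `θ(t)` over the `t ∈ T^{wF}` with the same
eigenvalues as `s`; if `s` is central then it is `θ(s) Q_w(u)`, with Green function
`Q_w(1) = 1 + sgn(w) q` and `Q_w(u) = 1` for `u ≠ 1`. -/
def DLChar (κ : kˣ →* Qbarˣ) (w : Equiv.Perm (Fin 2)) (lam : Fin 2 → ℤ) (g : GL (Fin 2) F) :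
    Qbar :=
  (if g ∈ Subgroup.center (GL (Fin 2) F) then
      1 + ((Equiv.Perm.sign w : ℤ) : Qbar) * (Fintype.card F : Qbar) else 1) *
    ∑ᶠ t ∈ {t : Fin 2 → kˣ | t ∈ torus F k w ∧ HasEigenvalues g.1 t},
      ((κ (charVal lam t) : Qbarˣ) : Qbar)

/-- `lam ∈ X(T)` and `y ∈ T^*` define corresponding elements `κ ∘ lam` of `Irr (T^{wF})` and `y` of
`T^{*wF*}`: under `T^* = Y(T^*) ⊗ kˣ ≅ X(T) ⊗ (ℚ/ℤ)_{p'}` (by `ι`), the point `y` is the class of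
`(wF - 1)⁻¹ lam ∈ X(T) ⊗ ℚ`. -/
def IsDual {p : ℕ} (ι : Additive kˣ ≃+ QModZ p) (q : ℕ) (w : Equiv.Perm (Fin 2))
    (lam : Fin 2 → ℤ) (y : Fin 2 → kˣ) : Prop :=
  ∃ v : Fin 2 → ℚ, (∀ i, (q : ℚ) * v (w i) - v i = lam i) ∧
    ∀ i, (ι (Additive.ofMul (y i)) : AddCircle (1 : ℚ)) = (v i : AddCircle (1 : ℚ))

end DeligneLusztig

/-! ### The group `GL₂` and its duals `GL₂`, `GL₂` -/

section GLTwo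

variable {p : ℕ} {F k : Type} [Field F] [Fintype F] [Field k] [Algebra F k]

/-- The upper triangular unipotent subgroup of `GL₂(𝔽_q)`. -/
def uGL (F : Type) [Field F] : Multiplicative F →* GL (Fin 2) F :=
  Matrix.GeneralLinearGroup.upperRightHom.toMonoidHom

/-- The Weyl group of `GL₂`, acting on `X(T^∨) = ℤ²` by permutations of the coordinates. -/
def weylGL : Set ((Fin 2 → ℤ) →+ (Fin 2 → ℤ)) :=
  Set.range fun σ : Equiv.Perm (Fin 2) => (LinearMap.funLeft ℤ ℤ σ).toAddMonoidHom

/-- For `G = GL₂`: `V` is the irreducible representation `ρ_{ψ,[x]}` of `GL₂(𝔽_q)`, that is, `x` is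
a `p`-regular element of the dual group `GL₂(𝔽_q)`, and `V` is an irreducible component of the
Gelfand-Graev representation `Qbar[G^F] e_ψ` and lies in the rational Lusztig series of `[x]`. -/
def IsRhoGL (ι : Additive kˣ ≃+ QModZ p) (κ : kˣ →* Qbarˣ) (ψ : AddChar F Qbar)
    (x : GL (Fin 2) F) (V : FDRep Qbar (GL (Fin 2) F)) : Prop :=
  (orderOf x).Coprime p ∧ Simple V ∧ idemChi V * idemPsi (uGL F) ψ ≠ 0 ∧
    ∃ (y : Fin 2 → kˣ) (w : Equiv.Perm (Fin 2)) (lam : Fin 2 → ℤ),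
      HasEigenvalues x.1 y ∧ IsDual ι (Fintype.card F) w lam y ∧
      pairing V.character (DLChar κ w lam) ≠ 0

/-- The point of `T^∨(Qbar) = Hom(ℤ², Qbarˣ)` given by (an ordering of) the eigenvalues of `x`. -/
def IsPointGL (κ : kˣ →* Qbarˣ) (x : GL (Fin 2) F)
    (t : Multiplicative (Fin 2 → ℤ) →* Qbarˣ) : Prop :=
  ∃ y : Fin 2 → kˣ, HasEigenvalues x.1 y ∧
    ∀ lam : Fin 2 → ℤ, t (Multiplicative.ofAdd lam) = κ (charVal lam y)

end GLTwo

/-! ### The group `PGL₂` and its duals `SL₂`, `SL₂` -/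

section PGLTwo

variable {p : ℕ} {F k : Type} [Field F] [Fintype F] [Field k] [Algebra F k]

/-- The group `PGL₂(𝔽_q)`. -/
abbrev PGLTwo (F : Type) [Field F] : Type := Matrix.ProjGenLinGroup (Fin 2) F

/-- The projection `GL₂(𝔽_q) → PGL₂(𝔽_q)`. -/
def toPGL (F : Type) [Field F] : GL (Fin 2) F →* PGLTwo F := Matrix.ProjGenLinGroup.mk

instance (F : Type) [Field F] [Finite F] : Finite (PGLTwo F) :=
  Finite.of_surjective _ Matrix.ProjGenLinGroup.mk_surjective

/-- The upper triangular unipotent subgroup of `PGL₂(𝔽_q)`. -/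
def uPGL (F : Type) [Field F] : Multiplicative F →* PGLTwo F := (toPGL F).comp (uGL F)

/-- The Weyl group `{±1}` of `SL₂`, acting on `X(T^∨) = ℤ`. -/
def weylSL : Set (ℤ →+ ℤ) := {AddMonoidHom.id ℤ, -AddMonoidHom.id ℤ}

/-- For `G = PGL₂`: `V` is the irreducible representation `ρ_{ψ,[x]}` of `PGL₂(𝔽_q)`, where `x` is a
`p`-regular element of the dual group `SL₂(𝔽_q)`. The characters of the diagonal torus of `PGL₂`
are the `lam ∈ ℤ²` with `lam 0 + lam 1 = 0`, and the inflation to `GL₂(𝔽_q)` of a Deligne-Lusztig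
character of `PGL₂(𝔽_q)` is the Deligne-Lusztig character of the inflated character of the
torus. -/
def IsRhoPGL (ι : Additive kˣ ≃+ QModZ p) (κ : kˣ →* Qbarˣ) (ψ : AddChar F Qbar)
    (x : Matrix.SpecialLinearGroup (Fin 2) F) (V : FDRep Qbar (PGLTwo F)) : Prop :=
  (orderOf x).Coprime p ∧ Simple V ∧ idemChi V * idemPsi (uPGL F) ψ ≠ 0 ∧
    ∃ (y : Fin 2 → kˣ) (w : Equiv.Perm (Fin 2)) (lam : Fin 2 → ℤ), lam 0 + lam 1 = 0 ∧
      HasEigenvalues x.1 y ∧ IsDual ι (Fintype.card F) w lam y ∧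
      pairing (fun g : GL (Fin 2) F => V.character (toPGL F g)) (DLChar κ w lam) ≠ 0

/-- The point of `T^∨(Qbar) = Hom(ℤ, Qbarˣ)` given by an eigenvalue of `x`. -/
def IsPointSL (κ : kˣ →* Qbarˣ) (x : Matrix.SpecialLinearGroup (Fin 2) F)
    (t : Multiplicative ℤ →* Qbarˣ) : Prop :=
  ∃ y : Fin 2 → kˣ, HasEigenvalues x.1 y ∧
    ∀ n : ℤ, t (Multiplicative.ofAdd n) = κ (y 0 ^ n)

end PGLTwo

end GelfandGraevGLTwo

end

open CategoryTheory TensorProduct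

noncomputable section

namespace GelfandGraevGLTwo


/-! ### Localized rings inside a common algebra -/

section Localized

variable {A A₁ A₂ 𝓐 : Type*} [Semiring A] [Algebra ℤ A] [Semiring A₁] [Algebra ℤ A₁]
  [Semiring A₂] [Algebra ℤ A₂] [Ring 𝓐] [Algebra ℚ 𝓐]

/-! Both groups are handled at once. Write q = |F| and let r be the number of scalar matrices that
survive in H = G^F: r = q - 1 for GL₂ and r = 1 for PGL₂. The finite dual group then consists of the
matrices over F whose determinant has trivial r-th power (`IsDetPowOne`). Everything rests on qr
monomials σ^i δ^j with i < q and j < r, where σ is x₀ + x₁ in B and the natural plane in K, while δ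
is x₀x₁ in B and the determinant in K. They form a basis of B and of K over ℤ, and of E once p is
inverted. There is a linear form on each side taking σ^a δ^b, for a < q, to 1 if a = q - 1 and r ∣
b, and to 0 otherwise. The Gram matrix of such a form is antitriangular with unit entries, hence can
be inverted over ℤ (`mem_of_gram`). For B and E the form is q times the coefficient at a non-trivial
unipotent element (`coeff_lowerUni_mono`); for K it is the multiplicity of the Steinberg
representation (`stRank_pow_mul`).

The comparison of E and B takes place inside Qbar[H]. An endomorphism of the induced module is right
multiplication by an element of the corner cut out by the idempotent ε = `epsU`, which embeds E
(`etaE`). To a weight mu one attaches a central element `zElt mu`, a normalized difference of a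
split and a non-split weighted class sum. On a constituent of a Deligne-Lusztig character with dual
parameter y it acts by the average of κ(mu(y)) over the two orderings of y (`idemChi_mul_zElt`). The
reason is the product rule `sum_zTorus_mul_torusSum`: multiplication by the difference attached to t
turns the torus sum at r into q times the sum of those at tr and t^w r. In the split case this
follows from writing a class sum as a sum over the q + 1 lines of the plane; in the non-split case
it is a count of points on anisotropic conics. Consequently a W-invariant f acts by its value f(y),
and f ↦ z(f)ε is a ring homomorphism on B (`etaB`).

Invariants are integral combinations of orbit sums and fixed monomials (`DualDatum.mem_of_orbits`);
on these the factor 1/2 in `zElt` disappears, so q z(f) lies in the center of ℤ[H] and B maps into E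
up to powers of p. This is why |W| need not be inverted. Conversely, an element of E commutes with
the Borel subgroup, and by the Bruhat decomposition e_ψ Qbar[H] e_ψ has dimension at most qr. The
monomials are independent by the Gram matrix, so they span. Applying the same matrix to the products
of an element of E with the monomials shows that its coefficients lie in ℤ[1/p]
(`exists_smul_etaE_eq`).

The comparison of B and K already holds over ℤ. Newton's identities and the relations F^∨ f = f show
that the monomials span B (`DualDatum.exists_eq_sum`). In K, the trace of a modular representation
at an element depends only on the trace and determinant of that element, so there are at most qr
irreducible representations (`IsDetPowOne.card_le`); the Gram matrix gives a surjection of K onto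
ℤ^(qr), which must be bijective, and the monomials span K. Brauer characters of the monomials in K
agree with the values of the monomials in B, so both rings are the same ring of functions.

Canonicity and uniqueness hold because the generic irreducible representations separate the elements
of Qbar[H]ε (`Separates.ext`). -/

theorem inv_pow_mem_ZInv (n k : ℕ) : ((n : ℚ)⁻¹) ^ k ∈ ZInv n :=
  pow_mem (Algebra.subset_adjoin (Set.mem_singleton _)) k

theorem exists_pow_mul_eq_intCast {n : ℕ} (hn : n ≠ 0) {c : ℚ} (hc : c ∈ ZInv n) :
    ∃ (k : ℕ) (a : ℤ), (n : ℚ) ^ k * c = a := by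
  have hn' : (n : ℚ) ≠ 0 := by exact_mod_cast hn
  induction hc using Algebra.adjoin_induction with
  | mem x hx =>
    rw [Set.mem_singleton_iff] at hx
    exact ⟨1, 1, by simp [hx, hn']⟩
  | algebraMap r => exact ⟨0, r, by simp⟩
  | add x y _ _ hx hy =>
    obtain ⟨k, a, h⟩ := hx
    obtain ⟨l, b, h'⟩ := hy
    exact ⟨k + l, n ^ l * a + n ^ k * b, by push_cast; rw [← h, ← h']; ring⟩
  | mul x y _ _ hx hy =>
    obtain ⟨k, a, h⟩ := hx
    obtain ⟨l, b, h'⟩ := hy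
    exact ⟨k + l, a * b, by push_cast; rw [← h, ← h']; ring⟩

/-- The extension of an additive map `A → 𝓐` to `ℤ[1/n] ⊗ A`, for a `ℚ`-algebra `𝓐`. -/
def extend (n : ℕ) (η : A →ₙₐ[ℤ] 𝓐) : (ZInv n ⊗[ℤ] A) →ₗ[ℤ] 𝓐 :=
  TensorProduct.lift <| LinearMap.mk₂ ℤ
    (fun (c : ZInv n) (a : A) => (c : ℚ) • η a)
    (by intros; simp [add_smul])
    (by intros; simp [mul_smul, Int.cast_smul_eq_zsmul])
    (by intros; simp)
    (by intro c m n; rw [map_smul]; exact smul_comm _ _ _)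

@[simp] theorem extend_tmul (n : ℕ) (η : A →ₙₐ[ℤ] 𝓐) (c : ZInv n) (a : A) :
    extend n η (c ⊗ₜ a) = (c : ℚ) • η a := by
  rfl

theorem extend_smul (n : ℕ) (η : A →ₙₐ[ℤ] 𝓐) (c : ZInv n) (x : ZInv n ⊗[ℤ] A) :
    extend n η (c • x) = (c : ℚ) • extend n η x := by
  induction x using TensorProduct.induction_on with
  | zero => simp
  | tmul d a => simp [TensorProduct.smul_tmul', mul_smul]
  | add x y hx hy => simp [smul_add, hx, hy]

theorem extend_mul (n : ℕ) (η : A →ₙₐ[ℤ] 𝓐) (x y : ZInv n ⊗[ℤ] A) :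
    extend n η (x * y) = extend n η x * extend n η y := by
  induction x using TensorProduct.induction_on with
  | zero => simp
  | add x x' hx hx' => simp [add_mul, hx, hx']
  | tmul c a =>
    induction y using TensorProduct.induction_on with
    | zero => simp
    | add x x' hx hx' => simp [mul_add, hx, hx']
    | tmul d b => simp [smul_smul, mul_comm]

theorem extend_one (n : ℕ) (η : A →ₙₐ[ℤ] 𝓐) : extend n η 1 = η 1 := by
  rw [Algebra.TensorProduct.one_def, extend_tmul]; simp

theorem extend_enlarge (n : ℕ) (η : A →ₙₐ[ℤ] 𝓐) (x : ZInv n ⊗[ℤ] A) :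
    extend (n * 2) η (enlarge n A x) = extend n η x := by
  induction x using TensorProduct.induction_on with
  | zero => rw [map_zero, map_zero, map_zero]
  | add x y hx hy => rw [map_add, map_add, map_add, hx, hy]
  | tmul c a =>
    rw [enlarge, Algebra.TensorProduct.map_tmul, extend_tmul, extend_tmul,
      Subalgebra.coe_inclusion, AlgHom.id_apply]

/-- Finitely many denominators have a common power of n, and numerators can be moved across the
tensor sign, so the localization consists of simple fractions a/n^k. -/
theorem exists_eq_inv_pow_tmul {n : ℕ} (hn : n ≠ 0) (x : ZInv n ⊗[ℤ] A) :
    ∃ (k : ℕ) (a : A), x = (⟨_, inv_pow_mem_ZInv n k⟩ : ZInv n) ⊗ₜ[ℤ] a := by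
  have hn' : (n : ℚ) ≠ 0 := by exact_mod_cast hn
  have key : ∀ (k : ℕ) (c : ZInv n) (b : ℤ) (a : A), (n : ℚ) ^ k * c = b →
      c ⊗ₜ[ℤ] a = (⟨_, inv_pow_mem_ZInv n k⟩ : ZInv n) ⊗ₜ[ℤ] (b • a) := by
    intro k c b a h
    rw [← TensorProduct.smul_tmul]
    congr 1
    ext
    change (c : ℚ) = b • ((n : ℚ)⁻¹) ^ k
    rw [zsmul_eq_mul, ← h, inv_pow]
    field_simp
  induction x using TensorProduct.induction_on with
  | zero => exact ⟨0, 0, by simp⟩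
  | tmul c a =>
    obtain ⟨k, b, h⟩ := exists_pow_mul_eq_intCast hn c.2
    exact ⟨k, b • a, key k c b a h⟩
  | add x y hx hy =>
    obtain ⟨k, a, rfl⟩ := hx
    obtain ⟨l, b, rfl⟩ := hy
    refine ⟨k + l, (n ^ l : ℤ) • a + (n ^ k : ℤ) • b, ?_⟩
    rw [TensorProduct.tmul_add]
    congr 1
    · apply key; push_cast; rw [pow_add, inv_pow]; field_simp
    · apply key; push_cast; rw [pow_add, inv_pow]; field_simp

theorem inv_pow_tmul_eq {n : ℕ} (hn : n ≠ 0) (k l : ℕ) (a : A) :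
    (⟨_, inv_pow_mem_ZInv n k⟩ : ZInv n) ⊗ₜ[ℤ] a =
      (⟨_, inv_pow_mem_ZInv n (k + l)⟩ : ZInv n) ⊗ₜ[ℤ] ((n ^ l : ℤ) • a) := by
  have hn' : (n : ℚ) ≠ 0 := by exact_mod_cast hn
  rw [← TensorProduct.smul_tmul]
  congr 1
  ext
  change ((n : ℚ)⁻¹) ^ k = (n ^ l : ℤ) • ((n : ℚ)⁻¹) ^ (k + l)
  rw [zsmul_eq_mul, pow_add, inv_pow, inv_pow]
  push_cast
  field_simp

/-- Two fractions over a common denominator have images differing from values of η by one invertible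
rational scalar. The embedding in a ℚ-algebra replaces any flatness or torsion-freeness argument. -/
theorem extend_injective {n : ℕ} (hn : n ≠ 0) {η : A →ₙₐ[ℤ] 𝓐} (hη : Function.Injective η) :
    Function.Injective (extend n η) := by
  intro x y hxy
  obtain ⟨k, a, rfl⟩ := exists_eq_inv_pow_tmul hn x
  obtain ⟨l, b, rfl⟩ := exists_eq_inv_pow_tmul hn y
  have hn' : (n : ℚ) ≠ 0 := by exact_mod_cast hn
  rw [inv_pow_tmul_eq hn k l, inv_pow_tmul_eq hn l k] at hxy ⊢
  simp only [extend_tmul, add_comm l k] at hxy ⊢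
  have := smul_right_injective 𝓐 (pow_ne_zero (k + l) (inv_ne_zero hn')) hxy
  rw [hη this]

theorem enlarge_injective {n : ℕ} (hn : n ≠ 0) {η : A →ₙₐ[ℤ] 𝓐} (hη : Function.Injective η) :
    Function.Injective (enlarge n A) := by
  intro x y h
  refine extend_injective hn hη ?_
  rw [← extend_enlarge, h, extend_enlarge]

theorem exists_extend_eq {n : ℕ} (hn : n ≠ 0) {η₁ : A₁ →ₙₐ[ℤ] 𝓐} {η₂ : A₂ →ₙₐ[ℤ] 𝓐}
    (h : ∀ a, ∃ (k : ℕ) (b : A₂), n ^ k • η₁ a = η₂ b) (x : ZInv n ⊗[ℤ] A₁) :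
    ∃ y : ZInv n ⊗[ℤ] A₂, extend n η₂ y = extend n η₁ x := by
  have hn' : (n : ℚ) ≠ 0 := by exact_mod_cast hn
  obtain ⟨k, a, rfl⟩ := exists_eq_inv_pow_tmul hn x
  obtain ⟨l, b, hb⟩ := h a
  refine ⟨(⟨_, inv_pow_mem_ZInv n (k + l)⟩ : ZInv n) ⊗ₜ[ℤ] b, ?_⟩
  rw [extend_tmul, extend_tmul, ← hb, ← Nat.cast_smul_eq_nsmul ℚ, smul_smul]
  congr 1
  push_cast
  rw [pow_add, inv_pow, inv_pow]
  field_simp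

/-- Both localizations have the same image in 𝓐, since each lattice lies in the other up to powers
of n; the isomorphism is the identity of that image. The embeddings are non-unital because the
common unit will be the idempotent ε rather than 1, whence the separate assumption on units. -/
theorem exists_algEquiv_extend {n : ℕ} (hn : n ≠ 0) {η₁ : A₁ →ₙₐ[ℤ] 𝓐} {η₂ : A₂ →ₙₐ[ℤ] 𝓐}
    (h₁ : Function.Injective η₁) (h₂ : Function.Injective η₂) (h_one : η₁ 1 = η₂ 1)
    (h₁₂ : ∀ a, ∃ (k : ℕ) (b : A₂), n ^ k • η₁ a = η₂ b)
    (h₂₁ : ∀ a, ∃ (k : ℕ) (b : A₁), n ^ k • η₂ a = η₁ b) :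
    ∃ d : (ZInv n ⊗[ℤ] A₁) ≃ₐ[ZInv n] (ZInv n ⊗[ℤ] A₂),
      ∀ x, extend n η₂ (d x) = extend n η₁ x := by
  choose f hf using exists_extend_eq hn h₁₂
  choose g hg using exists_extend_eq hn h₂₁
  have i₁ := extend_injective hn h₁
  have i₂ := extend_injective hn h₂
  refine ⟨AlgEquiv.ofLinearEquiv
    { toFun := f
      invFun := g
      map_add' := fun x y => i₂ (by simp [hf])
      map_smul' := fun c x => i₂ (by simp [hf, extend_smul])
      left_inv := fun x => i₁ (by simp [hf, hg])
      right_inv := fun x => i₂ (by simp [hf, hg]) } ?_ ?_, fun x => hf x⟩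
  · exact i₂ ((hf 1).trans (by rw [extend_one, extend_one, h_one]))
  · exact fun x y => i₂ ((hf _).trans (by rw [extend_mul, extend_mul]; exact congr_arg₂ _ (hf x).symm (hf y).symm))

omit [Algebra ℚ 𝓐] in
theorem commensurable_mul {n m : ℕ} {η₁ : A₁ →ₙₐ[ℤ] 𝓐} {η₂ : A₂ →ₙₐ[ℤ] 𝓐}
    (h : ∀ a, ∃ (k : ℕ) (b : A₂), n ^ k • η₁ a = η₂ b) (a : A₁) :
    ∃ (k : ℕ) (b : A₂), (n * m) ^ k • η₁ a = η₂ b := by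
  obtain ⟨k, b, hb⟩ := h a
  exact ⟨k, m ^ k • b, by rw [map_nsmul, ← hb, smul_smul, mul_pow, mul_comm]⟩

end Localized


/-! ### Counting matrices with given trace and determinant -/

section Counting

open Matrix

variable {F : Type} [Field F]

theorem mem_center_iff_entries {g : GL (Fin 2) F} :
    g ∈ Subgroup.center (GL (Fin 2) F) ↔ g.1 0 1 = 0 ∧ g.1 1 0 = 0 ∧ g.1 0 0 = g.1 1 1 := by
  rw [Matrix.GeneralLinearGroup.mem_center_iff_val_mem_range_scalar]
  constructor
  · rintro ⟨a, ha⟩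
    rw [← ha]
    simp
  · rintro ⟨h1, h2, h3⟩
    refine ⟨g.1 0 0, ?_⟩
    ext i j
    fin_cases i <;> fin_cases j <;> simp [h1, h2, h3]

theorem det_ne_zero_GL (g : GL (Fin 2) F) : g.1.det ≠ 0 := by
  have := (Matrix.isUnit_iff_isUnit_det g.1).mp g.isUnit
  exact this.ne_zero

/-- The elementary unipotent matrix. -/
abbrev uni (x : F) : GL (Fin 2) F := uGL F (Multiplicative.ofAdd x)

theorem uni_val (x : F) : (uni x).1 = !![1, x; 0, 1] := rfl

theorem mul_uni_val (g : GL (Fin 2) F) (x : F) :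
    (g * uni x).1 = !![g.1 0 0, g.1 0 0 * x + g.1 0 1; g.1 1 0, g.1 1 0 * x + g.1 1 1] := by
  rw [Units.val_mul, uni_val]
  ext i j
  fin_cases i <;> fin_cases j <;> simp [Matrix.mul_apply, Fin.sum_univ_two]

theorem det_mul_uni (g : GL (Fin 2) F) (x : F) : (g * uni x).1.det = g.1.det := by
  rw [mul_uni_val, Matrix.det_fin_two, Matrix.det_fin_two]
  simp
  ring

theorem trace_mul_uni (g : GL (Fin 2) F) (hg : g.1 1 0 = 0) (x : F) :
    (g * uni x).1.trace = g.1 0 0 + g.1 1 1 := by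
  rw [mul_uni_val, Matrix.trace_fin_two]
  simp [hg]

theorem det_of_upper (g : GL (Fin 2) F) (hg : g.1 1 0 = 0) : g.1.det = g.1 0 0 * g.1 1 1 := by
  rw [Matrix.det_fin_two, hg]; ring

theorem eq_or_eq_of_add_mul {R : Type*} [CommRing R] [IsDomain R] {a b c d : R}
    (h1 : a + b = c + d) (h2 : a * b = c * d) :
    (a = c ∧ b = d) ∨ (a = d ∧ b = c) := by
  have : (a - c) * (a - d) = 0 := by linear_combination a * h1 - h2
  rcases mul_eq_zero.mp this with h | h
  · exact Or.inl ⟨by linear_combination h, by linear_combination h1 - h⟩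
  · exact Or.inr ⟨by linear_combination h, by linear_combination h1 - h⟩

variable [Fintype F]

open Classical in
/-- The weighted characteristic function of the matrices of trace `S` and determinant `D`, where
scalar matrices have weight `1 + ε q`. -/
def wt (ε : ℤ) (S D : F) (g : GL (Fin 2) F) : ℤ :=
  if g.1.trace = S ∧ g.1.det = D then
    (if g ∈ Subgroup.center (GL (Fin 2) F) then 1 + ε * Fintype.card F else 1) else 0

open Classical in
theorem wt_conj (ε : ℤ) (S D : F) (g x : GL (Fin 2) F) : wt ε S D (x * g * x⁻¹) = wt ε S D g := by
  have h1 : (x * g * x⁻¹).1.trace = g.1.trace := by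
    rw [Units.val_mul, Units.val_mul, Matrix.trace_mul_cycle, ← Units.val_mul]
    simp
  have h2 : (x * g * x⁻¹).1.det = g.1.det := by
    rw [Units.val_mul, Units.val_mul, Matrix.det_mul, Matrix.det_mul, mul_right_comm, ← Matrix.det_mul,
      ← Units.val_mul]
    simp
  have h3 : x * g * x⁻¹ ∈ Subgroup.center (GL (Fin 2) F) ↔ g ∈ Subgroup.center (GL (Fin 2) F) := by
    constructor
    · intro h
      have := (inferInstance : (Subgroup.center (GL (Fin 2) F)).Normal).conj_mem _ h x⁻¹
      simpa [mul_assoc] using this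
    · intro h
      exact (inferInstance : (Subgroup.center (GL (Fin 2) F)).Normal).conj_mem _ h x
  unfold wt
  rw [h1, h2]
  exact if_congr Iff.rfl (if_congr h3 rfl rfl) rfl

open Classical in
-- On a coset gU outside the Borel subgroup the determinant is constant, the trace takes every value
-- exactly once and no element is scalar. The answer does not depend on ε or S, so differences of
-- class sums with the same determinant vanish off the Borel subgroup.
theorem sum_wt_mul_uni_of_ne_zero (ε : ℤ) (S D : F) (g : GL (Fin 2) F) (hg : g.1 1 0 ≠ 0) :
    ∑ x : F, wt ε S D (g * uni x) = if g.1.det = D then 1 else 0 := by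
  have hc : ∀ x, g * uni x ∉ Subgroup.center (GL (Fin 2) F) := by
    intro x hx
    have := (mem_center_iff_entries.mp hx).2.1
    rw [mul_uni_val] at this
    exact hg (by simpa using this)
  have ht : ∀ x, (g * uni x).1.trace = S ↔ x = (S - g.1 0 0 - g.1 1 1) / g.1 1 0 := by
    intro x
    rw [mul_uni_val, Matrix.trace_fin_two, eq_div_iff hg]
    simp only [of_apply, cons_val', cons_val_zero, cons_val_one, cons_val_fin_one]
    constructor <;> intro h
    · rw [← h]; ring
    · linear_combination h
  simp only [wt, hc, if_false, det_mul_uni, ht]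
  by_cases hD : g.1.det = D <;> simp [hD]

open Classical in
theorem sum_ite_eq_center (c : ℤ) (g : GL (Fin 2) F) (hg : g.1 1 0 = 0) :
    ∑ x : F, (if g * uni x ∈ Subgroup.center (GL (Fin 2) F) then 1 + c else 1) =
      Fintype.card F + if g.1 0 0 = g.1 1 1 then c else 0 := by
  have h00 : g.1 0 0 ≠ 0 := by
    intro h
    apply det_ne_zero_GL g
    rw [Matrix.det_fin_two, h, hg]; ring
  have hc : ∀ x, g * uni x ∈ Subgroup.center (GL (Fin 2) F) ↔
      (x = - g.1 0 1 / g.1 0 0 ∧ g.1 0 0 = g.1 1 1) := by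
    intro x
    rw [mem_center_iff_entries, mul_uni_val, eq_div_iff h00]
    simp only [of_apply, cons_val', cons_val_zero, cons_val_one, cons_val_fin_one, hg]
    constructor
    · rintro ⟨h1, -, h3⟩
      exact ⟨by linear_combination h1, by linear_combination h3⟩
    · rintro ⟨h1, h3⟩
      exact ⟨by linear_combination h1, trivial, by linear_combination h3⟩
  have : ∀ x, (if g * uni x ∈ Subgroup.center (GL (Fin 2) F) then 1 + c else 1) =
      1 + if x = - g.1 0 1 / g.1 0 0 then (if g.1 0 0 = g.1 1 1 then c else 0) else 0 := by
    intro x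
    simp only [hc]
    split_ifs <;> simp_all
  simp only [this, Finset.sum_add_distrib, Finset.sum_ite_eq', Finset.mem_univ, if_true]
  simp

open Classical in
-- Trace and determinant are constant on an upper triangular coset, which gives q elements of weight
-- 1. If a = b, one of them is scalar, and its extra weight q accounts for the second of the two
-- coinciding indicator terms.
theorem sum_wt_split_mul_uni (a b : F) (g : GL (Fin 2) F) (hg : g.1 1 0 = 0) :
    ∑ x : F, wt 1 (a + b) (a * b) (g * uni x) =
      Fintype.card F * ((if g.1 0 0 = a ∧ g.1 1 1 = b then 1 else 0) +
        (if g.1 0 0 = b ∧ g.1 1 1 = a then 1 else 0)) := by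
  simp only [wt, trace_mul_uni g hg, det_mul_uni, det_of_upper g hg, one_mul]
  by_cases h : g.1 0 0 + g.1 1 1 = a + b ∧ g.1 0 0 * g.1 1 1 = a * b
  · simp only [h, and_self, if_true]
    rw [sum_ite_eq_center _ g hg]
    rcases eq_or_eq_of_add_mul h.1 h.2 with h' | h' <;> rw [h'.1, h'.2] <;>
      by_cases hab : a = b <;> simp [hab, mul_two, eq_comm (a := b)]
  · have h1 : ¬ (g.1 0 0 = a ∧ g.1 1 1 = b) := fun h' => h (by rw [h'.1, h'.2]; exact ⟨rfl, rfl⟩)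
    have h2 : ¬ (g.1 0 0 = b ∧ g.1 1 1 = a) := fun h' => h (by
      rw [h'.1, h'.2]; exact ⟨add_comm _ _, mul_comm _ _⟩)
    simp [h, h1, h2]

/-- Only cosets with equal diagonal entries can meet the support; each contains exactly one scalar
matrix, whose weight 1 - q cancels the q - 1 other elements. -/
theorem sum_wt_nonsplit_mul_uni (S D : F) (hSD : ∀ a b : F, a + b = S → a * b = D → a = b)
    (g : GL (Fin 2) F) (hg : g.1 1 0 = 0) : ∑ x : F, wt (-1) S D (g * uni x) = 0 := by
  classical
  simp only [wt, trace_mul_uni g hg, det_mul_uni, det_of_upper g hg]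
  by_cases h : g.1 0 0 + g.1 1 1 = S ∧ g.1 0 0 * g.1 1 1 = D
  · simp only [h, and_self, if_true]
    rw [sum_ite_eq_center _ g hg, if_pos (hSD _ _ h.1 h.2)]
    simp
  · simp [h]

end Counting


/-! ### Class sums in the group ring of `GL₂(F)` -/

section ClassSums

open Matrix

variable {F : Type} [Field F]

/-- The diagonal matrix with entries `a`, `b`. -/
def dg (a b : Fˣ) : GL (Fin 2) F :=
  ⟨!![(a : F), 0; 0, b], !![((a⁻¹ : Fˣ) : F), 0; 0, ((b⁻¹ : Fˣ) : F)],
    by simp [one_fin_two], by simp [one_fin_two]⟩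

theorem dg_val (a b : Fˣ) : (dg a b).1 = !![(a : F), 0; 0, b] := rfl

theorem dg_mul (a b c d : Fˣ) : dg a b * dg c d = dg (a * c) (b * d) := by
  ext i j
  fin_cases i <;> fin_cases j <;> simp [dg_val]

/-- A matrix with first column `(m, 1)`. -/
def colMat (m : F) : GL (Fin 2) F :=
  ⟨!![m, -1; 1, 0], !![0, 1; -1, m], by simp [one_fin_two], by simp [one_fin_two]⟩

theorem colMat_inv_val (m : F) : (colMat m)⁻¹.1 = !![0, 1; -1, m] := rfl

theorem colMat_val (m : F) : (colMat m).1 = !![m, -1; 1, 0] := rfl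

theorem uni_neg (x : F) : (uni x)⁻¹ = uni (-x) := by
  simp [uni, uGL]

theorem exists_eq_dg_mul_uni_iff (a b : Fˣ) (g : GL (Fin 2) F) :
    (∃ y, g = dg a b * uni y) ↔ g.1 1 0 = 0 ∧ g.1 0 0 = a ∧ g.1 1 1 = b := by
  constructor
  · rintro ⟨y, rfl⟩
    rw [mul_uni_val]
    simp [dg_val]
  · rintro ⟨h1, h2, h3⟩
    refine ⟨(a : F)⁻¹ * g.1 0 1, ?_⟩
    ext i j
    rw [mul_uni_val]
    fin_cases i <;> fin_cases j <;> simp [dg_val, h1, h2, h3]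

variable [Fintype F]

/-- The sum of the elements of the upper triangular unipotent subgroup. -/
def uSum (F : Type) [Field F] [Fintype F] : MonoidAlgebra ℤ (GL (Fin 2) F) :=
  ∑ x : F, MonoidAlgebra.single (uni x) 1

/-- The weighted sum of the matrices of trace `S` and determinant `D`. -/
def classSum (ε : ℤ) (S D : F) : MonoidAlgebra ℤ (GL (Fin 2) F) :=
  ∑ᶠ g, MonoidAlgebra.single g (wt ε S D g)

theorem classSum_coeff (ε : ℤ) (S D : F) (g : GL (Fin 2) F) :
    (classSum ε S D).coeff g = wt ε S D g := by
  classical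
  cases nonempty_fintype (GL (Fin 2) F)
  rw [classSum, finsum_eq_sum_of_fintype, MonoidAlgebra.coeff_sum, Finset.sum_apply']
  simp [Finsupp.single_apply]

theorem classSum_comm (ε : ℤ) (S D : F) (x : MonoidAlgebra ℤ (GL (Fin 2) F)) :
    classSum ε S D * x = x * classSum ε S D := by
  induction x using MonoidAlgebra.induction_linear with
  | zero => simp
  | add x y hx hy => simp [mul_add, add_mul, hx, hy]
  | single h r =>
    ext g
    rw [MonoidAlgebra.coeff_mul_single_apply, MonoidAlgebra.coeff_single_mul_apply, classSum_coeff,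
      classSum_coeff, mul_comm]
    congr 1
    rw [← wt_conj ε S D (g * h⁻¹) h⁻¹]
    congr 1
    group

theorem mul_uSum_coeff (x : MonoidAlgebra ℤ (GL (Fin 2) F)) (g : GL (Fin 2) F) :
    (x * uSum F).coeff g = ∑ y : F, x.coeff (g * uni y) := by
  rw [uSum, Finset.mul_sum, MonoidAlgebra.coeff_sum, Finset.sum_apply']
  simp only [MonoidAlgebra.coeff_mul_single_apply, mul_one, uni_neg]
  exact Fintype.sum_equiv (Equiv.neg F) _ _ (fun _ => rfl)

open Classical in
theorem single_mul_uSum_coeff (g h : GL (Fin 2) F) :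
    (MonoidAlgebra.single h 1 * uSum F).coeff g =
      if ∃ y, g = h * uni y then 1 else 0 := by
  rw [mul_uSum_coeff]
  simp only [MonoidAlgebra.coeff_single, Finsupp.single_apply]
  split_ifs with hg
  · obtain ⟨y, rfl⟩ := hg
    rw [Finset.sum_eq_single (-y)]
    · rw [mul_assoc, ← uni_neg]; simp
    · intro z _ hz
      rw [if_neg]
      intro e
      apply hz
      rw [mul_assoc, left_eq_mul] at e
      have := congrArg (fun M => M.1 0 1) e
      simp only [mul_uni_val, uni_val] at this
      simp at this
      linear_combination this
    · simp
  · refine Finset.sum_eq_zero fun y _ => if_neg fun e => hg ⟨-y, ?_⟩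
    rw [e, mul_assoc, ← uni_neg]; simp

/-- The difference of a split and a non-split class sum. -/
def zSum (a b : Fˣ) (S : F) : MonoidAlgebra ℤ (GL (Fin 2) F) :=
  classSum 1 (a + b : F) (a * b) - classSum (-1) S (a * b)

theorem zSum_comm (a b : Fˣ) (S : F) (x : MonoidAlgebra ℤ (GL (Fin 2) F)) :
    zSum a b S * x = x * zSum a b S := by
  rw [zSum, sub_mul, mul_sub, classSum_comm, classSum_comm]

/-- `X² - S X + D` has no two distinct roots in `F`. -/
def NonSplit (S D : F) : Prop := ∀ x y : F, x + y = S → x * y = D → x = y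

/-- Off the Borel subgroup the split and non-split coset sums cancel; on it the non-split part
vanishes and the split part is q times the indicator of the two torus cosets. Thus the central
element `zSum` acts on U-invariants as translation by a torus element plus its Weyl conjugate. -/
theorem zSum_mul_uSum {a b : Fˣ} {S : F} (hS : NonSplit S (a * b : F)) :
    zSum a b S * uSum F = (Fintype.card F : ℤ) •
      ((MonoidAlgebra.single (dg a b) 1 + MonoidAlgebra.single (dg b a) 1) * uSum F) := by
  classical
  ext g
  rw [MonoidAlgebra.coeff_smul_apply, add_mul, MonoidAlgebra.coeff_add, Finsupp.add_apply,
    single_mul_uSum_coeff, single_mul_uSum_coeff]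
  simp only [exists_eq_dg_mul_uni_iff]
  rw [mul_uSum_coeff]
  simp only [zSum, MonoidAlgebra.coeff_sub, Finsupp.sub_apply, classSum_coeff,
    Finset.sum_sub_distrib]
  by_cases hg : g.1 1 0 = 0
  · rw [sum_wt_split_mul_uni _ _ _ hg, sum_wt_nonsplit_mul_uni _ _ hS _ hg]
    simp [hg]
  · rw [sum_wt_mul_uni_of_ne_zero _ _ _ _ hg, sum_wt_mul_uni_of_ne_zero _ _ _ _ hg]
    simp [hg]

theorem sum_zSum_mul_uni {a b : Fˣ} {S : F} (g : GL (Fin 2) F) (hg : g.1 1 0 ≠ 0) :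
    ∑ y : F, (zSum a b S).coeff (g * uni y) = 0 := by
  classical
  simp only [zSum, MonoidAlgebra.coeff_sub, Finsupp.sub_apply, classSum_coeff,
    Finset.sum_sub_distrib]
  rw [sum_wt_mul_uni_of_ne_zero _ _ _ _ hg, sum_wt_mul_uni_of_ne_zero _ _ _ _ hg, sub_self]

omit [Fintype F] in
theorem colMat_conj_val (m : F) (g : GL (Fin 2) F) :
    ((colMat m)⁻¹ * g * colMat m).1 =
      !![g.1 1 0 * m + g.1 1 1, -g.1 1 0;
        -(g.1 0 0 * m + g.1 0 1) + m * (g.1 1 0 * m + g.1 1 1), g.1 0 0 - m * g.1 1 0] := by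
  rw [Units.val_mul, Units.val_mul, colMat_inv_val, colMat_val]
  conv_lhs => rw [Matrix.eta_fin_two g.1]
  rw [Matrix.mul_fin_two, Matrix.mul_fin_two]
  ext i j
  fin_cases i <;> fin_cases j <;> simp <;> ring

open Classical in
/-- The number of lines on which `g` acts by `a`, with `g` acting by `b` on the quotient. -/
theorem wt_one_eq (a b : Fˣ) (g : GL (Fin 2) F) :
    wt 1 (a + b : F) (a * b) g = (if g.1 1 0 = 0 ∧ g.1 0 0 = a ∧ g.1 1 1 = b then 1 else 0) +
      ∑ m : F, if -(g.1 0 0 * m + g.1 0 1) + m * (g.1 1 0 * m + g.1 1 1) = 0 ∧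
        g.1 1 0 * m + g.1 1 1 = a ∧ g.1 0 0 - m * g.1 1 0 = b then 1 else 0 := by
  have hb : ∀ m, g.1 1 0 * m + g.1 1 1 = a ∧ g.1 0 0 - m * g.1 1 0 = b →
      g.1.trace = a + b := by
    rintro m ⟨h1, h2⟩
    rw [Matrix.trace_fin_two, ← h1, ← h2]; ring
  by_cases hs : g.1.trace = a + b ∧ g.1.det = a * b
  · obtain ⟨ht, hd⟩ := hs
    rw [wt, if_pos ⟨ht, hd⟩]
    rw [Matrix.trace_fin_two] at ht
    rw [Matrix.det_fin_two] at hd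
    by_cases hg : g.1 1 0 = 0
    · have hd' : g.1 0 0 * g.1 1 1 = a * b := by rw [← hd, hg]; ring
      simp only [mem_center_iff_entries, hg, true_and, zero_mul, mul_zero, sub_zero, zero_add]
      by_cases hab : (a : F) = b
      · have h0 : g.1 0 0 = a ∧ g.1 1 1 = a := by
          rcases eq_or_eq_of_add_mul ht hd' with h | h <;> simp [h.1, h.2, hab]
        by_cases h01 : g.1 0 1 = 0
        · have : ∀ m : F, -((a : F) * m) + m * a = 0 := fun m => by ring
          simp [h0.1, h0.2, h01, ← hab, this]
        · have : ∀ m : F, ¬ (-((a : F) * m + g.1 0 1) + m * a = 0) := fun m h =>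
            h01 (by linear_combination -h)
          simp only [h0.1, h0.2, h01, ← hab, this]
          simp
      · have hne : ¬ (g.1 0 1 = 0 ∧ g.1 0 0 = g.1 1 1) := by
          rintro ⟨-, h⟩
          rcases eq_or_eq_of_add_mul ht hd' with h' | h' <;> rw [h'.1, h'.2] at h
          · exact hab h
          · exact hab h.symm
        rw [if_neg hne]
        rcases eq_or_eq_of_add_mul ht hd' with h' | h' <;> rw [h'.1, h'.2]
        · simp [hab, eq_comm (a := (b : F))]
        -- With the diagonal entries in the opposite order, the a-eigenline is not the coordinate
        -- line; it is spanned by (m, 1) for exactly this m.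
        · have : ∀ m : F, -((b : F) * m + g.1 0 1) + m * a = 0 ↔ m = g.1 0 1 / (a - b) := by
            intro m
            rw [eq_div_iff (sub_ne_zero.mpr hab)]
            constructor <;> intro h <;> linear_combination h
          simp only [this]
          simp [hab, eq_comm (a := (b : F))]
    · have hm : ∀ m, (-(g.1 0 0 * m + g.1 0 1) + m * (g.1 1 0 * m + g.1 1 1) = 0 ∧
          g.1 1 0 * m + g.1 1 1 = a ∧ g.1 0 0 - m * g.1 1 0 = b) ↔ m = (a - g.1 1 1) / g.1 1 0 := by
        intro m
        rw [eq_div_iff hg]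
        constructor
        · rintro ⟨-, h, -⟩
          linear_combination h
        · intro h
          refine ⟨?_, by linear_combination h, by linear_combination ht - h⟩
          apply mul_left_cancel₀ hg
          have e1 : g.1 1 0 * m = a - g.1 1 1 := by linear_combination h
          linear_combination (-(g.1 0 0) + g.1 1 0 * m + a) * e1 + hd - a * ht
      have hc : g ∉ Subgroup.center (GL (Fin 2) F) := fun h =>
        hg (mem_center_iff_entries.mp h).2.1
      simp only [hm]
      simp [hc, hg]
  · rw [wt, if_neg hs, if_neg, Finset.sum_eq_zero, add_zero]
    · intro m _
      rw [if_neg]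
      rintro ⟨h1, h2, h3⟩
      refine hs ⟨hb m ⟨h2, h3⟩, ?_⟩
      rw [Matrix.det_fin_two, ← h2, ← h3]
      linear_combination (g.1 1 0) * h1
    · rintro ⟨h1, h2, h3⟩
      refine hs ⟨?_, ?_⟩
      · rw [Matrix.trace_fin_two, h2, h3]
      · rw [Matrix.det_fin_two, h1, h2, h3]; ring

/-- Each matrix is counted once for every line on which it acts by a, with b on the quotient.
Sorting by the line gives the Borel coset for the coordinate line and its conjugate by `colMat m`
for the line through (m, 1). -/
theorem classSum_one_eq (a b : Fˣ) :
    classSum 1 (a + b : F) (a * b) = MonoidAlgebra.single (dg a b) 1 * uSum F +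
      ∑ m : F, MonoidAlgebra.single (colMat m) 1 * (MonoidAlgebra.single (dg a b) 1 * uSum F) *
        MonoidAlgebra.single (colMat m)⁻¹ 1 := by
  classical
  ext g
  rw [classSum_coeff, wt_one_eq, MonoidAlgebra.coeff_add, Finsupp.add_apply,
    MonoidAlgebra.coeff_sum, Finset.sum_apply', single_mul_uSum_coeff]
  simp only [exists_eq_dg_mul_uni_iff]
  congr 1
  refine Finset.sum_congr rfl fun m _ => ?_
  rw [MonoidAlgebra.coeff_mul_single_apply, MonoidAlgebra.coeff_single_mul_apply,
    single_mul_uSum_coeff]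
  simp only [exists_eq_dg_mul_uni_iff, inv_inv, one_mul, mul_one, ← mul_assoc, colMat_conj_val]
  simp

/-- Being central, `zSum` passes through the conjugations in `classSum_one_eq`, and on each Borel
coset sum it acts by `zSum_mul_uSum`. -/
theorem zSum_mul_classSum_one {a b c d : Fˣ} {S : F} (hS : NonSplit S (a * b : F)) :
    zSum a b S * classSum 1 (c + d : F) (c * d) = (Fintype.card F : ℤ) •
      (classSum 1 (a * c + b * d : F) (a * c * (b * d)) +
        classSum 1 (b * c + a * d : F) (b * c * (a * d))) := by
  have key : zSum a b S * (MonoidAlgebra.single (dg c d) 1 * uSum F) = (Fintype.card F : ℤ) •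
      (MonoidAlgebra.single (dg (a * c) (b * d)) 1 * uSum F +
        MonoidAlgebra.single (dg (b * c) (a * d)) 1 * uSum F) := by
    rw [← mul_assoc, zSum_comm, mul_assoc, zSum_mul_uSum hS, mul_smul_comm, ← mul_assoc, mul_add,
      MonoidAlgebra.single_mul_single, MonoidAlgebra.single_mul_single, dg_mul, dg_mul, add_mul]
    simp only [mul_comm c, mul_comm d, mul_one]
  have h1 := classSum_one_eq c d
  have h2 := classSum_one_eq (a * c) (b * d)
  have h3 := classSum_one_eq (b * c) (a * d)
  simp only [Units.val_mul] at h2 h3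
  rw [h1, h2, h3, mul_add, key, Finset.mul_sum]
  have : ∀ m : F, zSum a b S * (MonoidAlgebra.single (colMat m) 1 *
      (MonoidAlgebra.single (dg c d) 1 * uSum F) * MonoidAlgebra.single (colMat m)⁻¹ 1) =
      (Fintype.card F : ℤ) • (MonoidAlgebra.single (colMat m) 1 *
        (MonoidAlgebra.single (dg (a * c) (b * d)) 1 * uSum F) *
          MonoidAlgebra.single (colMat m)⁻¹ 1 + MonoidAlgebra.single (colMat m) 1 *
        (MonoidAlgebra.single (dg (b * c) (a * d)) 1 * uSum F) *
          MonoidAlgebra.single (colMat m)⁻¹ 1) := by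
    intro m
    rw [← mul_assoc, ← mul_assoc, zSum_comm, mul_assoc _ (zSum a b S), key, mul_smul_comm,
      smul_mul_assoc, mul_add, add_mul]
  simp only [this, ← Finset.smul_sum, Finset.sum_add_distrib, smul_add]
  abel

end ClassSums


/-! ### Quadratic extensions of finite fields and point counts on conics -/

section Conics

variable {F k : Type} [Field F] [Fintype F] [Field k] [Algebra F k]

theorem frob_add (x y : k) : (x + y) ^ (Fintype.card F) = x ^ (Fintype.card F) + y ^ (Fintype.card F) :=
  map_add (FiniteField.frobeniusAlgHom F k) x y

theorem frob_sub (x y : k) : (x - y) ^ (Fintype.card F) = x ^ (Fintype.card F) - y ^ (Fintype.card F) :=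
  map_sub (FiniteField.frobeniusAlgHom F k) x y

theorem frob_algebraMap (a : F) : (algebraMap F k a) ^ (Fintype.card F) = algebraMap F k a := by
  rw [← map_pow, FiniteField.pow_card]

theorem exists_algebraMap_eq_of_frob {x : k} (hx : x ^ (Fintype.card F) = x) : ∃ a : F, algebraMap F k a = x := by
  have h1 : (∏ a : F, (Polynomial.X - Polynomial.C a)) = Polynomial.X ^ (Fintype.card F) - Polynomial.X := by
    have hm : (Polynomial.X ^ (Fintype.card F) - Polynomial.X : Polynomial F).Monic :=
      Polynomial.monic_X_pow_sub (by
        rw [Polynomial.degree_X]; exact_mod_cast Fintype.one_lt_card)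
    have := Polynomial.prod_multiset_X_sub_C_of_monic_of_roots_card_eq hm (by
      rw [FiniteField.roots_X_pow_card_sub_X,
        FiniteField.X_pow_card_sub_X_natDegree_eq _ Fintype.one_lt_card]; rfl)
    rw [FiniteField.roots_X_pow_card_sub_X] at this
    exact this
  have h2 := congrArg (Polynomial.aeval x) h1
  simp only [map_prod, map_sub, Polynomial.aeval_X, Polynomial.aeval_C, map_pow, hx, sub_self] at h2
  obtain ⟨a, -, ha⟩ := Finset.prod_eq_zero_iff.mp h2
  exact ⟨a, (sub_eq_zero.mp ha).symm⟩

open Polynomial in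
theorem card_pow_eq [IsAlgClosed k] {n : ℕ} (hn : (n : k) ≠ 0) {c : k} (hc : c ≠ 0) :
    Nat.card {x : k // x ^ n = c} = n := by
  classical
  have hn0 : 0 < n := Nat.pos_of_ne_zero (by rintro rfl; simp at hn)
  have hsep : (X ^ n - C c).Separable := separable_X_pow_sub_C c hn hc
  have := card_rootSet_eq_natDegree (K := k) hsep (IsAlgClosed.splits _)
  rw [natDegree_X_pow_sub_C, ← Nat.card_eq_fintype_card] at this
  refine Eq.trans (Nat.card_congr (Equiv.subtypeEquivRight fun x => ?_)) this
  rw [mem_rootSet]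
  simp [sub_eq_zero, X_pow_sub_C_ne_zero hn0]

variable {ρ : k} (hρ : (ρ ^ (Fintype.card F)) ^ (Fintype.card F) = ρ) (hρ' : ρ ^ (Fintype.card F) ≠ ρ) {T N : F}
  (hT : algebraMap F k T = ρ + ρ ^ (Fintype.card F)) (hN : algebraMap F k N = ρ * ρ ^ (Fintype.card F))

include hρ hρ' in
theorem exists_add_mul_eq {ξ : k} (hξ2 : (ξ ^ (Fintype.card F)) ^ (Fintype.card F) = ξ) :
    ∃ x w : F, algebraMap F k x + algebraMap F k w * ρ = ξ := by
  have hρ0 : ρ ^ (Fintype.card F) - ρ ≠ 0 := sub_ne_zero.mpr hρ'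
  -- Subtracting ξ = x + wρ from its Frobenius conjugate forces w to be this quotient, which is
  -- itself fixed by Frobenius.
  obtain ⟨w, hw⟩ := exists_algebraMap_eq_of_frob (F := F) (x := (ξ ^ (Fintype.card F) - ξ) / (ρ ^ (Fintype.card F) - ρ)) (by
    rw [div_pow, frob_sub, frob_sub, hξ2, hρ, ← neg_sub, ← neg_sub (ρ ^ (Fintype.card F)), neg_div_neg_eq])
  have hw' : algebraMap F k w * (ρ ^ (Fintype.card F) - ρ) = ξ ^ (Fintype.card F) - ξ := by rw [hw]; field_simp
  obtain ⟨x, hx⟩ := exists_algebraMap_eq_of_frob (F := F) (x := ξ - algebraMap F k w * ρ) (by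
    rw [frob_sub, mul_pow, frob_algebraMap]
    linear_combination -hw')
  exact ⟨x, w, by rw [hx]; ring⟩


include hT hN in
-- The quadratic form is the norm of x + wρ from the quadratic extension, and the norm is the power
-- q + 1.
theorem norm_add_mul (x w : F) : algebraMap F k (x * x + T * x * w + N * w * w) =
    (algebraMap F k x + algebraMap F k w * ρ) ^ (Fintype.card F + 1) := by
  rw [pow_succ, frob_add, mul_pow, frob_algebraMap, frob_algebraMap]
  simp only [map_add, map_mul, hT, hN]
  ring

include hρ hρ' hT hN

open Classical in
-- For c ≠ 0 the solutions correspond to the roots in k of ξ^(q+1) = c: there are q + 1 of them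
-- since q + 1 is invertible in k, and all lie in F(ρ) because c is fixed by Frobenius. For c = 0
-- the norm form is anisotropic.
theorem card_norm_eq [IsAlgClosed k] (c : F) :
    Nat.card {v : F × F // v.1 * v.1 + T * v.1 * v.2 + N * v.2 * v.2 = c} =
      if c = 0 then 1 else Fintype.card F + 1 := by
  classical
  have hρ0 : ρ ^ (Fintype.card F) - ρ ≠ 0 := sub_ne_zero.mpr hρ'
  have inj : ∀ v v' : F × F, algebraMap F k v.1 + algebraMap F k v.2 * ρ =
      algebraMap F k v'.1 + algebraMap F k v'.2 * ρ → v = v' := by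
    intro v v' h
    have h' := congrArg (· ^ (Fintype.card F)) h
    simp only [frob_add, mul_pow, frob_algebraMap] at h'
    have e : (algebraMap F k v.2 - algebraMap F k v'.2) * (ρ ^ (Fintype.card F) - ρ) = 0 := by
      linear_combination h' - h
    have e2 : algebraMap F k v.2 = algebraMap F k v'.2 :=
      sub_eq_zero.mp ((mul_eq_zero.mp e).resolve_right hρ0)
    have e1 : algebraMap F k v.1 = algebraMap F k v'.1 := by
      rw [e2] at h; exact add_right_cancel h
    exact Prod.ext ((algebraMap F k).injective e1) ((algebraMap F k).injective e2)
  split_ifs with hc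
  · subst hc
    rw [Nat.card_eq_one_iff_exists]
    refine ⟨⟨(0, 0), by simp⟩, ?_⟩
    rintro ⟨v, hv⟩
    rw [Subtype.mk.injEq]
    apply inj
    have := norm_add_mul hT hN v.1 v.2
    rw [hv, map_zero] at this
    simpa using (pow_eq_zero_iff (by omega)).mp this.symm
  · have hc' : algebraMap F k c ≠ 0 := by simpa using hc
    have hq : ((Fintype.card F + 1 : ℕ) : k) ≠ 0 := by
      have : ((Fintype.card F : ℕ) : k) = 0 := by
        rw [← map_natCast (algebraMap F k), FiniteField.cast_card_eq_zero, map_zero]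
      push_cast
      rw [this]; simp
    refine Eq.trans ?_ (card_pow_eq hq hc')
    refine Nat.card_congr (Equiv.ofBijective (fun v => ⟨algebraMap F k v.1.1 +
      algebraMap F k v.1.2 * ρ, ?_⟩) ⟨?_, ?_⟩)
    · rw [← norm_add_mul hT hN, v.2]
    · intro v v' h
      exact Subtype.ext (inj _ _ (Subtype.ext_iff.mp h))
    · rintro ⟨ξ, hξ⟩
      have hξ0 : ξ ≠ 0 := by rintro rfl; simp at hξ; exact hc' hξ.symm
      have hξ2 : (ξ ^ (Fintype.card F)) ^ (Fintype.card F) = ξ := by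
        have h1 := frob_algebraMap (k := k) c
        rw [← hξ] at h1
        have h2 : (ξ ^ (Fintype.card F)) ^ (Fintype.card F) * ξ ^ (Fintype.card F) = ξ * ξ ^ (Fintype.card F) := by
          rw [← mul_pow, ← pow_succ, h1, pow_succ, mul_comm]
        exact mul_right_cancel₀ (pow_ne_zero _ hξ0) h2
      obtain ⟨x, w, hx⟩ := exists_add_mul_eq hρ hρ' hξ2
      replace hx : algebraMap F k x = ξ - algebraMap F k w * ρ := by rw [← hx]; ring
      refine ⟨⟨(x, w), ?_⟩, Subtype.ext (by simp [hx])⟩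
      apply (algebraMap F k).injective
      rw [norm_add_mul hT hN, hx, ← hξ]
      simp

open Classical in
/-- The number of points on an anisotropic affine conic. -/
theorem card_conic [IsAlgClosed k] (l m D : F) :
    Nat.card {v : F × F //
      v.1 * v.1 + T * v.1 * v.2 + N * v.2 * v.2 - l * v.1 - m * v.2 + D = 0} =
      if ∃ x w : F, 2 * x + T * w = l ∧ T * x + 2 * N * w = m ∧
        x * x + T * x * w + N * w * w = D then 1 else Fintype.card F + 1 := by
  have hd : T ^ 2 - 4 * N ≠ 0 := by
    intro h
    have := congrArg (algebraMap F k) h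
    simp only [map_sub, map_mul, map_pow, hT, hN, map_zero, map_ofNat] at this
    have h2 : (ρ ^ (Fintype.card F) - ρ) ^ 2 = 0 := by linear_combination this
    exact hρ' (sub_eq_zero.mp (pow_eq_zero_iff two_ne_zero |>.mp h2))
  -- The center of the conic. The discriminant T² - 4N equals (ρ^q - ρ)², so the gradient equations
  -- can be solved in every characteristic, two included; translating to the center leaves a norm
  -- equation.
  obtain ⟨x₀, w₀, hl, hm⟩ : ∃ x w : F, 2 * x + T * w = l ∧ T * x + 2 * N * w = m :=
    ⟨(T * m - 2 * N * l) / (T ^ 2 - 4 * N), (T * l - 2 * m) / (T ^ 2 - 4 * N),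
      by linear_combination l * mul_inv_cancel₀ hd, by linear_combination m * mul_inv_cancel₀ hd⟩
  have huniq : ∀ x w : F, 2 * x + T * w = l → T * x + 2 * N * w = m → x = x₀ ∧ w = w₀ := by
    intro x w h1 h2
    constructor <;> apply mul_left_cancel₀ hd
    · linear_combination T * (h2 - hm) - 2 * N * (h1 - hl)
    · linear_combination T * (h1 - hl) - 2 * (h2 - hm)
  have h1 : (∃ x w : F, 2 * x + T * w = l ∧ T * x + 2 * N * w = m ∧
      x * x + T * x * w + N * w * w = D) ↔ x₀ * x₀ + T * x₀ * w₀ + N * w₀ * w₀ - D = 0 := by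
    constructor
    · rintro ⟨x, w, h1, h2, h3⟩
      obtain ⟨rfl, rfl⟩ := huniq x w h1 h2
      rw [h3, sub_self]
    · exact fun h => ⟨x₀, w₀, hl, hm, sub_eq_zero.mp h⟩
  rw [if_congr h1 rfl rfl, ← card_norm_eq hρ hρ' hT hN]
  refine Nat.card_congr ((Equiv.subRight (x₀, w₀)).subtypeEquiv fun v => ?_)
  simp only [Equiv.subRight_apply, Prod.fst_sub, Prod.snd_sub]
  rw [← hl, ← hm, ← sub_eq_zero (a := (_ : F) + _) (b := _ - D)]
  constructor <;> intro h <;> linear_combination h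

end Conics


/-! ### Products with non-split class sums -/

section NonSplitProducts

open Matrix

variable {F : Type} [Field F]

/-- The companion matrix with trace `t` and determinant `d`. -/
def cmp (t : F) (d : Fˣ) : GL (Fin 2) F :=
  Matrix.GeneralLinearGroup.mkOfDetNeZero !![0, -(d : F); 1, t] (by simp [det_fin_two])

theorem cmp_val (t : F) (d : Fˣ) : (cmp t d).1 = !![0, -(d : F); 1, t] := rfl

theorem cmp_trace (t : F) (d : Fˣ) : (cmp t d).1.trace = t := by simp [cmp_val, trace_fin_two]

theorem cmp_det (t : F) (d : Fˣ) : (cmp t d).1.det = d := by simp [cmp_val, det_fin_two]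

theorem cmp_not_mem_center (t : F) (d : Fˣ) : cmp t d ∉ Subgroup.center (GL (Fin 2) F) := by
  rw [mem_center_iff_entries]
  simp [cmp_val]

/-- A non-scalar matrix of size two has a cyclic vector v, and in the basis v, gv it becomes a
companion matrix. A coordinate vector serves, or (1, 1) if g is diagonal. -/
theorem exists_conj_cmp {g : GL (Fin 2) F} (hg : g ∉ Subgroup.center (GL (Fin 2) F)) {d : Fˣ}
    (hd : g.1.det = d) : ∃ x : GL (Fin 2) F, g = x * cmp g.1.trace d * x⁻¹ := by
  suffices h : ∃ v0 v1 : F, v0 * (g.1 1 0 * v0 + g.1 1 1 * v1) -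
      (g.1 0 0 * v0 + g.1 0 1 * v1) * v1 ≠ 0 by
    obtain ⟨v0, v1, hv⟩ := h
    refine ⟨Matrix.GeneralLinearGroup.mkOfDetNeZero !![v0, g.1 0 0 * v0 + g.1 0 1 * v1;
      v1, g.1 1 0 * v0 + g.1 1 1 * v1] (by simpa [det_fin_two] using hv), ?_⟩
    rw [eq_mul_inv_iff_mul_eq]
    ext i j
    rw [Units.val_mul, Units.val_mul, cmp_val, ← hd, det_fin_two g.1, trace_fin_two g.1]
    fin_cases i <;> fin_cases j <;>
      simp [Matrix.GeneralLinearGroup.mkOfDetNeZero, Matrix.mul_apply, Fin.sum_univ_two] <;> ring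
  by_cases h1 : g.1 1 0 = 0
  · by_cases h2 : g.1 0 1 = 0
    · refine ⟨1, 1, ?_⟩
      intro h
      refine hg (mem_center_iff_entries.mpr ⟨h2, h1, ?_⟩)
      rw [h1, h2] at h
      linear_combination -h
    · exact ⟨0, 1, by simpa using h2⟩
  · exact ⟨1, 0, by simpa using h1⟩

/-- A class function takes the same value at non-central elements with the same trace and
determinant. -/
theorem classFun_eq {A : Type*} {χ : GL (Fin 2) F → A} (hχ : ∀ x g, χ (x * g * x⁻¹) = χ g)
    {g h : GL (Fin 2) F} (hg : g ∉ Subgroup.center (GL (Fin 2) F))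
    (hh : h ∉ Subgroup.center (GL (Fin 2) F)) (ht : g.1.trace = h.1.trace)
    (hd : g.1.det = h.1.det) : χ g = χ h := by
  obtain ⟨x, hx⟩ := exists_conj_cmp hg (d := Units.mk0 _ (det_ne_zero_GL g)) rfl
  obtain ⟨y, hy⟩ := exists_conj_cmp hh (d := Units.mk0 _ (det_ne_zero_GL g)) hd.symm
  rw [hx, hy, hχ, hχ, ht]

variable [Fintype F]

theorem card_det_eq (d : Fˣ) :
    Nat.card {g : GL (Fin 2) F // g.1 1 0 ≠ 0 ∧ g.1.det = d} =
      Fintype.card F * Fintype.card F * (Fintype.card F - 1) := by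
  classical
  have : Nat.card (F × F × Fˣ) = Fintype.card F * Fintype.card F * (Fintype.card F - 1) := by
    rw [Nat.card_prod, Nat.card_prod, Nat.card_units, Nat.card_eq_fintype_card, mul_assoc]
  rw [← this]
  refine Nat.card_congr
    { toFun := fun g => (g.1.1 0 0, g.1.1 1 1, Units.mk0 _ g.2.1)
      invFun := fun v => ⟨Matrix.GeneralLinearGroup.mkOfDetNeZero
        !![v.1, (v.1 * v.2.1 - d) / v.2.2; v.2.2, v.2.1] (by simp [det_fin_two]), ?_, ?_⟩
      left_inv := ?_, right_inv := ?_ }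
  · simp [Matrix.GeneralLinearGroup.mkOfDetNeZero]
  · simp [Matrix.GeneralLinearGroup.mkOfDetNeZero, det_fin_two]
  · rintro ⟨g, h1, h2⟩
    rw [Subtype.mk.injEq]
    ext i j
    have : (g.1 0 0 * g.1 1 1 - d) / g.1 1 0 = g.1 0 1 := by
      rw [div_eq_iff h1, ← h2, det_fin_two]; ring
    fin_cases i <;> fin_cases j <;> simp [Matrix.GeneralLinearGroup.mkOfDetNeZero, this]
  · rintro ⟨x, y, w⟩
    simp [Matrix.GeneralLinearGroup.mkOfDetNeZero]

variable [Fintype (GL (Fin 2) F)]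

/-- Summing over all translates by U counts the total q times, while only matrices outside the Borel
subgroup contribute; with the given determinant there are q²(q - 1) of these. -/
theorem sum_wt_nonsplit {S : F} {d : Fˣ} (hS : NonSplit S (d : F)) :
    ∑ g, wt (-1) S (d : F) g = Fintype.card F * (Fintype.card F - 1) := by
  classical
  have h1 : ∑ g : GL (Fin 2) F, ∑ x : F, wt (-1) S (d : F) (g * uni x) =
      Fintype.card F * ∑ g, wt (-1) S (d : F) g := by
    rw [Finset.sum_comm]
    simp_rw [fun x : F => Fintype.sum_equiv (Equiv.mulRight (uni x))
      (fun g => wt (-1) S (d : F) (g * uni x)) (fun g => wt (-1) S (d : F) g) (fun _ => rfl)]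
    simp
  have h2 : ∀ g : GL (Fin 2) F, ∑ x : F, wt (-1) S (d : F) (g * uni x) =
      if g.1 1 0 ≠ 0 ∧ g.1.det = d then 1 else 0 := by
    intro g
    by_cases hg : g.1 1 0 = 0
    · rw [sum_wt_nonsplit_mul_uni _ _ hS _ hg]; simp [hg]
    · rw [sum_wt_mul_uni_of_ne_zero _ _ _ _ hg]; simp [hg]
  have h3 := card_det_eq d
  rw [Nat.card_eq_fintype_card, Fintype.card_subtype] at h3
  simp_rw [h2] at h1
  rw [Finset.sum_boole, h3] at h1
  have h4 : (Fintype.card F : ℤ) ≠ 0 := by exact_mod_cast Fintype.card_ne_zero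
  apply mul_left_cancel₀ h4
  rw [← h1]
  have := Fintype.card_pos (α := F)
  push_cast [this]
  ring

open Classical in
/-- The value of a class function on a non-split class sum. -/
theorem sum_wt_smul {A : Type*} [AddCommGroup A] {χ : GL (Fin 2) F → A}
    (hχ : ∀ x g, χ (x * g * x⁻¹) = χ g) {S : F} {d : Fˣ} (hS : NonSplit S (d : F)) :
    ∑ g, wt (-1) S (d : F) g • χ g =
      ((Fintype.card F : ℤ) * (Fintype.card F - 1)) • χ (cmp S d) +
      ∑ g with g ∈ Subgroup.center (GL (Fin 2) F),
        wt (-1) S (d : F) g • (χ g - χ (cmp S d)) := by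
  rw [← sum_wt_nonsplit hS, Finset.sum_smul, Finset.sum_filter, ← Finset.sum_add_distrib]
  refine Finset.sum_congr rfl fun g _ => ?_
  by_cases hg : g ∈ Subgroup.center (GL (Fin 2) F)
  · rw [if_pos hg, smul_sub]; abel
  · rw [if_neg hg, add_zero]
    by_cases h : g.1.trace = S ∧ g.1.det = d
    · rw [classFun_eq hχ hg (cmp_not_mem_center S d) (by rw [h.1, cmp_trace])
        (by rw [h.2, cmp_det])]
    · simp [wt, h]

end NonSplitProducts


/-! ### Traces of products with an elliptic companion matrix -/

section NonSplitProducts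

open Matrix

variable {F k : Type} [Field F] [Fintype F] [Field k] [Algebra F k]

/-- By unique factorization roots in F would have to be τ and τ^q, and a root in F is fixed by
Frobenius. -/
theorem nonSplit_of_frob {τ : k} {S D : F} (hS : algebraMap F k S = τ + τ ^ Fintype.card F)
    (hD : algebraMap F k D = τ * τ ^ Fintype.card F) : NonSplit S D := by
  intro x y h1 h2
  rcases eq_or_eq_of_add_mul (R := k) (a := algebraMap F k x) (b := algebraMap F k y)
    (c := τ) (d := τ ^ Fintype.card F) (by rw [← map_add, h1, hS]) (by rw [← map_mul, h2, hD])
    with ⟨h3, h4⟩ | ⟨h3, h4⟩ <;> apply (algebraMap F k).injective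
  · rw [h4, ← h3, frob_algebraMap]
  · rw [h3, ← h4, frob_algebraMap]

variable {ρ : k} (hρ : (ρ ^ (Fintype.card F)) ^ (Fintype.card F) = ρ)
  (hρ' : ρ ^ (Fintype.card F) ≠ ρ) {T : F} {N : Fˣ}
  (hT : algebraMap F k T = ρ + ρ ^ (Fintype.card F))
  (hN : algebraMap F k N = ρ * ρ ^ (Fintype.card F))

omit [Fintype F] in
-- The two trace conditions are linear and eliminate the second column of h; the determinant
-- condition then becomes a conic in the first column.
theorem card_trace_mul_cmp (l σ D : F) (hD : D ≠ 0) :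
    Nat.card {h : GL (Fin 2) F // (h.1.trace = l ∧ h.1.det = D) ∧ (h * cmp T N).1.trace = σ} =
    Nat.card {v : F × F // v.1 * v.1 + T * v.1 * v.2 + N * v.2 * v.2 - l * v.1 -
      (T * l - σ) * v.2 + D = 0} := by
  have key : ∀ h : GL (Fin 2) F, (h * cmp T N).1.trace =
      h.1 0 1 + (h.1 1 0 * (-N) + h.1 1 1 * T) := by
    intro h
    rw [Units.val_mul, cmp_val, trace_fin_two]
    simp [Matrix.mul_apply, Fin.sum_univ_two]
  refine Nat.card_congr
    { toFun := fun h => ⟨(h.1.1 0 0, h.1.1 1 0), ?_⟩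
      invFun := fun v => ⟨Matrix.GeneralLinearGroup.mkOfDetNeZero
        !![v.1.1, σ + N * v.1.2 - T * (l - v.1.1); v.1.2, l - v.1.1] ?_, ?_⟩
      left_inv := ?_, right_inv := ?_ }
  · obtain ⟨h, ⟨h1, h2⟩, h3⟩ := h
    rw [key] at h3
    rw [trace_fin_two] at h1
    rw [det_fin_two] at h2
    simp only
    linear_combination (h.1 0 0 + T * h.1 1 0) * h1 - h2 - h.1 1 0 * h3
  · rw [det_fin_two]
    have := v.2
    intro h0
    apply hD
    simp at h0
    linear_combination this + h0
  · rw [key]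
    have := v.2
    refine ⟨⟨?_, ?_⟩, ?_⟩
    · simp [Matrix.GeneralLinearGroup.mkOfDetNeZero, trace_fin_two]
    · simp [Matrix.GeneralLinearGroup.mkOfDetNeZero, det_fin_two]
      linear_combination -this
    · simp [Matrix.GeneralLinearGroup.mkOfDetNeZero]
      ring
  · rintro ⟨h, ⟨h1, h2⟩, h3⟩
    rw [key] at h3
    rw [trace_fin_two] at h1
    have e1 : l - h.1 0 0 = h.1 1 1 := by rw [← h1]; ring
    have e2 : σ + N * h.1 1 0 - T * h.1 1 1 = h.1 0 1 := by rw [← h3]; ring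
    rw [Subtype.mk.injEq]
    ext i j
    fin_cases i <;> fin_cases j <;> simp [Matrix.GeneralLinearGroup.mkOfDetNeZero, e1, e2]
  · rintro ⟨⟨x, w⟩, hv⟩
    simp [Matrix.GeneralLinearGroup.mkOfDetNeZero]

/-- The scalar matrices. -/
def sc (a : Fˣ) : GL (Fin 2) F := dg a a

omit [Fintype F] in
theorem mem_center_iff_sc {g : GL (Fin 2) F} :
    g ∈ Subgroup.center (GL (Fin 2) F) ↔ ∃ a : Fˣ, g = sc a := by
  rw [mem_center_iff_entries]
  constructor
  · rintro ⟨h1, h2, h3⟩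
    have h0 : g.1 0 0 ≠ 0 := by
      intro h
      apply det_ne_zero_GL g
      rw [det_fin_two, h, h2]; ring
    refine ⟨Units.mk0 _ h0, ?_⟩
    ext i j
    fin_cases i <;> fin_cases j <;> simp [sc, dg_val, h1, h2, h3]
  · rintro ⟨a, rfl⟩
    simp [sc, dg_val]

omit [Fintype F] in
theorem sc_trace (a : Fˣ) : (sc a).1.trace = 2 * a := by
  simp [sc, dg_val, trace_fin_two, two_mul]

omit [Fintype F] in
theorem sc_det (a : Fˣ) : (sc a).1.det = a * a := by
  simp [sc, dg_val, det_fin_two]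

omit [Fintype F] in
theorem sc_mul_trace (a : Fˣ) (g : GL (Fin 2) F) : (sc a * g).1.trace = a * g.1.trace := by
  rw [Units.val_mul, trace_fin_two, trace_fin_two]
  simp [sc, dg_val, Matrix.mul_apply, Fin.sum_univ_two, mul_add]

omit [Fintype F] in
theorem sc_mul_det (a : Fˣ) (g : GL (Fin 2) F) : (sc a * g).1.det = a * a * g.1.det := by
  rw [Units.val_mul, det_mul, sc_det]

variable [Fintype (GL (Fin 2) F)]

open Classical in
theorem sum_wt_filter (ε : ℤ) (S D : F) (P : GL (Fin 2) F → Prop) :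
    ∑ h with P h, wt ε S D h =
      Nat.card {h : GL (Fin 2) F // (h.1.trace = S ∧ h.1.det = D) ∧ P h} +
      ε * Fintype.card F * Nat.card {a : Fˣ // (2 * (a : F) = S ∧ (a : F) * a = D) ∧ P (sc a)} := by
  have e1 : ∀ h : GL (Fin 2) F, wt ε S D h = (if h.1.trace = S ∧ h.1.det = D then 1 else 0) +
      ε * Fintype.card F * (if (h.1.trace = S ∧ h.1.det = D) ∧
        h ∈ Subgroup.center (GL (Fin 2) F) then 1 else 0) := by
    intro h
    rw [wt]
    split_ifs <;> simp_all
  have e2 : Nat.card {a : Fˣ // (2 * (a : F) = S ∧ (a : F) * a = D) ∧ P (sc a)} =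
      Nat.card {h : GL (Fin 2) F // P h ∧ (h.1.trace = S ∧ h.1.det = D) ∧
        h ∈ Subgroup.center (GL (Fin 2) F)} := by
    refine Nat.card_congr (Equiv.ofBijective (fun a => ⟨sc a.1, a.2.2, ?_, ?_⟩) ⟨?_, ?_⟩)
    · rw [sc_trace, sc_det]; exact a.2.1
    · exact mem_center_iff_sc.mpr ⟨_, rfl⟩
    · intro a b h
      have := congrArg (fun g : GL (Fin 2) F => g.1 0 0) (Subtype.ext_iff.mp h)
      exact Subtype.ext (Units.ext (by simpa [sc, dg_val] using this))
    · rintro ⟨h, h1, h2, h3⟩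
      obtain ⟨a, rfl⟩ := mem_center_iff_sc.mp h3
      rw [sc_trace, sc_det] at h2
      exact ⟨⟨a, h2, h1⟩, rfl⟩
  rw [e2]
  simp_rw [e1, Finset.sum_add_distrib, ← Finset.mul_sum, Finset.sum_boole, Finset.filter_filter,
    Nat.card_eq_fintype_card, Fintype.card_subtype, and_comm]


include hρ hρ' hT hN

omit [Fintype (GL (Fin 2) F)] in
open Classical in
-- The conic degenerates to one point exactly when its center (x, w) satisfies the norm equation.
-- With α = x + wρ the center equations prescribe the traces of α and αρ, and the remaining equation
-- prescribes the norm of α.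
theorem card_trace_mul_cmp_eq [IsAlgClosed k] (l σ D : F) (hD : D ≠ 0) :
    Nat.card {h : GL (Fin 2) F // (h.1.trace = l ∧ h.1.det = D) ∧ (h * cmp T N).1.trace = σ} =
    if ∃ α : k, (α ^ Fintype.card F) ^ Fintype.card F = α ∧ α + α ^ Fintype.card F = algebraMap F k l ∧
      α * α ^ Fintype.card F = algebraMap F k D ∧
      α * ρ + (α * ρ) ^ Fintype.card F = algebraMap F k σ then 1 else Fintype.card F + 1 := by
  rw [card_trace_mul_cmp l σ D hD, card_conic hρ hρ' hT hN]
  refine if_congr ?_ rfl rfl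
  have hinj := (algebraMap F k).injective
  constructor
  · rintro ⟨x, w, h1, h2, h3⟩
    refine ⟨algebraMap F k x + algebraMap F k w * ρ, ?_, ?_, ?_, ?_⟩
    · rw [frob_add, mul_pow, frob_algebraMap, frob_algebraMap, frob_add, mul_pow, frob_algebraMap,
        frob_algebraMap, hρ]
    · rw [frob_add, mul_pow, frob_algebraMap, frob_algebraMap, ← h1]
      simp only [map_add, map_mul, hT, map_ofNat]
      ring
    · rw [← pow_succ', ← norm_add_mul hT hN, h3]
    · have h4 : σ = T * (2 * x + T * w) - (T * x + 2 * N * w) := by rw [h2, h1]; ring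
      rw [mul_pow, frob_add, mul_pow, frob_algebraMap, frob_algebraMap, h4]
      simp only [map_sub, map_add, map_mul, hT, hN, map_ofNat]
      ring
  · rintro ⟨α, h0, h1, h2, h3⟩
    obtain ⟨x, w, rfl⟩ := exists_add_mul_eq hρ hρ' h0
    have e := frob_add (F := F) (algebraMap F k x) (algebraMap F k w * ρ)
    rw [mul_pow, frob_algebraMap, frob_algebraMap] at e
    refine ⟨x, w, hinj ?_, hinj ?_, hinj ?_⟩
    · rw [← h1, e]
      simp only [map_add, map_mul, hT, map_ofNat]
      ring
    · simp only [map_sub, map_add, map_mul, hT, hN, map_ofNat, ← h1, ← h3, mul_pow, e]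
      ring
    · rw [← h2, ← pow_succ', norm_add_mul hT hN]

open Classical in
-- The conic degenerates, losing q points, only if a = b and σ = aT. In that case the scalar matrix
-- a satisfies the trace condition as well, and its extra weight q restores the count.
theorem sum_wt_split_trace [IsAlgClosed k] (a b : Fˣ) (σ : F) :
    ∑ h : GL (Fin 2) F with (h * cmp T N).1.trace = σ, wt 1 (a + b : F) (a * b) h =
      Fintype.card F + 1 := by
  have hinj := (algebraMap F k).injective
  rw [sum_wt_filter, card_trace_mul_cmp_eq hρ hρ' hT hN _ _ _ (mul_ne_zero a.ne_zero b.ne_zero)]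
  have h1 : (∃ α : k, (α ^ Fintype.card F) ^ Fintype.card F = α ∧
      α + α ^ Fintype.card F = algebraMap F k (a + b : F) ∧
      α * α ^ Fintype.card F = algebraMap F k (a * b : F) ∧
      α * ρ + (α * ρ) ^ Fintype.card F = algebraMap F k σ) ↔ a = b ∧ a * T = σ := by
    constructor
    · rintro ⟨α, h0, h1, h2, h3⟩
      rw [map_add] at h1
      rw [map_mul] at h2
      have key : α = algebraMap F k a ∧ a = b := by
        rcases eq_or_eq_of_add_mul h1 h2 with ⟨h4, h5⟩ | ⟨h4, h5⟩ <;>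
        · rw [h4, frob_algebraMap] at h5
          have := hinj h5
          exact ⟨by rw [h4, this], Units.ext (by rw [this])⟩
      refine ⟨key.2, hinj ?_⟩
      rw [map_mul, hT, ← h3, key.1, mul_pow, frob_algebraMap, mul_add]
    · rintro ⟨rfl, h2⟩
      refine ⟨algebraMap F k a, ?_, ?_, ?_, ?_⟩
      · simp only [frob_algebraMap]
      · rw [frob_algebraMap, map_add]
      · rw [frob_algebraMap, map_mul]
      · rw [mul_pow, frob_algebraMap, ← mul_add, ← hT, ← map_mul, h2]
  have h2 : Nat.card {c : Fˣ // (2 * (c : F) = a + b ∧ (c : F) * c = a * b) ∧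
      (sc c * cmp T N).1.trace = σ} = if a = b ∧ a * T = σ then 1 else 0 := by
    have e : ∀ c : Fˣ, ((2 * (c : F) = a + b ∧ (c : F) * c = a * b) ∧
        (sc c * cmp T N).1.trace = σ) ↔ c = a ∧ (a = b ∧ a * T = σ) := by
      intro c
      rw [sc_mul_trace, cmp_trace, two_mul]
      constructor
      · rintro ⟨⟨h1, h2⟩, h3⟩
        rcases eq_or_eq_of_add_mul h1 h2 with ⟨h4, h5⟩ | ⟨h4, h5⟩
        · exact ⟨Units.ext h4, Units.ext (h4.symm.trans h5), by rw [← h4, h3]⟩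
        · exact ⟨Units.ext h5, Units.ext (h5.symm.trans h4), by rw [← h5, h3]⟩
      · rintro ⟨rfl, rfl, h⟩
        exact ⟨⟨rfl, rfl⟩, h⟩
    rw [Nat.card_congr (Equiv.subtypeEquivRight e)]
    split_ifs with h
    · rw [Nat.card_eq_one_iff_exists]
      exact ⟨⟨a, rfl, h⟩, fun c => Subtype.ext c.2.1⟩
    · simp [h]
  rw [h2, if_congr h1 rfl rfl]
  split_ifs <;> push_cast <;> ring

variable {τ : k} (hτ : (τ ^ (Fintype.card F)) ^ (Fintype.card F) = τ) (hτ0 : τ ≠ 0) {S D S₁ S₂ : F}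
  (hS : algebraMap F k S = τ + τ ^ (Fintype.card F))
  (hD : algebraMap F k D = τ * τ ^ (Fintype.card F))
  (hS₁ : algebraMap F k S₁ = τ * ρ + (τ * ρ) ^ (Fintype.card F))
  (hS₂ : algebraMap F k S₂ = τ ^ (Fintype.card F) * ρ + (τ ^ (Fintype.card F) * ρ) ^ (Fintype.card F))

include hτ hτ0 hS hD hS₁ hS₂

open Classical in
-- The degenerate values of σ are the traces of τρ and τ^q ρ, each costing q points. They coincide
-- exactly when τ lies in F; the scalar matrix τ, of extra weight -q, then supplies the second loss.
theorem sum_wt_nonsplit_trace [IsAlgClosed k] (σ : F) :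
    ∑ h : GL (Fin 2) F with (h * cmp T N).1.trace = σ, wt (-1) S D h =
      Fintype.card F + 1 - Fintype.card F * ((if σ = S₁ then 1 else 0) +
        (if σ = S₂ then 1 else 0)) := by
  have hinj := (algebraMap F k).injective
  have hD0 : D ≠ 0 := by
    rintro rfl
    rw [map_zero] at hD
    rcases mul_eq_zero.mp hD.symm with h | h
    · exact hτ0 h
    · exact hτ0 (pow_eq_zero_iff (Fintype.card_ne_zero) |>.mp h)
  rw [sum_wt_filter, card_trace_mul_cmp_eq hρ hρ' hT hN _ _ _ hD0]
  have h1 : (∃ α : k, (α ^ Fintype.card F) ^ Fintype.card F = α ∧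
      α + α ^ Fintype.card F = algebraMap F k S ∧
      α * α ^ Fintype.card F = algebraMap F k D ∧
      α * ρ + (α * ρ) ^ Fintype.card F = algebraMap F k σ) ↔ σ = S₁ ∨ σ = S₂ := by
    rw [hS, hD, ← hinj.eq_iff, ← hinj.eq_iff, hS₁, hS₂]
    constructor
    · rintro ⟨α, h0, h1, h2, h3⟩
      rcases eq_or_eq_of_add_mul h1 h2 with ⟨rfl, h5⟩ | ⟨rfl, h5⟩
      · exact Or.inl h3.symm
      · exact Or.inr h3.symm
    · rintro (h | h)
      · exact ⟨τ, hτ, rfl, rfl, h.symm⟩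
      · exact ⟨τ ^ Fintype.card F, by rw [hτ], by rw [hτ, add_comm], by rw [hτ, mul_comm], h.symm⟩
  have h12 : S₁ = S₂ ↔ τ ^ Fintype.card F = τ := by
    rw [← hinj.eq_iff, hS₁, hS₂, mul_pow, mul_pow, hτ]
    constructor
    · intro h
      have : (τ ^ Fintype.card F - τ) * (ρ ^ Fintype.card F - ρ) = 0 := by linear_combination h
      exact sub_eq_zero.mp ((mul_eq_zero.mp this).resolve_right (sub_ne_zero.mpr hρ'))
    · intro h; rw [h]
  have h2 : Nat.card {c : Fˣ // (2 * (c : F) = S ∧ (c : F) * c = D) ∧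
      (sc c * cmp T N).1.trace = σ} = if σ = S₁ ∧ σ = S₂ then 1 else 0 := by
    have e : ∀ c : Fˣ, ((2 * (c : F) = S ∧ (c : F) * c = D) ∧
        (sc c * cmp T N).1.trace = σ) ↔ algebraMap F k c = τ ∧ (σ = S₁ ∧ σ = S₂) := by
      intro c
      rw [sc_mul_trace, cmp_trace, two_mul, ← hinj.eq_iff, ← hinj.eq_iff (b := D), hS, hD, map_add,
        map_mul, ← hinj.eq_iff (b := σ), ← hinj.eq_iff (a := σ), ← hinj.eq_iff (a := σ), map_mul, hT]
      constructor
      · rintro ⟨⟨h1, h2⟩, h3⟩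
        have h4 : τ ^ Fintype.card F = τ ∧ algebraMap F k c = τ := by
          rcases eq_or_eq_of_add_mul h1 h2 with ⟨h4, h5⟩ | ⟨h4, h5⟩
          · exact ⟨h5.symm.trans h4, h4⟩
          · exact ⟨h4.symm.trans h5, h5⟩
        refine ⟨h4.2, ?_, ?_⟩ <;> rw [← h3, h4.2]
        · rw [hS₁, mul_pow, h4.1, mul_add]
        · rw [hS₂, mul_pow, h4.1, h4.1, mul_add]
      · rintro ⟨h1, h2, h3⟩
        have h4 : τ ^ Fintype.card F = τ := by rw [← h1, frob_algebraMap]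
        rw [h1, h4, h2, hS₁, mul_pow, h4, mul_add]
        exact ⟨⟨rfl, rfl⟩, rfl⟩
    rw [Nat.card_congr (Equiv.subtypeEquivRight e)]
    split_ifs with h
    · obtain ⟨c, hc⟩ := exists_algebraMap_eq_of_frob (h12.mp (h.1.symm.trans h.2))
      have hc0 : c ≠ 0 := by rintro rfl; rw [map_zero] at hc; exact hτ0 hc.symm
      rw [Nat.card_eq_one_iff_exists]
      refine ⟨⟨Units.mk0 c hc0, hc, h⟩, ?_⟩
      rintro ⟨c', hc', -⟩
      rw [Subtype.mk.injEq]
      exact Units.ext (hinj (hc'.trans hc.symm))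
    · simp [h]
  rw [h2, if_congr h1 rfl rfl]
  by_cases h3 : σ = S₁ <;> by_cases h4 : σ = S₂ <;> simp [h3, h4]
  · have : S₁ = S₂ := h3.symm.trans h4
    simp [this]; ring
  · have : S₁ ≠ S₂ := fun h => h4 (h3.trans h)
    simp [this]
  · have : S₂ ≠ S₁ := fun h => h3 (h4.trans h)
    simp [this]

end NonSplitProducts


/-! ### The product of `zSum` with a non-split class sum -/

section NonSplitProducts

open Matrix

theorem sum_coeff_mul_smul {G A : Type*} [Group G] [Fintype G] [AddCommGroup A] (χ : G → A)
    (x y : MonoidAlgebra ℤ G) :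
    ∑ g, (x * y).coeff g • χ g = ∑ h, y.coeff h • ∑ g, x.coeff g • χ (g * h) := by
  classical
  induction y using MonoidAlgebra.induction_linear with
  | zero => simp
  | add y z hy hz =>
    simp only [mul_add, MonoidAlgebra.coeff_add, Finsupp.add_apply, add_smul,
      Finset.sum_add_distrib, hy, hz]
  | single h r =>
    have e : ∀ g, ((MonoidAlgebra.single h r).coeff g) • ∑ g', x.coeff g' • χ (g' * g) =
        if g = h then r • ∑ g', x.coeff g' • χ (g' * h) else 0 := by
      intro g
      rw [MonoidAlgebra.coeff_single, Finsupp.single_apply]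
      by_cases hg : h = g
      · simp [hg]
      · simp [hg, Ne.symm hg]
    simp only [e, Finset.sum_ite_eq', Finset.mem_univ, if_true, Finset.smul_sum, smul_smul,
      MonoidAlgebra.coeff_mul_single_apply]
    refine (Fintype.sum_equiv (Equiv.mulRight h) _ _ fun g => ?_).symm
    simp [mul_comm r]

variable {F k : Type} [Field F] [Fintype F] [Field k] [Algebra F k] [IsAlgClosed k]

theorem zSum_coeff_conj (a b : Fˣ) (S : F) (x g : GL (Fin 2) F) :
    (zSum a b S).coeff (x * g * x⁻¹) = (zSum a b S).coeff g := by
  simp only [zSum, MonoidAlgebra.coeff_sub, Finsupp.sub_apply, classSum_coeff, wt_conj]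

omit [Fintype F] in
theorem mul_cmp_eq_sc {h : GL (Fin 2) F} {T : F} {N c : Fˣ} (e : h * cmp T N = sc c) :
    N * h.1.trace = T * c ∧ N * h.1.det = c * c := by
  have e' := fun i j => congrArg (fun g : GL (Fin 2) F => g.1 i j) e
  have e1 := e' 0 0
  have e2 := e' 0 1
  have e3 := e' 1 0
  have e4 := e' 1 1
  simp [cmp_val, sc, dg_val, Matrix.mul_apply, Fin.sum_univ_two] at e1 e2 e3 e4
  rw [trace_fin_two, det_fin_two]
  constructor
  · linear_combination -e2 + T * e1 + N * e3
  · linear_combination (N : F) * h.1 0 0 * e3 + c * e4 - N * h.1 1 0 * e1 - c * T * e3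

variable [Fintype (GL (Fin 2) F)]

variable {ρ : k} (hρ : (ρ ^ (Fintype.card F)) ^ (Fintype.card F) = ρ)
  (hρ' : ρ ^ (Fintype.card F) ≠ ρ) {T : F} {N : Fˣ}
  (hT : algebraMap F k T = ρ + ρ ^ (Fintype.card F))
  (hN : algebraMap F k N = ρ * ρ ^ (Fintype.card F))
  {τ : k} (hτ : (τ ^ (Fintype.card F)) ^ (Fintype.card F) = τ) (hτ0 : τ ≠ 0) {S S₁ S₂ : F}
  {a b : Fˣ}
  (hS : algebraMap F k S = τ + τ ^ (Fintype.card F))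
  (hD : algebraMap F k (a * b : F) = τ * τ ^ (Fintype.card F))
  (hS₁ : algebraMap F k S₁ = τ * ρ + (τ * ρ) ^ (Fintype.card F))
  (hS₂ : algebraMap F k S₂ = τ ^ (Fintype.card F) * ρ + (τ ^ (Fintype.card F) * ρ) ^ (Fintype.card F))

include hρ hρ' hT hN hτ hτ0 hS hD hS₁ hS₂

omit [Fintype (GL (Fin 2) F)] [IsAlgClosed k] in
-- If the product is the scalar c, then h has eigenvalues c/ρ and c/ρ^q, neither in F, so only the
-- non-split part of `zSum` can see h. It does so with coefficient -1 exactly when c is τρ or τ^q ρ,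
-- that is, when the scalar c has weight 1 - q in one of the two target sums.
theorem zSum_coeff_of_mul_cmp {h : GL (Fin 2) F}
    (hc : h * cmp T N ∈ Subgroup.center (GL (Fin 2) F)) :
    ((Fintype.card F : ℤ) - 1) * (zSum a b S).coeff h =
      wt (-1) S₁ (a * b * N : F) (h * cmp T N) + wt (-1) S₂ (a * b * N : F) (h * cmp T N) := by
  classical
  have hinj := (algebraMap F k).injective
  obtain ⟨c, e⟩ := mem_center_iff_sc.mp hc
  obtain ⟨e1, e2⟩ := mul_cmp_eq_sc e
  have hh : h ∉ Subgroup.center (GL (Fin 2) F) := by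
    intro hh
    have := mul_mem (inv_mem hh) hc
    rw [inv_mul_cancel_left] at this
    exact cmp_not_mem_center _ _ this
  have hρ0 : ρ ≠ 0 := by
    rintro rfl
    rw [zero_mul, map_eq_zero] at hN
    exact N.ne_zero hN
  have hρq : ρ ^ Fintype.card F ≠ 0 := pow_ne_zero _ hρ0
  have e1' := congrArg (algebraMap F k) e1
  have e2' := congrArg (algebraMap F k) e2
  simp only [map_mul, hT, hN] at e1' e2'
  have h1 : algebraMap F k h.1.trace = algebraMap F k c / ρ + algebraMap F k c / ρ ^ Fintype.card F := by
    field_simp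
    linear_combination e1'
  have h2 : algebraMap F k h.1.det = (algebraMap F k c / ρ) * (algebraMap F k c / ρ ^ Fintype.card F) := by
    field_simp
    linear_combination e2'
  have n1 : ∀ x : F, algebraMap F k c ≠ algebraMap F k x * ρ := by
    intro x hx
    have hx0 : algebraMap F k x ≠ 0 := by
      intro h0
      rw [h0, zero_mul, map_eq_zero] at hx
      exact c.ne_zero hx
    have := congrArg (· ^ Fintype.card F) hx
    simp only [mul_pow, frob_algebraMap] at this
    exact hρ' (mul_left_cancel₀ hx0 (this.symm.trans hx))
  have w1 : wt 1 (a + b : F) (a * b) h = 0 := by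
    rw [wt, if_neg]
    rintro ⟨t1, t2⟩
    rw [t1, map_add] at h1
    rw [t2, map_mul] at h2
    rcases eq_or_eq_of_add_mul h1 h2 with ⟨h3, -⟩ | ⟨-, h3⟩
    · exact n1 a (by rw [h3]; field_simp)
    · exact n1 b (by rw [h3]; field_simp)
  have key : h.1.trace = S ∧ h.1.det = a * b ↔
      algebraMap F k c = τ * ρ ∨ algebraMap F k c = τ ^ Fintype.card F * ρ := by
    rw [← hinj.eq_iff, ← hinj.eq_iff (b := (a * b : F)), hS, hD, h1, h2]
    constructor
    · rintro ⟨t1, t2⟩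
      rcases eq_or_eq_of_add_mul t1 t2 with ⟨h3, -⟩ | ⟨h3, -⟩
      · left; rw [← h3]; field_simp
      · right; rw [← h3]; field_simp
    · rintro (h3 | h3)
      · have h4 := congrArg (· ^ Fintype.card F) h3
        simp only [mul_pow, frob_algebraMap] at h4
        have h5 : algebraMap F k c / ρ = τ := by rw [h3]; field_simp
        have h6 : algebraMap F k c / ρ ^ Fintype.card F = τ ^ Fintype.card F := by rw [h4]; field_simp
        rw [h5, h6]; exact ⟨rfl, rfl⟩
      · have h4 := congrArg (· ^ Fintype.card F) h3
        simp only [mul_pow, frob_algebraMap, hτ] at h4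
        have h5 : algebraMap F k c / ρ = τ ^ Fintype.card F := by rw [h3]; field_simp
        have h6 : algebraMap F k c / ρ ^ Fintype.card F = τ := by rw [h4]; field_simp
        rw [h5, h6, add_comm, mul_comm]; exact ⟨rfl, rfl⟩
  have key2 : ∀ τ' : k, (τ' ^ Fintype.card F) ^ Fintype.card F = τ' →
      algebraMap F k (a * b : F) = τ' * τ' ^ (Fintype.card F) → ∀ S' : F,
      algebraMap F k S' = τ' * ρ + (τ' * ρ) ^ (Fintype.card F) →
      ((sc c).1.trace = S' ∧ (sc c).1.det = a * b * N ↔ algebraMap F k c = τ' * ρ) := by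
    intro τ' hτ' hD' S' hS'
    rw [sc_trace, sc_det, ← hinj.eq_iff, ← hinj.eq_iff (b := (a * b * N : F)), map_mul _ (a * b : F),
      hD', hS', hN, two_mul, map_add, map_mul, mul_mul_mul_comm, ← mul_pow]
    constructor
    · rintro ⟨t1, t2⟩
      rcases eq_or_eq_of_add_mul t1 t2 with ⟨h3, -⟩ | ⟨-, h3⟩ <;> exact h3
    · intro h3
      have h4 := frob_algebraMap (k := k) (c : F)
      rw [← h3, h4]; exact ⟨rfl, rfl⟩
  have nb : τ * ρ = algebraMap F k c → τ ^ Fintype.card F * ρ = algebraMap F k c → False := by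
    intro h3 h4
    have h5 : τ = τ ^ Fintype.card F := mul_right_cancel₀ hρ0 (h3.trans h4.symm)
    obtain ⟨x, hx⟩ := exists_algebraMap_eq_of_frob h5.symm
    exact n1 x (by rw [hx, h3])
  have hc' := mem_center_iff_sc.mpr ⟨c, rfl⟩
  simp only [zSum, MonoidAlgebra.coeff_sub, Finsupp.sub_apply, classSum_coeff]
  rw [w1, e]
  simp only [wt, hh, if_false, hc', if_true, key, key2 τ hτ hD S₁ hS₁,
    key2 (τ ^ Fintype.card F) (by rw [hτ]) (by rw [hD, hτ, mul_comm]) S₂ hS₂]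
  by_cases h3 : algebraMap F k c = τ * ρ
  · have h4 : ¬ algebraMap F k c = τ ^ Fintype.card F * ρ := fun h4 => nb h3.symm h4.symm
    simp only [h3, true_or, if_true]
    rw [if_neg (by rw [← h3]; exact h4)]; ring
  · by_cases h4 : algebraMap F k c = τ ^ Fintype.card F * ρ
    · simp only [h4, or_true, if_true]
      rw [if_neg (by rw [← h4]; exact h3)]; ring
    · simp [h3, h4]

/-- The product of `zSum a b S` with a non-split class sum, tested on class functions. -/
theorem sum_zSum_mul_classSum {A : Type*} [AddCommGroup A] {χ : GL (Fin 2) F → A}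
    (hχ : ∀ x g, χ (x * g * x⁻¹) = χ g) :
    ∑ g, (zSum a b S * classSum (-1) T N).coeff g • χ g = (Fintype.card F : ℤ) •
      (∑ g, wt (-1) S₁ (a * b * N : F) g • χ g + ∑ g, wt (-1) S₂ (a * b * N : F) g • χ g) := by
  classical
  have hinj := (algebraMap F k).injective
  set δ : Fˣ := a * b * N with hδ
  have hδ' : (a * b * N : F) = δ := by simp [hδ]
  have hD2 : algebraMap F k (a * b : F) = τ ^ Fintype.card F * (τ ^ Fintype.card F) ^ (Fintype.card F) := by
    rw [hD, hτ, mul_comm]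
  have n1 : NonSplit S₁ (δ : F) := nonSplit_of_frob hS₁ (by
    rw [← hδ', map_mul, hD, hN, mul_mul_mul_comm, ← mul_pow])
  have n2 : NonSplit S₂ (δ : F) := nonSplit_of_frob hS₂ (by
    rw [← hδ', map_mul, hD2, hN, mul_mul_mul_comm, ← mul_pow])
  have n3 : NonSplit T (N : F) := nonSplit_of_frob hT hN
  set Φ : GL (Fin 2) F → A := fun h => ∑ g, (zSum a b S).coeff g • χ (g * h) with hΦ
  have hΦc : ∀ x g, Φ (x * g * x⁻¹) = Φ g := by
    intro x g
    refine Fintype.sum_equiv (MulAut.conj x⁻¹).toEquiv _ _ fun h => ?_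
    have e1 : (zSum a b S).coeff (MulAut.conj x⁻¹ h) = (zSum a b S).coeff h :=
      zSum_coeff_conj _ _ _ _ _
    have e2 : χ (MulAut.conj x⁻¹ h * g) = χ (h * (x * g * x⁻¹)) := by
      rw [← hχ x⁻¹ (h * (x * g * x⁻¹)), MulAut.conj_apply]
      congr 1
      group
    rw [MulEquiv.toEquiv_eq_coe, MulEquiv.coe_toEquiv, e1, e2]
  -- Since `zSum` is central, Φ is a class function, so the whole class contributes a multiple of
  -- one value at its companion matrix. The class contains no scalar because ρ is not in F.
  have hsum : ∑ g, (zSum a b S * classSum (-1) T N).coeff g • χ g =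
      ((Fintype.card F : ℤ) * (Fintype.card F - 1)) • Φ (cmp T N) := by
    rw [sum_coeff_mul_smul]
    simp only [classSum_coeff]
    rw [sum_wt_smul hΦc n3, add_eq_left]
    refine Finset.sum_eq_zero fun g hg => ?_
    obtain ⟨c, rfl⟩ := mem_center_iff_sc.mp (Finset.mem_filter.mp hg).2
    rw [wt, if_neg, zero_smul]
    rintro ⟨t1, t2⟩
    rw [sc_trace, ← hinj.eq_iff, hT, two_mul, map_add] at t1
    rw [sc_det, ← hinj.eq_iff, hN, map_mul] at t2
    rcases eq_or_eq_of_add_mul t1 t2 with ⟨h3, h4⟩ | ⟨h3, h4⟩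
    · exact hρ' (h4.symm.trans h3)
    · exact hρ' (h3.symm.trans h4)
  -- Every product is first replaced by the companion matrix with the same trace and determinant;
  -- only the distribution of traces then matters, and all but S₁ and S₂ cancel between the split
  -- and non-split counts.
  have hfib : ∑ h, (zSum a b S).coeff h • χ (cmp (h * cmp T N).1.trace δ) =
      (Fintype.card F : ℤ) • (χ (cmp S₁ δ) + χ (cmp S₂ δ)) := by
    have e1 : ∀ σ : F, ∑ h : GL (Fin 2) F with (h * cmp T N).1.trace = σ, (zSum a b S).coeff h =
        Fintype.card F * ((if σ = S₁ then 1 else 0) + (if σ = S₂ then 1 else 0)) := by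
      intro σ
      simp only [zSum, MonoidAlgebra.coeff_sub, Finsupp.sub_apply, classSum_coeff,
        Finset.sum_sub_distrib]
      rw [sum_wt_split_trace hρ hρ' hT hN, sum_wt_nonsplit_trace hρ hρ' hT hN hτ hτ0 hS hD hS₁ hS₂]
      ring
    rw [← Finset.sum_fiberwise _ (fun h : GL (Fin 2) F => (h * cmp T N).1.trace)]
    have e2 : ∀ σ : F, ∑ h : GL (Fin 2) F with (h * cmp T N).1.trace = σ,
        (zSum a b S).coeff h • χ (cmp (h * cmp T N).1.trace δ) =
        ((Fintype.card F : ℤ) * ((if σ = S₁ then 1 else 0) + (if σ = S₂ then 1 else 0))) •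
          χ (cmp σ δ) := by
      intro σ
      rw [← e1, Finset.sum_smul]
      refine Finset.sum_congr rfl fun h hh => ?_
      rw [(Finset.mem_filter.mp hh).2]
    simp_rw [e2, mul_smul, add_smul, ite_smul, one_smul, zero_smul, ← Finset.smul_sum,
      Finset.sum_add_distrib, Finset.sum_ite_eq', Finset.mem_univ, if_true]
  have hz : ∀ h : GL (Fin 2) F, h.1.det ≠ a * b → (zSum a b S).coeff h = 0 := by
    intro h hh
    simp [zSum, classSum_coeff, wt, hh]
  -- The replacement is wrong precisely for scalar products, which are corrected here and matched
  -- below with the scalar terms of the target sums.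
  have hval : Φ (cmp T N) = (Fintype.card F : ℤ) • (χ (cmp S₁ δ) + χ (cmp S₂ δ)) +
      ∑ h with h * cmp T N ∈ Subgroup.center (GL (Fin 2) F),
        (zSum a b S).coeff h • (χ (h * cmp T N) - χ (cmp (h * cmp T N).1.trace δ)) := by
    rw [← hfib, Finset.sum_filter, ← Finset.sum_add_distrib]
    refine Finset.sum_congr rfl fun h _ => ?_
    split_ifs with hc
    · rw [smul_sub]; abel
    · rw [add_zero]
      by_cases hd : h.1.det = a * b
      · rw [classFun_eq hχ hc (cmp_not_mem_center _ δ) (cmp_trace _ _).symm]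
        rw [cmp_det, Units.val_mul, det_mul, hd, cmp_det, hδ']
      · rw [hz h hd, zero_smul, zero_smul]
  have hsw : ∀ S' : F, ∑ g with g ∈ Subgroup.center (GL (Fin 2) F),
      wt (-1) S' (δ : F) g • (χ g - χ (cmp S' δ)) =
      ∑ h with h * cmp T N ∈ Subgroup.center (GL (Fin 2) F),
        wt (-1) S' (δ : F) (h * cmp T N) •
          (χ (h * cmp T N) - χ (cmp (h * cmp T N).1.trace δ)) := by
    intro S'
    rw [Finset.sum_filter, Finset.sum_filter]
    refine (Fintype.sum_equiv (Equiv.mulRight (cmp T N)) _ _ fun h => ?_).symm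
    rw [Equiv.coe_mulRight]
    by_cases ht : (h * cmp T N).1.trace = S'
    · rw [ht]
    · have : wt (-1) S' (δ : F) (h * cmp T N) = 0 := by rw [wt, if_neg (fun h => ht h.1)]
      rw [this, zero_smul, zero_smul]
  rw [hsum, hval, hδ', sum_wt_smul hχ n1, sum_wt_smul hχ n2, hsw, hsw, smul_add, smul_smul]
  have e3 : ((Fintype.card F : ℤ) * (Fintype.card F - 1)) •
      ∑ h with h * cmp T N ∈ Subgroup.center (GL (Fin 2) F),
        (zSum a b S).coeff h • (χ (h * cmp T N) - χ (cmp (h * cmp T N).1.trace δ)) =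
      (Fintype.card F : ℤ) • (∑ h with h * cmp T N ∈ Subgroup.center (GL (Fin 2) F),
        wt (-1) S₁ (δ : F) (h * cmp T N) •
          (χ (h * cmp T N) - χ (cmp (h * cmp T N).1.trace δ)) +
        ∑ h with h * cmp T N ∈ Subgroup.center (GL (Fin 2) F),
        wt (-1) S₂ (δ : F) (h * cmp T N) •
          (χ (h * cmp T N) - χ (cmp (h * cmp T N).1.trace δ))) := by
    rw [mul_smul, Finset.smul_sum, ← Finset.sum_add_distrib]
    congr 1
    refine Finset.sum_congr rfl fun h hh => ?_
    rw [smul_smul, zSum_coeff_of_mul_cmp hρ hρ' hT hN hτ hτ0 hS hD hS₁ hS₂ (Finset.mem_filter.mp hh).2,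
      hδ', add_smul]
  rw [e3]
  module

end NonSplitProducts


/-! ### Class sums attached to elements of the finite tori -/

section TorusSums

open Matrix

variable {F k : Type} [Field F] [Fintype F] [Field k] [Algebra F k]

theorem perm_fin_two (w : Equiv.Perm (Fin 2)) : w = 1 ∨ w = Equiv.swap 0 1 := by
  revert w; decide

omit [Field F] [Algebra F k] in
theorem mem_torus_one {t : Fin 2 → kˣ} : t ∈ torus F k 1 ↔
    (t 0 : k) ^ Fintype.card F = t 0 ∧ (t 1 : k) ^ Fintype.card F = t 1 := by
  simp [torus, Units.ext_iff]

omit [Field F] [Algebra F k] in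
theorem mem_torus_swap {t : Fin 2 → kˣ} : t ∈ torus F k (Equiv.swap 0 1) ↔
    (t 1 : k) ^ Fintype.card F = t 0 ∧ (t 0 : k) ^ Fintype.card F = t 1 := by
  simp [torus, Units.ext_iff]

/-- The descent of an element of `k` to `F`. -/
def down (F : Type) {k : Type} [Field F] [Field k] [Algebra F k] (x : k) : F :=
  Function.invFun (algebraMap F k) x

omit [Fintype F] in
theorem down_algebraMap (a : F) : down F (algebraMap F k a) = a :=
  Function.leftInverse_invFun (algebraMap F k).injective a

theorem algebraMap_down {x : k} (hx : x ^ Fintype.card F = x) : algebraMap F k (down F x) = x :=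
  Function.invFun_eq (exists_algebraMap_eq_of_frob hx)

theorem algebraMap_down_add {w : Equiv.Perm (Fin 2)} {t : Fin 2 → kˣ} (ht : t ∈ torus F k w) :
    algebraMap F k (down F (t 0 + t 1 : k)) = t 0 + t 1 := by
  apply algebraMap_down
  rw [frob_add]
  rcases perm_fin_two w with rfl | rfl
  · rw [mem_torus_one] at ht
    rw [ht.1, ht.2]
  · rw [mem_torus_swap] at ht
    rw [ht.1, ht.2, add_comm]

theorem algebraMap_down_mul {w : Equiv.Perm (Fin 2)} {t : Fin 2 → kˣ} (ht : t ∈ torus F k w) :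
    algebraMap F k (down F (t 0 * t 1 : k)) = t 0 * t 1 := by
  apply algebraMap_down
  rw [mul_pow]
  rcases perm_fin_two w with rfl | rfl
  · rw [mem_torus_one] at ht
    rw [ht.1, ht.2]
  · rw [mem_torus_swap] at ht
    rw [ht.1, ht.2, mul_comm]

/-- The weighted sum of the elements of `GL₂(F)` with eigenvalues `t 0`, `t 1`. -/
def torusSum (F : Type) {k : Type} [Field F] [Fintype F] [Field k] [Algebra F k]
    (w : Equiv.Perm (Fin 2)) (t : Fin 2 → kˣ) : MonoidAlgebra ℤ (GL (Fin 2) F) :=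
  classSum (Equiv.Perm.sign w : ℤ) (down F (t 0 + t 1 : k)) (down F (t 0 * t 1 : k))

/-- The difference of a split and a non-split torus sum. -/
def zTorus (F : Type) {k : Type} [Field F] [Fintype F] [Field k] [Algebra F k]
    (t t' : Fin 2 → kˣ) : MonoidAlgebra ℤ (GL (Fin 2) F) :=
  torusSum F 1 t - torusSum F (Equiv.swap 0 1) t'

theorem zTorus_comm (t t' : Fin 2 → kˣ) (x : MonoidAlgebra ℤ (GL (Fin 2) F)) :
    zTorus F t t' * x = x * zTorus F t t' := by
  simp only [zTorus, torusSum, sub_mul, mul_sub, classSum_comm]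

theorem exists_units_of_torus_one {t : Fin 2 → kˣ} (ht : t ∈ torus F k 1) :
    ∃ a b : Fˣ, (t 0 : k) = algebraMap F k a ∧ (t 1 : k) = algebraMap F k b := by
  rw [mem_torus_one] at ht
  obtain ⟨a, ha⟩ := exists_algebraMap_eq_of_frob ht.1
  obtain ⟨b, hb⟩ := exists_algebraMap_eq_of_frob ht.2
  have ha0 : a ≠ 0 := by rintro rfl; rw [map_zero] at ha; exact (t 0).ne_zero ha.symm
  have hb0 : b ≠ 0 := by rintro rfl; rw [map_zero] at hb; exact (t 1).ne_zero hb.symm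
  exact ⟨Units.mk0 a ha0, Units.mk0 b hb0, ha.symm, hb.symm⟩

theorem zTorus_eq {t t' : Fin 2 → kˣ} {a b : Fˣ} (ha : (t 0 : k) = algebraMap F k a)
    (hb : (t 1 : k) = algebraMap F k b) (h : t 0 * t 1 = t' 0 * t' 1) :
    zTorus F t t' = zSum a b (down F (t' 0 + t' 1 : k)) := by
  have h' : (t' 0 * t' 1 : k) = t 0 * t 1 := by
    rw [← Units.val_mul, ← Units.val_mul, h]
  simp only [zTorus, torusSum, zSum, h']
  simp only [ha, hb, ← map_add, ← map_mul, down_algebraMap]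
  simp

theorem sc_mul_classSum (c : Fˣ) (ε : ℤ) (S D : F) :
    MonoidAlgebra.single (sc c) 1 * classSum ε S D = classSum ε (c * S) (c * c * D) := by
  classical
  ext g
  rw [MonoidAlgebra.coeff_single_mul_apply, classSum_coeff, classSum_coeff, one_mul]
  obtain ⟨h, rfl⟩ : ∃ h, g = sc c * h := ⟨(sc c)⁻¹ * g, by group⟩
  rw [inv_mul_cancel_left]
  have hc : sc c * h ∈ Subgroup.center (GL (Fin 2) F) ↔ h ∈ Subgroup.center (GL (Fin 2) F) :=
    Subgroup.mul_mem_cancel_left _ (mem_center_iff_sc.mpr ⟨c, rfl⟩)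
  simp only [wt, sc_mul_trace, sc_mul_det, hc]
  have h1 : (c : F) * h.1.trace = c * S ↔ h.1.trace = S := mul_right_inj' c.ne_zero
  have h2 : (c : F) * c * h.1.det = c * c * D ↔ h.1.det = D :=
    mul_right_inj' (mul_ne_zero c.ne_zero c.ne_zero)
  simp only [h1, h2]

/-- With a double eigenvalue the two sums have the same support and differ only in the weight of the
scalar, 1 + q against 1 - q. -/
theorem classSum_neg_one_sc (c : Fˣ) : classSum (-1) (c + c : F) (c * c) =
    classSum 1 (c + c : F) (c * c) - (2 * Fintype.card F : ℤ) • MonoidAlgebra.single (sc c) 1 := by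
  classical
  ext g
  rw [MonoidAlgebra.coeff_sub, Finsupp.sub_apply, MonoidAlgebra.coeff_smul_apply, classSum_coeff,
    classSum_coeff, MonoidAlgebra.coeff_single, Finsupp.single_apply]
  by_cases hg : sc c = g
  · subst hg
    have : sc c ∈ Subgroup.center (GL (Fin 2) F) := mem_center_iff_sc.mpr ⟨c, rfl⟩
    simp only [wt, sc_trace, sc_det, two_mul, and_self, if_true, this, smul_eq_mul]
    ring
  · rw [if_neg hg, smul_zero, sub_zero]
    by_cases hc : g ∈ Subgroup.center (GL (Fin 2) F)
    · obtain ⟨d, rfl⟩ := mem_center_iff_sc.mp hc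
      have : ¬ ((sc d).1.trace = (c + c : F) ∧ (sc d).1.det = c * c) := by
        rintro ⟨h1, h2⟩
        rw [sc_trace, two_mul] at h1
        rw [sc_det] at h2
        apply hg
        rcases eq_or_eq_of_add_mul h1 h2 with h | h <;> rw [Units.ext h.1]
      simp only [wt, this, if_false]
    · simp only [wt, hc, if_false]

/-- A double eigenvalue in the non-split torus escapes the companion matrix argument. By
`classSum_neg_one_sc` it reduces to the split product rule and to multiplication by a central group
element. -/
theorem zSum_mul_classSum_sc {a b c : Fˣ} {S : F} (hS : NonSplit S (a * b : F)) :
    zSum a b S * classSum (-1) (c + c : F) (c * c) = (Fintype.card F : ℤ) •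
      (classSum (-1) (c * S) (c * c * (a * b)) + classSum (-1) (c * S) (c * c * (a * b))) := by
  rw [classSum_neg_one_sc, mul_sub, zSum_mul_classSum_one hS, mul_smul_comm, zSum_comm, zSum,
    mul_sub, sc_mul_classSum, sc_mul_classSum]
  have e1 : (a * c + b * c : F) = c * (a + b) := by ring
  have e2 : (b * c + a * c : F) = c * (a + b) := by ring
  have e3 : (a * c * (b * c) : F) = c * c * (a * b) := by ring
  have e4 : (b * c * (a * c) : F) = c * c * (a * b) := by ring
  rw [e1, e2, e3, e4]
  module

/-- The product of `zTorus t t'` with a torus sum, tested on class functions. -/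
theorem sum_zTorus_mul_torusSum [IsAlgClosed k] [Fintype (GL (Fin 2) F)]
    {A : Type*} [AddCommGroup A] {χ : GL (Fin 2) F → A}
    (hχ : ∀ x g, χ (x * g * x⁻¹) = χ g) {t t' : Fin 2 → kˣ} (ht : t ∈ torus F k 1)
    (ht' : t' ∈ torus F k (Equiv.swap 0 1)) (h : t 0 * t 1 = t' 0 * t' 1)
    {w : Equiv.Perm (Fin 2)} {s : Fin 2 → kˣ} (hs : w = 1 → s = t) (hs' : w = Equiv.swap 0 1 → s = t')
    {r : Fin 2 → kˣ} (hr : r ∈ torus F k w) :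
    ∑ g, (zTorus F t t' * torusSum F w r).coeff g • χ g = (Fintype.card F : ℤ) •
      (∑ g, (torusSum F w (s * r)).coeff g • χ g +
        ∑ g, (torusSum F w ((s ∘ Equiv.swap 0 1) * r)).coeff g • χ g) := by
  obtain ⟨a, b, ha, hb⟩ := exists_units_of_torus_one ht
  have hS := algebraMap_down_add ht'
  have hP := algebraMap_down_mul ht'
  rw [zTorus_eq ha hb h]
  have h' : (t' 0 * t' 1 : k) = algebraMap F k a * algebraMap F k b := by
    rw [← ha, ← hb, ← Units.val_mul, ← Units.val_mul, h]
  have ht'2 := mem_torus_swap.mp ht'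
  have hNS : NonSplit (down F (t' 0 + t' 1 : k)) (a * b : F) := by
    apply nonSplit_of_frob (τ := (t' 0 : k))
    · rw [hS, ht'2.2]
    · rw [ht'2.2, h', map_mul]
  have lin : ∀ x y z : MonoidAlgebra ℤ (GL (Fin 2) F), x = (Fintype.card F : ℤ) • (y + z) →
      ∑ g, x.coeff g • χ g = (Fintype.card F : ℤ) • (∑ g, y.coeff g • χ g + ∑ g, z.coeff g • χ g) := by
    rintro x y z rfl
    simp only [MonoidAlgebra.coeff_smul_apply, MonoidAlgebra.coeff_add, Finsupp.add_apply,
      smul_eq_mul, mul_smul, add_smul, ← Finset.smul_sum, Finset.sum_add_distrib]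
  rcases perm_fin_two w with rfl | rfl
  · obtain rfl := hs rfl
    obtain ⟨c, d, hc, hd⟩ := exists_units_of_torus_one hr
    apply lin
    simp only [torusSum, Pi.mul_apply, Units.val_mul, Function.comp_apply, Equiv.swap_apply_left,
      Equiv.swap_apply_right, ha, hb, hc, hd, ← map_mul, ← map_add, down_algebraMap]
    simpa using zSum_mul_classSum_one hNS
  · obtain rfl := hs' rfl
    have hr2 := mem_torus_swap.mp hr
    -- Equal coordinates in the non-split torus mean a scalar over F; unequal ones provide a
    -- generator ρ = r 0 of the quadratic extension.
    by_cases hr0 : (r 1 : k) = r 0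
    · have hr3 : (r 0 : k) ^ Fintype.card F = r 0 := by rw [hr2.2, hr0]
      obtain ⟨c, hc⟩ := exists_algebraMap_eq_of_frob hr3
      have hc0 : c ≠ 0 := by rintro rfl; rw [map_zero] at hc; exact (r 0).ne_zero hc.symm
      apply lin
      have e1 : (s 0 * r 0 + s 1 * r 1 : k) = algebraMap F k (c * down F (s 0 + s 1 : k)) := by
        rw [map_mul, hS, hr0, ← hc]; ring
      have e2 : (s 1 * r 0 + s 0 * r 1 : k) = algebraMap F k (c * down F (s 0 + s 1 : k)) := by
        rw [map_mul, hS, hr0, ← hc]; ring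
      have e3 : (s 0 * r 0 * (s 1 * r 1) : k) = algebraMap F k (c * c * (a * b)) := by
        rw [hr0, ← hc, map_mul, map_mul, map_mul, ← h']; ring
      have e4 : (s 1 * r 0 * (s 0 * r 1) : k) = algebraMap F k (c * c * (a * b)) := by
        rw [hr0, ← hc, map_mul, map_mul, map_mul, ← h']; ring
      have e5 : (r 0 + r 1 : k) = algebraMap F k (c + c) := by rw [hr0, map_add, hc]
      have e6 : (r 0 * r 1 : k) = algebraMap F k (c * c) := by rw [hr0, map_mul, hc]
      simp only [torusSum, Pi.mul_apply, Units.val_mul, Function.comp_apply, Equiv.swap_apply_left,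
        Equiv.swap_apply_right, e1, e2, e3, e4, e5, e6, down_algebraMap]
      have := zSum_mul_classSum_sc (c := Units.mk0 c hc0) hNS
      simpa [Equiv.Perm.sign_swap] using this
    · have hN0 : down F (r 0 * r 1 : k) ≠ 0 := by
        intro h0
        have := algebraMap_down_mul hr
        rw [h0, map_zero] at this
        exact mul_ne_zero (r 0).ne_zero (r 1).ne_zero this.symm
      have e3 : (s 0 * r 0 * (s 1 * r 1) : k) = algebraMap F k (a * b * down F (r 0 * r 1 : k)) := by
        rw [map_mul, map_mul, ← h', algebraMap_down_mul hr]; ring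
      have e4 : (s 1 * r 0 * (s 0 * r 1) : k) = algebraMap F k (a * b * down F (r 0 * r 1 : k)) := by
        rw [map_mul, map_mul, ← h', algebraMap_down_mul hr]; ring
      have e5 : algebraMap F k (down F (s 0 * r 0 + s 1 * r 1 : k)) = s 0 * r 0 + s 1 * r 1 := by
        apply algebraMap_down
        rw [frob_add, mul_pow, mul_pow, hr2.1, hr2.2, ht'2.1, ht'2.2, add_comm]
      have e6 : algebraMap F k (down F (s 1 * r 0 + s 0 * r 1 : k)) = s 1 * r 0 + s 0 * r 1 := by
        apply algebraMap_down
        rw [frob_add, mul_pow, mul_pow, hr2.1, hr2.2, ht'2.1, ht'2.2, add_comm]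
      have := sum_zSum_mul_classSum (ρ := (r 0 : k)) (by rw [hr2.2, hr2.1]) (by rw [hr2.2]; exact hr0)
        (T := down F (r 0 + r 1 : k)) (N := Units.mk0 _ hN0)
        (by rw [algebraMap_down_add hr, hr2.2]) (by rw [Units.val_mk0, algebraMap_down_mul hr, hr2.2])
        (τ := (s 0 : k)) (by rw [ht'2.2, ht'2.1]) (s 0).ne_zero (S := down F (s 0 + s 1 : k))
        (a := a) (b := b) (S₁ := down F (s 0 * r 0 + s 1 * r 1 : k))
        (S₂ := down F (s 1 * r 0 + s 0 * r 1 : k)) (by rw [hS, ht'2.2]) (by rw [map_mul, ← h', ht'2.2])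
        (by rw [e5, mul_pow, ht'2.2, hr2.2]) (by rw [e6, ht'2.2, mul_pow, ht'2.1, hr2.2]) hχ
      simp only [torusSum, Pi.mul_apply, Units.val_mul, Function.comp_apply, Equiv.swap_apply_left,
        Equiv.swap_apply_right, e3, e4, down_algebraMap, classSum_coeff]
      simpa [Equiv.Perm.sign_swap] using this

end TorusSums


/-! ### Deligne-Lusztig characters and torus sums -/

section DLPairing

open Matrix

variable {F k : Type} [Field F] [Fintype F] [Field k] [Algebra F k]

omit [Fintype F] in
theorem hasEigenvalues_iff {g : Matrix (Fin 2) (Fin 2) F} {t : Fin 2 → kˣ} :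
    HasEigenvalues g t ↔
      algebraMap F k g.trace = t 0 + t 1 ∧ algebraMap F k g.det = t 0 * t 1 := by
  have h1 : (g.map (algebraMap F k)).trace = algebraMap F k g.trace := by
    rw [trace_fin_two, trace_fin_two, map_add]; rfl
  have h2 : (g.map (algebraMap F k)).det = algebraMap F k g.det := by
    rw [det_fin_two, det_fin_two, map_sub, map_mul, map_mul]; rfl
  have h3 : ∏ i, (Polynomial.X - Polynomial.C (t i : k)) =
      Polynomial.X ^ 2 - Polynomial.C (t 0 + t 1 : k) * Polynomial.X + Polynomial.C (t 0 * t 1 : k) := by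
    rw [Fin.prod_univ_two, Polynomial.C_add, Polynomial.C_mul]
    ring
  rw [HasEigenvalues, charpoly_fin_two, h1, h2, h3]
  constructor
  · intro h
    have c0 := congrArg (fun P => Polynomial.coeff P 0) h
    have c1 := congrArg (fun P => Polynomial.coeff P 1) h
    simp [Polynomial.coeff_X, Polynomial.coeff_C, Polynomial.coeff_X_pow] at c0 c1
    exact ⟨by linear_combination -c1, c0⟩
  · rintro ⟨h4, h5⟩
    rw [h4, h5]

open Classical in
theorem torusSum_coeff {w : Equiv.Perm (Fin 2)} {t : Fin 2 → kˣ} (ht : t ∈ torus F k w)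
    (g : GL (Fin 2) F) : (torusSum F w t).coeff g = if HasEigenvalues g.1 t then
      (if g ∈ Subgroup.center (GL (Fin 2) F) then
        1 + (Equiv.Perm.sign w : ℤ) * Fintype.card F else 1) else 0 := by
  rw [torusSum, classSum_coeff, wt]
  refine if_congr ?_ rfl rfl
  have h1 := algebraMap_down_add ht
  have h2 := algebraMap_down_mul ht
  have hinj := (algebraMap F k).injective
  rw [hasEigenvalues_iff]
  exact ⟨fun h => ⟨by rw [h.1, h1], by rw [h.2, h2]⟩,
    fun h => ⟨hinj (h.1.trans h1.symm), hinj (h.2.trans h2.symm)⟩⟩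

/-- The finite torus, as a subgroup. -/
def torusSubgroup (F k : Type) [Fintype F] [Field k] (w : Equiv.Perm (Fin 2)) :
    Subgroup (Fin 2 → kˣ) where
  carrier := torus F k w
  one_mem' := fun i => by simp
  mul_mem' := fun hx hy i => by
    rw [Pi.mul_apply, Pi.mul_apply, mul_pow, hx i, hy i]
  inv_mem' := fun hx i => by
    rw [Pi.inv_apply, Pi.inv_apply, inv_pow, hx i]

omit [Field F] [Algebra F k] in
theorem torus_pow {w : Equiv.Perm (Fin 2)} {t : Fin 2 → kˣ} (ht : t ∈ torus F k w) (i : Fin 2) :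
    (t i ^ Fintype.card F) ^ Fintype.card F = t i := by
  have hw : w (w i) = i := by
    rcases perm_fin_two w with rfl | rfl
    · rfl
    · simp
  have h1 := ht (w i)
  rw [hw] at h1
  rw [h1, ht i]

omit [Algebra F k] in
theorem torus_pow_sq_sub_one {w : Equiv.Perm (Fin 2)} {t : Fin 2 → kˣ} (ht : t ∈ torus F k w)
    (i : Fin 2) : t i ^ (Fintype.card F ^ 2 - 1) = 1 := by
  have h := torus_pow ht i
  rw [← pow_mul, ← sq] at h
  have h1 : 1 ≤ Fintype.card F ^ 2 := Nat.one_le_pow _ _ Fintype.card_pos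
  apply mul_right_cancel (b := t i)
  rw [← pow_succ, Nat.sub_add_cancel h1, h, one_mul]

omit [Algebra F k] in
theorem one_lt_card_sq : 0 < Fintype.card F ^ 2 - 1 := by
  have h := Fintype.one_lt_card (α := F)
  have : 1 < Fintype.card F ^ 2 := Nat.one_lt_pow two_ne_zero h
  omega

instance finite_torusSubgroup (w : Equiv.Perm (Fin 2)) : Finite (torusSubgroup F k w) := by
  have : NeZero (Fintype.card F ^ 2 - 1) := ⟨one_lt_card_sq.ne'⟩
  refine Finite.of_injective (β := Fin 2 → rootsOfUnity (Fintype.card F ^ 2 - 1) k)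
    (fun t i => ⟨t.1 i, (mem_rootsOfUnity _ _).mpr (torus_pow_sq_sub_one t.2 i)⟩) ?_
  intro s t h
  refine Subtype.ext (funext fun i => ?_)
  simpa [Units.ext_iff] using congrFun h i

theorem charVal_mul {G : Type} [CommGroup G] (lam : Fin 2 → ℤ) (s t : Fin 2 → G) :
    charVal lam (s * t) = charVal lam s * charVal lam t := by
  simp [charVal, mul_zpow, Finset.prod_mul_distrib]

theorem charVal_inv {G : Type} [CommGroup G] (lam : Fin 2 → ℤ) (t : Fin 2 → G) :
    charVal lam t⁻¹ = (charVal lam t)⁻¹ := by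
  simp [charVal]

omit [Field F] [Algebra F k] in
theorem torus_comp_swap {w : Equiv.Perm (Fin 2)} {t : Fin 2 → kˣ} (ht : t ∈ torus F k w) :
    t ∘ Equiv.swap 0 1 ∈ torus F k w := by
  intro i
  have hw : Equiv.swap 0 1 (w i) = w (Equiv.swap 0 1 i) := by
    rcases perm_fin_two w with rfl | rfl <;> simp
  rw [Function.comp_apply, Function.comp_apply, hw, ht]

/-- The character formula is a Fourier transform over the finite torus of the weighted indicator
functions `torusSum`, whose weights on scalars are the values of the Green function. -/
theorem DLChar_eq (κ : kˣ →* Qbarˣ) (w : Equiv.Perm (Fin 2)) (lam : Fin 2 → ℤ) (g : GL (Fin 2) F)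
    [Fintype (torusSubgroup F k w)] :
    DLChar κ w lam g = ∑ t : torusSubgroup F k w,
      ((κ (charVal lam t.1) : Qbarˣ) : Qbar) * ((torusSum F w t.1).coeff g : Qbar) := by
  classical
  have h1 : ∑ᶠ t ∈ {t : Fin 2 → kˣ | t ∈ torus F k w ∧ HasEigenvalues g.1 t},
      ((κ (charVal lam t) : Qbarˣ) : Qbar) = ∑ t : torusSubgroup F k w,
        if HasEigenvalues g.1 t.1 then ((κ (charVal lam t.1) : Qbarˣ) : Qbar) else 0 := by
    rw [← finsum_eq_sum_of_fintype]
    refine Eq.trans ?_ (finsum_set_coe_eq_finsum_mem (torus F k w) (f := fun t =>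
      if HasEigenvalues g.1 t then ((κ (charVal lam t) : Qbarˣ) : Qbar) else 0)).symm
    refine finsum_congr fun t => ?_
    rw [finsum_eq_if, finsum_eq_if, ← ite_and]
    exact if_congr Iff.rfl rfl rfl
  rw [DLChar, h1, Finset.mul_sum]
  refine Finset.sum_congr rfl fun t _ => ?_
  rw [torusSum_coeff t.2]
  split_ifs <;> push_cast <;> ring

theorem torusSum_coeff_inv {w : Equiv.Perm (Fin 2)} {t : Fin 2 → kˣ} (ht : t ∈ torus F k w)
    (g : GL (Fin 2) F) : (torusSum F w t).coeff g⁻¹ = (torusSum F w t⁻¹).coeff g := by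
  classical
  rw [torusSum_coeff ht, torusSum_coeff ((torusSubgroup F k w).inv_mem ht)]
  refine if_congr ?_ (if_congr (inv_mem_iff) rfl rfl) rfl
  rw [hasEigenvalues_iff, hasEigenvalues_iff]
  have hd := det_ne_zero_GL g
  have h1 : g⁻¹.1.trace = g.1.trace / g.1.det := by
    rw [GeneralLinearGroup.coe_inv, inv_def, adjugate_fin_two, trace_fin_two, trace_fin_two g.1,
      Ring.inverse_eq_inv']
    simp
    ring
  have h2 : g⁻¹.1.det = (g.1.det)⁻¹ := by
    rw [GeneralLinearGroup.coe_inv, det_nonsing_inv, Ring.inverse_eq_inv']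
  have hd' : algebraMap F k g.1.det ≠ 0 := by simpa using hd
  have t0 := (t 0).ne_zero
  have t1 := (t 1).ne_zero
  rw [h1, h2, map_div₀, map_inv₀]
  simp only [Pi.inv_apply, Units.val_inv_eq_inv_val]
  constructor
  · rintro ⟨h3, h4⟩
    have h5 : algebraMap F k g.1.det = (t 0 : k)⁻¹ * (t 1 : k)⁻¹ := by
      rw [← inv_inv (algebraMap F k g.1.det), h4, mul_inv]
    refine ⟨?_, h5⟩
    rw [h5] at h3
    field_simp at h3 ⊢
    linear_combination h3
  · rintro ⟨h3, h4⟩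
    rw [h3, h4]
    constructor <;> field_simp
    ring

variable [Fintype (GL (Fin 2) F)]

/-- After inversion of both summation variables, the pairing is a Fourier coefficient of the
function on the torus that sends t to the value of f on the torus sum at t. -/
theorem card_mul_pairing_DLChar (κ : kˣ →* Qbarˣ) (w : Equiv.Perm (Fin 2)) (lam : Fin 2 → ℤ)
    [Fintype (torusSubgroup F k w)] (f : GL (Fin 2) F → Qbar) :
    (Nat.card (GL (Fin 2) F) : Qbar) * pairing f (DLChar κ w lam) =
      ∑ t : torusSubgroup F k w, ((κ (charVal lam t.1) : Qbarˣ) : Qbar)⁻¹ *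
        ∑ g, (torusSum F w t.1).coeff g • f g := by
  have hc : (Nat.card (GL (Fin 2) F) : Qbar) ≠ 0 := by exact_mod_cast Nat.card_pos.ne'
  rw [pairing, mul_inv_cancel_left₀ hc, finsum_eq_sum_of_fintype]
  simp_rw [DLChar_eq, Finset.mul_sum]
  rw [Finset.sum_comm]
  refine Fintype.sum_equiv (Equiv.inv _) _ _ fun t => ?_
  refine Fintype.sum_equiv (Equiv.inv _) _ _ fun g => ?_
  simp only [Equiv.inv_apply, InvMemClass.coe_inv, charVal_inv, map_inv, Units.val_inv_eq_inv_val,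
    inv_inv, zsmul_eq_mul]
  rw [← torusSum_coeff_inv t.2, inv_inv]
  ring

/-- The action of `zTorus t t'` on Deligne-Lusztig characters. -/
theorem eigenvalue_of_pairing_ne_zero [IsAlgClosed k] {κ : kˣ →* Qbarˣ} {w : Equiv.Perm (Fin 2)}
    {lam : Fin 2 → ℤ} {f : GL (Fin 2) F → Qbar} (hf : ∀ x g, f (x * g * x⁻¹) = f g)
    (hne : pairing f (DLChar κ w lam) ≠ 0) {t t' : Fin 2 → kˣ} (ht : t ∈ torus F k 1)
    (ht' : t' ∈ torus F k (Equiv.swap 0 1)) (h : t 0 * t 1 = t' 0 * t' 1)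
    {s : Fin 2 → kˣ} (hs : w = 1 → s = t) (hs' : w = Equiv.swap 0 1 → s = t') {ω : Qbar}
    (hω : ∀ x, ∑ g, (zTorus F t t').coeff g • f (g * x) = ω * f x) :
    ω = Fintype.card F * (((κ (charVal lam s) : Qbarˣ) : Qbar) +
      ((κ (charVal lam (s ∘ Equiv.swap 0 1)) : Qbarˣ) : Qbar)) := by
  cases nonempty_fintype (torusSubgroup F k w)
  have hs0 : s ∈ torus F k w := by
    rcases perm_fin_two w with rfl | rfl
    · rw [hs rfl]; exact ht
    · rw [hs' rfl]; exact ht'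
  have hs1 := torus_comp_swap hs0
  set X : torusSubgroup F k w → Qbar := fun r => ∑ g, (torusSum F w r.1).coeff g • f g with hX
  -- The product rule says that multiplication by ω is a sum of two translations on the function X;
  -- a non-zero Fourier coefficient of X then reveals ω.
  have key : ∀ r : torusSubgroup F k w, ω * X r = Fintype.card F *
      (X (⟨s, hs0⟩ * r) + X (⟨s ∘ Equiv.swap 0 1, hs1⟩ * r)) := by
    intro r
    have := sum_zTorus_mul_torusSum hf ht ht' h hs hs' r.2
    rw [sum_coeff_mul_smul] at this
    simp only [hω, ← mul_smul_comm, ← Finset.mul_sum] at this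
    simp only [hX, zsmul_eq_mul, Int.cast_natCast] at this ⊢
    exact this
  set P := ∑ r : torusSubgroup F k w, ((κ (charVal lam r.1) : Qbarˣ) : Qbar)⁻¹ * X r with hP
  have hP0 : P ≠ 0 := by
    rw [hP, ← card_mul_pairing_DLChar]
    exact mul_ne_zero (by exact_mod_cast Nat.card_pos.ne') hne
  have shift : ∀ s' : torusSubgroup F k w, ∑ r : torusSubgroup F k w,
      ((κ (charVal lam r.1) : Qbarˣ) : Qbar)⁻¹ * X (s' * r) =
      ((κ (charVal lam s'.1) : Qbarˣ) : Qbar) * P := by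
    intro s'
    rw [hP, Finset.mul_sum]
    refine Fintype.sum_equiv (Equiv.mulLeft s') _ _ fun r => ?_
    rw [Equiv.coe_mulLeft, Subgroup.coe_mul, charVal_mul, map_mul, Units.val_mul]
    field_simp
  apply mul_right_cancel₀ hP0
  rw [mul_assoc, add_mul]
  rw [← shift ⟨s, hs0⟩, ← shift ⟨_, hs1⟩, ← Finset.sum_add_distrib, hP, Finset.mul_sum,
    Finset.mul_sum]
  refine Finset.sum_congr rfl fun r _ => ?_
  rw [← mul_add, mul_left_comm, key]
  ring

end DLPairing

/-! ### Duality of finite tori -/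

section Duality

variable {p : ℕ} {k : Type} [Field k] (ι : Additive kˣ ≃+ QModZ p)

/-- If lam = (qw - 1)v and mu = (qw - 1)u, both sides are the class in ℚ/ℤ of a pairing of u with v
through qw - 1, which is self-adjoint because w is an involution. -/
theorem charVal_eq_of_isDual {q : ℕ} {w : Equiv.Perm (Fin 2)} {lam mu : Fin 2 → ℤ}
    {y t : Fin 2 → kˣ} (hy : IsDual ι q w lam y) (ht : IsDual ι q w mu t) :
    charVal lam t = charVal mu y := by
  obtain ⟨v, hv, hvy⟩ := hy
  obtain ⟨u, hu, hut⟩ := ht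
  apply Additive.ofMul.injective
  apply ι.injective
  apply Subtype.ext
  have e : ∀ (lam : Fin 2 → ℤ) (t : Fin 2 → kˣ) (u : Fin 2 → ℚ),
      (∀ i, (ι (Additive.ofMul (t i)) : AddCircle (1 : ℚ)) = (u i : AddCircle (1 : ℚ))) →
      (ι (Additive.ofMul (charVal lam t)) : AddCircle (1 : ℚ)) =
        ((∑ i, (lam i : ℚ) * u i : ℚ) : AddCircle (1 : ℚ)) := by
    intro lam t u h
    simp only [charVal, Fin.sum_univ_two, Fin.prod_univ_two, ofMul_mul, ofMul_zpow, map_add,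
      map_zsmul, AddSubgroup.coe_add, AddSubgroup.coe_zsmul, h, AddCircle.coe_add, ← zsmul_eq_mul,
      AddCircle.coe_zsmul]
  rw [e lam t u hut, e mu y v hvy]
  congr 1
  simp only [Fin.sum_univ_two, ← hv, ← hu]
  rcases perm_fin_two w with rfl | rfl
  · simp; ring
  · simp; ring

/-- Summing the coordinates removes w: the product corresponds to (mu 0 + mu 1)/(q - 1) for both
tori. The split and non-split elements attached to one mu thus have the same determinant, as the
cancellation in `zSum` requires. -/
theorem mul_eq_of_isDual {q : ℕ} {w w' : Equiv.Perm (Fin 2)} {mu : Fin 2 → ℤ} (hq : 1 < q)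
    {t t' : Fin 2 → kˣ} (ht : IsDual ι q w mu t) (ht' : IsDual ι q w' mu t') :
    t 0 * t 1 = t' 0 * t' 1 := by
  have hq' : (q : ℚ) - 1 ≠ 0 := by
    have : (1 : ℚ) < q := by exact_mod_cast hq
    linarith
  have e : ∀ (w : Equiv.Perm (Fin 2)) (t : Fin 2 → kˣ), IsDual ι q w mu t →
      (ι (Additive.ofMul (t 0 * t 1)) : AddCircle (1 : ℚ)) =
        (((mu 0 + mu 1) / (q - 1) : ℚ) : AddCircle (1 : ℚ)) := by
    rintro w t ⟨u, hu, hut⟩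
    rw [ofMul_mul, map_add, AddSubgroup.coe_add, hut, hut, ← AddCircle.coe_add]
    congr 1
    rw [eq_div_iff hq', ← hu, ← hu]
    rcases perm_fin_two w with rfl | rfl
    · simp; ring
    · simp; ring
  apply Additive.ofMul.injective
  apply ι.injective
  apply Subtype.ext
  rw [e w t ht, e w' t' ht']

theorem mem_torus_of_isDual {F : Type} [Fintype F] {w : Equiv.Perm (Fin 2)} {mu : Fin 2 → ℤ}
    {t : Fin 2 → kˣ} (ht : IsDual ι (Fintype.card F) w mu t) : t ∈ torus F k w := by
  obtain ⟨u, hu, hut⟩ := ht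
  intro i
  apply Additive.ofMul.injective
  apply ι.injective
  apply Subtype.ext
  rw [ofMul_pow, map_nsmul, AddSubgroup.coe_nsmul, hut, hut, ← AddCircle.coe_nsmul, nsmul_eq_mul,
    eq_comm, ← sub_eq_zero, ← AddCircle.coe_sub, AddCircle.coe_eq_zero_iff]
  refine ⟨-mu i, ?_⟩
  rw [neg_smul, zsmul_one, ← hu i]
  ring

theorem exists_isDual {q : ℕ} (hq : 1 < q) (hpq : p ∣ q) (w : Equiv.Perm (Fin 2))
    (mu : Fin 2 → ℤ) : ∃ t : Fin 2 → kˣ, IsDual ι q w mu t := by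
  suffices h : ∃ v : Fin 2 → ℚ, (∀ i, (q : ℚ) * v (w i) - v i = mu i) ∧
      ∀ i, (v i : AddCircle (1 : ℚ)) ∈ QModZ p by
    obtain ⟨v, h1, h2⟩ := h
    refine ⟨fun i => (ι.symm ⟨_, h2 i⟩).toMul, v, h1, fun i => ?_⟩
    rw [ofMul_toMul, AddEquiv.apply_symm_apply]
  have hq1 : (1 : ℚ) < q := by exact_mod_cast hq
  have h1 : ((q : ℚ) ^ 2 - 1) ≠ 0 := by nlinarith
  have hq2 : 1 ≤ q ^ 2 := Nat.one_le_pow _ _ (by omega)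
  have hco : (q ^ 2 - 1).Coprime p := by
    refine Nat.Coprime.coprime_dvd_right (dvd_pow hpq two_ne_zero) ?_
    rw [Nat.coprime_self_sub_left hq2]
    exact Nat.coprime_one_left _
  have hmem : ∀ m : ℤ, (((m : ℚ) / ((q : ℚ) ^ 2 - 1) : ℚ) : AddCircle (1 : ℚ)) ∈ QModZ p := by
    intro m
    refine ⟨q ^ 2 - 1, hco, ?_⟩
    rw [← AddCircle.coe_nsmul, AddCircle.coe_eq_zero_iff]
    refine ⟨m, ?_⟩
    rw [nsmul_eq_mul, Nat.cast_sub hq2, zsmul_one]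
    push_cast
    field_simp
  -- Since w² = 1, the inverse of qw - 1 is (qw + 1)/(q² - 1), and q² - 1 is prime to p.
  rcases perm_fin_two w with rfl | rfl
  · refine ⟨fun i => ((mu i * (q + 1) : ℤ) : ℚ) / ((q : ℚ) ^ 2 - 1), fun i => ?_, fun i => hmem _⟩
    push_cast
    field_simp
    simp
    ring
  · refine ⟨fun i => ((mu i + q * mu (Equiv.swap 0 1 i) : ℤ) : ℚ) / ((q : ℚ) ^ 2 - 1), fun i => ?_,
      fun i => hmem _⟩
    push_cast
    field_simp
    simp
    ring

end Duality


/-! ### Central idempotents in group algebras over `Qbar` -/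

section Idempotents

variable {H : Type} [Group H]

theorem coeff_mul_eq_sum {R : Type*} [CommSemiring R] [Fintype H] (x y : MonoidAlgebra R H) (h : H) :
    (x * y).coeff h = ∑ g, x.coeff (h * g⁻¹) * y.coeff g := by
  classical
  induction y using MonoidAlgebra.induction_linear with
  | zero => simp
  | add y z hy hz =>
    simp only [mul_add, MonoidAlgebra.coeff_add, Finsupp.add_apply, Finset.sum_add_distrib, hy, hz]
  | single g r =>
    rw [MonoidAlgebra.coeff_mul_single_apply, Finset.sum_eq_single g]
    · simp
    · intro g' _ hg
      rw [MonoidAlgebra.coeff_single, Finsupp.single_eq_of_ne hg, mul_zero]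
    · simp

theorem central_of_coeff {R : Type*} [CommSemiring R] {Y : MonoidAlgebra R H}
    (hY : ∀ x g, Y.coeff (x * g * x⁻¹) = Y.coeff g) (x : MonoidAlgebra R H) : Y * x = x * Y := by
  induction x using MonoidAlgebra.induction_linear with
  | zero => simp
  | add x y hx hy => simp [mul_add, add_mul, hx, hy]
  | single h r =>
    ext g
    rw [MonoidAlgebra.coeff_mul_single_apply, MonoidAlgebra.coeff_single_mul_apply, mul_comm,
      ← hY h⁻¹ (g * h⁻¹)]
    congr 2
    group

omit [Group H] in
theorem eq_sum_single {R : Type*} [CommSemiring R] [Fintype H] (x : MonoidAlgebra R H) :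
    x = ∑ g, MonoidAlgebra.single g (x.coeff g) := by
  classical
  ext g
  rw [MonoidAlgebra.coeff_sum, Finset.sum_apply']
  simp [Finsupp.single_apply]

theorem asAlgebraHom_eq_sum {R : Type*} [CommRing R] [Fintype H] {V : Type*} [AddCommGroup V]
    [Module R V] (ρ : Representation R H V) (x : MonoidAlgebra R H) :
    ρ.asAlgebraHom x = ∑ g, x.coeff g • ρ g := by
  conv_lhs => rw [eq_sum_single x]
  rw [map_sum]
  simp

variable [Finite H]

theorem idemChi_coeff (V : FDRep Qbar H) (h : H) :
    (idemChi V).coeff h = V.character 1 / (Nat.card H : Qbar) * V.character h⁻¹ := by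
  classical
  cases nonempty_fintype H
  rw [idemChi, finsum_eq_sum_of_fintype, MonoidAlgebra.coeff_smul_apply, MonoidAlgebra.coeff_sum,
    Finset.sum_apply']
  simp [Finsupp.single_apply]

theorem idemChi_comm (V : FDRep Qbar H) (x : MonoidAlgebra Qbar H) :
    idemChi V * x = x * idemChi V := by
  refine central_of_coeff (fun x g => ?_) x
  rw [idemChi_coeff, idemChi_coeff, mul_inv_rev, mul_inv_rev, inv_inv, ← mul_assoc, V.char_conj]

theorem char_one_ne_zero (V : FDRep Qbar H) [Simple V] : V.character 1 ≠ 0 := by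
  cases nonempty_fintype H
  intro h0
  have h1 := V.simple_iff_char_is_norm_one.mp inferInstance
  rw [FDRep.char_one, Nat.cast_eq_zero, Module.finrank_zero_iff] at h0
  have h2 : ∀ g, V.character g = 0 := by
    intro g
    have : V.ρ g = 0 := Subsingleton.elim _ _
    rw [FDRep.character, this, map_zero]
  simp only [h2, mul_zero, Finset.sum_const_zero] at h1
  exact Nat.card_pos.ne' (by exact_mod_cast h1.symm)

omit [Finite H] in
theorem exists_central_scalar (V : FDRep Qbar H) [Simple V] {Y : MonoidAlgebra Qbar H}
    (hY : ∀ x, Y * x = x * Y) :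
    ∃ ω : Qbar, Representation.asAlgebraHom V.ρ Y = ω • LinearMap.id := by
  let f : V ⟶ V := ⟨InducedCategory.homMk (ModuleCat.ofHom (Representation.asAlgebraHom V.ρ Y)), by
    intro g
    ext1
    have h1 := congrArg (Representation.asAlgebraHom V.ρ) (hY (MonoidAlgebra.single g 1))
    rw [map_mul, map_mul, Representation.asAlgebraHom_single_one] at h1
    exact h1⟩
  obtain ⟨c, hc⟩ := endomorphism_simple_eq_smul_id Qbar f
  refine ⟨c, ?_⟩
  have := congrArg (fun φ : V ⟶ V => φ.hom.hom.hom) hc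
  exact this.symm

omit [Finite H] in
theorem sum_coeff_mul_char [Fintype H] (V : FDRep Qbar H) (Y : MonoidAlgebra Qbar H) (x : H) :
    ∑ g, Y.coeff g * V.character (g * x) =
      LinearMap.trace Qbar V (Representation.asAlgebraHom V.ρ Y * V.ρ x) := by
  rw [asAlgebraHom_eq_sum, Finset.sum_mul, map_sum]
  refine Finset.sum_congr rfl fun g _ => ?_
  rw [smul_mul_assoc, map_smul, smul_eq_mul, FDRep.character, map_mul]

/-- A central element acts on an irreducible representation by a scalar. -/
theorem exists_eigenvalue [Fintype H] (V : FDRep Qbar H) [Simple V] {Y : MonoidAlgebra Qbar H}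
    (hY : ∀ x, Y * x = x * Y) :
    ∃ ω : Qbar, (∀ x, ∑ g, Y.coeff g * V.character (g * x) = ω * V.character x) ∧
      idemChi V * Y = ω • idemChi V := by
  obtain ⟨ω, hω⟩ := exists_central_scalar V hY
  have h1 : ∀ x, ∑ g, Y.coeff g * V.character (g * x) = ω * V.character x := by
    intro x
    rw [sum_coeff_mul_char, hω, smul_mul_assoc, map_smul, smul_eq_mul]
    rfl
  refine ⟨ω, h1, ?_⟩
  ext h
  rw [coeff_mul_eq_sum, MonoidAlgebra.coeff_smul_apply, idemChi_coeff, smul_eq_mul, mul_left_comm,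
    ← h1, Finset.mul_sum]
  refine Finset.sum_congr rfl fun g _ => ?_
  rw [idemChi_coeff, mul_inv_rev, inv_inv]
  ring

/-- By Schur's lemma the element acts by a scalar; its trace is found from the norm of the
irreducible character, which is one. -/
theorem asAlgebraHom_idemChi (V : FDRep Qbar H) [Simple V] :
    Representation.asAlgebraHom V.ρ (idemChi V) = LinearMap.id := by
  cases nonempty_fintype H
  obtain ⟨ω, hω⟩ := exists_central_scalar V (idemChi_comm V)
  have h1 := sum_coeff_mul_char V (idemChi V) 1
  rw [hω, map_one, mul_one, map_smul, smul_eq_mul] at h1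
  have h2 : LinearMap.trace Qbar V LinearMap.id = V.character 1 := by
    rw [FDRep.character, map_one]; rfl
  have h3 : ∑ g : H, V.character g⁻¹ * V.character g = Nat.card H := by
    rw [← V.simple_iff_char_is_norm_one.mp inferInstance]
    exact Finset.sum_congr rfl fun g _ => mul_comm _ _
  have hc : (Nat.card H : Qbar) ≠ 0 := by exact_mod_cast Nat.card_pos.ne'
  simp only [idemChi_coeff, mul_one, mul_assoc] at h1
  rw [← Finset.mul_sum, h3, div_mul_cancel₀ _ hc, h2] at h1
  have : ω = 1 := mul_right_cancel₀ (char_one_ne_zero V) (by rw [← h1, one_mul])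
  rw [hω, this, one_smul]

/-- The blocks of the irreducible representations separate the elements of the group algebra. -/
theorem eq_zero_of_idemChi_mul {Y : MonoidAlgebra Qbar H}
    (h : ∀ V : FDRep Qbar H, Simple V → idemChi V * Y = 0) : Y = 0 := by
  cases nonempty_fintype H
  have hfin : Module.Finite Qbar (MonoidAlgebra Qbar H) :=
    Module.Finite.of_basis (MonoidAlgebra.basis H Qbar)
  have : IsArtinianRing (MonoidAlgebra Qbar H) := IsArtinianRing.of_finite Qbar _
  by_contra hY
  have hL : Submodule.span (MonoidAlgebra Qbar H) {Y} ≠ ⊥ := by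
    rwa [Ne, Submodule.span_singleton_eq_bot]
  -- A minimal left ideal inside the one generated by Y is an irreducible representation. Its own
  -- block idempotent acts on it as the identity, yet annihilates it by the assumption on Y.
  obtain ⟨M, hM, hle⟩ := (IsAtomic.eq_bot_or_exists_atom_le _).resolve_left hL
  have hs : IsSimpleModule (MonoidAlgebra Qbar H) M := isSimpleModule_iff_isAtom.mpr hM
  let ρ : Representation Qbar H M := Representation.ofModule' M
  have hρ : ∀ g (m : M), ρ g m = MonoidAlgebra.single g (1 : Qbar) • m := fun g m => by
    simp [ρ, Representation.ofModule', Algebra.lsmul]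
  have hfM : Module.Finite Qbar M :=
    Module.Finite.of_injective (M.subtype.restrictScalars Qbar) M.injective_subtype
  have hact : ∀ (x : MonoidAlgebra Qbar H) (m : M), ρ.asAlgebraHom x m = x • m := by
    intro x m
    rw [asAlgebraHom_eq_sum]
    conv_rhs => rw [eq_sum_single x, Finset.sum_smul]
    rw [LinearMap.sum_apply]
    refine Finset.sum_congr rfl fun g _ => ?_
    rw [LinearMap.smul_apply, hρ, ← smul_assoc, MonoidAlgebra.smul_single, smul_eq_mul, mul_one]
  have hirr : ρ.IsIrreducible := by
    rw [Representation.irreducible_iff_isSimpleModule_asModule]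
    let e : ρ.asModule ≃ₗ[MonoidAlgebra Qbar H] M :=
      { ρ.asModuleEquiv.toAddEquiv with
        map_smul' := fun x m => by
          change ρ.asModuleEquiv (x • m) = x • ρ.asModuleEquiv m
          rw [Representation.asModuleEquiv_map_smul, hact] }
    exact IsSimpleModule.congr e
  have hV : Simple (FDRep.of ρ) := by
    rw [FDRep.simple_iff_char_is_norm_one]
    have hc : (Nat.card H : Qbar) ≠ 0 := by exact_mod_cast Nat.card_pos.ne'
    have := invertibleOfNonzero hc
    have h1 := Representation.char_orthonormal ρ ρ
    rw [if_pos ⟨Representation.Equiv.refl ρ⟩, inv_mul_eq_one₀ hc] at h1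
    exact h1.symm
  have h1 := asAlgebraHom_idemChi (FDRep.of ρ)
  have h2 : ∀ m : M, m = 0 := by
    intro m
    have h3 : ρ.asAlgebraHom (idemChi (FDRep.of ρ)) m = m := by
      exact LinearMap.congr_fun h1 m
    rw [hact] at h3
    rw [← h3]
    apply Subtype.ext
    obtain ⟨a, ha⟩ := Submodule.mem_span_singleton.mp (hle m.2)
    rw [Submodule.coe_smul, ← ha, smul_eq_mul, smul_eq_mul, ← mul_assoc, idemChi_comm, mul_assoc,
      h _ hV, mul_zero]
    rfl
  exact hM.1 ((Submodule.eq_bot_iff _).mpr fun m hm => congrArg Subtype.val (h2 ⟨m, hm⟩))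

end Idempotents


/-! ### Central elements attached to cocharacters -/

section Push

variable {G H : Type} [Group G] [Group H]

/-- The map `ℤ[G] → Qbar[H]` induced by a homomorphism `G → H`. -/
def push (π : G →* H) : MonoidAlgebra ℤ G →+* MonoidAlgebra Qbar H :=
  (MonoidAlgebra.mapRingHom H (Int.castRingHom Qbar)).comp (MonoidAlgebra.mapDomainRingHom ℤ π)

theorem push_single (π : G →* H) (g : G) (n : ℤ) :
    push π (MonoidAlgebra.single g n) = MonoidAlgebra.single (π g) (n : Qbar) := by
  simp [push]

theorem push_comm {π : G →* H} (hπ : Function.Surjective π) {x : MonoidAlgebra ℤ G}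
    (hx : ∀ y, x * y = y * x) (y : MonoidAlgebra Qbar H) : push π x * y = y * push π x := by
  induction y using MonoidAlgebra.induction_linear with
  | zero => simp
  | add y z hy hz => rw [mul_add, add_mul, hy, hz]
  | single h r =>
    obtain ⟨g, rfl⟩ := hπ h
    have h1 : MonoidAlgebra.single (π g) r = r • push π (MonoidAlgebra.single g 1) := by
      rw [push_single, MonoidAlgebra.smul_single, Int.cast_one, smul_eq_mul, mul_one]
    rw [h1, mul_smul_comm, smul_mul_assoc, ← map_mul, ← map_mul, hx]

theorem push_coeff [Fintype G] [DecidableEq H] (π : G →* H) (x : MonoidAlgebra ℤ G) (h : H) :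
    (push π x).coeff h = ∑ g with π g = h, (x.coeff g : Qbar) := by
  conv_lhs => rw [eq_sum_single x]
  rw [map_sum, MonoidAlgebra.coeff_sum, Finset.sum_apply', Finset.sum_filter]
  refine Finset.sum_congr rfl fun g _ => ?_
  rw [push_single, MonoidAlgebra.coeff_single, Finsupp.single_apply]

theorem sum_push_coeff_mul [Fintype G] [Fintype H] (π : G →* H) (x : MonoidAlgebra ℤ G) (f : H → Qbar) :
    ∑ h, (push π x).coeff h * f h = ∑ g, x.coeff g • f (π g) := by
  classical
  simp_rw [push_coeff, Finset.sum_mul, zsmul_eq_mul]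
  rw [← Finset.sum_fiberwise _ π]
  refine Finset.sum_congr rfl fun h _ => Finset.sum_congr rfl fun g hg => ?_
  rw [(Finset.mem_filter.mp hg).2]

end Push

/-! ### Dual torus elements and the eigenvalues of the central elements -/

section CentralElements

variable {p : ℕ} {F k : Type} [Field F] [Fintype F] [Field k] [Algebra F k]

/-- The element of `T^{wF}` dual to the cocharacter `mu`. -/
def dualElt (ι : Additive kˣ ≃+ QModZ p) (q : ℕ) (w : Equiv.Perm (Fin 2)) (mu : Fin 2 → ℤ) :
    Fin 2 → kˣ :=
  Classical.epsilon (IsDual ι q w mu)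

theorem card_gt_one_and_dvd [Fact p.Prime] [CharP F p] :
    1 < Fintype.card F ∧ p ∣ Fintype.card F := by
  refine ⟨Fintype.one_lt_card, ?_⟩
  obtain ⟨n, -, hn⟩ := FiniteField.card F p
  rw [hn]
  exact dvd_pow_self p n.ne_zero

theorem isDual_dualElt (F : Type) [Field F] [Fintype F] [Fact p.Prime] [CharP F p]
    (ι : Additive kˣ ≃+ QModZ p) (w : Equiv.Perm (Fin 2)) (mu : Fin 2 → ℤ) :
    IsDual ι (Fintype.card F) w mu (dualElt ι (Fintype.card F) w mu) :=
  Classical.epsilon_spec (exists_isDual ι (card_gt_one_and_dvd (p := p) (F := F)).1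
    (card_gt_one_and_dvd (p := p) (F := F)).2 w mu)

theorem isDual_comp_swap {ι : Additive kˣ ≃+ QModZ p} {q : ℕ} {w : Equiv.Perm (Fin 2)}
    {mu : Fin 2 → ℤ} {t : Fin 2 → kˣ} (h : IsDual ι q w mu t) :
    IsDual ι q w (mu ∘ Equiv.swap 0 1) (t ∘ Equiv.swap 0 1) := by
  obtain ⟨v, h1, h2⟩ := h
  refine ⟨v ∘ Equiv.swap 0 1, fun i => ?_, fun i => h2 _⟩
  rw [Function.comp_apply, Function.comp_apply, Function.comp_apply, ← h1]
  rcases perm_fin_two w with rfl | rfl <;> simp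

theorem isDual_add {ι : Additive kˣ ≃+ QModZ p} {q : ℕ} {w : Equiv.Perm (Fin 2)}
    {mu nu : Fin 2 → ℤ} {s t : Fin 2 → kˣ} (hs : IsDual ι q w mu s) (ht : IsDual ι q w nu t) :
    IsDual ι q w (mu + nu) (s * t) := by
  obtain ⟨u, h1, h2⟩ := hs
  obtain ⟨v, h3, h4⟩ := ht
  refine ⟨u + v, fun i => ?_, fun i => ?_⟩
  · rw [Pi.add_apply, Pi.add_apply, Pi.add_apply, Int.cast_add, ← h1, ← h3]; ring
  · rw [Pi.mul_apply, ofMul_mul, map_add, AddSubgroup.coe_add, h2, h4, Pi.add_apply,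
      AddCircle.coe_add]

theorem isDual_unique {ι : Additive kˣ ≃+ QModZ p} {q : ℕ} (hq : 1 < q) {w : Equiv.Perm (Fin 2)}
    {mu : Fin 2 → ℤ} {s t : Fin 2 → kˣ} (hs : IsDual ι q w mu s) (ht : IsDual ι q w mu t) :
    s = t := by
  obtain ⟨u, h1, h2⟩ := hs
  obtain ⟨v, h3, h4⟩ := ht
  have hq1 : (1 : ℚ) < q := by exact_mod_cast hq
  have huv : ∀ i, (q : ℚ) * (u (w i) - v (w i)) = u i - v i := by
    intro i
    linear_combination h1 i - h3 i
  have h0 : ∀ i, u i - v i = 0 := by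
    intro i
    rcases perm_fin_two w with rfl | rfl
    · have := huv i
      have h5 : ((q : ℚ) - 1) * (u i - v i) = 0 := by
        rw [Equiv.Perm.one_apply] at this; linear_combination this
      exact (mul_eq_zero.mp h5).resolve_left (by linarith)
    · have h5 := huv i
      have h6 := huv (Equiv.swap 0 1 i)
      rw [Equiv.swap_apply_self] at h6
      have h7 : ((q : ℚ) ^ 2 - 1) * (u i - v i) = 0 := by linear_combination q * h6 + h5
      exact (mul_eq_zero.mp h7).resolve_left (by nlinarith)
  funext i
  apply Additive.ofMul.injective
  apply ι.injective
  apply Subtype.ext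
  rw [h2, h4, sub_eq_zero.mp (h0 i)]

variable {H : Type} [Group H] (π : GL (Fin 2) F →* H) (ι : Additive kˣ ≃+ QModZ p)

/-- The central element of `Qbar[H]` attached to the cocharacter `mu`. -/
def zElt (mu : Fin 2 → ℤ) : MonoidAlgebra Qbar H :=
  (2 * Fintype.card F : Qbar)⁻¹ • push π (zTorus F (dualElt ι (Fintype.card F) 1 mu)
    (dualElt ι (Fintype.card F) (Equiv.swap 0 1) mu))

variable {π}

theorem zElt_comm (hπ : Function.Surjective π) (mu : Fin 2 → ℤ) (x : MonoidAlgebra Qbar H) :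
    zElt π ι mu * x = x * zElt π ι mu := by
  rw [zElt, smul_mul_assoc, mul_smul_comm, push_comm hπ (zTorus_comm _ _)]

/-- The action of `zElt mu` on a constituent of a Deligne-Lusztig character. -/
theorem idemChi_mul_zElt [IsAlgClosed k] [Fact p.Prime] [CharP F p] [Finite H]
    (hπ : Function.Surjective π) {κ : kˣ →* Qbarˣ} {V : FDRep Qbar H} [Simple V]
    {w : Equiv.Perm (Fin 2)} {lam : Fin 2 → ℤ} {y : Fin 2 → kˣ}
    (hy : IsDual ι (Fintype.card F) w lam y)
    (hne : pairing (fun g => V.character (π g)) (DLChar κ w lam) ≠ 0) (mu : Fin 2 → ℤ) :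
    idemChi V * zElt π ι mu = ((2 : Qbar)⁻¹ * (((κ (charVal mu y) : Qbarˣ) : Qbar) +
      ((κ (charVal (mu ∘ Equiv.swap 0 1) y) : Qbarˣ) : Qbar))) • idemChi V := by
  cases nonempty_fintype H
  cases nonempty_fintype (GL (Fin 2) F)
  have d1 := isDual_dualElt F ι 1 mu
  have ds := isDual_dualElt F ι (Equiv.swap 0 1) mu
  have dw := isDual_dualElt F ι w mu
  set t := dualElt ι (Fintype.card F) 1 mu
  set t' := dualElt ι (Fintype.card F) (Equiv.swap 0 1) mu
  obtain ⟨ω, h1, h2⟩ := exists_eigenvalue V (push_comm hπ (zTorus_comm (F := F) t t'))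
  have h3 := eigenvalue_of_pairing_ne_zero (f := fun g => V.character (π g)) (by
      intro x g
      simp only [map_mul, map_inv, V.char_conj]) hne (mem_torus_of_isDual ι d1)
      (mem_torus_of_isDual ι ds) (mul_eq_of_isDual ι Fintype.one_lt_card d1 ds)
      (s := dualElt ι (Fintype.card F) w mu) (by rintro rfl; rfl) (by rintro rfl; rfl) (ω := ω) (by
      intro x
      rw [← h1 (π x), sum_push_coeff_mul]
      simp only [map_mul])
  -- Duality exchanges the roles: the character lam at the element dual to mu becomes mu at the
  -- parameter y. The eigenvalue no longer depends on w except through y.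
  rw [charVal_eq_of_isDual ι hy dw, charVal_eq_of_isDual ι hy (isDual_comp_swap dw)] at h3
  have hq : (Fintype.card F : Qbar) ≠ 0 := by exact_mod_cast Fintype.card_ne_zero
  rw [zElt, mul_smul_comm, h2, smul_smul, h3]
  congr 1
  field_simp

end CentralElements


/-! ### Separation by the constituents of the Gelfand-Graev representation -/

section Separation

variable {F : Type} [Field F] [Fintype F] {H : Type} [Group H]

/-- The idempotent `1 - e`, where `e` is the idempotent of the trivial character of `U^F`. -/
def epsU (u : Multiplicative F →* H) : MonoidAlgebra Qbar H := 1 - idemPsi u 1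

/-- The shifts of a non-trivial additive character run over all characters of F, so this is Fourier
inversion on U. -/
theorem sum_idemPsi_mulShift (u : Multiplicative F →* H) {ψ : AddChar F Qbar} (hψ : ψ ≠ 1) :
    ∑ b : F, idemPsi u (ψ.mulShift b) = 1 := by
  classical
  have hq : (Fintype.card F : Qbar) ≠ 0 := by exact_mod_cast Fintype.card_ne_zero
  have hp : ψ.IsPrimitive := AddChar.IsPrimitive.of_ne_one hψ
  simp only [idemPsi]
  rw [← Finset.smul_sum, Finset.sum_comm]
  have h1 : ∀ a : F, ∑ b : F, (ψ.mulShift b) (-a) • MonoidAlgebra.of Qbar H (u (Multiplicative.ofAdd a)) =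
      if a = 0 then (Fintype.card F : Qbar) • (1 : MonoidAlgebra Qbar H) else 0 := by
    intro a
    rw [← Finset.sum_smul]
    simp only [AddChar.mulShift_apply]
    rw [AddChar.sum_mulShift (-a) hp]
    by_cases ha : a = 0
    · simp [ha, MonoidAlgebra.one_def]
    · simp [ha]
  simp only [h1, Finset.sum_ite_eq', Finset.mem_univ, if_true]
  rw [smul_smul, inv_mul_cancel₀ hq, one_smul]

theorem epsU_eq_sum (u : Multiplicative F →* H) {ψ : AddChar F Qbar} (hψ : ψ ≠ 1) [DecidableEq F] :
    epsU u = ∑ b ∈ Finset.univ.erase (0 : F), idemPsi u (ψ.mulShift b) := by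
  rw [epsU, ← sum_idemPsi_mulShift u hψ, sub_eq_iff_eq_add,
    ← Finset.add_sum_erase _ _ (Finset.mem_univ (0 : F)), add_comm, AddChar.mulShift_zero]

variable {π : GL (Fin 2) F →* H}

omit [Fintype F] in
theorem dg_conj_uni (b : Fˣ) (x : F) : dg b 1 * uni x * (dg b 1)⁻¹ = uni (b * x) := by
  rw [mul_inv_eq_iff_eq_mul]
  ext i j
  rw [Units.val_mul, Units.val_mul, uni_val, uni_val, dg_val]
  fin_cases i <;> fin_cases j <;> simp

/-- Conjugation by the diagonal torus rescales U, hence permutes the non-trivial characters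
transitively; all their idempotents are conjugate. -/
theorem conj_idemPsi (b : Fˣ) (ψ : AddChar F Qbar) :
    MonoidAlgebra.single (π (dg b 1)) 1 * idemPsi (π.comp (uGL F)) ψ *
      MonoidAlgebra.single (π (dg b 1))⁻¹ 1 =
    idemPsi (π.comp (uGL F)) (ψ.mulShift (b⁻¹ : Fˣ)) := by
  rw [idemPsi, idemPsi, mul_smul_comm, smul_mul_assoc, Finset.mul_sum, Finset.sum_mul]
  congr 1
  refine Fintype.sum_equiv (Units.mulLeft b) _ _ fun x => ?_
  rw [mul_smul_comm, smul_mul_assoc, MonoidAlgebra.of_apply, MonoidAlgebra.of_apply,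
    MonoidAlgebra.single_mul_single, MonoidAlgebra.single_mul_single, mul_one, mul_one,
    AddChar.mulShift_apply]
  congr 1
  · congr 1
    rw [Units.mulLeft_apply, mul_neg, Units.inv_mul_cancel_left]
  · congr 1
    rw [← map_inv, MonoidHom.comp_apply, ← map_mul, ← map_mul, dg_conj_uni]
    rfl

variable [Finite H]

/-- The idempotent ε is the sum of the e for all non-trivial characters, each conjugate to e_ψ, and
the block idempotent is central. -/
theorem idemChi_mul_epsU {V : FDRep Qbar H} {ψ : AddChar F Qbar} (hψ : ψ ≠ 1)
    (h : idemChi V * idemPsi (π.comp (uGL F)) ψ = 0) :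
    idemChi V * epsU (π.comp (uGL F)) = 0 := by
  classical
  rw [epsU_eq_sum _ hψ, Finset.mul_sum]
  refine Finset.sum_eq_zero fun b hb => ?_
  have hb0 : b ≠ 0 := Finset.ne_of_mem_erase hb
  have h1 := conj_idemPsi (π := π) (Units.mk0 b hb0)⁻¹ ψ
  rw [inv_inv, Units.val_mk0] at h1
  rw [← h1, ← mul_assoc, ← mul_assoc, idemChi_comm, mul_assoc (MonoidAlgebra.single _ _), h,
    mul_zero, zero_mul]

/-- The generic irreducible representations separate the elements killed by `1 - epsU`. -/
theorem eq_zero_of_generic {Y : MonoidAlgebra Qbar H} {ψ : AddChar F Qbar} (hψ : ψ ≠ 1)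
    (hY : Y * epsU (π.comp (uGL F)) = Y)
    (h : ∀ V : FDRep Qbar H, Simple V → idemChi V * idemPsi (π.comp (uGL F)) ψ ≠ 0 →
      idemChi V * Y = 0) : Y = 0 := by
  refine eq_zero_of_idemChi_mul fun V hV => ?_
  by_cases hg : idemChi V * idemPsi (π.comp (uGL F)) ψ = 0
  · rw [← hY, ← mul_assoc, idemChi_comm, mul_assoc, idemChi_mul_epsU hψ hg, mul_zero]
  · exact h V hV hg

end Separation

/-! ### Existence of Lusztig series -/

section Series

open Matrix

variable {F k : Type} [Field F] [Fintype F] [Field k] [Algebra F k]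

/-- When both torus elements are the same scalar, everything cancels except the weight difference 2q
at that scalar. -/
theorem zTorus_scalar {t t' : Fin 2 → kˣ} {c : Fˣ} (h0 : (t 0 : k) = algebraMap F k c)
    (h1 : (t 1 : k) = algebraMap F k c) (h0' : (t' 0 : k) = algebraMap F k c)
    (h1' : (t' 1 : k) = algebraMap F k c) :
    zTorus F t t' = (2 * Fintype.card F : ℤ) • MonoidAlgebra.single (sc c) 1 := by
  simp only [zTorus, torusSum, h0, h1, h0', h1', ← map_add, ← map_mul, down_algebraMap]
  have h2 := classSum_neg_one_sc c
  rw [Equiv.Perm.sign_swap (by decide), Equiv.Perm.sign_one]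
  simp only [Units.val_neg, Units.val_one]
  rw [h2]
  abel

theorem sc_mul_torusSum {w : Equiv.Perm (Fin 2)} {t : Fin 2 → kˣ} (ht : t ∈ torus F k w) (c : Fˣ) :
    MonoidAlgebra.single (sc c) 1 * torusSum F w t =
      torusSum F w ((fun _ => Units.map (algebraMap F k).toMonoidHom c) * t) := by
  have e1 : algebraMap F k c * t 0 + algebraMap F k c * t 1 =
      algebraMap F k (c * down F (t 0 + t 1 : k)) := by
    rw [map_mul, algebraMap_down_add ht, mul_add]
  have e2 : algebraMap F k c * t 0 * (algebraMap F k c * t 1) =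
      algebraMap F k (c * c * down F (t 0 * t 1 : k)) := by
    rw [map_mul, map_mul, algebraMap_down_mul ht]; ring
  simp only [torusSum, sc_mul_classSum, Pi.mul_apply, Units.val_mul, Units.coe_map]
  simp only [RingHom.toMonoidHom_eq_coe, MonoidHom.coe_coe, e1, e2, down_algebraMap]

theorem sum_pow_eq_ite {N : ℕ} {ζ : Qbarˣ} (h : ζ ^ N = 1) [Decidable (ζ = 1)] :
    ∑ i ∈ Finset.range N, (ζ : Qbar) ^ i = if ζ = 1 then (N : Qbar) else 0 := by
  split_ifs with h1
  · simp [h1]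
  · have h2 := mul_geom_sum (ζ : Qbar) N
    rw [← Units.val_pow_eq_pow_val, h, Units.val_one, sub_self] at h2
    refine (mul_eq_zero.mp h2).resolve_left fun h3 => h1 (Units.ext ?_)
    rw [Units.val_one]
    exact sub_eq_zero.mp h3

variable {κ : kˣ →* Qbarˣ}

omit [Algebra F k] in
theorem kappa_pow {w : Equiv.Perm (Fin 2)} {t : Fin 2 → kˣ} (ht : t ∈ torus F k w) (i : Fin 2) :
    ((κ (t i))⁻¹) ^ (Fintype.card F ^ 2 - 1) = 1 := by
  rw [inv_pow, ← map_pow, torus_pow_sq_sub_one ht, map_one, inv_one]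

/-- The split and non-split torus sums at the identity differ by 2q times the identity of the group,
so f cannot vanish on both. -/
theorem exists_pairing_torus_ne_zero [Fintype (GL (Fin 2) F)] {f : GL (Fin 2) F → Qbar}
    (hf : f 1 ≠ 0) : ∃ w : Equiv.Perm (Fin 2),
      ∑ g, (torusSum F w (1 : Fin 2 → kˣ)).coeff g • f g ≠ 0 := by
  by_contra! h
  have h1 := zTorus_scalar (F := F) (t := (1 : Fin 2 → kˣ)) (t' := 1) (c := 1)
    (by simp) (by simp) (by simp) (by simp)
  have h2 : ∑ g, (zTorus F (1 : Fin 2 → kˣ) 1).coeff g • f g = 0 := by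
    simp only [zTorus, MonoidAlgebra.coeff_sub, Finsupp.sub_apply, sub_smul,
      Finset.sum_sub_distrib, h, sub_self]
  have h3 : sc (1 : Fˣ) = 1 := by
    ext i j
    fin_cases i <;> fin_cases j <;> simp [sc, dg_val]
  classical
  rw [h1, h3, Finset.sum_eq_single 1] at h2
  · simp [MonoidAlgebra.coeff_single, hf] at h2
  · intro g _ hg
    rw [MonoidAlgebra.coeff_smul_apply, MonoidAlgebra.coeff_single, Finsupp.single_eq_of_ne hg,
      smul_zero, zero_smul]
  · simp

/-- Every irreducible representation lies in some series. Summing the Fourier coefficients over lam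
= (i, j) with 0 ≤ i, j < q² - 1 isolates t = 1, as q² - 1 kills the torus and κ is injective. -/
theorem exists_pairing_ne_zero (hκ : Function.Injective κ) {f : GL (Fin 2) F → Qbar}
    (hf : f 1 ≠ 0) : ∃ (w : Equiv.Perm (Fin 2)) (lam : Fin 2 → ℤ),
      pairing f (DLChar κ w lam) ≠ 0 := by
  classical
  cases nonempty_fintype (GL (Fin 2) F)
  obtain ⟨w, hw⟩ := exists_pairing_torus_ne_zero (k := k) hf
  cases nonempty_fintype (torusSubgroup F k w)
  refine ⟨w, ?_⟩
  by_contra! h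
  set N := Fintype.card F ^ 2 - 1 with hN
  have hN0 : (N : Qbar) ≠ 0 := by exact_mod_cast (one_lt_card_sq (F := F)).ne'
  have h1 : ∀ i j : ℕ, ∑ t : torusSubgroup F k w,
      ((((κ (t.1 0))⁻¹ : Qbarˣ) : Qbar) ^ i * (((κ (t.1 1))⁻¹ : Qbarˣ) : Qbar) ^ j) *
        ∑ g, (torusSum F w t.1).coeff g • f g = 0 := by
    intro i j
    have := card_mul_pairing_DLChar κ w ![(i : ℤ), (j : ℤ)] f
    rw [h, mul_zero] at this
    rw [this]
    refine Finset.sum_congr rfl fun t _ => ?_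
    simp [charVal, Fin.prod_univ_two, inv_pow, mul_comm]
  have h2 : ∑ i ∈ Finset.range N, ∑ j ∈ Finset.range N, ∑ t : torusSubgroup F k w,
      ((((κ (t.1 0))⁻¹ : Qbarˣ) : Qbar) ^ i * (((κ (t.1 1))⁻¹ : Qbarˣ) : Qbar) ^ j) *
        ∑ g, (torusSum F w t.1).coeff g • f g = 0 :=
    Finset.sum_eq_zero fun i _ => Finset.sum_eq_zero fun j _ => h1 i j
  simp_rw [Finset.sum_comm (s := Finset.range N) (t := Finset.univ), ← Finset.sum_mul,
    ← Finset.mul_sum, ← Finset.sum_mul] at h2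
  rw [Finset.sum_eq_single 1] at h2
  · rw [OneMemClass.coe_one, Pi.one_apply, Pi.one_apply, map_one, inv_one] at h2
    simp only [Units.val_one, one_pow, Finset.sum_const, Finset.card_range, nsmul_eq_mul,
      mul_one] at h2
    exact (mul_ne_zero (mul_ne_zero hN0 hN0) hw) h2
  · intro t _ ht
    rw [sum_pow_eq_ite (kappa_pow t.2 0), sum_pow_eq_ite (kappa_pow t.2 1)]
    have h3 : ∀ i, (κ (t.1 i))⁻¹ = 1 ↔ t.1 i = 1 := by
      intro i
      rw [inv_eq_one, ← map_one κ, hκ.eq_iff]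
    simp only [h3]
    by_cases h4 : t.1 0 = 1
    · by_cases h5 : t.1 1 = 1
      · exfalso
        apply ht
        ext i
        fin_cases i
        · simp [h4]
        · simp [h5]
      · rw [if_neg h5, mul_zero, zero_mul]
    · rw [if_neg h4, zero_mul, zero_mul]
  · simp

/-- Only the weights (i, -i) are available, and summing over them isolates the t with equal
coordinates. These are scalars over F, and by the invariance of f each contributes the same as t =
1. -/
theorem exists_pairing_ne_zero_of_central (hκ : Function.Injective κ) {f : GL (Fin 2) F → Qbar}
    (hf : f 1 ≠ 0) (hc : ∀ c g, f (sc c * g) = f g) :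
    ∃ (w : Equiv.Perm (Fin 2)) (lam : Fin 2 → ℤ), lam 0 + lam 1 = 0 ∧
      pairing f (DLChar κ w lam) ≠ 0 := by
  classical
  cases nonempty_fintype (GL (Fin 2) F)
  obtain ⟨w, hw⟩ := exists_pairing_torus_ne_zero (k := k) hf
  cases nonempty_fintype (torusSubgroup F k w)
  refine ⟨w, ?_⟩
  by_contra! h
  set N := Fintype.card F ^ 2 - 1 with hN
  have hN0 : (N : Qbar) ≠ 0 := by exact_mod_cast (one_lt_card_sq (F := F)).ne'
  have h1 : ∀ i : ℕ, ∑ t : torusSubgroup F k w, (((κ (t.1 0 / t.1 1))⁻¹ : Qbarˣ) : Qbar) ^ i *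
        ∑ g, (torusSum F w t.1).coeff g • f g = 0 := by
    intro i
    have := card_mul_pairing_DLChar κ w ![(i : ℤ), -(i : ℤ)] f
    rw [h _ (by simp), mul_zero] at this
    rw [this]
    refine Finset.sum_congr rfl fun t _ => ?_
    congr 1
    rw [← Units.val_pow_eq_pow_val, ← Units.val_inv_eq_inv_val, inv_pow, ← map_pow]
    simp [charVal, Fin.prod_univ_two, div_eq_mul_inv, mul_pow]
  have h2 : ∑ i ∈ Finset.range N, ∑ t : torusSubgroup F k w,
      (((κ (t.1 0 / t.1 1))⁻¹ : Qbarˣ) : Qbar) ^ i *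
        ∑ g, (torusSum F w t.1).coeff g • f g = 0 :=
    Finset.sum_eq_zero fun i _ => h1 i
  simp_rw [Finset.sum_comm (s := Finset.range N) (t := Finset.univ), ← Finset.sum_mul] at h2
  have h3 : ∀ t : torusSubgroup F k w, (∑ i ∈ Finset.range N,
      (((κ (t.1 0 / t.1 1))⁻¹ : Qbarˣ) : Qbar) ^ i) * ∑ g, (torusSum F w t.1).coeff g • f g =
      if t.1 0 = t.1 1 then (N : Qbar) * ∑ g, (torusSum F w (1 : Fin 2 → kˣ)).coeff g • f g
        else 0 := by
    intro t
    rw [sum_pow_eq_ite (by rw [inv_pow, ← map_pow, div_pow, torus_pow_sq_sub_one t.2,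
      torus_pow_sq_sub_one t.2, div_one, map_one, inv_one])]
    have h4 : (κ (t.1 0 / t.1 1))⁻¹ = 1 ↔ t.1 0 = t.1 1 := by
      rw [inv_eq_one, ← map_one κ, hκ.eq_iff, div_eq_one]
    simp only [h4]
    split_ifs with h5
    · congr 1
      have h6 : (t.1 0 : k) ^ Fintype.card F = t.1 0 := by
        have h7 := t.2 0
        have h8 : t.1 (w 0) = t.1 0 := by
          rcases perm_fin_two w with rfl | rfl
          · rfl
          · rw [Equiv.swap_apply_left, h5]
        rw [h8] at h7
        rw [← Units.val_pow_eq_pow_val, h7]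
      obtain ⟨c, hc1⟩ := exists_algebraMap_eq_of_frob h6
      have hc0 : c ≠ 0 := by rintro rfl; rw [map_zero] at hc1; exact (t.1 0).ne_zero hc1.symm
      have h9 : t.1 = (fun _ => Units.map (algebraMap F k).toMonoidHom (Units.mk0 c hc0)) *
          (1 : Fin 2 → kˣ) := by
        rw [mul_one]
        funext i
        apply Units.ext
        fin_cases i
        · simpa using hc1.symm
        · simpa [← h5] using hc1.symm
      rw [h9, ← sc_mul_torusSum (w := w) (t := (1 : Fin 2 → kˣ)) (torusSubgroup F k w).one_mem]
      refine (Fintype.sum_equiv (Equiv.mulLeft (sc (Units.mk0 c hc0))) _ _ fun g => ?_).symm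
      rw [MonoidAlgebra.coeff_single_mul_apply, Equiv.coe_mulLeft, inv_mul_cancel_left, hc, one_mul]
    · rw [zero_mul]
  simp only [h3] at h2
  rw [← Finset.sum_filter, Finset.sum_const, nsmul_eq_mul] at h2
  refine mul_ne_zero ?_ (mul_ne_zero hN0 hw) h2
  rw [Nat.cast_ne_zero, Finset.card_ne_zero]
  exact ⟨1, by simp⟩

/-- A scalar matrix if the eigenvalues coincide and a companion matrix otherwise. In both cases the
order divides q² - 1, which is prime to p. -/
theorem exists_regular {p : ℕ} [Fact p.Prime] [CharP F p] {w : Equiv.Perm (Fin 2)} {y : Fin 2 → kˣ}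
    (hy : y ∈ torus F k w) :
    ∃ x : GL (Fin 2) F, HasEigenvalues x.1 y ∧ (orderOf x).Coprime p := by
  have hco : (Fintype.card F ^ 2 - 1).Coprime p := by
    refine Nat.Coprime.coprime_dvd_right (dvd_pow (card_gt_one_and_dvd (p := p) (F := F)).2 two_ne_zero) ?_
    rw [Nat.coprime_self_sub_left (Nat.one_le_pow _ _ Fintype.card_pos)]
    exact Nat.coprime_one_left _
  suffices h : ∃ x : GL (Fin 2) F, HasEigenvalues x.1 y ∧ x ^ (Fintype.card F ^ 2 - 1) = 1 by
    obtain ⟨x, h1, h2⟩ := h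
    exact ⟨x, h1, Nat.Coprime.coprime_dvd_left (orderOf_dvd_of_pow_eq_one h2) hco⟩
  have hS := algebraMap_down_add hy
  have hD := algebraMap_down_mul hy
  by_cases h01 : y 0 = y 1
  · have h6 : (y 0 : k) ^ Fintype.card F = y 0 := by
      have h7 := hy 0
      have h8 : y (w 0) = y 0 := by
        rcases perm_fin_two w with rfl | rfl
        · rfl
        · rw [Equiv.swap_apply_left, h01]
      rw [h8] at h7
      rw [← Units.val_pow_eq_pow_val, h7]
    obtain ⟨c, hc1⟩ := exists_algebraMap_eq_of_frob h6
    have hc0 : c ≠ 0 := by rintro rfl; rw [map_zero] at hc1; exact (y 0).ne_zero hc1.symm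
    refine ⟨sc (Units.mk0 c hc0), ?_, ?_⟩
    · rw [hasEigenvalues_iff, sc_trace, sc_det]
      simp [hc1, ← h01, two_mul]
    · have h9 : ∀ n : ℕ, sc (Units.mk0 c hc0) ^ n = sc (Units.mk0 c hc0 ^ n) := by
        intro n
        induction n with
        | zero =>
          ext i j
          fin_cases i <;> fin_cases j <;> simp [sc, dg_val]
        | succ n ih => rw [pow_succ, ih, sc, sc, dg_mul, ← pow_succ]; rfl
      have h10 : Units.mk0 c hc0 ^ (Fintype.card F ^ 2 - 1) = 1 := by
        apply Units.ext
        apply (algebraMap F k).injective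
        have := congrArg Units.val (torus_pow_sq_sub_one hy 0)
        rw [Units.val_pow_eq_pow_val, ← hc1, ← map_pow, Units.val_one] at this
        rw [Units.val_pow_eq_pow_val, Units.val_mk0, this, Units.val_one, map_one]
      rw [h9, h10]
      ext i j
      fin_cases i <;> fin_cases j <;> simp [sc, dg_val]
  · have hD0 : down F (y 0 * y 1 : k) ≠ 0 := by
      intro h0
      rw [h0, map_zero] at hD
      exact mul_ne_zero (y 0).ne_zero (y 1).ne_zero hD.symm
    have hE : HasEigenvalues (cmp (down F (y 0 + y 1 : k)) (Units.mk0 _ hD0)).1 y := by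
      rw [hasEigenvalues_iff, cmp_trace, cmp_det, hS, Units.val_mk0, hD]
      exact ⟨rfl, rfl⟩
    refine ⟨_, hE, ?_⟩
    set x := cmp (down F (y 0 + y 1 : k)) (Units.mk0 _ hD0)
    set N := Fintype.card F ^ 2 - 1
    -- Distinct roots of X^N - 1 give a divisor, and Cayley-Hamilton then makes the N-th power of
    -- the companion matrix trivial.
    have hdvd : (∏ i, (Polynomial.X - Polynomial.C (y i : k))) ∣ Polynomial.X ^ N - 1 := by
      rw [Fin.prod_univ_two]
      refine IsCoprime.mul_dvd ?_ ?_ ?_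
      · refine Polynomial.isCoprime_X_sub_C_of_isUnit_sub ?_
        rw [isUnit_iff_ne_zero, sub_ne_zero]
        exact fun h => h01 (Units.ext h)
      all_goals
        rw [Polynomial.dvd_iff_isRoot, Polynomial.IsRoot, Polynomial.eval_sub, Polynomial.eval_pow,
          Polynomial.eval_X, Polynomial.eval_one, ← Units.val_pow_eq_pow_val,
          torus_pow_sq_sub_one hy, Units.val_one, sub_self]
    rw [HasEigenvalues] at hE
    rw [← hE] at hdvd
    obtain ⟨Q, hQ⟩ := hdvd
    have h11 := congrArg (Polynomial.aeval (x.1.map (algebraMap F k))) hQ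
    rw [map_mul, Matrix.aeval_self_charpoly, zero_mul, map_sub, map_pow, Polynomial.aeval_X, map_one,
      sub_eq_zero] at h11
    apply Units.ext
    apply Matrix.map_injective (algebraMap F k).injective
    rw [Units.val_pow_eq_pow_val]
    have h12 := map_pow (algebraMap F k).mapMatrix x.1 N
    rw [RingHom.mapMatrix_apply, RingHom.mapMatrix_apply] at h12
    refine h12.trans (h11.trans ?_)
    simp

end Series


/-! ### The action of invariants -/

section InvariantAction

variable {X : Type} [AddCommGroup X] {𝓐 : Type} [AddCommGroup 𝓐]

/-- The linear extension of a map to the group ring. -/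
def extendLinear (φ : X → 𝓐) : AddMonoidAlgebra ℤ X →ₗ[ℤ] 𝓐 :=
  (Finsupp.linearCombination ℤ φ).comp (AddMonoidAlgebra.coeffLinearEquiv ℤ).toLinearMap

omit [AddCommGroup X] in
theorem extendLinear_single (φ : X → 𝓐) (x : X) (n : ℤ) :
    extendLinear φ (AddMonoidAlgebra.single x n) = n • φ x := by
  simp [extendLinear, AddMonoidAlgebra.coeffLinearEquiv]

theorem evalAt_single (t : Multiplicative X →* Qbarˣ) (x : X) (n : ℤ) :
    evalAt t (AddMonoidAlgebra.single x n) = n • ((t (Multiplicative.ofAdd x) : Qbarˣ) : Qbar) := by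
  simp [evalAt, AddMonoidAlgebra.lift_single]

theorem evalAt_add (t : Multiplicative X →* Qbarˣ) (f g : AddMonoidAlgebra ℤ X) :
    evalAt t (f + g) = evalAt t f + evalAt t g := map_add _ _ _

theorem evalAt_mul (t : Multiplicative X →* Qbarˣ) (f g : AddMonoidAlgebra ℤ X) :
    evalAt t (f * g) = evalAt t f * evalAt t g := map_mul _ _ _

theorem evalAt_mapDomain (t : Multiplicative X →* Qbarˣ) (s : X →+ X) (f : AddMonoidAlgebra ℤ X) :
    evalAt t (AddMonoidAlgebra.mapDomainAlgHom ℤ ℤ s f) =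
      evalAt (t.comp (AddMonoidHom.toMultiplicative s)) f := by
  induction f using AddMonoidAlgebra.induction_linear with
  | zero => simp [evalAt]
  | add f g hf hg => rw [map_add, evalAt_add, evalAt_add, hf, hg]
  | single x n =>
    rw [AddMonoidAlgebra.mapDomainAlgHom_apply, AddMonoidAlgebra.mapDomain_single, evalAt_single,
      evalAt_single]
    rfl

theorem mem_invariants {W : Set (X →+ X)} {f : AddMonoidAlgebra ℤ X} :
    f ∈ invariants W ↔ ∀ w ∈ W, AddMonoidAlgebra.mapDomainAlgHom ℤ ℤ w f = f := by
  simp [invariants, Algebra.mem_iInf, AlgHom.mem_equalizer]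

variable {p : ℕ} {F k : Type} [Field F] [Fintype F] [Field k] [Algebra F k]
  {H : Type} [Group H] {π : GL (Fin 2) F →* H} {ι : Additive kˣ ≃+ QModZ p}

/-- A monomial acts by the average of its values at the point and at the reflected point, so f acts
by the average of f and its reflection; invariance makes the two agree. -/
theorem idemChi_mul_extendLinear [IsAlgClosed k] [Fact p.Prime] [CharP F p] [Finite H]
    (hπ : Function.Surjective π) {κ : kˣ →* Qbarˣ} {V : FDRep Qbar H} [Simple V]
    {w : Equiv.Perm (Fin 2)} {lam : Fin 2 → ℤ} {y : Fin 2 → kˣ}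
    (hy : IsDual ι (Fintype.card F) w lam y)
    (hne : pairing (fun g => V.character (π g)) (DLChar κ w lam) ≠ 0) (ℓ : X → Fin 2 → ℤ)
    {s : X →+ X} {t : Multiplicative X →* Qbarˣ}
    (ht : ∀ x, ((κ (charVal (ℓ x) y) : Qbarˣ) : Qbar) +
      ((κ (charVal (ℓ x ∘ Equiv.swap 0 1) y) : Qbarˣ) : Qbar) =
      ((t (Multiplicative.ofAdd x) : Qbarˣ) : Qbar) + ((t (Multiplicative.ofAdd (s x)) : Qbarˣ) : Qbar))
    {f : AddMonoidAlgebra ℤ X} (hf : AddMonoidAlgebra.mapDomainAlgHom ℤ ℤ s f = f) :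
    idemChi V * extendLinear (fun x => zElt π ι (ℓ x)) f = evalAt t f • idemChi V := by
  have key : ∀ f : AddMonoidAlgebra ℤ X, idemChi V * extendLinear (fun x => zElt π ι (ℓ x)) f =
      ((2 : Qbar)⁻¹ * (evalAt t f + evalAt t (AddMonoidAlgebra.mapDomainAlgHom ℤ ℤ s f))) •
        idemChi V := by
    intro f
    induction f using AddMonoidAlgebra.induction_linear with
    | zero => simp [evalAt]
    | add f g hf hg =>
      rw [map_add, mul_add, hf, hg, map_add, evalAt_add, evalAt_add, ← add_smul]
      congr 1
      ring
    | single x n =>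
      rw [extendLinear_single, mul_smul_comm, idemChi_mul_zElt ι hπ hy hne, ht,
        AddMonoidAlgebra.mapDomainAlgHom_apply, AddMonoidAlgebra.mapDomain_single, evalAt_single,
        evalAt_single, ← smul_assoc]
      congr 1
      rw [← smul_add, mul_smul_comm]
  rw [key, hf]
  congr 1
  ring

end InvariantAction

/-- The properties shared by the two groups on which the comparison of `E` and `B` rests: `z` is a
map from `ℤ[X]` to central elements, and invariants act through their values at points. -/
structure Separates {F H Hd X : Type} [Field F] [Fintype F] [Group H] [Finite H]
    [AddCommGroup X] (π : GL (Fin 2) F →* H) (ψ : AddChar F Qbar) (W : Set (X →+ X))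
    (IsRho : Hd → FDRep Qbar H → Prop) (IsPoint : Hd → (Multiplicative X →* Qbarˣ) → Prop)
    (z : AddMonoidAlgebra ℤ X →ₗ[ℤ] MonoidAlgebra Qbar H) : Prop where
  surj : Function.Surjective π
  ne_one : ψ ≠ 1
  exists_rho : ∀ V, Simple V → idemChi V * idemPsi (π.comp (uGL F)) ψ ≠ 0 → ∃ x, IsRho x V
  exists_point : ∀ {x V}, IsRho x V → ∃ t, IsPoint x t
  eigen : ∀ {x V t}, IsRho x V → IsPoint x t → ∀ f ∈ invariants W,
    idemChi V * z f = evalAt t f • idemChi V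
  frob : ∀ {x t}, IsPoint x t → ∀ f ∈ invariants W,
    evalAt t (AddMonoidAlgebra.mapDomainAlgHom ℤ ℤ
      (nsmulAddMonoidHom (Fintype.card F) : X →+ X) f) = evalAt t f
  comm : ∀ f x, z f * x = x * z f

/-! ### Eigenvalue pairs as points of the torus -/

section Points

variable {p : ℕ} {F k : Type} [Field F] [Fintype F] [Field k] [Algebra F k]

omit [Fintype F] in
theorem eq_or_eq_swap {x : Matrix (Fin 2) (Fin 2) F} {y y' : Fin 2 → kˣ} (h : HasEigenvalues x y)
    (h' : HasEigenvalues x y') : y' = y ∨ y' = y ∘ Equiv.swap 0 1 := by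
  rw [hasEigenvalues_iff] at h h'
  rcases eq_or_eq_of_add_mul (h'.1.symm.trans h.1) (h'.2.symm.trans h.2) with ⟨h1, h2⟩ | ⟨h1, h2⟩
  · left
    funext i
    fin_cases i
    · exact Units.ext h1
    · exact Units.ext h2
  · right
    funext i
    fin_cases i
    · exact Units.ext (by simpa using h1)
    · exact Units.ext (by simpa using h2)

theorem exists_mem_torus {x : Matrix (Fin 2) (Fin 2) F} {y : Fin 2 → kˣ} (h : HasEigenvalues x y) :
    ∃ w, y ∈ torus F k w := by
  rw [hasEigenvalues_iff] at h
  have h1 : (y 0 : k) ^ Fintype.card F + (y 1 : k) ^ Fintype.card F = y 0 + y 1 := by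
    rw [← frob_add, ← h.1, frob_algebraMap]
  have h2 : (y 0 : k) ^ Fintype.card F * (y 1 : k) ^ Fintype.card F = y 0 * y 1 := by
    rw [← mul_pow, ← h.2, frob_algebraMap]
  rcases eq_or_eq_of_add_mul h1 h2 with ⟨h3, h4⟩ | ⟨h3, h4⟩
  · exact ⟨1, mem_torus_one.mpr ⟨h3, h4⟩⟩
  · exact ⟨Equiv.swap 0 1, mem_torus_swap.mpr ⟨h4, h3⟩⟩

omit [Fintype F] in
theorem exists_hasEigenvalues [IsAlgClosed k] {x : Matrix (Fin 2) (Fin 2) F} (hx : x.det ≠ 0) :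
    ∃ y : Fin 2 → kˣ, HasEigenvalues x y := by
  have hd : algebraMap F k x.det ≠ 0 := by simpa using hx
  obtain ⟨a, ha⟩ := IsAlgClosed.exists_root (Polynomial.X ^ 2 -
    Polynomial.C (algebraMap F k x.trace) * Polynomial.X + Polynomial.C (algebraMap F k x.det))
    (by
      have : (Polynomial.X ^ 2 - Polynomial.C (algebraMap F k x.trace) * Polynomial.X +
        Polynomial.C (algebraMap F k x.det)).degree = 2 := by compute_degree!
      rw [this]; decide)
  simp only [Polynomial.IsRoot, Polynomial.eval_add, Polynomial.eval_sub, Polynomial.eval_pow,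
    Polynomial.eval_X, Polynomial.eval_mul, Polynomial.eval_C] at ha
  have h1 : a * (algebraMap F k x.trace - a) = algebraMap F k x.det := by linear_combination -ha
  have ha0 : a ≠ 0 := by rintro rfl; rw [zero_mul] at h1; exact hd h1.symm
  have hb0 : algebraMap F k x.trace - a ≠ 0 := by
    intro h0; rw [h0, mul_zero] at h1; exact hd h1.symm
  refine ⟨![Units.mk0 a ha0, Units.mk0 _ hb0], hasEigenvalues_iff.mpr ⟨?_, ?_⟩⟩
  · simp
  · simpa using h1.symm

theorem charVal_nsmul {G : Type} [CommGroup G] (q : ℕ) (lam : Fin 2 → ℤ) (y : Fin 2 → G) :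
    charVal (q • lam) y = charVal lam (fun i => y i ^ q) := by
  simp [charVal, zpow_mul]

theorem charVal_comp_swap {G : Type} [CommGroup G] (lam : Fin 2 → ℤ) (y : Fin 2 → G) :
    charVal (lam ∘ Equiv.swap 0 1) y = charVal lam (y ∘ Equiv.swap 0 1) := by
  simp [charVal, Fin.prod_univ_two, mul_comm]

end Points

/-! ### Series, points and eigenvalues for GL₂ -/

section GLFacts

variable {p : ℕ} [Fact p.Prime] {F k : Type} [Field F] [Fintype F] [CharP F p] [Field k]
  [Algebra F k] [IsAlgClosed k] {ι : Additive kˣ ≃+ QModZ p} {κ : kˣ →* Qbarˣ}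

/-- The action of `ℤ[X(T^∨)]` for the group `GL₂`. -/
def zGL (F : Type) [Field F] [Fintype F] {k : Type} [Field k] [Algebra F k]
    (ι : Additive kˣ ≃+ QModZ p) :
    AddMonoidAlgebra ℤ (Fin 2 → ℤ) →ₗ[ℤ] MonoidAlgebra Qbar (GL (Fin 2) F) :=
  extendLinear (fun mu => zElt (MonoidHom.id (GL (Fin 2) F)) ι mu)

/-- The permutation of the coordinates of `ℤ²`. -/
def swapHom : (Fin 2 → ℤ) →+ (Fin 2 → ℤ) :=
  (LinearMap.funLeft ℤ ℤ (Equiv.swap (0 : Fin 2) 1)).toAddMonoidHom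

theorem swapHom_apply (mu : Fin 2 → ℤ) : swapHom mu = mu ∘ Equiv.swap 0 1 := rfl

theorem swapHom_mem : swapHom ∈ weylGL := ⟨_, rfl⟩

omit [Fact p.Prime] [CharP F p] [IsAlgClosed k] in
theorem extendLinear_comm {X : Type} [AddCommGroup X] {H : Type} [Group H]
    {π : GL (Fin 2) F →* H} (hπ : Function.Surjective π) (ℓ : X → Fin 2 → ℤ)
    (f : AddMonoidAlgebra ℤ X) (x : MonoidAlgebra Qbar H) :
    extendLinear (fun x => zElt π ι (ℓ x)) f * x = x * extendLinear (fun x => zElt π ι (ℓ x)) f := by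
  induction f using AddMonoidAlgebra.induction_linear with
  | zero => simp
  | add f g hf hg => rw [map_add, add_mul, mul_add, hf, hg]
  | single y n => rw [extendLinear_single, smul_mul_assoc, mul_smul_comm, zElt_comm ι hπ]

omit [Fintype F] in
theorem exists_point_GL (κ : kˣ →* Qbarˣ) (x : GL (Fin 2) F) : ∃ t, IsPointGL (F := F) κ x t := by
  obtain ⟨y, hy⟩ := exists_hasEigenvalues (k := k) (det_ne_zero_GL x)
  refine ⟨{ toFun := fun lam => κ (charVal lam.toAdd y), map_one' := ?_, map_mul' := ?_ }, y, hy,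
    fun lam => rfl⟩
  · simp [charVal]
  · intro a b
    rw [← map_mul]
    simp [charVal, zpow_add, Finset.prod_mul_distrib]

omit [Fact p.Prime] [CharP F p] [IsAlgClosed k] in
-- Multiplication by q on weights raises eigenvalues to the power q; this permutes the eigenvalues
-- of a matrix over F, and f does not see the permutation.
theorem frob_point_GL {x : GL (Fin 2) F} {t : Multiplicative (Fin 2 → ℤ) →* Qbarˣ}
    (h : IsPointGL κ x t) {f : AddMonoidAlgebra ℤ (Fin 2 → ℤ)} (hf : f ∈ invariants weylGL) :
    evalAt t (AddMonoidAlgebra.mapDomainAlgHom ℤ ℤ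
      (nsmulAddMonoidHom (Fintype.card F) : (Fin 2 → ℤ) →+ (Fin 2 → ℤ)) f) = evalAt t f := by
  obtain ⟨y, hy, ht⟩ := h
  obtain ⟨w, hw⟩ := exists_mem_torus hy
  have hf' := mem_invariants.mp hf
  rw [evalAt_mapDomain]
  have hq : ∀ lam : Fin 2 → ℤ, t (Multiplicative.ofAdd (Fintype.card F • lam)) =
      κ (charVal lam (fun i => y i ^ Fintype.card F)) := by
    intro lam
    rw [ht, charVal_nsmul]
  rcases perm_fin_two w with rfl | rfl
  · congr 1
    refine MonoidHom.ext fun lam => ?_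
    refine (hq lam.toAdd).trans ?_
    have e : (fun i => y i ^ Fintype.card F) = y := by
      funext i; exact hw i
    rw [e, ← ht]; rfl
  · conv_rhs => rw [← hf' swapHom swapHom_mem, evalAt_mapDomain]
    congr 1
    refine MonoidHom.ext fun lam => ?_
    refine (hq lam.toAdd).trans ?_
    have e : (fun i => y i ^ Fintype.card F) = y ∘ Equiv.swap 0 1 := by
      funext i
      have := hw (Equiv.swap 0 1 i)
      rw [Equiv.swap_apply_self] at this
      exact this
    rw [e, ← charVal_comp_swap, ← ht]; rfl

omit [IsAlgClosed k] in
theorem exists_rho_GL (hκ : Function.Injective κ) {ψ : AddChar F Qbar}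
    {V : FDRep Qbar (GL (Fin 2) F)} (hV : Simple V) (hg : idemChi V * idemPsi (uGL F) ψ ≠ 0) :
    ∃ x, IsRhoGL ι κ ψ x V := by
  obtain ⟨w, lam, h1⟩ := exists_pairing_ne_zero hκ (char_one_ne_zero V)
  obtain ⟨y, hy⟩ := exists_isDual ι (card_gt_one_and_dvd (p := p) (F := F)).1
    (card_gt_one_and_dvd (p := p) (F := F)).2 w lam
  obtain ⟨x, hx, ho⟩ := exists_regular (p := p) (mem_torus_of_isDual ι hy)
  exact ⟨x, ho, hV, hg, y, w, lam, hx, hy, h1⟩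

theorem eigen_GL {ψ : AddChar F Qbar} {x : GL (Fin 2) F} {V : FDRep Qbar (GL (Fin 2) F)}
    {t : Multiplicative (Fin 2 → ℤ) →* Qbarˣ} (hx : IsRhoGL ι κ ψ x V) (ht : IsPointGL κ x t)
    {f : AddMonoidAlgebra ℤ (Fin 2 → ℤ)} (hf : f ∈ invariants weylGL) :
    idemChi V * zGL F ι f = evalAt t f • idemChi V := by
  obtain ⟨-, hV, -, y, w, lam, hx, hy, hne⟩ := hx
  obtain ⟨y', hy', ht⟩ := ht
  refine idemChi_mul_extendLinear (π := MonoidHom.id (GL (Fin 2) F)) (fun g => ⟨g, rfl⟩) hy hne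
    (fun mu => mu) (s := swapHom) ?_ (mem_invariants.mp hf _ swapHom_mem)
  intro mu
  rw [swapHom_apply, ht, ht, charVal_comp_swap, charVal_comp_swap]
  rcases eq_or_eq_swap hx hy' with rfl | rfl
  · rfl
  · have e : (y ∘ Equiv.swap 0 1) ∘ Equiv.swap 0 1 = y := by
      funext i
      simp
    rw [add_comm, e]

theorem separates_GL (hκ : Function.Injective κ) {ψ : AddChar F Qbar} (hψ : ψ ≠ 1) :
    Separates (MonoidHom.id (GL (Fin 2) F)) ψ weylGL (IsRhoGL ι κ ψ) (IsPointGL (F := F) κ)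
      (zGL F ι) where
  surj := fun g => ⟨g, rfl⟩
  ne_one := hψ
  exists_rho := by
    intro V hV hg
    rw [MonoidHom.id_comp] at hg
    exact exists_rho_GL hκ hV hg
  exists_point := fun _ => exists_point_GL κ _
  eigen := fun hx ht f hf => eigen_GL hx ht hf
  frob := fun ht f hf => frob_point_GL ht hf
  comm := extendLinear_comm (fun g => ⟨g, rfl⟩) (fun mu => mu)

end GLFacts

/-! ### Series, points and eigenvalues for PGL₂ -/

section PGLFacts

variable {p : ℕ} [Fact p.Prime] {F k : Type} [Field F] [Fintype F] [CharP F p] [Field k]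
  [Algebra F k] [IsAlgClosed k] {ι : Additive kˣ ≃+ QModZ p} {κ : kˣ →* Qbarˣ}

/-- The action of `ℤ[X(T^∨)]` for the group `PGL₂`. -/
def zSL (F : Type) [Field F] [Fintype F] {k : Type} [Field k] [Algebra F k]
    (ι : Additive kˣ ≃+ QModZ p) :
    AddMonoidAlgebra ℤ ℤ →ₗ[ℤ] MonoidAlgebra Qbar (PGLTwo F) :=
  extendLinear (fun n => zElt (toPGL F) ι ![n, 0])

omit [Fintype F] [IsAlgClosed k] [Fact p.Prime] [CharP F p] in
theorem mul_eq_one_of_hasEigenvalues {x : Matrix.SpecialLinearGroup (Fin 2) F} {y : Fin 2 → kˣ}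
    (h : HasEigenvalues x.1 y) : y 1 = (y 0)⁻¹ := by
  have := (hasEigenvalues_iff.mp h).2
  rw [x.2, map_one] at this
  rw [eq_inv_iff_mul_eq_one, mul_comm]
  exact Units.ext this.symm

omit [Fintype F] [Fact p.Prime] [CharP F p] in
theorem toPGL_sc_mul (c : Fˣ) (g : GL (Fin 2) F) : toPGL F (sc c * g) = toPGL F g := by
  have : toPGL F (sc c) = 1 := by
    rw [toPGL, Matrix.ProjGenLinGroup.mk_eq_one]
    exact mem_center_iff_sc.mpr ⟨c, rfl⟩
  rw [map_mul, this, one_mul]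

omit [Fintype F] in
theorem exists_point_SL (κ : kˣ →* Qbarˣ) (x : Matrix.SpecialLinearGroup (Fin 2) F) :
    ∃ t, IsPointSL (F := F) κ x t := by
  obtain ⟨y, hy⟩ := exists_hasEigenvalues (k := k) (x := x.1) (by rw [x.2]; exact one_ne_zero)
  refine ⟨{ toFun := fun n => κ (y 0 ^ n.toAdd), map_one' := ?_, map_mul' := ?_ }, y, hy,
    fun lam => rfl⟩
  · simp
  · intro a b
    rw [← map_mul, toAdd_mul, zpow_add]

theorem neg_mem_weylSL : -AddMonoidHom.id ℤ ∈ weylSL := Or.inr rfl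

omit [IsAlgClosed k] [Fact p.Prime] [CharP F p] in
theorem frob_point_SL {x : Matrix.SpecialLinearGroup (Fin 2) F} {t : Multiplicative ℤ →* Qbarˣ}
    (h : IsPointSL κ x t) {f : AddMonoidAlgebra ℤ ℤ} (hf : f ∈ invariants weylSL) :
    evalAt t (AddMonoidAlgebra.mapDomainAlgHom ℤ ℤ
      (nsmulAddMonoidHom (Fintype.card F) : ℤ →+ ℤ) f) = evalAt t f := by
  obtain ⟨y, hy, ht⟩ := h
  obtain ⟨w, hw⟩ := exists_mem_torus hy
  have hf' := mem_invariants.mp hf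
  rw [evalAt_mapDomain]
  have hq : ∀ n : ℤ, t (Multiplicative.ofAdd (Fintype.card F • n)) =
      κ ((y 0 ^ Fintype.card F) ^ n) := by
    intro n
    rw [ht, nsmul_eq_mul, zpow_mul, zpow_natCast]
  rcases perm_fin_two w with rfl | rfl
  · congr 1
    ext1
    refine (hq 1).trans ?_
    have h0 : y 0 ^ Fintype.card F = y 0 := hw 0
    rw [h0, ← ht]
  · conv_rhs => rw [← hf' _ neg_mem_weylSL, evalAt_mapDomain]
    congr 1
    ext1
    refine (hq 1).trans ?_
    have : y 0 ^ Fintype.card F = y 1 := hw 1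
    rw [this, mul_eq_one_of_hasEigenvalues hy, inv_zpow', ← ht]; rfl

theorem separates_PGL (hκ : Function.Injective κ) {ψ : AddChar F Qbar} (hψ : ψ ≠ 1) :
    Separates (toPGL F) ψ weylSL (IsRhoPGL ι κ ψ) (IsPointSL (F := F) κ) (zSL F ι) where
  surj := Matrix.ProjGenLinGroup.mk_surjective
  ne_one := hψ
  exists_rho := by
    intro V hV hg
    obtain ⟨w, lam, h0, h1⟩ := exists_pairing_ne_zero_of_central hκ
      (f := fun g => V.character (toPGL F g)) (by
        rw [map_one]; exact char_one_ne_zero V) (fun c g => by rw [toPGL_sc_mul])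
    obtain ⟨y, hy⟩ := exists_isDual ι (card_gt_one_and_dvd (p := p) (F := F)).1
      (card_gt_one_and_dvd (p := p) (F := F)).2 w lam
    obtain ⟨x, hx, ho⟩ := exists_regular (p := p) (mem_torus_of_isDual ι hy)
    have hone : IsDual ι (Fintype.card F) w ![1, 1] (dualElt ι (Fintype.card F) w ![1, 1]) :=
      isDual_dualElt F ι w _
    -- The determinant is the weight (1, 1) at y. By duality it equals lam at the element dual to
    -- (1, 1); this element has equal coordinates, and lam 0 + lam 1 = 0.
    have hdet : x.1.det = 1 := by
      apply (algebraMap F k).injective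
      have h2 := charVal_eq_of_isDual ι hy hone
      have h3 : charVal ![1, 1] y = y 0 * y 1 := by simp [charVal, Fin.prod_univ_two]
      have h4 : dualElt ι (Fintype.card F) w ![1, 1] 0 = dualElt ι (Fintype.card F) w ![1, 1] 1 := by
        have h5 := isDual_comp_swap hone
        have h6 : (![1, 1] : Fin 2 → ℤ) ∘ Equiv.swap 0 1 = ![1, 1] := by
          funext i; fin_cases i <;> simp
        rw [h6] at h5
        have := congrFun (isDual_unique Fintype.one_lt_card h5 hone) 1
        simpa using this
      have h7 : charVal lam (dualElt ι (Fintype.card F) w ![1, 1]) = 1 := by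
        rw [charVal, Fin.prod_univ_two, h4, ← zpow_add, h0, zpow_zero]
      rw [(hasEigenvalues_iff.mp hx).2, map_one, ← Units.val_mul, ← h3, ← h2, h7, Units.val_one]
    obtain ⟨x, rfl⟩ : ∃ x' : Matrix.SpecialLinearGroup (Fin 2) F,
        Matrix.SpecialLinearGroup.toGL x' = x := ⟨⟨x.1, hdet⟩, Units.ext rfl⟩
    rw [orderOf_injective _ Matrix.SpecialLinearGroup.toGL_injective] at ho
    exact ⟨x, ho, hV, hg, y, w, lam, h0, hx, hy, h1⟩
  exists_point := fun _ => exists_point_SL κ _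
  eigen := by
    rintro x V t ⟨-, hV, -, y, w, lam, h0, hx, hy, hne⟩ ⟨y', hy', ht⟩ f hf
    refine idemChi_mul_extendLinear Matrix.ProjGenLinGroup.mk_surjective hy hne (fun n => ![n, 0])
      (s := -AddMonoidHom.id ℤ) ?_ (mem_invariants.mp hf _ neg_mem_weylSL)
    intro n
    have e := mul_eq_one_of_hasEigenvalues hx
    have e1 : charVal ![n, 0] y = y 0 ^ n := by simp [charVal, Fin.prod_univ_two]
    have e2 : charVal (![n, 0] ∘ Equiv.swap 0 1) y = y 0 ^ (-n) := by
      simp [charVal, Fin.prod_univ_two, e]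
    have e3 : (-AddMonoidHom.id ℤ) n = -n := rfl
    rw [e1, e2, e3, ht, ht]
    rcases eq_or_eq_swap hx hy' with rfl | rfl
    · rfl
    · rw [add_comm]
      simp [e]
  frob := frob_point_SL
  comm := extendLinear_comm Matrix.ProjGenLinGroup.mk_surjective _

end PGLFacts


/-! ### Coefficients of the central elements at a lower unipotent element -/

section DualDivisibility

variable {p : ℕ} {k : Type} [Field k] {ι : Additive kˣ ≃+ QModZ p} {q : ℕ} {mu : Fin 2 → ℤ}
  {t : Fin 2 → kˣ}

theorem eq_iff_of_coe_eq {x y : kˣ} {v w : ℚ}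
    (hx : (ι (Additive.ofMul x) : AddCircle (1 : ℚ)) = (v : AddCircle (1 : ℚ)))
    (hy : (ι (Additive.ofMul y) : AddCircle (1 : ℚ)) = (w : AddCircle (1 : ℚ))) :
    x = y ↔ ∃ n : ℤ, (n : ℚ) = v - w := by
  have h1 : x = y ↔ (ι (Additive.ofMul x) : AddCircle (1 : ℚ)) = ι (Additive.ofMul y) := by
    rw [Subtype.coe_inj, ι.injective.eq_iff, Additive.ofMul.injective.eq_iff]
  rw [h1, hx, hy, ← sub_eq_zero, ← AddCircle.coe_sub, AddCircle.coe_eq_zero_iff]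
  simp

theorem int_dvd_iff {m n : ℤ} (hm : m ≠ 0) {v : ℚ} (hv : (m : ℚ) * v = n) :
    (∃ l : ℤ, (l : ℚ) = v) ↔ m ∣ n := by
  constructor
  · rintro ⟨l, rfl⟩
    exact ⟨l, by exact_mod_cast hv.symm⟩
  · rintro ⟨l, rfl⟩
    refine ⟨l, ?_⟩
    have hm' : (m : ℚ) ≠ 0 := by exact_mod_cast hm
    push_cast at hv
    exact (mul_left_cancel₀ hm' hv).symm

theorem isDual_one_eq_one_iff (hq : 1 < q) (h : IsDual ι q 1 mu t) (i : Fin 2) :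
    t i = 1 ↔ ((q : ℤ) - 1) ∣ mu i := by
  obtain ⟨v, h1, h2⟩ := h
  rw [eq_iff_of_coe_eq (h2 i) (y := 1) (w := 0) (by simp), sub_zero]
  refine int_dvd_iff (by omega) ?_
  rw [← h1 i, Equiv.Perm.one_apply]
  push_cast
  ring

theorem isDual_one_eq_iff (hq : 1 < q) (h : IsDual ι q 1 mu t) :
    t 0 = t 1 ↔ ((q : ℤ) - 1) ∣ mu 0 - mu 1 := by
  obtain ⟨v, h1, h2⟩ := h
  rw [eq_iff_of_coe_eq (h2 0) (h2 1)]
  refine int_dvd_iff (by omega) ?_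
  have e0 := h1 0
  have e1 := h1 1
  rw [Equiv.Perm.one_apply] at e0 e1
  push_cast
  linear_combination e0 - e1

/-- Subtracting the two equations gives (q + 1)(v 1 - v 0) = mu 0 - mu 1, so equality means
divisibility by q + 1, which the bound reduces to vanishing. -/
theorem isDual_swap_eq_iff (h : IsDual ι q (Equiv.swap 0 1) mu t)
    (hb : |mu 0 - mu 1| < q + 1) : t 0 = t 1 ↔ mu 0 = mu 1 := by
  obtain ⟨v, h1, h2⟩ := h
  rw [eq_comm, eq_iff_of_coe_eq (h2 1) (h2 0), int_dvd_iff (m := (q : ℤ) + 1) (n := mu 0 - mu 1)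
    (by omega)]
  · constructor
    · intro h
      have := Int.eq_zero_of_abs_lt_dvd h hb
      omega
    · intro h
      rw [h, sub_self]
      exact dvd_zero _
  · have e0 := h1 0
    have e1 := h1 1
    rw [Equiv.swap_apply_left] at e0
    rw [Equiv.swap_apply_right] at e1
    push_cast
    linear_combination e0 - e1

theorem isDual_swap_of_eq (hq : 1 < q) (h : IsDual ι q (Equiv.swap 0 1) mu t)
    (hmu : mu 0 = mu 1) : IsDual ι q 1 mu t := by
  obtain ⟨v, h1, h2⟩ := h
  refine ⟨v, fun i => ?_, h2⟩
  have e0 := h1 0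
  have e1 := h1 1
  rw [Equiv.swap_apply_left] at e0
  rw [Equiv.swap_apply_right] at e1
  have hq1 : (1 : ℚ) < q := by exact_mod_cast hq
  have hmu' : (mu 0 : ℚ) = mu 1 := by exact_mod_cast hmu
  have e : v 0 = v 1 := by
    have : ((q : ℚ) + 1) * (v 0 - v 1) = 0 := by linear_combination e1 - e0 - hmu'
    rcases mul_eq_zero.mp this with h | h
    · linarith
    · linarith
  fin_cases i
  · rw [← h1]; simp [e]
  · rw [← h1]; simp [e]

end DualDivisibility

/-! ### Central elements of constant weight and coefficients at a unipotent -/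

section ZElt

variable {p : ℕ} [Fact p.Prime] {F k : Type} [Field F] [Fintype F] [CharP F p] [Field k]
  [Algebra F k] {H : Type} [Group H] {π : GL (Fin 2) F →* H} {ι : Additive kˣ ≃+ QModZ p}

omit [Algebra F k] in
theorem dualElt_eq {w : Equiv.Perm (Fin 2)} {mu : Fin 2 → ℤ} {t : Fin 2 → kˣ}
    (h : IsDual ι (Fintype.card F) w mu t) : dualElt ι (Fintype.card F) w mu = t :=
  isDual_unique Fintype.one_lt_card (isDual_dualElt F ι w mu) h

theorem zElt_comp_swap (mu : Fin 2 → ℤ) : zElt π ι (mu ∘ Equiv.swap 0 1) = zElt π ι mu := by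
  have h : ∀ w, dualElt ι (Fintype.card F) w (mu ∘ Equiv.swap 0 1) =
      dualElt ι (Fintype.card F) w mu ∘ Equiv.swap 0 1 := fun w =>
    dualElt_eq (isDual_comp_swap (isDual_dualElt F ι w mu))
  simp only [zElt, h, zTorus, torusSum]
  simp [add_comm, mul_comm]

theorem exists_dualElt_const (m : ℤ) : ∃ c : Fˣ, ∀ w i,
    (dualElt ι (Fintype.card F) w ![m, m] i : k) = algebraMap F k c := by
  have h1 := isDual_dualElt F ι (Equiv.swap 0 1) ![m, m]
  have h2 := isDual_swap_of_eq Fintype.one_lt_card h1 (by simp)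
  obtain ⟨a, -, ha, -⟩ := exists_units_of_torus_one (mem_torus_of_isDual ι h2)
  have h3 := (isDual_one_eq_iff Fintype.one_lt_card h2).mpr (by simp)
  have h4 : ∀ w, dualElt ι (Fintype.card F) w ![m, m] =
      dualElt ι (Fintype.card F) (Equiv.swap 0 1) ![m, m] := by
    intro w
    rcases perm_fin_two w with rfl | rfl
    · exact dualElt_eq h2
    · rfl
  refine ⟨a, fun w i => ?_⟩
  rw [h4, ← ha]
  fin_cases i
  · rfl
  · exact congrArg _ h3.symm

/-- For a constant weight the split and non-split dual elements are the same scalar, so the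
normalized difference collapses to a group element. In particular it is integral despite the factor
1/2. -/
theorem exists_zElt_const (m : ℤ) : ∃ c : Fˣ, zElt π ι ![m, m] = push π (MonoidAlgebra.single (sc c) 1) := by
  obtain ⟨c, hc⟩ := exists_dualElt_const (F := F) (ι := ι) m
  refine ⟨c, ?_⟩
  have hq : (2 * Fintype.card F : Qbar) ≠ 0 := by
    exact_mod_cast mul_ne_zero two_ne_zero Fintype.card_ne_zero
  rw [zElt, zTorus_scalar (hc _ _) (hc _ _) (hc _ _) (hc _ _), map_zsmul,
    ← Int.cast_smul_eq_zsmul Qbar, ← mul_smul]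
  push_cast
  rw [inv_mul_cancel₀ hq, one_smul]

/-- The class of a lower triangular unipotent matrix. -/
def lowerUni (F : Type) [Field F] : GL (Fin 2) F :=
  Matrix.GeneralLinearGroup.mkOfDetNeZero !![1, 0; 1, 1] (by simp)

omit [Fintype F] in
theorem lowerUni_val : (lowerUni F).1 = !![1, 0; 1, 1] := rfl

omit [Fintype F] in
theorem exists_sc_of_map_eq (hker : ∀ g, π g = 1 → g ∈ Subgroup.center (GL (Fin 2) F))
    {g h : GL (Fin 2) F} (hg : π g = π h) : ∃ c : Fˣ, g = sc c * h := by
  obtain ⟨c, hc⟩ := mem_center_iff_sc.mp (hker (g * h⁻¹) (by rw [map_mul, hg, map_inv, mul_inv_cancel]))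
  exact ⟨c, by rw [← hc, inv_mul_cancel_right]⟩

omit [Fintype F] in
theorem sc_mul_lowerUni_not_mem (c : Fˣ) :
    sc c * lowerUni F ∉ Subgroup.center (GL (Fin 2) F) := by
  intro h
  have := (mem_center_iff_entries.mp h).2.1
  revert this
  simp [sc, lowerUni_val, dg_val, Matrix.mul_apply, Fin.sum_univ_two]

theorem sum_zTorus_coeff_mul_uni {t t' : Fin 2 → kˣ} (ht : t ∈ torus F k 1)
    (h : t 0 * t 1 = t' 0 * t' 1) (g : GL (Fin 2) F) (hg : g.1 1 0 ≠ 0) :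
    ∑ y : F, (zTorus F t t').coeff (g * uni y) = 0 := by
  obtain ⟨a, b, ha, hb⟩ := exists_units_of_torus_one ht
  rw [zTorus_eq ha hb h]
  exact sum_zSum_mul_uni g hg

/-- The preimages of this element are scalar multiples of a lower unipotent matrix, hence outside
the Borel subgroup, where all U-coset sums of `zTorus` vanish. -/
theorem zElt_mul_idemPsi_coeff [Finite H]
    (hker : ∀ g, π g = 1 → g ∈ Subgroup.center (GL (Fin 2) F)) (mu : Fin 2 → ℤ) :
    (zElt π ι mu * idemPsi (π.comp (uGL F)) 1).coeff (π (lowerUni F)) = 0 := by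
  classical
  cases nonempty_fintype (GL (Fin 2) F)
  have h1 : ∑ a : F, (1 : AddChar F Qbar) (-a) • MonoidAlgebra.of Qbar H
      ((π.comp (uGL F)) (Multiplicative.ofAdd a)) = push π (uSum F) := by
    rw [uSum, map_sum]
    refine Finset.sum_congr rfl fun a _ => ?_
    rw [push_single, AddChar.one_apply, one_smul, MonoidAlgebra.of_apply, Int.cast_one]
    rfl
  rw [zElt, idemPsi, h1, smul_mul_assoc, mul_smul_comm, ← map_mul, MonoidAlgebra.coeff_smul_apply,
    MonoidAlgebra.coeff_smul_apply, push_coeff, Finset.sum_eq_zero, smul_zero, smul_zero]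
  intro g hg
  obtain ⟨c, rfl⟩ := exists_sc_of_map_eq hker (Finset.mem_filter.mp hg).2
  rw [mul_uSum_coeff, sum_zTorus_coeff_mul_uni (mem_torus_of_isDual ι (isDual_dualElt F ι 1 mu))
    (mul_eq_of_isDual ι Fintype.one_lt_card (isDual_dualElt F ι 1 mu) (isDual_dualElt F ι _ mu)),
    Int.cast_zero]
  simp [sc, lowerUni_val, dg_val, Matrix.mul_apply, Fin.sum_univ_two]

omit [CharP F p] [Fact p.Prime] [Fintype F] in
theorem hasEigenvalues_sc_mul_lowerUni {c : Fˣ} {t : Fin 2 → kˣ} :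
    HasEigenvalues (sc c * lowerUni F).1 t ↔
      (t 0 : k) = algebraMap F k c ∧ (t 1 : k) = algebraMap F k c := by
  have e1 : (sc c * lowerUni F).1.trace = (c + c : F) := by
    simp [sc, lowerUni_val, dg_val, Matrix.trace_fin_two]
  have e2 : (sc c * lowerUni F).1.det = (c * c : F) := by
    simp [sc, lowerUni_val, dg_val, Matrix.det_fin_two]
  rw [hasEigenvalues_iff, e1, e2, map_add, map_mul]
  constructor
  · rintro ⟨h1, h2⟩
    rcases eq_or_eq_of_add_mul h1.symm h2.symm with ⟨h3, h4⟩ | ⟨h3, h4⟩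
    · exact ⟨h3, h4⟩
    · exact ⟨h3, h4⟩
  · rintro ⟨h1, h2⟩
    rw [h1, h2]
    exact ⟨rfl, rfl⟩

open Classical in
theorem torusSum_coeff_sc_mul_lowerUni {w : Equiv.Perm (Fin 2)} {t : Fin 2 → kˣ}
    (ht : t ∈ torus F k w) (c : Fˣ) : (torusSum F w t).coeff (sc c * lowerUni F) =
      if (t 0 : k) = algebraMap F k c ∧ (t 1 : k) = algebraMap F k c then 1 else 0 := by
  rw [torusSum_coeff ht]
  refine if_congr hasEigenvalues_sc_mul_lowerUni ?_ rfl
  rw [if_neg (sc_mul_lowerUni_not_mem c)]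

theorem eq_const_iff {w : Equiv.Perm (Fin 2)} {t : Fin 2 → kˣ} (ht : t ∈ torus F k w) :
    t 0 = t 1 ↔ ∃ c : Fˣ, (t 0 : k) = algebraMap F k c ∧ (t 1 : k) = algebraMap F k c := by
  constructor
  · intro h
    have h1 : t ∈ torus F k 1 := by
      rcases perm_fin_two w with rfl | rfl
      · exact ht
      · rw [mem_torus_swap] at ht
        rw [mem_torus_one]
        rw [h] at ht ⊢
        exact ⟨ht.1, ht.1⟩
    obtain ⟨a, -, ha, -⟩ := exists_units_of_torus_one h1
    exact ⟨a, ha, by rw [← h]; exact ha⟩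
  · rintro ⟨c, h1, h2⟩
    exact Units.ext (h1.trans h2.symm)

/-- The parameter `r` is the order of the image of the scalar matrices, which is all or trivial. -/
def IsScalarOrder (π : GL (Fin 2) F →* H) (r : ℕ) : Prop :=
  (r + 1 = Fintype.card F ∧ Function.Injective π) ∨
    (r = 1 ∧ (∀ c, π (sc c) = 1) ∧ ∀ g, π g = 1 → g ∈ Subgroup.center (GL (Fin 2) F))

omit [Fact p.Prime] [CharP F p] in
theorem IsScalarOrder.ker {r : ℕ} (h : IsScalarOrder π r) (g : GL (Fin 2) F) (hg : π g = 1) :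
    g ∈ Subgroup.center (GL (Fin 2) F) := by
  rcases h with ⟨-, h⟩ | ⟨-, -, h⟩
  · rw [h (hg.trans (map_one π).symm)]
    exact one_mem _
  · exact h g hg

open Classical in
theorem push_torusSum_coeff_lowerUni [Finite H]
    (hker : ∀ g, π g = 1 → g ∈ Subgroup.center (GL (Fin 2) F)) {w : Equiv.Perm (Fin 2)}
    {t : Fin 2 → kˣ} (ht : t ∈ torus F k w) :
    (push π (torusSum F w t)).coeff (π (lowerUni F)) =
      if ∃ c : Fˣ, π (sc c) = 1 ∧ (t 0 : k) = algebraMap F k c ∧ (t 1 : k) = algebraMap F k c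
        then 1 else 0 := by
  cases nonempty_fintype (GL (Fin 2) F)
  rw [push_coeff]
  split_ifs with h
  · obtain ⟨c, hc, h0, h1⟩ := h
    rw [Finset.sum_eq_single_of_mem (sc c * lowerUni F)]
    · rw [torusSum_coeff_sc_mul_lowerUni ht, if_pos ⟨h0, h1⟩, Int.cast_one]
    · rw [Finset.mem_filter]
      exact ⟨Finset.mem_univ _, by rw [map_mul, hc, one_mul]⟩
    · intro g hg hne
      obtain ⟨b, rfl⟩ := exists_sc_of_map_eq hker (Finset.mem_filter.mp hg).2
      rw [torusSum_coeff_sc_mul_lowerUni ht, if_neg, Int.cast_zero]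
      rintro ⟨h2, -⟩
      apply hne
      have : b = c := Units.ext ((algebraMap F k).injective (h2.symm.trans h0))
      rw [this]
  · refine Finset.sum_eq_zero fun g hg => ?_
    have hg := (Finset.mem_filter.mp hg).2
    obtain ⟨b, rfl⟩ := exists_sc_of_map_eq hker hg
    rw [torusSum_coeff_sc_mul_lowerUni ht, if_neg, Int.cast_zero]
    rintro ⟨h2, h3⟩
    refine h ⟨b, ?_, h2, h3⟩
    rwa [map_mul, mul_eq_right] at hg

/-- The coefficient of `zElt mu` at the lower unipotent element, for small `mu 0 - mu 1`. -/
theorem zElt_coeff_lowerUni [Finite H] {r : ℕ} (hr : IsScalarOrder π r) {mu : Fin 2 → ℤ}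
    (hmu : |mu 0 - mu 1| < Fintype.card F + 1) :
    (2 * Fintype.card F : Qbar) * (zElt π ι mu).coeff (π (lowerUni F)) =
      (((if (Fintype.card F : ℤ) - 1 ∣ mu 0 - mu 1 ∧ (r : ℤ) ∣ mu 1 then 1 else 0) -
        (if mu 0 = mu 1 ∧ (r : ℤ) ∣ mu 1 then 1 else 0) : ℤ) : Qbar) := by
  classical
  have hq : (2 * Fintype.card F : Qbar) ≠ 0 := by
    exact_mod_cast mul_ne_zero two_ne_zero Fintype.card_ne_zero
  have hq1 : 1 < Fintype.card F := Fintype.one_lt_card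
  have d1 := isDual_dualElt F ι 1 mu
  have d2 := isDual_dualElt F ι (Equiv.swap 0 1) mu
  have m1 := mem_torus_of_isDual ι d1
  have m2 := mem_torus_of_isDual ι d2
  rw [zElt, MonoidAlgebra.coeff_smul_apply, smul_eq_mul, mul_inv_cancel_left₀ hq, zTorus, map_sub,
    MonoidAlgebra.coeff_sub, Finsupp.sub_apply, push_torusSum_coeff_lowerUni hr.ker m1,
    push_torusSum_coeff_lowerUni hr.ker m2]
  push_cast
  rcases hr with ⟨hr, hπ⟩ | ⟨rfl, hπ, -⟩
  · have hr' : (r : ℤ) = Fintype.card F - 1 := by omega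
    have hone : ∀ t : Fin 2 → kˣ, (∃ c : Fˣ, π (sc c) = 1 ∧ (t 0 : k) = algebraMap F k c ∧
        (t 1 : k) = algebraMap F k c) ↔ t 0 = t 1 ∧ t 1 = 1 := by
      intro t
      constructor
      · rintro ⟨c, h1, h2, h3⟩
        have : sc c = 1 := hπ (h1.trans (map_one π).symm)
        have hc : (c : F) = 1 := by
          have h4 := congrArg (fun g : GL (Fin 2) F => g.1 0 0) this
          simpa [sc, dg_val] using h4
        rw [hc, map_one] at h2 h3
        exact ⟨Units.ext (h2.trans h3.symm), Units.ext h3⟩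
      · rintro ⟨h1, h2⟩
        refine ⟨1, ?_, by rw [h1, h2]; simp, by rw [h2]; simp⟩
        have : sc (1 : Fˣ) = 1 := by
          ext i j
          fin_cases i <;> fin_cases j <;> simp [sc, dg_val]
        rw [this, map_one]
    rw [hr']
    congr 1
    · refine if_congr ((hone _).trans (and_congr (isDual_one_eq_iff hq1 d1)
        (isDual_one_eq_one_iff hq1 d1 1))) rfl rfl
    · refine if_congr ((hone _).trans ?_) rfl rfl
      rw [isDual_swap_eq_iff d2 hmu]
      refine and_congr_right fun h => ?_
      exact isDual_one_eq_one_iff hq1 (isDual_swap_of_eq hq1 d2 h) 1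
  · have hone : ∀ {w} {t : Fin 2 → kˣ} (_ : t ∈ torus F k w), (∃ c : Fˣ, π (sc c) = 1 ∧
        (t 0 : k) = algebraMap F k c ∧ (t 1 : k) = algebraMap F k c) ↔ t 0 = t 1 := by
      intro w t ht
      simp only [hπ, true_and]
      exact (eq_const_iff ht).symm
    simp only [Nat.cast_one, one_dvd, and_true]
    congr 1
    · exact if_congr ((hone m1).trans (isDual_one_eq_iff hq1 d1)) rfl rfl
    · exact if_congr ((hone m2).trans (isDual_swap_eq_iff d2 hmu)) rfl rfl

end ZElt

/-- The numerical identity behind the unimodularity of the Gram matrix. -/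
theorem sum_choose_coeff {q r a : ℕ} (hq : 1 < q) (hr : r ∣ q - 1) (ha : a < q) (b : ℕ) :
    ∑ i ∈ Finset.range (a + 1), (a.choose i : ℤ) *
      ((if (q : ℤ) - 1 ∣ (i : ℤ) - (a - i : ℕ) ∧ (r : ℤ) ∣ (a - i : ℕ) + b then 1 else 0) -
        (if (i : ℤ) = (a - i : ℕ) ∧ (r : ℤ) ∣ (a - i : ℕ) + b then 1 else 0)) =
      if a + 1 = q ∧ r ∣ b then 2 else 0 := by
  -- The difference of the exponents is at most a < q in absolute value, so q - 1 divides it without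
  -- its vanishing only for the extreme terms i = 0 and i = a, and only when a = q - 1. These two
  -- terms give the value 2.
  have key : ∀ i ≤ a, (a + 1 = q → i ≠ 0 ∧ i ≠ a) →
      ((if (q : ℤ) - 1 ∣ (i : ℤ) - (a - i : ℕ) ∧ (r : ℤ) ∣ (a - i : ℕ) + b then 1 else 0) -
        (if (i : ℤ) = (a - i : ℕ) ∧ (r : ℤ) ∣ (a - i : ℕ) + b then 1 else 0) : ℤ) = 0 := by
    intro i hi h
    have : (q : ℤ) - 1 ∣ (i : ℤ) - (a - i : ℕ) ↔ (i : ℤ) = (a - i : ℕ) := by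
      constructor
      · intro h1
        have := Int.eq_zero_of_abs_lt_dvd h1 (by
          rw [abs_lt]
          constructor <;> omega)
        omega
      · intro h1
        rw [h1, sub_self]
        exact dvd_zero _
    simp only [this, sub_self]
  by_cases haq : a + 1 = q
  · obtain ⟨a, rfl⟩ : ∃ a', a = a' + 1 := ⟨a - 1, by omega⟩
    rw [Finset.sum_range_succ, Finset.sum_range_succ', Finset.sum_eq_zero]
    · have hr1 : (r : ℤ) ∣ ((a + 1 : ℕ) : ℤ) := by
        rw [Int.natCast_dvd_natCast]
        have : q - 1 = a + 1 := by omega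
        rwa [this] at hr
      have h1 : (q : ℤ) - 1 = ((a + 1 : ℕ) : ℤ) := by omega
      have h2 : (r : ℤ) ∣ ((a + 1 - 0 : ℕ) : ℤ) + b ↔ r ∣ b := by
        rw [Nat.sub_zero, Int.dvd_add_right hr1, Int.natCast_dvd_natCast]
      have h3 : (r : ℤ) ∣ ((a + 1 - (a + 1) : ℕ) : ℤ) + b ↔ r ∣ b := by
        rw [Nat.sub_self, Nat.cast_zero, zero_add, Int.natCast_dvd_natCast]
      have h4 : (q : ℤ) - 1 ∣ ((0 : ℕ) : ℤ) - (a + 1 - 0 : ℕ) := by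
        rw [h1, Nat.cast_zero, zero_sub, Nat.sub_zero, dvd_neg]
      have h5 : (q : ℤ) - 1 ∣ ((a + 1 : ℕ) : ℤ) - (a + 1 - (a + 1) : ℕ) := by
        rw [h1, Nat.sub_self, Nat.cast_zero, sub_zero]
      have h6 : ¬ (((0 : ℕ) : ℤ) = (a + 1 - 0 : ℕ)) := by omega
      have h7 : ¬ (((a + 1 : ℕ) : ℤ) = (a + 1 - (a + 1) : ℕ)) := by omega
      simp only [h2, h3, h4, h5, h6, h7, true_and, false_and, if_false, sub_zero, haq,
        Nat.choose_zero_right, Nat.choose_self, Nat.cast_one, one_mul, zero_add]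
      split_ifs <;> norm_num
    · intro i hi
      rw [Finset.mem_range] at hi
      rw [key (i + 1) (by omega) (fun _ => by omega), mul_zero]
  · rw [if_neg (fun h => haq h.1)]
    refine Finset.sum_eq_zero fun i hi => ?_
    rw [Finset.mem_range] at hi
    rw [key i (by omega) (fun h => absurd h haq), mul_zero]


/-! ### Invariants as combinations of orbit sums -/

section Orbits

variable {X : Type} [AddCommGroup X]

/-- The lattice `X` is a quotient of `ℤ²` on which `W` acts through the exchange `s` of the
coordinates. -/
structure DualDatum (pr : (Fin 2 → ℤ) →+ X) (s : X →+ X) (W : Set (X →+ X)) : Prop where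
  surj : Function.Surjective pr
  sub_eq : ∀ {mu nu}, pr mu = pr nu → mu 0 - mu 1 = nu 0 - nu 1
  swap : ∀ mu, pr (mu ∘ Equiv.swap 0 1) = s (pr mu)
  mem_iff : ∀ f, f ∈ invariants W ↔ AddMonoidAlgebra.mapDomainAlgHom ℤ ℤ s f = f

variable {pr : (Fin 2 → ℤ) →+ X} {s : X →+ X} {W : Set (X →+ X)}

theorem const_eq_of_eq {mu : Fin 2 → ℤ} (h : mu 0 = mu 1) : mu = ![mu 0, mu 0] := by
  funext i
  fin_cases i
  · rfl
  · exact h.symm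

/-- Invariants are combinations of orbit sums. -/
theorem DualDatum.mem_of_orbits (D : DualDatum pr s W) (S : AddSubgroup (AddMonoidAlgebra ℤ X))
    (h1 : ∀ mu : Fin 2 → ℤ, mu 1 < mu 0 → AddMonoidAlgebra.single (pr mu) (1 : ℤ) +
      AddMonoidAlgebra.single (pr (mu ∘ Equiv.swap 0 1)) 1 ∈ S)
    (h2 : ∀ m : ℤ, AddMonoidAlgebra.single (pr ![m, m]) (1 : ℤ) ∈ S)
    {f : AddMonoidAlgebra ℤ X} (hf : f ∈ invariants W) : f ∈ S := by
  classical
  let pos : X → Prop := fun x => ∃ mu, pr mu = x ∧ mu 1 < mu 0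
  -- A linear selection of orbit representatives: the dominant member of each two-element orbit
  -- carries the whole orbit sum, the other member carries nothing.
  let T : AddMonoidAlgebra ℤ X →ₗ[ℤ] AddMonoidAlgebra ℤ X := extendLinear fun x =>
    if pos x then AddMonoidAlgebra.single x 1 + AddMonoidAlgebra.single (s x) 1
    else if s x = x then AddMonoidAlgebra.single x 1 else 0
  have hpos : ∀ mu, pos (pr mu) ↔ mu 1 < mu 0 := by
    refine fun mu => ⟨?_, fun h => ⟨mu, rfl, h⟩⟩
    rintro ⟨nu, h1, h2⟩
    have := D.sub_eq h1
    omega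
  have hfix : ∀ mu, s (pr mu) = pr mu ↔ mu 0 = mu 1 := by
    intro mu
    rw [← D.swap]
    constructor
    · intro h
      have := D.sub_eq h
      simp only [Function.comp_apply, Equiv.swap_apply_left, Equiv.swap_apply_right] at this
      omega
    · intro h
      rw [const_eq_of_eq h]
      congr 1
      funext i
      fin_cases i <;> simp
  have hss : ∀ x, s (s x) = x := by
    intro x
    obtain ⟨mu, rfl⟩ := D.surj x
    rw [← D.swap, ← D.swap]
    congr 1
    funext i
    simp
  have hT : ∀ g, T g ∈ S := by
    intro g
    induction g using AddMonoidAlgebra.induction_linear with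
    | zero => rw [map_zero]; exact S.zero_mem
    | add f g hf hg => rw [map_add]; exact S.add_mem hf hg
    | single x n =>
      obtain ⟨mu, rfl⟩ := D.surj x
      rw [extendLinear_single]
      refine S.zsmul_mem ?_ n
      split_ifs with h3 h4
      · rw [← D.swap]
        exact h1 mu ((hpos mu).mp h3)
      · rw [const_eq_of_eq ((hfix mu).mp h4)]
        exact h2 _
      · exact S.zero_mem
  have hsum : ∀ g, T g + T (AddMonoidAlgebra.mapDomainAlgHom ℤ ℤ s g) =
      g + AddMonoidAlgebra.mapDomainAlgHom ℤ ℤ s g := by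
    intro g
    induction g using AddMonoidAlgebra.induction_linear with
    | zero => simp
    | add f g hf hg =>
      simp only [map_add]
      calc _ = (T f + T (AddMonoidAlgebra.mapDomainAlgHom ℤ ℤ s f)) +
            (T g + T (AddMonoidAlgebra.mapDomainAlgHom ℤ ℤ s g)) := by abel
        _ = _ := by rw [hf, hg]; abel
    | single x n =>
      obtain ⟨mu, rfl⟩ := D.surj x
      have e : ∀ x : X, AddMonoidAlgebra.single x n = n • AddMonoidAlgebra.single x (1 : ℤ) := by
        intro x
        rw [AddMonoidAlgebra.smul_single, smul_eq_mul, mul_one]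
      rw [AddMonoidAlgebra.mapDomainAlgHom_apply, AddMonoidAlgebra.mapDomain_single,
        extendLinear_single, extendLinear_single, e, e (s (pr mu)), ← smul_add, ← smul_add, hss]
      congr 1
      have hp2 : pos (s (pr mu)) ↔ mu 0 < mu 1 := by
        rw [← D.swap, hpos]
        simp
      rw [eq_comm (a := pr mu)]
      simp only [hpos, hp2, hfix]
      rcases lt_trichotomy (mu 0) (mu 1) with h | h | h
      · rw [if_neg (by omega), if_neg (by omega), if_pos h, zero_add, add_comm]
      · rw [if_neg (by omega), if_pos h, if_neg (by omega), if_pos h]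
      · rw [if_pos h, if_neg (by omega), if_neg (by omega), add_zero]
  -- For invariant f the identity becomes 2 T f = 2 f, and 2 can be cancelled because the
  -- coefficients are integers.
  have h3 := hsum f
  rw [(D.mem_iff f).mp hf, ← two_smul ℤ, ← two_smul ℤ] at h3
  have h4 : T f = f := by
    ext x
    have h5 := congrArg (fun g : AddMonoidAlgebra ℤ X => g.coeff x) h3
    simp only [AddMonoidAlgebra.coeff_smul_apply, smul_eq_mul] at h5
    exact mul_left_cancel₀ two_ne_zero h5
  rw [← h4]
  exact hT f

/-- The generator `x₀ + x₁`. -/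
def symElt (pr : (Fin 2 → ℤ) →+ X) : AddMonoidAlgebra ℤ X :=
  AddMonoidAlgebra.single (pr ![1, 0]) 1 + AddMonoidAlgebra.single (pr ![0, 1]) 1

/-- The generator `x₀ x₁`. -/
def detElt (pr : (Fin 2 → ℤ) →+ X) : AddMonoidAlgebra ℤ X :=
  AddMonoidAlgebra.single (pr ![1, 1]) 1

theorem symElt_pow_mul_detElt_pow (a b : ℕ) : symElt pr ^ a * detElt pr ^ b =
    ∑ i ∈ Finset.range (a + 1), (a.choose i : ℤ) •
      AddMonoidAlgebra.single (pr ![(i : ℤ) + b, (a - i : ℕ) + b]) 1 := by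
  rw [symElt, detElt, add_pow, Finset.sum_mul]
  refine Finset.sum_congr rfl fun i _ => ?_
  rw [AddMonoidAlgebra.single_pow, AddMonoidAlgebra.single_pow, AddMonoidAlgebra.single_pow,
    AddMonoidAlgebra.single_mul_single, mul_right_comm, AddMonoidAlgebra.single_mul_single,
    ← nsmul_eq_mul', natCast_zsmul]
  congr 2
  · rw [← map_nsmul, ← map_nsmul, ← map_nsmul, ← map_add, ← map_add]
    congr 1
    funext i
    fin_cases i <;> simp
  · simp

theorem DualDatum.symElt_mem (D : DualDatum pr s W) : symElt pr ∈ invariants W := by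
  rw [D.mem_iff, symElt, map_add, AddMonoidAlgebra.mapDomainAlgHom_apply,
    AddMonoidAlgebra.mapDomainAlgHom_apply, AddMonoidAlgebra.mapDomain_single,
    AddMonoidAlgebra.mapDomain_single, ← D.swap, ← D.swap, add_comm]
  congr 3 <;>
  · funext i
    fin_cases i <;> simp

theorem DualDatum.const_mem (D : DualDatum pr s W) (m : ℤ) :
    AddMonoidAlgebra.single (pr ![m, m]) (1 : ℤ) ∈ invariants W := by
  rw [D.mem_iff, AddMonoidAlgebra.mapDomainAlgHom_apply, AddMonoidAlgebra.mapDomain_single,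
    ← D.swap]
  congr 2
  funext i
  fin_cases i <;> simp

theorem DualDatum.orbit_mem (D : DualDatum pr s W) (mu : Fin 2 → ℤ) :
    AddMonoidAlgebra.single (pr mu) (1 : ℤ) +
      AddMonoidAlgebra.single (pr (mu ∘ Equiv.swap 0 1)) 1 ∈ invariants W := by
  rw [D.mem_iff, map_add, AddMonoidAlgebra.mapDomainAlgHom_apply,
    AddMonoidAlgebra.mapDomainAlgHom_apply, AddMonoidAlgebra.mapDomain_single,
    AddMonoidAlgebra.mapDomain_single, ← D.swap, ← D.swap, add_comm]
  congr 3
  funext i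
  simp

end Orbits

/-! ### The Gram matrix and the integrality of invariants -/

section Gram

variable {p : ℕ} [Fact p.Prime] {F k : Type} [Field F] [Fintype F] [CharP F p] [Field k]
  [Algebra F k] {H : Type} [Group H] {π : GL (Fin 2) F →* H} {ι : Additive kˣ ≃+ QModZ p}
  {X : Type} [AddCommGroup X] {pr : (Fin 2 → ℤ) →+ X} {s : X →+ X} {W : Set (X →+ X)}
  {z : AddMonoidAlgebra ℤ X →ₗ[ℤ] MonoidAlgebra Qbar H}

theorem IsScalarOrder.dvd {r : ℕ} (hr : IsScalarOrder π r) : r ∣ Fintype.card F - 1 := by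
  rcases hr with ⟨h, -⟩ | ⟨rfl, -⟩
  · rw [← h, Nat.add_sub_cancel]
  · exact one_dvd _

theorem IsScalarOrder.pos {r : ℕ} (hr : IsScalarOrder π r) : 0 < r := by
  have := Fintype.one_lt_card (α := F)
  rcases hr with ⟨h, -⟩ | ⟨rfl, -⟩ <;> omega

theorem coeff_lowerUni_mul_epsU [Finite H] {r : ℕ} (hr : IsScalarOrder π r) (D : DualDatum pr s W)
    (hz : ∀ mu, z (AddMonoidAlgebra.single (pr mu) 1) = zElt π ι mu) (f : AddMonoidAlgebra ℤ X) :
    (z f * epsU (π.comp (uGL F))).coeff (π (lowerUni F)) = (z f).coeff (π (lowerUni F)) := by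
  rw [epsU, mul_sub, mul_one, MonoidAlgebra.coeff_sub, Finsupp.sub_apply, sub_eq_self]
  induction f using AddMonoidAlgebra.induction_linear with
  | zero => simp
  | add f g hf hg =>
    rw [map_add, add_mul, MonoidAlgebra.coeff_add, Finsupp.add_apply, hf, hg, add_zero]
  | single x n =>
    obtain ⟨mu, rfl⟩ := D.surj x
    have e : AddMonoidAlgebra.single (pr mu) n = n • AddMonoidAlgebra.single (pr mu) (1 : ℤ) := by
      rw [AddMonoidAlgebra.smul_single, smul_eq_mul, mul_one]
    rw [e, map_zsmul, hz, smul_mul_assoc, ← Int.cast_smul_eq_zsmul Qbar,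
      MonoidAlgebra.coeff_smul_apply, zElt_mul_idemPsi_coeff hr.ker, smul_zero]

/-- The Gram matrix of the monomials in the two generators. -/
theorem coeff_lowerUni_mono [Finite H] {r : ℕ} (hr : IsScalarOrder π r)
    (hz : ∀ mu, z (AddMonoidAlgebra.single (pr mu) 1) = zElt π ι mu) {a : ℕ}
    (ha : a < Fintype.card F) (b : ℕ) :
    (Fintype.card F : Qbar) * (z (symElt pr ^ a * detElt pr ^ b)).coeff (π (lowerUni F)) =
      if a + 1 = Fintype.card F ∧ r ∣ b then 1 else 0 := by
  have h2 : (2 : Qbar) ≠ 0 := two_ne_zero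
  refine mul_left_cancel₀ h2 ?_
  rw [← mul_assoc, symElt_pow_mul_detElt_pow, map_sum, MonoidAlgebra.coeff_sum,
    Finset.sum_apply', Finset.mul_sum]
  have h3 := congrArg (Int.cast : ℤ → Qbar)
    (sum_choose_coeff Fintype.one_lt_card hr.dvd ha b)
  rw [Int.cast_sum] at h3
  refine Eq.trans (Finset.sum_congr rfl fun i hi => ?_) (h3.trans ?_)
  · rw [Finset.mem_range] at hi
    rw [map_zsmul, hz, ← Int.cast_smul_eq_zsmul Qbar, MonoidAlgebra.coeff_smul_apply, smul_eq_mul,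
      mul_left_comm, zElt_coeff_lowerUni hr, Int.cast_mul]
    · simp
    · rw [abs_lt]
      simp only [Matrix.cons_val_zero, Matrix.cons_val_one]
      constructor <;> omega
  · split_ifs <;> simp

/-- Up to the factor `q`, invariants act as integral central elements. -/
theorem exists_central [Finite H] (hπ : Function.Surjective π) (D : DualDatum pr s W)
    (hz : ∀ mu, z (AddMonoidAlgebra.single (pr mu) 1) = zElt π ι mu) {f : AddMonoidAlgebra ℤ X}
    (hf : f ∈ invariants W) : ∃ c : MonoidAlgebra ℤ H, (∀ x, c * x = x * c) ∧
      MonoidAlgebra.mapRingHom H (Int.castRingHom Qbar) c = Fintype.card F • z f := by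
  let S : AddSubgroup (AddMonoidAlgebra ℤ X) :=
    ((Subring.center (MonoidAlgebra ℤ H)).toAddSubgroup.map
      (MonoidAlgebra.mapRingHom H (Int.castRingHom Qbar)).toAddMonoidHom).comap
      ((nsmulAddMonoidHom (Fintype.card F)).comp z.toAddMonoidHom)
  have hq : (Fintype.card F : Qbar) ≠ 0 := by exact_mod_cast Fintype.card_ne_zero
  have hpush : ∀ x : MonoidAlgebra ℤ (GL (Fin 2) F), (∀ y, x * y = y * x) →
      MonoidAlgebra.mapDomainRingHom ℤ π x ∈ Subring.center (MonoidAlgebra ℤ H) := by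
    intro x hx
    rw [Subring.mem_center_iff]
    intro y
    obtain ⟨y, rfl⟩ : ∃ y', MonoidAlgebra.mapDomainRingHom ℤ π y' = y := by
      induction y using MonoidAlgebra.induction_linear with
      | zero => exact ⟨0, map_zero _⟩
      | add y z hy hz =>
        obtain ⟨y, rfl⟩ := hy
        obtain ⟨z, rfl⟩ := hz
        exact ⟨y + z, map_add _ _ _⟩
      | single h n =>
        obtain ⟨g, rfl⟩ := hπ h
        exact ⟨MonoidAlgebra.single g n, by simp⟩
    rw [← map_mul, ← map_mul, hx]
  have h3 : f ∈ S := by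
    refine D.mem_of_orbits S ?_ ?_ hf
    -- The two members of the orbit give the same central element, so the orbit sum doubles it and
    -- cancels the factor 1/2; only the denominator q remains.
    · intro mu _
      refine ⟨_, hpush _ (zTorus_comm (dualElt ι (Fintype.card F) 1 mu)
        (dualElt ι (Fintype.card F) (Equiv.swap 0 1) mu)), ?_⟩
      change push π _ = Fintype.card F • z _
      rw [map_add, hz, hz, zElt_comp_swap, ← two_smul Qbar, zElt, ← Nat.cast_smul_eq_nsmul Qbar,
        smul_smul, smul_smul, mul_comm 2 (Fintype.card F : Qbar), mul_inv_cancel₀, one_smul]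
      exact mul_ne_zero hq two_ne_zero
    · intro m
      obtain ⟨c, hc⟩ := exists_zElt_const (π := π) (ι := ι) m
      have hcc : ∀ y, MonoidAlgebra.single (sc c) (1 : ℤ) * y = y * MonoidAlgebra.single (sc c) 1 := by
        intro y
        induction y using MonoidAlgebra.induction_linear with
        | zero => simp
        | add y z hy hz => rw [mul_add, add_mul, hy, hz]
        | single g n =>
          rw [MonoidAlgebra.single_mul_single, MonoidAlgebra.single_mul_single, one_mul, mul_one,
            (Subgroup.mem_center_iff.mp (mem_center_iff_sc.mpr ⟨c, rfl⟩) g)]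
      refine ⟨_, (Subring.center _).nsmul_mem (hpush _ hcc) (Fintype.card F), ?_⟩
      change MonoidAlgebra.mapRingHom H (Int.castRingHom Qbar) _ = Fintype.card F • z _
      rw [map_nsmul, hz, hc]
      rfl
  obtain ⟨c, hc, h⟩ := h3
  exact ⟨c, fun x => (Subring.mem_center_iff.mp hc x).symm, h⟩

end Gram

/-- An antitriangular system of linear equations with values in an abelian group. -/
theorem mem_of_gram {M : Type*} [AddCommGroup M] {g : ℕ → ℕ → ℤ} {q r : ℕ} (hr : 0 < r)
    (hg : ∀ a b, a < q → g a b = if a + 1 = q ∧ r ∣ b then 1 else 0) (x : ℕ → ℕ → M)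
    (S : AddSubgroup M) (h : ∀ k < q, ∀ l < r, ∑ i ∈ Finset.range q, ∑ j ∈ Finset.range r,
      g (i + k) (j + l) • x i j ∈ S) : ∀ i < q, ∀ j < r, x i j ∈ S := by
  suffices h1 : ∀ n, ∀ i < q, q ≤ i + n → ∀ j < r, x i j ∈ S from
    fun i hi => h1 q i hi (by omega)
  intro n
  induction n with
  | zero => intro i hi hn; omega
  | succ n ih =>
    intro i hi hn j hj
    by_cases hn' : q ≤ i + n
    · exact ih i hi hn' j hj
    -- Testing with k = q - 1 - i and l ≡ -j modulo r puts the unit entry at (i, j). Rows above i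
    -- contribute zero, and rows below i are known by induction, whatever their Gram entries.
    · have h2 := h (q - 1 - i) (by omega) ((r - j) % r) (Nat.mod_lt _ hr)
      rw [← Finset.add_sum_erase _ _ (Finset.mem_range.mpr hi)] at h2
      have h3 : ∑ i' ∈ (Finset.range q).erase i, ∑ j' ∈ Finset.range r,
          g (i' + (q - 1 - i)) (j' + (r - j) % r) • x i' j' ∈ S := by
        refine S.sum_mem fun i' hi' => S.sum_mem fun j' hj' => ?_
        rw [Finset.mem_erase, Finset.mem_range] at hi'
        rw [Finset.mem_range] at hj'
        by_cases hlt : i' < i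
        · rw [hg _ _ (by omega), if_neg (by omega), zero_smul]
          exact S.zero_mem
        · exact S.zsmul_mem (ih i' hi'.2 (by omega) j' hj') _
      rw [S.add_mem_cancel_right h3, Finset.sum_eq_single_of_mem j (Finset.mem_range.mpr hj)] at h2
      · rwa [hg _ _ (by omega), if_pos, one_smul] at h2
        refine ⟨by omega, ?_⟩
        rw [Nat.dvd_iff_mod_eq_zero, Nat.add_mod, Nat.mod_mod, ← Nat.add_mod]
        rw [Nat.add_sub_cancel' hj.le, Nat.mod_self]
      · intro j' hj' hne
        rw [Finset.mem_range] at hj'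
        rw [hg _ _ (by omega), if_neg, zero_smul]
        rintro ⟨-, hd⟩
        apply hne
        have h4 : j' + (r - j) ≡ 0 [MOD r] := by
          have : j' + (r - j) % r ≡ j' + (r - j) [MOD r] := Nat.ModEq.add_left _ (Nat.mod_modEq _ _)
          exact this.symm.trans ((Nat.modEq_zero_iff_dvd).mpr hd)
        have h5 : j' + r ≡ j + 0 [MOD r] := by
          have := h4.add_right j
          rwa [add_assoc, Nat.sub_add_cancel hj.le, zero_add] at this
        have h6 : j' ≡ j [MOD r] := by
          have : j' + r ≡ j' [MOD r] := by simp [Nat.ModEq]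
          exact this.symm.trans h5
        exact Nat.ModEq.eq_of_lt_of_lt h6 hj' hj


/-! ### Endomorphisms of the induced module -/

section Endomorphisms

variable {F : Type} [Field F] [Fintype F] {H : Type} [Group H]

/-- The embedding of `ℤ[H]` in `Qbar[H]`. -/
def toQ (H : Type) [Group H] : MonoidAlgebra ℤ H →+* MonoidAlgebra Qbar H :=
  MonoidAlgebra.mapRingHom H (Int.castRingHom Qbar)

theorem toQ_coeff (x : MonoidAlgebra ℤ H) (h : H) : (toQ H x).coeff h = (x.coeff h : Qbar) := by
  simp [toQ]

theorem toQ_injective : Function.Injective (toQ H) := by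
  intro x y hxy
  ext h
  have := congrArg (fun z : MonoidAlgebra Qbar H => z.coeff h) hxy
  simp only [toQ_coeff] at this
  exact_mod_cast this

theorem toQbar_eq {u : Multiplicative F →* H} (m : indF0 u) : toQbar u m = toQ H m := rfl

/-- The multiple `q ε` of the idempotent `ε`, which lies in `ℤ[H]`. -/
def qEps (u : Multiplicative F →* H) : MonoidAlgebra ℤ H :=
  Fintype.card F • 1 - ∑ a : F, MonoidAlgebra.of ℤ H (u (Multiplicative.ofAdd a))

theorem qEps_mem (u : Multiplicative F →* H) : qEps u ∈ indF0 u := by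
  classical
  refine Submodule.subset_span ⟨fun a => (if a = 0 then (Fintype.card F : ℤ) else 0) - 1, ?_, ?_⟩
  · simp
  · simp only [sub_smul, Finset.sum_sub_distrib, one_smul, ite_smul, zero_smul,
      Finset.sum_ite_eq', Finset.mem_univ, if_true, qEps]
    rw [ofAdd_zero, map_one, map_one, natCast_zsmul]

theorem toQ_qEps (u : Multiplicative F →* H) :
    toQ H (qEps u) = (Fintype.card F : Qbar) • epsU u := by
  have hq : (Fintype.card F : Qbar) ≠ 0 := by exact_mod_cast Fintype.card_ne_zero
  rw [epsU, idemPsi, smul_sub, smul_smul, mul_inv_cancel₀ hq, one_smul, qEps, map_sub, map_nsmul,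
    map_one, map_sum, ← Nat.cast_smul_eq_nsmul Qbar]
  congr 1
  refine Finset.sum_congr rfl fun a _ => ?_
  simp [toQ]


theorem of_mul_sum (u : Multiplicative F →* H) (b : F) :
    MonoidAlgebra.of ℤ H (u (Multiplicative.ofAdd b)) *
      ∑ a : F, MonoidAlgebra.of ℤ H (u (Multiplicative.ofAdd a)) =
      ∑ a : F, MonoidAlgebra.of ℤ H (u (Multiplicative.ofAdd a)) := by
  rw [Finset.mul_sum]
  refine Fintype.sum_equiv (Equiv.addLeft b) _ _ fun a => ?_
  rw [← map_mul, ← map_mul, ← ofAdd_add, Equiv.coe_addLeft]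

/-- The sum over U annihilates functions of sum zero from the right, so q ε acts on the induced
module as multiplication by q. -/
theorem mul_qEps {u : Multiplicative F →* H} {m : MonoidAlgebra ℤ H} (hm : m ∈ indF0 u) :
    m * qEps u = Fintype.card F • m := by
  rw [qEps, mul_sub, mul_smul_comm, mul_one, sub_eq_self]
  induction hm using Submodule.span_induction with
  | mem x hx =>
    obtain ⟨c, hc, rfl⟩ := hx
    rw [Finset.sum_mul]
    simp only [smul_mul_assoc, of_mul_sum]
    rw [← Finset.sum_smul, hc, zero_smul]
  | zero => rw [zero_mul]
  | add x y _ _ hx hy => rw [add_mul, hx, hy, add_zero]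
  | smul a x _ hx => rw [smul_eq_mul, mul_assoc, hx, mul_zero]

theorem toQbar_mul_epsU {u : Multiplicative F →* H} (m : indF0 u) :
    toQbar u m * epsU u = toQbar u m := by
  have hq : (Fintype.card F : Qbar) ≠ 0 := by exact_mod_cast Fintype.card_ne_zero
  have h := congrArg (toQ H) (mul_qEps m.2)
  rw [map_mul, toQ_qEps, mul_smul_comm, map_nsmul, ← Nat.cast_smul_eq_nsmul Qbar] at h
  exact smul_right_injective _ hq h

theorem epsU_mul_self (u : Multiplicative F →* H) : epsU u * epsU u = epsU u := by
  have hq : (Fintype.card F : Qbar) ≠ 0 := by exact_mod_cast Fintype.card_ne_zero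
  have h := toQbar_mul_epsU ⟨qEps u, qEps_mem u⟩
  rw [toQbar_eq, toQ_qEps, smul_mul_assoc] at h
  exact smul_right_injective _ hq h

/-- The element of `Qbar[H]` by which an endomorphism acts from the right. -/
def yElt (u : Multiplicative F →* H) (θ : Module.End (MonoidAlgebra ℤ H) (indF0 u)) :
    MonoidAlgebra Qbar H :=
  (Fintype.card F : Qbar)⁻¹ • toQbar u (θ ⟨qEps u, qEps_mem u⟩)

/-- Since q m = m (q ε) with q ε inside the module, linearity gives q θ(m) = m θ(q ε); the value of
θ at q ε determines θ. -/
theorem toQbar_apply {u : Multiplicative F →* H} (θ : Module.End (MonoidAlgebra ℤ H) (indF0 u))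
    (m : indF0 u) : toQbar u (θ m) = toQbar u m * yElt u θ := by
  have hq : (Fintype.card F : Qbar) ≠ 0 := by exact_mod_cast Fintype.card_ne_zero
  have h1 : (m : MonoidAlgebra ℤ H) • (⟨qEps u, qEps_mem u⟩ : indF0 u) = Fintype.card F • m :=
    Subtype.ext (mul_qEps m.2)
  have h2 := congrArg (fun x => toQbar u (θ x)) h1
  simp only [map_smul, map_nsmul] at h2
  have h3 : toQbar u m * toQbar u (θ ⟨qEps u, qEps_mem u⟩) = Fintype.card F • toQbar u (θ m) := by
    rw [toQbar_eq, toQbar_eq, toQbar_eq, ← map_mul, ← map_nsmul]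
    exact h2
  rw [yElt, mul_smul_comm, h3, ← Nat.cast_smul_eq_nsmul Qbar, inv_smul_smul₀ hq]

theorem yElt_mul_epsU {u : Multiplicative F →* H} (θ : Module.End (MonoidAlgebra ℤ H) (indF0 u)) :
    yElt u θ * epsU u = yElt u θ := by
  rw [yElt, smul_mul_assoc, toQbar_mul_epsU]

theorem epsU_mul_yElt {u : Multiplicative F →* H} (θ : Module.End (MonoidAlgebra ℤ H) (indF0 u)) :
    epsU u * yElt u θ = yElt u θ := by
  have h := toQbar_apply θ ⟨qEps u, qEps_mem u⟩
  have hq : (Fintype.card F : Qbar) ≠ 0 := by exact_mod_cast Fintype.card_ne_zero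
  rw [toQbar_eq (u := u) ⟨qEps u, qEps_mem u⟩, toQ_qEps, smul_mul_assoc] at h
  conv_rhs => rw [yElt, h, inv_smul_smul₀ hq]

theorem yElt_mul {u : Multiplicative F →* H} (θ θ' : Module.End (MonoidAlgebra ℤ H) (indF0 u)) :
    yElt u (θ * θ') = yElt u θ' * yElt u θ := by
  rw [yElt, Module.End.mul_apply, toQbar_apply, ← smul_mul_assoc, ← yElt]

theorem yElt_one (u : Multiplicative F →* H) : yElt u 1 = epsU u := by
  have hq : (Fintype.card F : Qbar) ≠ 0 := by exact_mod_cast Fintype.card_ne_zero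
  rw [yElt, Module.End.one_apply, toQbar_eq, toQ_qEps, inv_smul_smul₀ hq]

theorem yElt_injective (u : Multiplicative F →* H) : Function.Injective (yElt u) := by
  intro θ θ' h
  ext m : 1
  apply Subtype.ext
  apply toQ_injective
  rw [← toQbar_eq, ← toQbar_eq, toQbar_apply, toQbar_apply, h]

theorem yElt_add {u : Multiplicative F →* H} (θ θ' : Module.End (MonoidAlgebra ℤ H) (indF0 u)) :
    yElt u (θ + θ') = yElt u θ + yElt u θ' := by
  rw [yElt, yElt, yElt, ← smul_add, LinearMap.add_apply]
  simp only [toQbar_eq, Submodule.coe_add, map_add]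

/-- The embedding of `E` in `Qbar[H]`. -/
def etaE (u : Multiplicative F →* H) : EAlg u →ₙₐ[ℤ] MonoidAlgebra Qbar H where
  toFun θ := yElt u θ.1
  map_smul' n θ := map_zsmul (AddMonoidHom.mk' (yElt u) yElt_add) n θ.1
  map_zero' := map_zero (AddMonoidHom.mk' (yElt u) yElt_add)
  map_add' θ θ' := yElt_add _ _
  map_mul' θ θ' := by
    -- Right multiplications compose in reverse order, which is harmless because the center is
    -- commutative.
    rw [mul_comm]
    exact yElt_mul _ _

theorem etaE_apply {u : Multiplicative F →* H} (θ : EAlg u) : etaE u θ = yElt u θ.1 := rfl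

theorem etaE_injective (u : Multiplicative F →* H) : Function.Injective (etaE u) :=
  fun _ _ h => Subtype.ext (yElt_injective u h)

theorem etaE_one (u : Multiplicative F →* H) : etaE u 1 = epsU u := yElt_one u

/-- The action of `ℤ[1/n] E` is right multiplication. -/
theorem act_eq {u : Multiplicative F →* H} (n : ℕ) (m : indF0 u) (x : ZInv n ⊗[ℤ] EAlg u) :
    act u n m x = toQbar u m * extend n (etaE u) x := by
  induction x using TensorProduct.induction_on with
  | zero => simp
  | add x y hx hy => rw [map_add, map_add, mul_add, hx, hy]
  | tmul c θ =>
    rw [extend_tmul, mul_smul_comm, etaE_apply, ← toQbar_apply, ← algebraMap_smul Qbar]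
    rfl

/-- Central elements of `ℤ[H]` give elements of `E`. -/
theorem exists_etaE_eq {u : Multiplicative F →* H} {c : MonoidAlgebra ℤ H}
    (hc : ∀ x, c * x = x * c) : ∃ θ : EAlg u, etaE u θ = toQ H c * epsU u := by
  have hq : (Fintype.card F : Qbar) ≠ 0 := by exact_mod_cast Fintype.card_ne_zero
  let θ : Module.End (MonoidAlgebra ℤ H) (indF0 u) :=
    { toFun := fun m => c • m
      map_add' := fun m m' => smul_add _ _ _
      map_smul' := fun a m => by rw [smul_smul, hc, ← smul_smul, RingHom.id_apply] }
  refine ⟨⟨θ, ?_⟩, ?_⟩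
  · rw [Subalgebra.mem_center_iff]
    intro φ
    ext m : 1
    exact map_smul φ c m
  · change (Fintype.card F : Qbar)⁻¹ • toQ H (c * qEps u) = _
    rw [map_mul, toQ_qEps, mul_smul_comm, inv_smul_smul₀ hq]

/-- Elements of `E` commute with the normalizer of `U`. -/
theorem etaE_comm {u : Multiplicative F →* H} (θ : EAlg u) {b : H}
    (φ : Equiv.Perm F) (hb : ∀ a, u (Multiplicative.ofAdd a) * b = b * u (Multiplicative.ofAdd (φ a))) :
    MonoidAlgebra.single b (1 : Qbar) * etaE u θ = etaE u θ * MonoidAlgebra.single b 1 := by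
  have hq : (Fintype.card F : Qbar) ≠ 0 := by exact_mod_cast Fintype.card_ne_zero
  have hb' : MonoidAlgebra.single b (1 : Qbar) = toQ H (MonoidAlgebra.single b 1) := by
    simp [toQ]
  have hstab : ∀ m ∈ indF0 u, m * MonoidAlgebra.single b 1 ∈ indF0 u := by
    intro m hm
    induction hm using Submodule.span_induction with
    | zero => rw [zero_mul]; exact zero_mem _
    | add x y _ _ hx hy => rw [add_mul]; exact add_mem hx hy
    | smul a x _ hx => rw [smul_eq_mul, mul_assoc]; exact Submodule.smul_mem _ a hx
    | mem x hx =>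
      obtain ⟨c, hc, rfl⟩ := hx
      have e : (∑ a, c a • MonoidAlgebra.of ℤ H (u (Multiplicative.ofAdd a))) *
          MonoidAlgebra.single b 1 = MonoidAlgebra.single b (1 : ℤ) •
            ∑ a, c (φ.symm a) • MonoidAlgebra.of ℤ H (u (Multiplicative.ofAdd a)) := by
        rw [smul_eq_mul, Finset.sum_mul, Finset.mul_sum]
        refine Fintype.sum_equiv φ _ _ fun a => ?_
        rw [smul_mul_assoc, mul_smul_comm, Equiv.symm_apply_apply, MonoidAlgebra.of_apply,
          MonoidAlgebra.of_apply, MonoidAlgebra.single_mul_single, MonoidAlgebra.single_mul_single,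
          hb]
      rw [e]
      refine Submodule.smul_mem _ _ (Submodule.subset_span ⟨_, ?_, rfl⟩)
      rw [← hc]
      exact Equiv.sum_comp φ.symm c
  -- As b normalizes U, right multiplication by b preserves the induced module and is linear over
  -- ℤ[H]; a central endomorphism must commute with it.
  let R : Module.End (MonoidAlgebra ℤ H) (indF0 u) :=
    { toFun := fun m => ⟨(m : MonoidAlgebra ℤ H) * MonoidAlgebra.single b 1, hstab m m.2⟩
      map_add' := fun m m' => Subtype.ext (add_mul _ _ _)
      map_smul' := fun a m => Subtype.ext (mul_assoc _ _ _) }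
  have h1 : (θ.1 * R) ⟨qEps u, qEps_mem u⟩ = (R * θ.1) ⟨qEps u, qEps_mem u⟩ := by
    rw [(Subalgebra.mem_center_iff.mp θ.2 R)]
  have h2 := congrArg (toQbar u) h1
  rw [Module.End.mul_apply, Module.End.mul_apply, toQbar_apply] at h2
  have h3 : ∀ m : indF0 u, toQbar u (R m) = toQbar u m * MonoidAlgebra.single b 1 := by
    intro m
    rw [hb', toQbar_eq, toQbar_eq, ← map_mul]
    rfl
  rw [h3, h3, toQbar_apply, toQbar_eq, toQ_qEps, smul_mul_assoc, smul_mul_assoc, smul_mul_assoc,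
    smul_mul_assoc] at h2
  have h4 := smul_right_injective _ hq h2
  have hqb : qEps u * MonoidAlgebra.single b 1 = MonoidAlgebra.single b 1 * qEps u := by
    rw [qEps, sub_mul, mul_sub, smul_mul_assoc, mul_smul_comm, one_mul, mul_one, Finset.sum_mul,
      Finset.mul_sum]
    congr 1
    refine Fintype.sum_equiv φ _ _ fun a => ?_
    rw [MonoidAlgebra.of_apply, MonoidAlgebra.of_apply, MonoidAlgebra.single_mul_single,
      MonoidAlgebra.single_mul_single, hb]
  have h5 : epsU u * MonoidAlgebra.single b (1 : Qbar) = MonoidAlgebra.single b 1 * epsU u := by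
    refine smul_right_injective _ hq ?_
    change (Fintype.card F : Qbar) • _ = (Fintype.card F : Qbar) • _
    rw [← smul_mul_assoc, ← mul_smul_comm, ← toQ_qEps, hb', ← map_mul, ← map_mul, hqb]
  rw [etaE_apply]
  rw [h5, mul_assoc, epsU_mul_yElt] at h4
  exact h4

end Endomorphisms


/-! ### The corner algebra of a non-degenerate character -/

section Corner

variable {F : Type} [Field F] [Fintype F] {H : Type} [Group H]

theorem idemPsi_mul_of (u : Multiplicative F →* H) (ψ : AddChar F Qbar) (x : F) :
    idemPsi u ψ * MonoidAlgebra.single (u (Multiplicative.ofAdd x)) 1 = ψ x • idemPsi u ψ := by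
  rw [idemPsi, smul_mul_assoc, smul_comm (ψ x), Finset.sum_mul,
    Finset.smul_sum (r := ψ x)]
  congr 1
  refine Fintype.sum_equiv (Equiv.addRight x)
    (fun a => ψ (-a) • MonoidAlgebra.of Qbar H (u (Multiplicative.ofAdd a)) *
      MonoidAlgebra.single (u (Multiplicative.ofAdd x)) 1)
    (fun a => ψ x • ψ (-a) • MonoidAlgebra.of Qbar H (u (Multiplicative.ofAdd a))) fun a => ?_
  rw [smul_mul_assoc, smul_smul, Equiv.coe_addRight, ← AddChar.map_add_eq_mul, neg_add,
    add_comm (-a), add_neg_cancel_left, MonoidAlgebra.of_apply, MonoidAlgebra.of_apply,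
    MonoidAlgebra.single_mul_single, ← map_mul, ← ofAdd_add, mul_one]

theorem of_mul_idemPsi (u : Multiplicative F →* H) (ψ : AddChar F Qbar) (x : F) :
    MonoidAlgebra.single (u (Multiplicative.ofAdd x)) 1 * idemPsi u ψ = ψ x • idemPsi u ψ := by
  rw [← idemPsi_mul_of, idemPsi, mul_smul_comm, smul_mul_assoc, Finset.sum_mul, Finset.mul_sum]
  congr 1
  refine Finset.sum_congr rfl fun a _ => ?_
  have e : u (Multiplicative.ofAdd x) * u (Multiplicative.ofAdd a) =
      u (Multiplicative.ofAdd a) * u (Multiplicative.ofAdd x) := by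
    rw [← map_mul u, ← map_mul u, mul_comm]
  rw [smul_mul_assoc, mul_smul_comm, MonoidAlgebra.of_apply,
    MonoidAlgebra.single_mul_single, MonoidAlgebra.single_mul_single, e]

theorem idemPsi_mul_self (u : Multiplicative F →* H) (ψ : AddChar F Qbar) :
    idemPsi u ψ * idemPsi u ψ = idemPsi u ψ := by
  have hq : (Fintype.card F : Qbar) ≠ 0 := by exact_mod_cast Fintype.card_ne_zero
  conv_lhs => rw [idemPsi.eq_def u ψ]
  rw [smul_mul_assoc, Finset.sum_mul]
  have : ∀ a : F, ψ (-a) • MonoidAlgebra.of Qbar H (u (Multiplicative.ofAdd a)) *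
      ((Fintype.card F : Qbar)⁻¹ • ∑ b : F, ψ (-b) • MonoidAlgebra.of Qbar H
        (u (Multiplicative.ofAdd b))) = idemPsi u ψ := by
    intro a
    rw [← idemPsi, smul_mul_assoc, MonoidAlgebra.of_apply, of_mul_idemPsi, smul_smul,
      ← AddChar.map_add_eq_mul, neg_add_cancel, AddChar.map_zero_eq_one, one_smul]
  rw [Finset.sum_congr rfl fun a _ => this a, Finset.sum_const, Finset.card_univ,
    ← Nat.cast_smul_eq_nsmul Qbar, inv_smul_smul₀ hq]

variable (π : GL (Fin 2) F →* H) (ψ : AddChar F Qbar)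

/-- The antidiagonal matrix with entries `D` and `1`. -/
def antiDiag (D : Fˣ) : GL (Fin 2) F :=
  Matrix.GeneralLinearGroup.mkOfDetNeZero !![0, (D : F); 1, 0] (by simp)

/-- The element `e_ψ h e_ψ`. -/
def cornerElt (h : H) : MonoidAlgebra Qbar H :=
  idemPsi (π.comp (uGL F)) ψ * MonoidAlgebra.single h 1 * idemPsi (π.comp (uGL F)) ψ

theorem cornerElt_uni_mul (x : F) (h : H) :
    cornerElt π ψ (π (uni x) * h) = ψ x • cornerElt π ψ h := by
  have h1 := idemPsi_mul_of (π.comp (uGL F)) ψ x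
  have h2 : MonoidAlgebra.single (π (uni x) * h) (1 : Qbar) =
      MonoidAlgebra.single ((π.comp (uGL F)) (Multiplicative.ofAdd x)) 1 *
        MonoidAlgebra.single h 1 := by
    rw [MonoidAlgebra.single_mul_single, mul_one]
    rfl
  rw [cornerElt, h2, ← mul_assoc, h1, smul_mul_assoc, smul_mul_assoc, cornerElt]

theorem cornerElt_mul_uni (x : F) (h : H) :
    cornerElt π ψ (h * π (uni x)) = ψ x • cornerElt π ψ h := by
  have h1 := of_mul_idemPsi (π.comp (uGL F)) ψ x
  have h2 : MonoidAlgebra.single (h * π (uni x)) (1 : Qbar) =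
      MonoidAlgebra.single h 1 *
      MonoidAlgebra.single ((π.comp (uGL F)) (Multiplicative.ofAdd x)) 1 := by
    rw [MonoidAlgebra.single_mul_single, mul_one]
    rfl
  rw [cornerElt, h2, mul_assoc, mul_assoc, h1, mul_smul_comm, mul_smul_comm, cornerElt, mul_assoc]

variable {π ψ}

/-- Up to a scalar factor the element depends only on the double coset UgU. Upper triangular g
contributes scalars if its diagonal entries agree and zero otherwise; the big cell is represented by
scalars times antidiagonal matrices. -/
theorem cornerElt_mem_span (hψ : ψ ≠ 1) (g : GL (Fin 2) F) :
    cornerElt π ψ (π g) ∈ Submodule.span Qbar (Set.range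
      fun i : Set.range (fun c : Fˣ => π (sc c)) × Option Fˣ =>
        cornerElt π ψ (i.2.elim i.1.1 fun D => i.1.1 * π (antiDiag D))) := by
  have hdet := det_ne_zero_GL g
  rw [Matrix.det_fin_two] at hdet
  by_cases hc : g.1 1 0 = 0
  · rw [hc, mul_zero, sub_zero] at hdet
    have ha : g.1 0 0 ≠ 0 := left_ne_zero_of_mul hdet
    have hd : g.1 1 1 ≠ 0 := right_ne_zero_of_mul hdet
    by_cases had : g.1 0 0 = g.1 1 1
    · have e : g = sc (Units.mk0 _ ha) * uni (g.1 0 1 / g.1 0 0) := by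
        ext i j
        rw [Units.val_mul, sc, dg_val, uni_val]
        fin_cases i <;> fin_cases j
        · simp
        · simp [mul_div_cancel₀ _ ha]
        · simpa using hc
        · simpa using had.symm
      rw [e, map_mul, cornerElt_mul_uni]
      exact Submodule.smul_mem _ _ (Submodule.subset_span ⟨(⟨_, _, rfl⟩, none), rfl⟩)
    · suffices h : cornerElt π ψ (π g) = 0 by rw [h]; exact zero_mem _
      have hne : g.1 1 1 - g.1 0 0 ≠ 0 := sub_ne_zero.mpr (Ne.symm had)
      obtain ⟨x, hx⟩ : ∃ x, ψ x ≠ 1 := by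
        by_contra! h
        exact hψ (DFunLike.ext _ _ h)
      -- With this y, moving a unipotent across g compares ψ at two points differing by x, where ψ
      -- is non-trivial; the corner element must therefore vanish.
      set y := x / (g.1 1 1 - g.1 0 0) with hy
      have e : uni (g.1 0 0 * y) * g = g * uni (g.1 1 1 * y) := by
        ext i j
        rw [Units.val_mul, Units.val_mul, uni_val, uni_val, Matrix.mul_apply, Matrix.mul_apply,
          Fin.sum_univ_two, Fin.sum_univ_two]
        fin_cases i <;> fin_cases j
        · simp [hc]
        · simp; ring
        · simp
        · simp [hc]
      have h1 := congrArg (fun g => cornerElt π ψ (π g)) e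
      simp only [map_mul, cornerElt_uni_mul, cornerElt_mul_uni] at h1
      have h2 : (ψ (g.1 1 1 * y) - ψ (g.1 0 0 * y)) • cornerElt π ψ (π g) = 0 := by
        rw [sub_smul, h1, sub_self]
      refine (smul_eq_zero.mp h2).resolve_left fun h3 => hx ?_
      have h4 : g.1 1 1 * y = x + g.1 0 0 * y := by
        rw [hy]; field_simp; ring
      rw [h4, AddChar.map_add_eq_mul] at h3
      have h5 : ψ (g.1 0 0 * y) ≠ 0 := by
        intro h0
        have := AddChar.map_add_eq_mul ψ (g.1 0 0 * y) (-(g.1 0 0 * y))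
        rw [h0, zero_mul, add_neg_cancel, AddChar.map_zero_eq_one] at this
        exact one_ne_zero this
      have h6 : (ψ x - 1) * ψ (g.1 0 0 * y) = 0 := by rw [sub_mul, one_mul, h3]
      exact sub_eq_zero.mp ((mul_eq_zero.mp h6).resolve_right h5)
  · set c := g.1 1 0
    -- This quantity is -det g / c², the upper entry of the antidiagonal factor in the Bruhat
    -- decomposition below.
    have hD : g.1 0 1 / c - g.1 0 0 * g.1 1 1 / (c * c) ≠ 0 := by
      intro h
      apply hdet
      field_simp at h
      linear_combination -h
    have e : g = uni (g.1 0 0 / c) * (sc (Units.mk0 c hc) * antiDiag (Units.mk0 _ hD)) *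
        uni (g.1 1 1 / c) := by
      ext i j
      rw [Units.val_mul, Units.val_mul, Units.val_mul, sc, dg_val, uni_val, uni_val]
      fin_cases i <;> fin_cases j
      · simp [antiDiag, Matrix.GeneralLinearGroup.mkOfDetNeZero]; field_simp
      · simp [antiDiag, Matrix.GeneralLinearGroup.mkOfDetNeZero]; field_simp; ring
      · simp [antiDiag, Matrix.GeneralLinearGroup.mkOfDetNeZero]; rfl
      · simp [antiDiag, Matrix.GeneralLinearGroup.mkOfDetNeZero]; field_simp
    rw [e, map_mul, map_mul, cornerElt_mul_uni, cornerElt_uni_mul, map_mul]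
    exact Submodule.smul_mem _ _ (Submodule.smul_mem _ _
      (Submodule.subset_span ⟨(⟨_, _, rfl⟩, some _), rfl⟩))

/-- There are r scalars in H, each combined with the identity or with one of q - 1 antidiagonal
matrices. -/
theorem IsScalarOrder.card_range {r : ℕ} (hr : IsScalarOrder π r) :
    Nat.card (Set.range (fun c : Fˣ => π (sc c)) × Option Fˣ) = Fintype.card F * r := by
  have h1 : Nat.card (Option Fˣ) = Fintype.card F := by
    classical
    rw [Nat.card_eq_fintype_card, Fintype.card_option, Fintype.card_units]
    have := Fintype.card_pos (α := F)
    omega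
  have h2 : Nat.card (Set.range (fun c : Fˣ => π (sc c))) = r := by
    rcases hr with ⟨h, hπ⟩ | ⟨rfl, hπ, -⟩
    · have hinj : Function.Injective (fun c : Fˣ => π (sc c)) := by
        intro a b hab
        have := congrArg (fun g : GL (Fin 2) F => g.1 0 0) (hπ hab)
        exact Units.ext (by simpa [sc, dg_val] using this)
      rw [← Nat.card_congr (Equiv.ofInjective _ hinj)]
      classical
      rw [Nat.card_eq_fintype_card, Fintype.card_units, ← h, Nat.add_sub_cancel]
    · rw [Nat.card_eq_one_iff_exists]
      refine ⟨⟨1, 1, hπ 1⟩, ?_⟩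
      rintro ⟨_, c, rfl⟩
      exact Subtype.ext (hπ c)
  rw [Nat.card_prod, h1, h2, mul_comm]

/-- The span of the elements `e_ψ h e_ψ` has dimension at most `q r`. -/
theorem finrank_corner_le (hπ : Function.Surjective π) (hψ : ψ ≠ 1) {r : ℕ}
    (hr : IsScalarOrder π r) [Finite H] :
    Module.finrank Qbar (Submodule.span Qbar (Set.range (cornerElt π ψ))) ≤
      Fintype.card F * r := by
  classical
  cases nonempty_fintype (Set.range (fun c : Fˣ => π (sc c)) × Option Fˣ)
  rw [← hr.card_range, Nat.card_eq_fintype_card]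
  refine le_trans (Submodule.finrank_mono ?_) (finrank_range_le_card
    (fun i : Set.range (fun c : Fˣ => π (sc c)) × Option Fˣ =>
        cornerElt π ψ (i.2.elim i.1.1 fun D => i.1.1 * π (antiDiag D))))
  rw [Submodule.span_le]
  rintro _ ⟨h, rfl⟩
  obtain ⟨g, rfl⟩ := hπ h
  exact cornerElt_mem_span hψ g

theorem corner_mem_span (Y : MonoidAlgebra Qbar H) :
    idemPsi (π.comp (uGL F)) ψ * Y * idemPsi (π.comp (uGL F)) ψ ∈
      Submodule.span Qbar (Set.range (cornerElt π ψ)) := by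
  induction Y using MonoidAlgebra.induction_linear with
  | zero => simp
  | add x y hx hy => rw [mul_add, add_mul]; exact add_mem hx hy
  | single h n =>
    have : MonoidAlgebra.single h n = n • MonoidAlgebra.single h (1 : Qbar) := by
      rw [MonoidAlgebra.smul_single, smul_eq_mul, mul_one]
    rw [this, mul_smul_comm, smul_mul_assoc]
    exact Submodule.smul_mem _ _ (Submodule.subset_span ⟨h, rfl⟩)

/-- An element commuting with the diagonal matrices which is killed by `e_ψ` is killed by
`epsU`. -/
theorem mul_epsU_eq_zero (hψ : ψ ≠ 1) {Y : MonoidAlgebra Qbar H}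
    (hY : ∀ b : Fˣ, MonoidAlgebra.single (π (dg b 1)) 1 * Y = Y * MonoidAlgebra.single (π (dg b 1)) 1)
    (h : Y * idemPsi (π.comp (uGL F)) ψ = 0) : Y * epsU (π.comp (uGL F)) = 0 := by
  classical
  rw [epsU_eq_sum _ hψ, Finset.mul_sum]
  refine Finset.sum_eq_zero fun b hb => ?_
  have hb0 : b ≠ 0 := Finset.ne_of_mem_erase hb
  have h1 := conj_idemPsi (π := π) (Units.mk0 b hb0)⁻¹ ψ
  rw [inv_inv, Units.val_mk0] at h1
  rw [← h1, ← mul_assoc, ← mul_assoc, ← hY, mul_assoc (MonoidAlgebra.single _ _), h, mul_zero,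
    zero_mul]

end Corner


/-! ### Coefficients of elements of `E` -/

section Comparison

variable {p : ℕ} {F k : Type} [Field F] [Fintype F] [Field k]
  [Algebra F k] {H Hd : Type} [Group H] [Finite H] {π : GL (Fin 2) F →* H}
  {ι : Additive kˣ ≃+ QModZ p}
  {X : Type} [AddCommGroup X] {pr : (Fin 2 → ℤ) →+ X} {s : X →+ X} {W : Set (X →+ X)}
  {z : AddMonoidAlgebra ℤ X →ₗ[ℤ] MonoidAlgebra Qbar H} {ψ : AddChar F Qbar}
  {IsRho : Hd → FDRep Qbar H → Prop} {IsPoint : Hd → (Multiplicative X →* Qbarˣ) → Prop}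

/-- The generic representations cut out everything to the left of ε, and each of them has a
parameter and a point, so agreement can be tested on blocks. -/
theorem Separates.ext (S : Separates π ψ W IsRho IsPoint z) {Y Y' : MonoidAlgebra Qbar H}
    (hY : Y * epsU (π.comp (uGL F)) = Y) (hY' : Y' * epsU (π.comp (uGL F)) = Y')
    (h : ∀ x V t, IsRho x V → IsPoint x t → idemChi V * Y = idemChi V * Y') : Y = Y' := by
  rw [← sub_eq_zero]
  refine eq_zero_of_generic S.ne_one (by rw [sub_mul, hY, hY']) fun V hV hg => ?_
  obtain ⟨x, hx⟩ := S.exists_rho V hV hg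
  obtain ⟨t, ht⟩ := S.exists_point hx
  rw [mul_sub, h x V t hx ht, sub_self]

theorem evalAt_eq_zero_of_mem_frobIdeal (S : Separates π ψ W IsRho IsPoint z) {x : Hd}
    {t : Multiplicative X →* Qbarˣ} (ht : IsPoint x t) {f : invariants W}
    (hf : f ∈ frobIdeal W (Fintype.card F)) : evalAt t (f : AddMonoidAlgebra ℤ X) = 0 := by
  let ev : invariants W →+* Qbar :=
    ((AddMonoidAlgebra.lift ℤ Qbar X ((Units.coeHom Qbar).comp t)).comp (invariants W).val).toRingHom
  suffices h : frobIdeal W (Fintype.card F) ≤ RingHom.ker ev from h hf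
  rw [frobIdeal, Ideal.span_le]
  rintro g ⟨f, hf⟩
  change evalAt t (g : AddMonoidAlgebra ℤ X) = 0
  rw [hf, sub_eq_add_neg, evalAt_add, S.frob ht f f.2]
  rw [← neg_one_mul, evalAt_mul]
  have : evalAt t (-1) = -1 := by
    unfold evalAt
    rw [map_neg, map_one]
  rw [this, neg_one_mul, add_neg_cancel]

/-- The map z is defined only linearly. On the generic blocks it acts by evaluation at points, which
is multiplicative, and ε restricts the comparison to these blocks. -/
theorem Separates.mul_epsU (S : Separates π ψ W IsRho IsPoint z) {f g : AddMonoidAlgebra ℤ X}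
    (hf : f ∈ invariants W) (hg : g ∈ invariants W) :
    z f * (z g * epsU (π.comp (uGL F))) = z (f * g) * epsU (π.comp (uGL F)) := by
  refine S.ext ?_ ?_ fun x V t hx ht => ?_
  · rw [mul_assoc, mul_assoc, epsU_mul_self]
  · rw [mul_assoc, epsU_mul_self]
  · have e : idemChi V * (z f * (z g * epsU (π.comp (uGL F)))) =
        idemChi V * z f * z g * epsU (π.comp (uGL F)) := by simp only [mul_assoc]
    rw [e, S.eigen hx ht f hf, smul_mul_assoc, S.eigen hx ht g hg, smul_smul, ← evalAt_mul,
      ← mul_assoc, S.eigen hx ht _ (mul_mem hf hg)]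

theorem Separates.one_epsU (S : Separates π ψ W IsRho IsPoint z) :
    z 1 * epsU (π.comp (uGL F)) = epsU (π.comp (uGL F)) := by
  refine S.ext ?_ (epsU_mul_self _) fun x V t hx ht => ?_
  · rw [mul_assoc, epsU_mul_self]
  · rw [← mul_assoc, S.eigen hx ht 1 (one_mem _)]
    have : evalAt t 1 = 1 := by
      unfold evalAt
      rw [map_one]
    rw [this, one_smul]

theorem DualDatum.mono_mem (D : DualDatum pr s W) (a b : ℕ) :
    symElt pr ^ a * detElt pr ^ b ∈ invariants W :=
  mul_mem (pow_mem D.symElt_mem a) (pow_mem (D.const_mem 1) b)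

/-- The coefficients of a combination of the monomials are controlled by its products with the
monomials. -/
theorem Separates.coeff_mem [Fact p.Prime] [CharP F p] (S : Separates π ψ W IsRho IsPoint z)
    (D : DualDatum pr s W) (hz : ∀ mu, z (AddMonoidAlgebra.single (pr mu) 1) = zElt π ι mu) {r : ℕ}
    (hr : IsScalarOrder π r) (x : ℕ → ℕ → Qbar) {Y : MonoidAlgebra Qbar H}
    (hY : Y = ∑ i ∈ Finset.range (Fintype.card F), ∑ j ∈ Finset.range r,
      x i j • (z (symElt pr ^ i * detElt pr ^ j) * epsU (π.comp (uGL F)))) (T : AddSubgroup Qbar)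
    (hT : ∀ k < Fintype.card F, ∀ l < r, (Fintype.card F : Qbar) *
      (Y * z (symElt pr ^ k * detElt pr ^ l)).coeff (π (lowerUni F)) ∈ T) :
    ∀ i < Fintype.card F, ∀ j < r, x i j ∈ T := by
  -- The Gram entries are integers even outside the range a < q where they are known, since q z(f)
  -- has integral coefficients; `mem_of_gram` needs this for the uncontrolled rows.
  have hex : ∀ a b : ℕ, ∃ n : ℤ, (n : Qbar) =
      (Fintype.card F : Qbar) * (z (symElt pr ^ a * detElt pr ^ b)).coeff (π (lowerUni F)) := by
    intro a b
    obtain ⟨c, -, hc⟩ := exists_central S.surj D hz (D.mono_mem a b)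
    refine ⟨c.coeff (π (lowerUni F)), ?_⟩
    have := congrArg (fun y : MonoidAlgebra Qbar H => y.coeff (π (lowerUni F))) hc
    simp only [← Nat.cast_smul_eq_nsmul Qbar, MonoidAlgebra.coeff_smul_apply, smul_eq_mul] at this
    rw [← this, ← toQ, toQ_coeff]
  choose g hg using hex
  refine mem_of_gram (g := g) hr.pos (fun a b ha => ?_) x T fun k hk l hl => ?_
  · have := (hg a b).trans (coeff_lowerUni_mono hr hz ha b)
    split_ifs at this ⊢ <;> exact_mod_cast this
  · have h1 := hT k hk l hl
    convert h1 using 1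
    rw [hY, Finset.sum_mul, MonoidAlgebra.coeff_sum, Finset.sum_apply', Finset.mul_sum]
    refine Finset.sum_congr rfl fun i _ => ?_
    rw [Finset.sum_mul, MonoidAlgebra.coeff_sum, Finset.sum_apply', Finset.mul_sum]
    refine Finset.sum_congr rfl fun j _ => ?_
    have h2 : (z (symElt pr ^ i * detElt pr ^ j) * epsU (π.comp (uGL F))) *
        z (symElt pr ^ k * detElt pr ^ l) =
        z (symElt pr ^ (i + k) * detElt pr ^ (j + l)) * epsU (π.comp (uGL F)) := by
      rw [← S.comm, S.mul_epsU (D.mono_mem _ _) (D.mono_mem _ _)]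
      congr 2
      ring
    rw [smul_mul_assoc, h2, MonoidAlgebra.coeff_smul_apply, coeff_lowerUni_mul_epsU hr D hz,
      smul_eq_mul, mul_left_comm, ← hg, zsmul_eq_mul, mul_comm]

omit [Finite H] in
theorem epsU_comm_dg (b : Fˣ) : MonoidAlgebra.single (π (dg b 1)) (1 : Qbar) * epsU (π.comp (uGL F)) =
    epsU (π.comp (uGL F)) * MonoidAlgebra.single (π (dg b 1)) 1 := by
  have h := conj_idemPsi (π := π) b (1 : AddChar F Qbar)
  have h1 : (1 : AddChar F Qbar).mulShift ((b⁻¹ : Fˣ) : F) = 1 := by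
    ext x
    rw [AddChar.mulShift_apply, AddChar.one_apply, AddChar.one_apply]
  rw [h1] at h
  have h2 := congrArg (· * MonoidAlgebra.single (π (dg b 1)) (1 : Qbar)) h
  simp only [mul_assoc, MonoidAlgebra.single_mul_single, inv_mul_cancel, mul_one] at h2
  rw [← MonoidAlgebra.one_def, mul_one] at h2
  rw [epsU, mul_sub, sub_mul, h2, mul_one, one_mul]

omit [Finite H] in
theorem epsU_comm_uni (a : F) : MonoidAlgebra.single (π (uni a)) (1 : Qbar) * epsU (π.comp (uGL F)) =
    epsU (π.comp (uGL F)) * MonoidAlgebra.single (π (uni a)) 1 := by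
  have h1 := of_mul_idemPsi (π.comp (uGL F)) 1 a
  have h2 := idemPsi_mul_of (π.comp (uGL F)) 1 a
  have h3 := h1.trans h2.symm
  rw [epsU, mul_sub, sub_mul, mul_one, one_mul]
  congr 1

/-- Elements of the commutant of the Borel subgroup are combinations of the monomials. -/
theorem Separates.exists_coeff [Fact p.Prime] [CharP F p] (S : Separates π ψ W IsRho IsPoint z)
    (D : DualDatum pr s W) (hz : ∀ mu, z (AddMonoidAlgebra.single (pr mu) 1) = zElt π ι mu) {r : ℕ}
    (hr : IsScalarOrder π r) {Y : MonoidAlgebra Qbar H} (hY : Y * epsU (π.comp (uGL F)) = Y)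
    (hdg : ∀ b : Fˣ, MonoidAlgebra.single (π (dg b 1)) 1 * Y =
      Y * MonoidAlgebra.single (π (dg b 1)) 1)
    (huni : ∀ a : F, MonoidAlgebra.single (π (uni a)) 1 * Y =
      Y * MonoidAlgebra.single (π (uni a)) 1) :
    ∃ x : ℕ → ℕ → Qbar, Y = ∑ i ∈ Finset.range (Fintype.card F), ∑ j ∈ Finset.range r,
      x i j • (z (symElt pr ^ i * detElt pr ^ j) * epsU (π.comp (uGL F))) := by
  classical
  let x' : (Fin (Fintype.card F) × Fin r → Qbar) → ℕ → ℕ → Qbar := fun v i j =>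
    if h : i < Fintype.card F ∧ j < r then v (⟨i, h.1⟩, ⟨j, h.2⟩) else 0
  let e := idemPsi (π.comp (uGL F)) ψ
  let L : (Fin (Fintype.card F) × Fin r → Qbar) →ₗ[Qbar] MonoidAlgebra Qbar H :=
    Fintype.linearCombination Qbar fun ij =>
      z (symElt pr ^ (ij.1 : ℕ) * detElt pr ^ (ij.2 : ℕ)) * epsU (π.comp (uGL F))
  have hL : ∀ v, L v = ∑ i ∈ Finset.range (Fintype.card F), ∑ j ∈ Finset.range r,
      x' v i j • (z (symElt pr ^ i * detElt pr ^ j) * epsU (π.comp (uGL F))) := by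
    intro v
    rw [Fintype.linearCombination_apply, Fintype.sum_prod_type, Finset.sum_range]
    refine Finset.sum_congr rfl fun i _ => ?_
    rw [Finset.sum_range]
    refine Finset.sum_congr rfl fun j _ => ?_
    simp only [x', i.2, j.2, and_self, dif_pos]
  have hLeps : ∀ v, L v * epsU (π.comp (uGL F)) = L v := by
    intro v
    rw [Fintype.linearCombination_apply, Finset.sum_mul]
    refine Finset.sum_congr rfl fun ij _ => ?_
    rw [smul_mul_assoc, mul_assoc, epsU_mul_self]
  have hLcomm : ∀ v h, MonoidAlgebra.single h (1 : Qbar) * epsU (π.comp (uGL F)) =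
      epsU (π.comp (uGL F)) * MonoidAlgebra.single h 1 →
      MonoidAlgebra.single h (1 : Qbar) * L v = L v * MonoidAlgebra.single h 1 := by
    intro v h hh
    rw [Fintype.linearCombination_apply, Finset.sum_mul, Finset.mul_sum]
    refine Finset.sum_congr rfl fun ij _ => ?_
    rw [smul_mul_assoc, mul_smul_comm, ← mul_assoc, ← S.comm, mul_assoc, mul_assoc, hh]
  have key : ∀ v, (Y - L v) * e = 0 → Y = L v := by
    intro v hv
    rw [← sub_eq_zero]
    have h1 : (Y - L v) * epsU (π.comp (uGL F)) = Y - L v := by rw [sub_mul, hY, hLeps]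
    rw [← h1]
    refine mul_epsU_eq_zero S.ne_one (fun b => ?_) hv
    rw [mul_sub, sub_mul, hdg, hLcomm v _ (epsU_comm_dg b)]
  let L' : (Fin (Fintype.card F) × Fin r → Qbar) →ₗ[Qbar] MonoidAlgebra Qbar H :=
    (LinearMap.mulRight Qbar e).comp L
  -- An element of the span that dies under e_ψ dies under ε, hence is zero, and the Gram matrix
  -- with the trivial subgroup as target then kills its coefficients.
  have hinj : Function.Injective L' := by
    rw [injective_iff_map_eq_zero]
    intro v hv
    have h0 : L v = 0 := by
      rw [← hLeps]
      exact mul_epsU_eq_zero S.ne_one (fun b => hLcomm v _ (epsU_comm_dg b)) hv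
    have h1 := S.coeff_mem D hz hr (x' v) (Y := 0) (by rw [← hL, h0]) ⊥ (fun k _ l _ => by simp)
    funext ij
    have h2 := h1 ij.1 ij.1.2 ij.2 ij.2.2
    simpa [x'] using h2
  have hu : ∀ y : MonoidAlgebra Qbar H, (∀ a : F, MonoidAlgebra.single (π (uni a)) 1 * y =
      y * MonoidAlgebra.single (π (uni a)) 1) → e * y = y * e := by
    intro y hy
    simp only [e, idemPsi, smul_mul_assoc, mul_smul_comm, Finset.sum_mul, Finset.mul_sum]
    congr 1
    exact Finset.sum_congr rfl fun a _ => congrArg _ (hy a)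
  have hmem : ∀ y : MonoidAlgebra Qbar H, (∀ a : F, MonoidAlgebra.single (π (uni a)) 1 * y =
      y * MonoidAlgebra.single (π (uni a)) 1) →
      y * e ∈ Submodule.span Qbar (Set.range (cornerElt π ψ)) := by
    intro y hy
    have h1 : y * e = e * y * e := by
      rw [hu y hy, mul_assoc]
      exact congrArg _ (idemPsi_mul_self _ _).symm
    rw [h1]
    exact corner_mem_span y
  have hle : LinearMap.range L' ≤ Submodule.span Qbar (Set.range (cornerElt π ψ)) := by
    rintro _ ⟨v, rfl⟩
    exact hmem _ fun a => hLcomm v _ (epsU_comm_uni a)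
  -- The qr independent monomials fill the corner span, whose dimension is at most qr.
  have heq := Submodule.eq_of_le_of_finrank_le hle (by
    rw [LinearMap.finrank_range_of_inj hinj, Module.finrank_fintype_fun_eq_card, Fintype.card_prod,
      Fintype.card_fin, Fintype.card_fin]
    exact finrank_corner_le S.surj S.ne_one hr)
  have hYe := hmem Y huni
  rw [← heq] at hYe
  obtain ⟨v, hv⟩ := hYe
  refine ⟨x' v, ?_⟩
  rw [← hL]
  refine key v ?_
  rw [sub_mul, sub_eq_zero]
  exact hv.symm

end Comparison


/-! ### Generators of `B` -/

section SpanB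

variable {X : Type} [AddCommGroup X] {pr : (Fin 2 → ℤ) →+ X} {s : X →+ X} {W : Set (X →+ X)}
  {q : ℕ}

instance : CommRing (BAlg W q) := Ideal.Quotient.commRing _

instance : Ring (BAlg W q) := Ideal.Quotient.instRingQuotient _

instance : Semiring (BAlg W q) := Ideal.Quotient.semiring _

instance : Algebra ℤ (BAlg W q) := Ideal.instAlgebraQuotient ℤ _

/-- The class of `x₀ + x₁` in `B`. -/
def DualDatum.sym (D : DualDatum pr s W) (q : ℕ) : BAlg W q :=
  Ideal.Quotient.mk _ ⟨symElt pr, D.symElt_mem⟩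

/-- The class of `(x₀ x₁)^m` in `B`. -/
def DualDatum.const (D : DualDatum pr s W) (q : ℕ) (m : ℤ) : BAlg W q :=
  Ideal.Quotient.mk _ ⟨AddMonoidAlgebra.single (pr ![m, m]) 1, D.const_mem m⟩

theorem powSum_mem (D : DualDatum pr s W) (n : ℕ) :
    AddMonoidAlgebra.single (pr ![1, 0]) (1 : ℤ) ^ n + AddMonoidAlgebra.single (pr ![0, 1]) 1 ^ n ∈
      invariants W := by
  have h := D.orbit_mem ![n, 0]
  convert h using 2
  · rw [AddMonoidAlgebra.single_pow, ← map_nsmul, one_pow]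
    congr 2
    funext i
    fin_cases i <;> simp
  · rw [AddMonoidAlgebra.single_pow, ← map_nsmul, one_pow]
    congr 2
    funext i
    fin_cases i <;> simp

/-- The class of `x₀^n + x₁^n` in `B`. -/
def DualDatum.powSum (D : DualDatum pr s W) (q n : ℕ) : BAlg W q :=
  Ideal.Quotient.mk _ ⟨_, powSum_mem D n⟩

theorem DualDatum.const_add (D : DualDatum pr s W) (m n : ℤ) :
    D.const q (m + n) = D.const q m * D.const q n := by
  rw [DualDatum.const, DualDatum.const, DualDatum.const, ← map_mul]
  congr 1
  apply Subtype.ext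
  change AddMonoidAlgebra.single (pr ![m + n, m + n]) (1 : ℤ) =
    AddMonoidAlgebra.single (pr ![m, m]) (1 : ℤ) * AddMonoidAlgebra.single (pr ![n, n]) 1
  rw [AddMonoidAlgebra.single_mul_single, ← map_add, mul_one]
  congr 2
  funext i
  fin_cases i <;> simp

theorem DualDatum.const_zero (D : DualDatum pr s W) : D.const q 0 = 1 := by
  rw [DualDatum.const, ← map_one (Ideal.Quotient.mk _)]
  congr 1
  apply Subtype.ext
  change AddMonoidAlgebra.single (pr ![0, 0]) (1 : ℤ) = 1
  have : (![0, 0] : Fin 2 → ℤ) = 0 := by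
    funext i; fin_cases i <;> rfl
  rw [this, map_zero]
  rfl

theorem mk_eq_of_frob {f g : invariants W} (h : (g : AddMonoidAlgebra ℤ X) =
    AddMonoidAlgebra.mapDomainAlgHom ℤ ℤ (nsmulAddMonoidHom q : X →+ X) f) :
    Ideal.Quotient.mk (frobIdeal W q) g = Ideal.Quotient.mk _ f := by
  rw [Ideal.Quotient.eq]
  refine Ideal.subset_span ⟨f, ?_⟩
  rw [← h]
  rfl

theorem DualDatum.const_card_mul (D : DualDatum pr s W) (m : ℤ) :
    D.const q (q * m) = D.const q m := by
  refine mk_eq_of_frob ?_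
  rw [AddMonoidAlgebra.mapDomainAlgHom_apply, AddMonoidAlgebra.mapDomain_single]
  change AddMonoidAlgebra.single (pr ![q * m, q * m]) (1 : ℤ) =
    AddMonoidAlgebra.single (q • pr ![m, m]) 1
  rw [← map_nsmul]
  congr 2
  funext i
  fin_cases i <;> simp

/-- The defining relation of B for x₀ + x₁; through Newton's recursion it becomes a monic equation
of degree q for σ. -/
theorem DualDatum.powSum_card (D : DualDatum pr s W) : D.powSum q q = D.sym q := by
  refine mk_eq_of_frob ?_
  change AddMonoidAlgebra.single (pr ![1, 0]) (1 : ℤ) ^ q + AddMonoidAlgebra.single (pr ![0, 1]) 1 ^ q =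
    AddMonoidAlgebra.mapDomainAlgHom ℤ ℤ (nsmulAddMonoidHom q : X →+ X) (symElt pr)
  rw [symElt, map_add, AddMonoidAlgebra.mapDomainAlgHom_apply,
    AddMonoidAlgebra.mapDomainAlgHom_apply, AddMonoidAlgebra.mapDomain_single,
    AddMonoidAlgebra.mapDomain_single, AddMonoidAlgebra.single_pow, AddMonoidAlgebra.single_pow,
    one_pow]
  rfl

theorem DualDatum.powSum_zero (D : DualDatum pr s W) : D.powSum q 0 = 2 := by
  have h : D.powSum q 0 = Ideal.Quotient.mk _ (1 + 1) := by
    rw [DualDatum.powSum]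
    congr 1
  rw [h, map_add, map_one, one_add_one_eq_two]

theorem DualDatum.powSum_one (D : DualDatum pr s W) : D.powSum q 1 = D.sym q := by
  rw [DualDatum.powSum, DualDatum.sym]
  congr 1
  apply Subtype.ext
  simp [symElt]

theorem DualDatum.powSum_add_two (D : DualDatum pr s W) (n : ℕ) :
    D.powSum q (n + 2) = D.sym q * D.powSum q (n + 1) - D.const q 1 * D.powSum q n := by
  rw [DualDatum.powSum, DualDatum.powSum, DualDatum.powSum, DualDatum.sym, DualDatum.const,
    ← map_mul, ← map_mul, ← map_sub]
  congr 1
  apply Subtype.ext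
  have e : AddMonoidAlgebra.single (pr ![1, 1]) (1 : ℤ) =
      AddMonoidAlgebra.single (pr ![1, 0]) 1 * AddMonoidAlgebra.single (pr ![0, 1]) 1 := by
    rw [AddMonoidAlgebra.single_mul_single, ← map_add, mul_one]
    congr 2
    funext i
    fin_cases i <;> simp
  change _ = symElt pr * _ - AddMonoidAlgebra.single (pr ![1, 1]) (1 : ℤ) * _
  rw [e, symElt]
  ring

theorem DualDatum.const_emod (D : DualDatum pr s W) {r : ℕ} (h : D.const q r = 1) (m : ℤ) :
    D.const q m = D.const q (m % r) := by
  have h1 : ∀ n : ℕ, D.const q (r * n) = 1 := by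
    intro n
    induction n with
    | zero => rw [Nat.cast_zero, mul_zero, D.const_zero]
    | succ n ih => rw [Nat.cast_succ, mul_add, D.const_add, ih, mul_one, h, mul_one]
  have h2 : ∀ n : ℤ, D.const q (r * n) = 1 := by
    intro n
    obtain ⟨n, rfl | rfl⟩ := n.eq_nat_or_neg
    · exact h1 n
    · have := D.const_add (q := q) (r * n) (r * -n)
      rwa [mul_neg, add_neg_cancel, D.const_zero, h1, one_mul, eq_comm, ← mul_neg] at this
  conv_lhs => rw [← Int.mul_ediv_add_emod m r, D.const_add, h2, one_mul]

/-- A subgroup stable under a Newton recursion is spanned by monomials. -/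
theorem exists_newton_subgroup {R : Type*} [CommRing R] {σ : R} {δ : ℤ → R} {P : ℕ → R} {q r : ℕ}
    (hq : 1 < q) (hr : 0 < r) (h0 : δ 0 = 1) (hadd : ∀ m n, δ (m + n) = δ m * δ n)
    (hmod : ∀ m, δ m = δ (m % r)) (hP0 : P 0 = 2) (hP1 : P 1 = σ)
    (hP : ∀ n, P (n + 2) = σ * P (n + 1) - δ 1 * P n) (hPq : P q = σ) :
    ∃ S : AddSubgroup R, (∀ m n, δ m * P n ∈ S) ∧ (∀ m, δ m ∈ S) ∧ ∀ x ∈ S, ∃ c : ℕ → ℕ → ℤ,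
      x = ∑ i ∈ Finset.range q, ∑ j ∈ Finset.range r, (c i j : R) * (σ ^ i * δ 1 ^ j) := by
  let M : ℕ → Submodule ℤ R := fun n =>
    Submodule.span ℤ {x | ∃ (i : ℕ) (m : ℤ), i < n ∧ x = σ ^ i * δ m}
  have hM : ∀ {n} i m, i < n → σ ^ i * δ m ∈ M n := fun i m hi =>
    Submodule.subset_span ⟨i, m, hi, rfl⟩
  have hmono : ∀ {m n}, m ≤ n → M m ≤ M n := by
    intro m n hmn
    refine Submodule.span_mono ?_
    rintro x ⟨i, l, hi, rfl⟩
    exact ⟨i, l, by omega, rfl⟩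
  have hconst : ∀ {n} m x, x ∈ M n → δ m * x ∈ M n := by
    intro n m x hx
    induction hx using Submodule.span_induction with
    | zero => rw [mul_zero]; exact zero_mem _
    | add x y _ _ hx hy => rw [mul_add]; exact add_mem hx hy
    | smul a x _ hx => rw [mul_smul_comm]; exact Submodule.smul_mem _ a hx
    | mem x hx =>
      obtain ⟨i, l, hi, rfl⟩ := hx
      rw [mul_left_comm, ← hadd]
      exact hM i _ hi
  have hsym : ∀ {n} x, x ∈ M n → σ * x ∈ M (n + 1) := by
    intro n x hx
    induction hx using Submodule.span_induction with
    | zero => rw [mul_zero]; exact zero_mem _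
    | add x y _ _ hx hy => rw [mul_add]; exact add_mem hx hy
    | smul a x _ hx => rw [mul_smul_comm]; exact Submodule.smul_mem _ a hx
    | mem x hx =>
      obtain ⟨i, l, hi, rfl⟩ := hx
      rw [← mul_assoc, ← pow_succ']
      exact hM _ _ (by omega)
  have hpowmem : ∀ {n} i, i < n → σ ^ i ∈ M n := by
    intro n i hi
    have := hM (n := n) i 0 hi
    rwa [h0, mul_one] at this
  have hpow : ∀ n, P n ∈ M (n + 1) ∧ P (n + 1) - σ ^ (n + 1) ∈ M (n + 1) := by
    intro n
    induction n with
    | zero =>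
      rw [hP0, hP1, pow_one, sub_self]
      refine ⟨?_, zero_mem _⟩
      have := (M 1).smul_mem 2 (hpowmem 0 Nat.one_pos)
      rw [pow_zero] at this
      convert this using 1
      rw [two_smul, one_add_one_eq_two]
    | succ n ih =>
      constructor
      · have := add_mem (hmono (Nat.le_succ _) ih.2) (hpowmem (n + 1) (Nat.lt_succ_self (n + 1)))
        rwa [sub_add_cancel] at this
      · have h1 := hsym _ ih.2
        have h2 := hmono (Nat.le_succ _) (hconst 1 _ ih.1)
        have e : P (n + 1 + 1) - σ ^ (n + 1 + 1) =
            σ * (P (n + 1) - σ ^ (n + 1)) - δ 1 * P n := by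
          rw [show n + 1 + 1 = n + 2 from rfl, hP]
          ring
        rw [e]
        exact sub_mem h1 h2
  -- The power sum P_q equals σ^q plus terms of lower degree in σ, and it also equals σ; this
  -- expresses σ^q in lower degrees.
  have hq0 : σ ^ q ∈ M q := by
    have h1 := (hpow (q - 1)).2
    rw [Nat.sub_add_cancel hq.le, hPq] at h1
    have h2 := hpowmem 1 hq
    rw [pow_one] at h2
    have h3 := sub_mem h2 h1
    rwa [sub_sub_cancel] at h3
  have hsymq : ∀ x ∈ M q, σ * x ∈ M q := by
    intro x hx
    induction hx using Submodule.span_induction with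
    | zero => rw [mul_zero]; exact zero_mem _
    | add x y _ _ hx hy => rw [mul_add]; exact add_mem hx hy
    | smul a x _ hx => rw [mul_smul_comm]; exact Submodule.smul_mem _ a hx
    | mem x hx =>
      obtain ⟨i, l, hi, rfl⟩ := hx
      rw [← mul_assoc, ← pow_succ']
      by_cases hiq : i + 1 = q
      · rw [hiq, mul_comm]
        exact hconst _ _ hq0
      · exact hM _ _ (by omega)
  have hpowq : ∀ n, P n ∈ M q ∧ P (n + 1) ∈ M q := by
    intro n
    induction n with
    | zero =>
      refine ⟨hmono (by omega) (hpow 0).1, hmono (by omega) (hpow 1).1⟩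
    | succ n ih =>
      refine ⟨ih.2, ?_⟩
      rw [show n + 1 + 1 = n + 2 from rfl, hP]
      exact sub_mem (hsymq _ ih.2) (hconst _ _ ih.1)
  refine ⟨(M q).toAddSubgroup, fun m n => hconst m _ (hpowq n).1, fun m => ?_, fun x hx => ?_⟩
  · have := hM (n := q) 0 m (by omega)
    rwa [pow_zero, one_mul] at this
  have hpow1 : ∀ n : ℕ, δ 1 ^ n = δ n := by
    intro n
    induction n with
    | zero => rw [pow_zero, Nat.cast_zero, h0]
    | succ n ih => rw [pow_succ, ih, Nat.cast_succ, hadd]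
  change x ∈ M q at hx
  induction hx using Submodule.span_induction with
  | zero => exact ⟨0, by simp⟩
  | add x y _ _ hx hy =>
    obtain ⟨c, rfl⟩ := hx
    obtain ⟨d, rfl⟩ := hy
    refine ⟨c + d, ?_⟩
    simp only [Pi.add_apply, Int.cast_add, add_mul, Finset.sum_add_distrib]
  | smul a x _ hx =>
    obtain ⟨c, rfl⟩ := hx
    refine ⟨a • c, ?_⟩
    simp only [Pi.smul_apply, Finset.smul_sum, smul_eq_mul, Int.cast_mul, zsmul_eq_mul, mul_assoc]
  | mem x hx =>
    obtain ⟨i, m, hi, rfl⟩ := hx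
    obtain ⟨l, hl⟩ : ∃ l : ℕ, m % r = l := ⟨(m % r).toNat, by
      rw [Int.toNat_of_nonneg (Int.emod_nonneg _ (by omega))]⟩
    have hlr : l < r := by
      have := Int.emod_lt_of_pos m (b := (r : ℤ)) (by omega)
      omega
    refine ⟨fun i' j' => if i' = i ∧ j' = l then 1 else 0, ?_⟩
    rw [Finset.sum_eq_single_of_mem i (Finset.mem_range.mpr hi),
      Finset.sum_eq_single_of_mem l (Finset.mem_range.mpr hlr)]
    · simp only [true_and, if_true]
      rw [Int.cast_one, one_mul, hpow1, hmod, hl]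
    · intro j _ hj
      simp [hj]
    · intro j _ hj
      refine Finset.sum_eq_zero fun l _ => ?_
      simp [hj]

/-- The monomials span `B`. -/
theorem DualDatum.exists_eq_sum (D : DualDatum pr s W) (hq : 1 < q) {r : ℕ} (hr : 0 < r)
    (h : D.const q r = 1) (b : BAlg W q) : ∃ c : ℕ → ℕ → ℤ,
      b = ∑ i ∈ Finset.range q, ∑ j ∈ Finset.range r,
        (c i j : BAlg W q) * (D.sym q ^ i * D.const q 1 ^ j) := by
  obtain ⟨S, h1, h2, h3⟩ := exists_newton_subgroup hq hr D.const_zero D.const_add (D.const_emod h)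
    D.powSum_zero D.powSum_one D.powSum_add_two D.powSum_card
  refine h3 b ?_
  obtain ⟨f, rfl⟩ := Ideal.Quotient.mk_surjective b
  let T : AddSubgroup (AddMonoidAlgebra ℤ X) :=
    (S.comap (Ideal.Quotient.mk (frobIdeal W q)).toAddMonoidHom).map
      (invariants W).val.toRingHom.toAddMonoidHom
  have hT : (f : AddMonoidAlgebra ℤ X) ∈ T := by
    refine D.mem_of_orbits T ?_ ?_ f.2
    · intro mu hmu
      refine ⟨⟨_, D.orbit_mem mu⟩, ?_, rfl⟩
      change Ideal.Quotient.mk (frobIdeal W q) _ ∈ S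
      obtain ⟨n, hn⟩ : ∃ n : ℕ, mu 0 = mu 1 + n := ⟨(mu 0 - mu 1).toNat, by omega⟩
      -- The orbit sum is (x₀x₁)^(mu 1) times the power sum of degree mu 0 - mu 1.
      convert h1 (mu 1) n using 1
      rw [DualDatum.const, DualDatum.powSum, ← map_mul]
      congr 1
      apply Subtype.ext
      change AddMonoidAlgebra.single (pr mu) (1 : ℤ) +
        AddMonoidAlgebra.single (pr (mu ∘ Equiv.swap 0 1)) 1 =
        AddMonoidAlgebra.single (pr ![mu 1, mu 1]) (1 : ℤ) *
        (AddMonoidAlgebra.single (pr ![1, 0]) (1 : ℤ) ^ n +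
          AddMonoidAlgebra.single (pr ![0, 1]) 1 ^ n)
      rw [AddMonoidAlgebra.single_pow, AddMonoidAlgebra.single_pow, one_pow, mul_add,
        AddMonoidAlgebra.single_mul_single, AddMonoidAlgebra.single_mul_single, ← map_nsmul,
        ← map_nsmul, ← map_add, ← map_add, mul_one]
      congr 3
      · funext i
        fin_cases i <;> simp [hn]
      · funext i
        fin_cases i <;> simp [hn]
    · intro m
      exact ⟨⟨_, D.const_mem m⟩, h2 m, rfl⟩
  obtain ⟨f', hf', he⟩ := hT
  have : f' = f := Subtype.ext he
  rw [← this]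
  exact hf'

/-- The relation `d^r = 1`. -/
theorem DualDatum.const_eq_one (D : DualDatum pr s W) (hq : 1 < q) {r : ℕ}
    (h : r + 1 = q ∨ (r = 1 ∧ pr ![1, 1] = 0)) : D.const q r = 1 := by
  rcases h with rfl | ⟨rfl, h⟩
  · have h1 := D.const_card_mul (q := r + 1) 1
    have h2 := D.const_add (q := r + 1) r 1
    have h3 := D.const_add (q := r + 1) 1 (-1)
    rw [add_neg_cancel, D.const_zero] at h3
    rw [mul_one, Nat.cast_succ, h2] at h1
    -- For GL₂ the Frobenius relation reads δ^q = δ, and δ is invertible.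
    calc D.const (r + 1) r = D.const (r + 1) r * D.const (r + 1) 1 * D.const (r + 1) (-1) := by
          rw [mul_assoc, ← h3, mul_one]
      _ = 1 := by rw [h1, ← h3]
  · rw [← D.const_zero, DualDatum.const, DualDatum.const]
    congr 1
    apply Subtype.ext
    change AddMonoidAlgebra.single (pr ![((1 : ℕ) : ℤ), ((1 : ℕ) : ℤ)]) (1 : ℤ) =
      AddMonoidAlgebra.single (pr ![0, 0]) 1
    have : (![0, 0] : Fin 2 → ℤ) = 0 := by
      funext i; fin_cases i <;> rfl
    rw [Nat.cast_one, h, this, map_zero]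

end SpanB


/-! ### The embeddings of `B` -/

section EtaB

variable {p : ℕ} {F k : Type} [Field F] [Fintype F] [Field k]
  [Algebra F k] {H Hd : Type} [Group H] [Finite H] {π : GL (Fin 2) F →* H}
  {ι : Additive kˣ ≃+ QModZ p}
  {X : Type} [AddCommGroup X] {pr : (Fin 2 → ℤ) →+ X} {s : X →+ X} {W : Set (X →+ X)}
  {z : AddMonoidAlgebra ℤ X →ₗ[ℤ] MonoidAlgebra Qbar H} {ψ : AddChar F Qbar}
  {IsRho : Hd → FDRep Qbar H → Prop} {IsPoint : Hd → (Multiplicative X →* Qbarˣ) → Prop}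

/-- The points that come from constituents of the Gelfand-Graev representation. -/
abbrev PointIndex (IsRho : Hd → FDRep Qbar H → Prop)
    (IsPoint : Hd → (Multiplicative X →* Qbarˣ) → Prop) : Type :=
  {i : Hd × (Multiplicative X →* Qbarˣ) // IsPoint i.1 i.2 ∧ ∃ V, IsRho i.1 V}

/-- The values of the elements of `B` at the points. -/
def evalB (S : Separates π ψ W IsRho IsPoint z) :
    BAlg W (Fintype.card F) →+* (PointIndex IsRho IsPoint → Qbar) :=
  Ideal.Quotient.lift _ (RingHom.pi fun i : PointIndex IsRho IsPoint =>
    ((AddMonoidAlgebra.lift ℤ Qbar X ((Units.coeHom Qbar).comp i.1.2)).toRingHom.comp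
      (invariants W).val.toRingHom))
    (fun _ hf => funext fun i => evalAt_eq_zero_of_mem_frobIdeal S i.2.1 hf)

theorem evalB_mk (S : Separates π ψ W IsRho IsPoint z) (f : invariants W)
    (i : PointIndex IsRho IsPoint) :
    evalB S (Ideal.Quotient.mk _ f) i = evalAt i.1.2 (f : AddMonoidAlgebra ℤ X) := rfl

/-- Values at points are the eigenvalues on generic blocks, and these determine an element of
Qbar[H]ε. -/
theorem eq_of_evalB_eq (S : Separates π ψ W IsRho IsPoint z) {f g : invariants W}
    (h : evalB S (Ideal.Quotient.mk _ f) = evalB S (Ideal.Quotient.mk _ g)) :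
    z f * epsU (π.comp (uGL F)) = z g * epsU (π.comp (uGL F)) := by
  refine S.ext (by rw [mul_assoc, epsU_mul_self]) (by rw [mul_assoc, epsU_mul_self])
    fun x V t hx ht => ?_
  have h1 := congrFun h ⟨(x, t), ht, V, hx⟩
  rw [evalB_mk, evalB_mk] at h1
  rw [← mul_assoc, ← mul_assoc, S.eigen hx ht f f.2, S.eigen hx ht g g.2, h1]

/-- A representative of an element of `B`. -/
def repB (b : BAlg W (Fintype.card F)) : invariants W :=
  Function.surjInv Ideal.Quotient.mk_surjective b

omit [Field F] in
theorem mk_repB (b : BAlg W (Fintype.card F)) : Ideal.Quotient.mk _ (repB b) = b :=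
  Function.surjInv_eq _ b

theorem z_eq_of_mk_eq (S : Separates π ψ W IsRho IsPoint z) {f g : invariants W}
    (h : Ideal.Quotient.mk (frobIdeal W (Fintype.card F)) f = Ideal.Quotient.mk _ g) :
    z f * epsU (π.comp (uGL F)) = z g * epsU (π.comp (uGL F)) :=
  eq_of_evalB_eq S (by rw [h])

/-- The embedding of `B` in `Qbar[H]`. -/
def etaB (S : Separates π ψ W IsRho IsPoint z) :
    BAlg W (Fintype.card F) →ₙₐ[ℤ] MonoidAlgebra Qbar H where
  toFun b := z (repB b) * epsU (π.comp (uGL F))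
  map_smul' n b := by
    rw [MonoidHom.id_apply, ← smul_mul_assoc, ← map_zsmul]
    refine z_eq_of_mk_eq S (g := n • repB b) ?_
    rw [mk_repB, map_zsmul, mk_repB]
  map_zero' := by
    rw [← zero_mul (epsU (π.comp (uGL F))), ← map_zero z]
    exact z_eq_of_mk_eq S (g := 0) (by rw [mk_repB, map_zero])
  map_add' a b := by
    rw [← add_mul, ← map_add]
    exact z_eq_of_mk_eq S (g := repB a + repB b) (by rw [mk_repB, map_add, mk_repB, mk_repB])
  map_mul' a b := by
    rw [mul_assoc, ← mul_assoc (epsU _), ← S.comm, mul_assoc (z _), epsU_mul_self,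
      S.mul_epsU (repB a).2 (repB b).2]
    exact z_eq_of_mk_eq S (g := repB a * repB b) (by rw [mk_repB, map_mul, mk_repB, mk_repB])

theorem etaB_mk (S : Separates π ψ W IsRho IsPoint z) (f : invariants W) :
    etaB S (Ideal.Quotient.mk _ f) = z f * epsU (π.comp (uGL F)) :=
  z_eq_of_mk_eq S (mk_repB _)

theorem etaB_one (S : Separates π ψ W IsRho IsPoint z) : etaB S 1 = epsU (π.comp (uGL F)) := by
  rw [← map_one (Ideal.Quotient.mk _), etaB_mk]
  exact S.one_epsU

theorem etaB_sym_const (S : Separates π ψ W IsRho IsPoint z) (D : DualDatum pr s W) (i j : ℕ) :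
    etaB S (D.sym _ ^ i * D.const _ 1 ^ j) =
      z (symElt pr ^ i * detElt pr ^ j) * epsU (π.comp (uGL F)) := by
  rw [DualDatum.sym, DualDatum.const, ← map_pow, ← map_pow, ← map_mul, etaB_mk]
  rfl

theorem etaB_sum (S : Separates π ψ W IsRho IsPoint z) (D : DualDatum pr s W) {r : ℕ}
    (c : ℕ → ℕ → ℤ) :
    etaB S (∑ i ∈ Finset.range (Fintype.card F), ∑ j ∈ Finset.range r,
      (c i j : BAlg W (Fintype.card F)) * (D.sym _ ^ i * D.const _ 1 ^ j)) =
    ∑ i ∈ Finset.range (Fintype.card F), ∑ j ∈ Finset.range r, (c i j : Qbar) •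
      (z (symElt pr ^ i * detElt pr ^ j) * epsU (π.comp (uGL F))) := by
  rw [map_sum]
  refine Finset.sum_congr rfl fun i _ => ?_
  rw [map_sum]
  refine Finset.sum_congr rfl fun j _ => ?_
  rw [← zsmul_eq_mul, map_zsmul, etaB_sym_const, Int.cast_smul_eq_zsmul]

variable [Fact p.Prime] [CharP F p]

/-- With the trivial subgroup as target, `Separates.coeff_mem` becomes the linear independence of
the monomials. -/
theorem coeff_eq_zero_of_sum_eq_zero (S : Separates π ψ W IsRho IsPoint z) (D : DualDatum pr s W)
    (hz : ∀ mu, z (AddMonoidAlgebra.single (pr mu) 1) = zElt π ι mu) {r : ℕ}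
    (hr : IsScalarOrder π r) {c : ℕ → ℕ → ℤ}
    (h : etaB S (∑ i ∈ Finset.range (Fintype.card F), ∑ j ∈ Finset.range r,
      (c i j : BAlg W (Fintype.card F)) * (D.sym _ ^ i * D.const _ 1 ^ j)) = 0) :
    ∀ i < Fintype.card F, ∀ j < r, c i j = 0 := by
  rw [etaB_sum] at h
  intro i hi j hj
  have h1 := S.coeff_mem D hz hr (fun i j => (c i j : Qbar)) h.symm ⊥ (by simp) i hi j hj
  rwa [AddSubgroup.mem_bot, Int.cast_eq_zero] at h1

theorem etaB_injective (S : Separates π ψ W IsRho IsPoint z) (D : DualDatum pr s W)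
    (hz : ∀ mu, z (AddMonoidAlgebra.single (pr mu) 1) = zElt π ι mu) {r : ℕ}
    (hr : IsScalarOrder π r) (hd : D.const (Fintype.card F) r = 1) :
    Function.Injective (etaB S) := by
  rw [injective_iff_map_eq_zero]
  intro b hb
  obtain ⟨c, rfl⟩ := D.exists_eq_sum Fintype.one_lt_card hr.pos hd b
  have h := coeff_eq_zero_of_sum_eq_zero S D hz hr hb
  refine Finset.sum_eq_zero fun i hi => Finset.sum_eq_zero fun j hj => ?_
  rw [h i (Finset.mem_range.mp hi) j (Finset.mem_range.mp hj), Int.cast_zero, zero_mul]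

theorem evalB_injective (S : Separates π ψ W IsRho IsPoint z) (D : DualDatum pr s W)
    (hz : ∀ mu, z (AddMonoidAlgebra.single (pr mu) 1) = zElt π ι mu) {r : ℕ}
    (hr : IsScalarOrder π r) (hd : D.const (Fintype.card F) r = 1) :
    Function.Injective (evalB S) := by
  intro a b hab
  apply etaB_injective S D hz hr hd
  obtain ⟨f, rfl⟩ := Ideal.Quotient.mk_surjective a
  obtain ⟨g, rfl⟩ := Ideal.Quotient.mk_surjective b
  rw [etaB_mk, etaB_mk]
  exact eq_of_evalB_eq S hab

omit [Fact p.Prime] in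
theorem exists_card_eq_pow : ∃ a : ℕ, Fintype.card F = p ^ a := by
  obtain ⟨n, -, hn⟩ := FiniteField.card F p
  exact ⟨n, hn⟩

theorem exists_smul_etaB_eq (S : Separates π ψ W IsRho IsPoint z) (D : DualDatum pr s W)
    (hz : ∀ mu, z (AddMonoidAlgebra.single (pr mu) 1) = zElt π ι mu)
    (b : BAlg W (Fintype.card F)) :
    ∃ (n : ℕ) (θ : EAlg (π.comp (uGL F))), p ^ n • etaB S b = etaE (π.comp (uGL F)) θ := by
  obtain ⟨a, ha⟩ := exists_card_eq_pow (p := p) (F := F)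
  obtain ⟨f, rfl⟩ := Ideal.Quotient.mk_surjective b
  obtain ⟨c, hc, h⟩ := exists_central S.surj D hz f.2
  obtain ⟨θ, hθ⟩ := exists_etaE_eq (u := π.comp (uGL F)) hc
  refine ⟨a, θ, ?_⟩
  rw [hθ, toQ, h, etaB_mk, ← ha, smul_mul_assoc]

/-- The numbers that become integers after multiplication by a power of `p`. -/
def pIntegers (p : ℕ) : AddSubgroup Qbar where
  carrier := {y | ∃ (n : ℕ) (m : ℤ), (p : Qbar) ^ n * y = m}
  zero_mem' := ⟨0, 0, by simp⟩
  neg_mem' := by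
    rintro y ⟨n, m, h⟩
    exact ⟨n, -m, by rw [mul_neg, h, Int.cast_neg]⟩
  add_mem' := by
    rintro x y ⟨n, m, h⟩ ⟨n', m', h'⟩
    refine ⟨n + n', p ^ n' * m + p ^ n * m', ?_⟩
    push_cast
    rw [← h, ← h']
    ring

/-- The element is a combination of the monomials over Qbar, and its coefficients are governed by
its products with the monomials. Those have p-power denominators, both factors becoming integral
after multiplication by q; inverting the unimodular Gram matrix creates no new ones. -/
theorem exists_smul_etaE_eq (S : Separates π ψ W IsRho IsPoint z) (D : DualDatum pr s W)
    (hz : ∀ mu, z (AddMonoidAlgebra.single (pr mu) 1) = zElt π ι mu) {r : ℕ}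
    (hr : IsScalarOrder π r) (θ : EAlg (π.comp (uGL F))) :
    ∃ (n : ℕ) (b : BAlg W (Fintype.card F)), p ^ n • etaE (π.comp (uGL F)) θ = etaB S b := by
  have hq : (Fintype.card F : Qbar) ≠ 0 := by exact_mod_cast Fintype.card_ne_zero
  obtain ⟨a, ha⟩ := exists_card_eq_pow (p := p) (F := F)
  obtain ⟨x, hx⟩ := S.exists_coeff D hz hr (Y := etaE (π.comp (uGL F)) θ) (yElt_mul_epsU _)
    (fun b => etaE_comm θ (Units.mulLeft b⁻¹) fun a => by
      change π (uni a) * π (dg b 1) = π (dg b 1) * π (uni _)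
      rw [← map_mul, ← map_mul]
      congr 1
      have := dg_conj_uni b ((b⁻¹ : Fˣ) * a)
      rw [Units.mul_inv_cancel_left] at this
      rw [← this, inv_mul_cancel_right]
      rfl)
    (fun b => etaE_comm θ (Equiv.refl F) fun a => by
      change π (uni a) * π (uni b) = π (uni b) * π (uni a)
      have e : uni a * uni b = uni b * uni a := by
        ext i j
        rw [Units.val_mul, Units.val_mul, uni_val, uni_val]
        fin_cases i <;> fin_cases j <;> simp [add_comm]
      rw [← map_mul π, ← map_mul π, e])
  -- One factor q is already present in the linear form and cancels the denominator of θ; a second,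
  -- q = p^a, clears that of the monomial.
  have hmem := S.coeff_mem D hz hr x hx (pIntegers p) (by
    intro k _ l _
    obtain ⟨c, -, hc⟩ := exists_central S.surj D hz (D.mono_mem k l)
    refine ⟨a, ((θ.1 ⟨qEps _, qEps_mem _⟩ : MonoidAlgebra ℤ H) * c).coeff (π (lowerUni F)), ?_⟩
    change toQ H c = _ at hc
    rw [← toQ_coeff, map_mul (toQ H), hc, etaE_apply, yElt, toQbar_eq, ← Nat.cast_pow, ← ha,
      smul_mul_assoc, MonoidAlgebra.coeff_smul_apply, smul_eq_mul, mul_inv_cancel_left₀ hq,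
      mul_smul_comm, ← Nat.cast_smul_eq_nsmul Qbar, MonoidAlgebra.coeff_smul_apply, smul_eq_mul])
  choose! N m hN using hmem
  -- A common exponent for all coefficients; the sum dominates each term.
  let M := ∑ i ∈ Finset.range (Fintype.card F), ∑ j ∈ Finset.range r, N i j
  have hM : ∀ i < Fintype.card F, ∀ j < r, N i j ≤ M := by
    intro i hi j hj
    refine le_trans ?_ (Finset.single_le_sum (f := fun i => ∑ j ∈ Finset.range r, N i j)
      (fun _ _ => Nat.zero_le _) (Finset.mem_range.mpr hi))
    exact Finset.single_le_sum (f := fun j => N i j) (fun _ _ => Nat.zero_le _)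
      (Finset.mem_range.mpr hj)
  refine ⟨M, _, Eq.trans ?_ (etaB_sum S D (r := r) fun i j => p ^ (M - N i j) * m i j).symm⟩
  rw [hx, Finset.smul_sum]
  refine Finset.sum_congr rfl fun i hi => ?_
  rw [Finset.smul_sum]
  refine Finset.sum_congr rfl fun j hj => ?_
  rw [Finset.mem_range] at hi hj
  rw [← Nat.cast_smul_eq_nsmul Qbar, smul_smul]
  congr 1
  push_cast
  rw [← hN i hi j hj, ← mul_assoc, ← pow_add, Nat.sub_add_cancel (hM i hi j hj)]

end EtaB


/-! ### The canonical isomorphisms -/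

section Abstract

variable {E B K 𝓐 : Type*} [Semiring E] [Algebra ℤ E] [Semiring B] [Algebra ℤ B]
  [Semiring K] [Algebra ℤ K]
  [Ring 𝓐] [Algebra ℚ 𝓐]

/-- A map compatible with sums and products as a homomorphism of non-unital `ℤ`-algebras. -/
def nonUnitalHom (f : B → 𝓐) (hsmul : ∀ (n : ℤ) b, f (n • b) = n • f b)
    (hadd : ∀ a b, f (a + b) = f a + f b)
    (hmul : ∀ a b, f (a * b) = f a * f b) : B →ₙₐ[ℤ] 𝓐 where
  toFun := f
  map_smul' := hsmul
  map_zero' := by simpa using hsmul 0 0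
  map_add' := hadd
  map_mul' := hmul

theorem tensor_equiv_ext {n : ℕ} {e e' : (ZInv n ⊗[ℤ] E) ≃ₐ[ZInv n] (ZInv n ⊗[ℤ] B)} {s : Set B}
    (hs : Submodule.span ℤ s = ⊤) (h : ∀ b ∈ s, e.symm (1 ⊗ₜ b) = e'.symm (1 ⊗ₜ b)) :
    e = e' := by
  have h0 : ∀ b : B, e.symm (1 ⊗ₜ b) = e'.symm (1 ⊗ₜ b) := by
    intro b
    have hb : b ∈ Submodule.span ℤ s := hs ▸ Submodule.mem_top
    induction hb using Submodule.span_induction with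
    | mem b hb => exact h b hb
    | zero => rw [TensorProduct.tmul_zero, map_zero, map_zero]
    | add a b _ _ ha hb => rw [TensorProduct.tmul_add, map_add, map_add, ha, hb]
    | smul n a _ ha =>
      rw [TensorProduct.tmul_smul, map_zsmul, map_zsmul, ha]
  have h1 : ∀ x, e.symm x = e'.symm x := by
    intro x
    induction x using TensorProduct.induction_on with
    | zero => rw [map_zero, map_zero]
    | add x y hx hy => rw [map_add, map_add, hx, hy]
    | tmul c b =>
      have : c ⊗ₜ[ℤ] b = c • ((1 : ZInv n) ⊗ₜ[ℤ] b) := by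
        rw [TensorProduct.smul_tmul', smul_eq_mul, mul_one]
      rw [this, map_smul, map_smul, h0]
  have h2 : e.symm = e'.symm := AlgEquiv.ext h1
  rw [← AlgEquiv.symm_symm e, h2, AlgEquiv.symm_symm]

/-- The extension of scalars of an isomorphism of rings. -/
def scalarEquiv (n : ℕ) (β : B ≃ₐ[ℤ] K) : (ZInv n ⊗[ℤ] B) ≃ₐ[ZInv n] (ZInv n ⊗[ℤ] K) :=
  Algebra.TensorProduct.congr AlgEquiv.refl β

theorem scalarEquiv_tmul (n : ℕ) (β : B ≃ₐ[ℤ] K) (c : ZInv n) (b : B) :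
    scalarEquiv n β (c ⊗ₜ b) = c ⊗ₜ β b := rfl

theorem enlarge_scalarEquiv (n : ℕ) (β : B ≃ₐ[ℤ] K) (x : ZInv n ⊗[ℤ] B) :
    enlarge n K (scalarEquiv n β x) = scalarEquiv (n * 2) β (enlarge n B x) := by
  induction x using TensorProduct.induction_on with
  | zero => simp only [map_zero]
  | add x y hx hy => simp only [map_add, hx, hy]
  | tmul c b => rfl

theorem exists_equivs {p : ℕ} (hp : p ≠ 0) {η : E →ₙₐ[ℤ] 𝓐} (hη : Function.Injective η)
    {f : B → 𝓐} (hf : Function.Injective f)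
    (hsmul : ∀ (n : ℤ) b, f (n • b) = n • f b) (hadd : ∀ a b, f (a + b) = f a + f b)
    (hmul : ∀ a b, f (a * b) = f a * f b) (hone : η 1 = f 1)
    (hBE : ∀ b, ∃ (n : ℕ) (θ : E), p ^ n • f b = η θ)
    (hEB : ∀ θ, ∃ (n : ℕ) (b : B), p ^ n • η θ = f b) (β : B ≃ₐ[ℤ] K) :
    ∃ (eEB : (ZInv (p * 2) ⊗[ℤ] E) ≃ₐ[ZInv (p * 2)] (ZInv (p * 2) ⊗[ℤ] B))
      (eBK : (ZInv (p * 2) ⊗[ℤ] B) ≃ₐ[ZInv (p * 2)] (ZInv (p * 2) ⊗[ℤ] K)),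
      (∀ b, extend (p * 2) η (eEB.symm (1 ⊗ₜ b)) = f b) ∧
      (∀ b, eBK (1 ⊗ₜ b) = 1 ⊗ₜ β b) ∧
      Function.Injective (enlarge p E) ∧ Function.Injective (enlarge p B) ∧
      Function.Injective (enlarge p K) ∧
      ∃ (dEB : (ZInv p ⊗[ℤ] E) ≃ₐ[ZInv p] (ZInv p ⊗[ℤ] B))
        (dBK : (ZInv p ⊗[ℤ] B) ≃ₐ[ZInv p] (ZInv p ⊗[ℤ] K)),
        (∀ h, enlarge p _ (dEB h) = eEB (enlarge p _ h)) ∧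
        (∀ b, enlarge p _ (dBK b) = eBK (enlarge p _ b)) := by
  have hp2 : p * 2 ≠ 0 := mul_ne_zero hp two_ne_zero
  let ηB := nonUnitalHom f hsmul hadd hmul
  have hB : Function.Injective ηB := hf
  obtain ⟨eEB, heEB⟩ := exists_algEquiv_extend hp2 hη hB hone (commensurable_mul hEB)
    (commensurable_mul hBE)
  obtain ⟨dEB, hdEB⟩ := exists_algEquiv_extend hp hη hB hone hEB hBE
  have hBe := enlarge_injective hp hB
  refine ⟨eEB, scalarEquiv (p * 2) β, fun b => ?_, fun b => scalarEquiv_tmul _ _ _ _,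
    enlarge_injective hp hη, hBe, ?_, dEB, scalarEquiv p β, fun h => ?_, enlarge_scalarEquiv p β⟩
  · rw [← heEB, AlgEquiv.apply_symm_apply, extend_tmul, OneMemClass.coe_one, one_smul]
    rfl
  · intro x y h
    obtain ⟨x, rfl⟩ := (scalarEquiv p β).surjective x
    obtain ⟨y, rfl⟩ := (scalarEquiv p β).surjective y
    rw [enlarge_scalarEquiv, enlarge_scalarEquiv] at h
    rw [hBe ((scalarEquiv (p * 2) β).injective h)]
  · apply extend_injective hp2 hB
    rw [extend_enlarge, hdEB, heEB, extend_enlarge]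

end Abstract

/-! ### Canonicity and uniqueness of the isomorphisms -/

section Canonical

theorem KAlg.span_range_mk {k H : Type} [Field k] [Group H] :
    Submodule.span ℤ (Set.range (KAlg.mk : FDRep k H → KAlg k H)) = ⊤ := by
  rw [eq_top_iff]
  intro a _
  obtain ⟨x, rfl⟩ := Ideal.Quotient.mk_surjective a
  induction x using FreeAbelianGroup.induction_on with
  | zero => rw [map_zero]; exact zero_mem _
  | of X =>
    obtain ⟨M, rfl⟩ : ∃ M : FDRep k H, toSkeleton M = X := by
      induction X using Quotient.inductionOn with
      | h M => exact ⟨M, rfl⟩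
    exact Submodule.subset_span ⟨M, rfl⟩
  | neg X h => rw [map_neg]; exact Submodule.neg_mem _ (h trivial)
  | add x y hx hy => rw [map_add]; exact add_mem (hx trivial) (hy trivial)

variable {p : ℕ} {F k : Type} [Field F] [Fintype F] [Field k]
  [Algebra F k] {H Hd : Type} [Group H] [Finite H] [Group Hd] {π : GL (Fin 2) F →* H}
  {X : Type} [AddCommGroup X] {W : Set (X →+ X)}
  {z : AddMonoidAlgebra ℤ X →ₗ[ℤ] MonoidAlgebra Qbar H} {ψ : AddChar F Qbar}
  {IsRho : Hd → FDRep Qbar H → Prop} {IsPoint : Hd → (Multiplicative X →* Qbarˣ) → Prop}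

omit [Finite H] in
theorem extend_etaE_mul_epsU (u : Multiplicative F →* H) {n : ℕ} (x : ZInv n ⊗[ℤ] EAlg u) :
    extend n (etaE u) x * epsU u = extend n (etaE u) x := by
  induction x using TensorProduct.induction_on with
  | zero => rw [map_zero, zero_mul]
  | add x y hx hy => rw [map_add, add_mul, hx, hy]
  | tmul c a => rw [extend_tmul, smul_mul_assoc, etaE_apply, yElt_mul_epsU]

omit [Finite H] in
theorem epsU_mul_extend_etaE (u : Multiplicative F →* H) {n : ℕ} (x : ZInv n ⊗[ℤ] EAlg u) :
    epsU u * extend n (etaE u) x = extend n (etaE u) x := by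
  induction x using TensorProduct.induction_on with
  | zero => rw [map_zero, mul_zero]
  | add x y hx hy => rw [map_add, mul_add, hx, hy]
  | tmul c a => rw [extend_tmul, mul_smul_comm, etaE_apply, epsU_mul_yElt]

omit [Group Hd] in
/-- Elements of `ℤ[1/n]E` are determined by their action on the isotypic parts. -/
theorem extend_etaE_eq_iff (S : Separates π ψ W IsRho IsPoint z) {n : ℕ}
    (a : ZInv n ⊗[ℤ] EAlg (π.comp (uGL F))) (f : invariants W) :
    extend n (etaE (π.comp (uGL F))) a = z f * epsU (π.comp (uGL F)) ↔
      ∀ (x : Hd) (V : FDRep Qbar H) (t : Multiplicative X →* Qbarˣ), IsRho x V → IsPoint x t →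
        ∀ m : indF0 (π.comp (uGL F)), idemChi V * act (π.comp (uGL F)) n m a =
          evalAt t f • (idemChi V * toQbar _ m) := by
  have hq : (Fintype.card F : Qbar) ≠ 0 := by exact_mod_cast Fintype.card_ne_zero
  constructor
  · intro h x V t hx ht m
    rw [act_eq, h, ← mul_assoc, idemChi_comm, mul_assoc, ← mul_assoc (idemChi V),
      S.eigen hx ht f f.2, smul_mul_assoc, mul_smul_comm, ← mul_assoc, ← idemChi_comm, mul_assoc,
      toQbar_mul_epsU]
  · intro h
    refine S.ext (extend_etaE_mul_epsU _ _) (by rw [mul_assoc, epsU_mul_self])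
      fun x V t hx ht => ?_
    have h1 := h x V t hx ht ⟨qEps _, qEps_mem _⟩
    rw [act_eq, toQbar_eq, toQ_qEps, smul_mul_assoc, epsU_mul_extend_etaE, mul_smul_comm,
      mul_smul_comm, smul_comm] at h1
    rw [← mul_assoc, S.eigen hx ht f f.2, smul_mul_assoc]
    exact smul_right_injective _ hq h1

omit [Algebra F k] in
-- Canonicity translates into an equality in Qbar[H]ε by `extend_etaE_eq_iff`, so existence comes
-- from the construction and uniqueness from the injectivity of the embedding of E. For K it
-- suffices to test the classes of representations, which generate it and are carried to B by β.
theorem canonicalIsosRestrict_of {κ : kˣ →* Qbarˣ} (hp : p ≠ 0)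
    (S : Separates π ψ W IsRho IsPoint z) (hB : Function.Injective (etaB S))
    (hBE : ∀ b, ∃ (n : ℕ) (θ : EAlg (π.comp (uGL F))),
      p ^ n • etaB S b = etaE (π.comp (uGL F)) θ)
    (hEB : ∀ θ, ∃ (n : ℕ) (b : BAlg W (Fintype.card F)),
      p ^ n • etaE (π.comp (uGL F)) θ = etaB S b)
    (β : BAlg W (Fintype.card F) ≃+* KAlg k Hd)
    (hβ : ∀ M i, brauer κ M i.1.1 = evalB S (β.symm (KAlg.mk M)) i) :
    CanonicalIsosRestrict p (π.comp (uGL F)) W (Fintype.card F) κ IsRho IsPoint := by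
  obtain ⟨eEB, eBK, h1, h2, i1, i2, i3, dEB, dBK, h3, h4⟩ := exists_equivs hp
    (etaE_injective (π.comp (uGL F))) (f := etaB S) hB (map_smul _) (map_add _) (map_mul _)
    (by rw [etaE_one, etaB_one]) hBE hEB (RingEquiv.toIntAlgEquiv β)
  have hE := extend_injective (mul_ne_zero hp two_ne_zero) (etaE_injective (π.comp (uGL F)))
  have h5 : ∀ M, (eEB.trans eBK).symm (1 ⊗ₜ KAlg.mk M) =
      eEB.symm (1 ⊗ₜ β.symm (KAlg.mk M)) := by
    intro M
    rw [AlgEquiv.symm_trans_apply]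
    congr 1
    rw [AlgEquiv.symm_apply_eq, h2]
    congr 1
    exact (RingEquiv.apply_symm_apply β _).symm
  refine ⟨eEB, eBK, fun e => ⟨fun he => ?_, ?_⟩, fun e => ⟨fun he => ?_, ?_⟩, i1, i2, i3,
    dEB, dBK, h3, h4⟩
  · refine tensor_equiv_ext (s := Set.univ) Submodule.span_univ fun b _ => hE ?_
    obtain ⟨f, rfl⟩ := Ideal.Quotient.mk_surjective b
    rw [h1, etaB_mk, extend_etaE_eq_iff S]
    exact fun x V t hx ht m => he x V t hx ht f m
  · rintro rfl x V t hx ht f m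
    exact (extend_etaE_eq_iff S _ _).mp ((h1 _).trans (etaB_mk S f)) x V t hx ht m
  · refine tensor_equiv_ext KAlg.span_range_mk ?_
    rintro _ ⟨M, rfl⟩
    apply hE
    obtain ⟨f, hf⟩ := Ideal.Quotient.mk_surjective (β.symm (KAlg.mk M))
    refine Eq.trans ?_ (congrArg (extend (p * 2) (etaE (π.comp (uGL F)))) (h5 M)).symm
    rw [h1, ← hf, etaB_mk, extend_etaE_eq_iff S]
    intro x V t hx ht m
    rw [he x V hx M m, hβ M ⟨(x, t), ht, V, hx⟩, ← hf, evalB_mk]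
  · rintro rfl x V hx M m
    obtain ⟨t, ht⟩ := S.exists_point hx
    obtain ⟨f, hf⟩ := Ideal.Quotient.mk_surjective (β.symm (KAlg.mk M))
    refine (congrArg (fun a => idemChi V * act (π.comp (uGL F)) (p * 2) m a) (h5 M)).trans ?_
    rw [hβ M ⟨(x, t), ht, V, hx⟩, ← hf, evalB_mk]
    exact (extend_etaE_eq_iff S _ _).mp ((h1 _).trans (hf ▸ etaB_mk S f)) x V t hx ht m

end Canonical


/-! ### Additive functions on representations -/

section AdditiveFunctions

open MonoidalCategory

variable {k H : Type} [Field k] [Group H]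

/-- The linear map underlying a morphism of representations. -/
def lin {M N : FDRep k H} (f : M ⟶ N) : M →ₗ[k] N := f.hom.hom.hom

theorem lin_rho {M N : FDRep k H} (f : M ⟶ N) (g : H) (m : M) :
    lin f (M.ρ g m) = N.ρ g (lin f m) :=
  congrArg (fun φ => φ.hom.hom m) (f.comm g)

/-- An equivariant linear map as a morphism of representations. -/
def homOf {M N : FDRep k H} (f : M →ₗ[k] N) (hf : ∀ g m, f (M.ρ g m) = N.ρ g (f m)) : M ⟶ N where
  hom := FGModuleCat.ofHom f
  comm g := by
    ext m
    exact hf g m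

/-- The short exact sequences of representations. -/
structure ShortExact {M₁ M₂ M₃ : FDRep k H} (f : M₁ ⟶ M₂) (g : M₂ ⟶ M₃) : Prop where
  inj : Function.Injective (lin f)
  exact : Function.Exact (lin f) (lin g)
  surj : Function.Surjective (lin g)

/-- The functions on representations that are additive on short exact sequences. -/
def IsAdditive {A : Type*} [Add A] (φ : FDRep k H → A) : Prop :=
  ∀ ⦃M₁ M₂ M₃ : FDRep k H⦄ (f : M₁ ⟶ M₂) (g : M₂ ⟶ M₃), ShortExact f g → φ M₂ = φ M₁ + φ M₃

theorem IsAdditive.eq_zero {A : Type*} [AddGroup A] {φ : FDRep k H → A} (hφ : IsAdditive φ)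
    (M : FDRep k H) [Subsingleton M] : φ M = 0 := by
  have := hφ (𝟙 M) (𝟙 M)
    ⟨fun _ _ _ => Subsingleton.elim _ _, fun x => ⟨fun _ => ⟨x, Subsingleton.elim _ _⟩,
      fun _ => Subsingleton.elim (α := M) _ _⟩, fun x => ⟨x, Subsingleton.elim (α := M) _ _⟩⟩
  rwa [left_eq_add] at this

/-- An isomorphism followed by the map to zero is a short exact sequence, and the zero
representation has value zero. -/
theorem IsAdditive.eq_of_iso {A : Type*} [AddGroup A] {φ : FDRep k H → A} (hφ : IsAdditive φ)
    {M N : FDRep k H} (i : M ≅ N) : φ N = φ M := by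
  let Z : FDRep k H := FDRep.of (1 : Representation k H PUnit.{1})
  have hi := FDRep.isoToLinearEquiv i
  have h1 : ∀ m, lin i.inv (lin i.hom m) = m := fun m => (FDRep.isoToLinearEquiv i).left_inv m
  have h2 : ∀ m, lin i.hom (lin i.inv m) = m := fun m => (FDRep.isoToLinearEquiv i).right_inv m
  have hZ : Subsingleton Z := inferInstanceAs (Subsingleton PUnit)
  have := hφ i.hom (homOf (N := Z) 0 fun _ _ => Subsingleton.elim (α := Z) _ _)
    ⟨Function.LeftInverse.injective h1, fun x => ⟨fun _ => ⟨_, h2 x⟩,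
      fun _ => Subsingleton.elim (α := Z) _ _⟩, fun x => ⟨0, Subsingleton.elim (α := Z) _ _⟩⟩
  rw [this, hφ.eq_zero Z, add_zero]

theorem KAlg.isAdditive_mk : IsAdditive (KAlg.mk : FDRep k H → KAlg k H) := by
  intro M₁ M₂ M₃ f g h
  rw [KAlg.mk, KAlg.mk, KAlg.mk, ← map_add, Ideal.Quotient.eq]
  exact Ideal.subset_span ⟨M₁, M₂, M₃, f, g, h.inj, h.exact, h.surj, rfl⟩

theorem KAlg.mk_tensor (M N : FDRep k H) :
    (KAlg.mk (M ⊗ N) : KAlg k H) = KAlg.mk M * KAlg.mk N := by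
  rw [KAlg.mk, Skeleton.toSkeleton_tensorObj, FreeAbelianGroup.of_mul, map_mul]
  rfl

theorem KAlg.mk_unit : (KAlg.mk (𝟙_ (FDRep k H)) : KAlg k H) = 1 := by
  rw [KAlg.mk]
  exact map_one (Ideal.Quotient.mk (grothendieckIdeal k H))

theorem ShortExact.tensor {M₁ M₂ M₃ : FDRep k H} {f : M₁ ⟶ M₂} {g : M₂ ⟶ M₃}
    (h : ShortExact f g) (N : FDRep k H) : ShortExact (N ◁ f) (N ◁ g) where
  inj := Module.Flat.lTensor_preserves_injective_linearMap (M := N) (lin f) h.inj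
  exact := lTensor_exact N h.exact h.surj
  surj := LinearMap.lTensor_surjective N h.surj

/-- The function on isomorphism classes defined by an additive function. -/
def IsAdditive.onSkeleton {A : Type*} [AddGroup A] {φ : FDRep k H → A} (hφ : IsAdditive φ) :
    Skeleton (FDRep k H) → A :=
  Quotient.lift φ fun _ _ ⟨i⟩ => (hφ.eq_of_iso i).symm

theorem IsAdditive.onSkeleton_toSkeleton {A : Type*} [AddGroup A] {φ : FDRep k H → A}
    (hφ : IsAdditive φ) (M : FDRep k H) : hφ.onSkeleton (toSkeleton M) = φ M := rfl

theorem exists_toSkeleton_eq (X : Skeleton (FDRep k H)) : ∃ M : FDRep k H, toSkeleton M = X := by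
  induction X using Quotient.inductionOn with
  | h M => exact ⟨M, rfl⟩

/-- The extension of an additive function to the Grothendieck ring. -/
def IsAdditive.lift {A : Type*} [AddCommGroup A] {φ : FDRep k H → A} (hφ : IsAdditive φ) :
    KAlg k H →+ A :=
  QuotientAddGroup.lift (grothendieckIdeal k H).toAddSubgroup
    (FreeAbelianGroup.lift hφ.onSkeleton) (by
      intro x hx
      rw [AddMonoidHom.mem_ker]
      change x ∈ grothendieckIdeal k H at hx
      rw [grothendieckIdeal, Ideal.span] at hx
      induction hx using Submodule.closure_induction with
      | zero => exact map_zero _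
      | add a b _ _ ha hb => rw [map_add, ha, hb, add_zero]
      | smul_mem r x hx =>
        obtain ⟨M₁, M₂, M₃, f, g, h1, h2, h3, rfl⟩ := hx
        rw [smul_eq_mul]
        induction r using FreeAbelianGroup.induction_on with
        | zero => rw [zero_mul, map_zero]
        | neg a h => rw [neg_mul, map_neg, h, neg_zero]
        | add a b ha hb => rw [add_mul, map_add, ha, hb, add_zero]
        -- Tensoring with a representation is exact, so a multiple of a relation is again a
        -- relation.
        | of X =>
          obtain ⟨N, rfl⟩ := exists_toSkeleton_eq X
          have h : ShortExact f g := ⟨h1, h2, h3⟩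
          rw [mul_sub, mul_add, ← FreeAbelianGroup.of_mul, ← FreeAbelianGroup.of_mul,
            ← FreeAbelianGroup.of_mul, ← Skeleton.toSkeleton_tensorObj,
            ← Skeleton.toSkeleton_tensorObj, ← Skeleton.toSkeleton_tensorObj, map_sub, map_add,
            FreeAbelianGroup.lift_apply_of, FreeAbelianGroup.lift_apply_of,
            FreeAbelianGroup.lift_apply_of, onSkeleton_toSkeleton, onSkeleton_toSkeleton,
            onSkeleton_toSkeleton, hφ _ _ (h.tensor N), sub_self])

theorem IsAdditive.lift_mk {A : Type*} [AddCommGroup A] {φ : FDRep k H → A} (hφ : IsAdditive φ)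
    (M : FDRep k H) : hφ.lift (KAlg.mk M) = φ M :=
  FreeAbelianGroup.lift_apply_of _ _

/-- The extension of an additive and multiplicative function to the Grothendieck ring. -/
def IsAdditive.ringLift {A : Type*} [CommRing A] {φ : FDRep k H → A} (hφ : IsAdditive φ)
    (h1 : φ (𝟙_ (FDRep k H)) = 1) (hmul : ∀ M N, φ (M ⊗ N) = φ M * φ N) : KAlg k H →+* A :=
  Ideal.Quotient.lift (grothendieckIdeal k H)
    (FreeAbelianGroup.liftMonoid
      { toFun := hφ.onSkeleton
        map_one' := h1
        map_mul' := fun X Y => by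
          obtain ⟨M, rfl⟩ := exists_toSkeleton_eq X
          obtain ⟨N, rfl⟩ := exists_toSkeleton_eq Y
          rw [← Skeleton.toSkeleton_tensorObj]
          exact hmul M N })
    (by
      change ∀ x ∈ Ideal.span _, x ∈ RingHom.ker _
      rw [← SetLike.le_def, Ideal.span_le]
      rintro _ ⟨M₁, M₂, M₃, f, g, h1, h2, h3, rfl⟩
      have h := hφ f g ⟨h1, h2, h3⟩
      rw [SetLike.mem_coe, RingHom.mem_ker, map_sub, map_add, FreeAbelianGroup.liftMonoid_coe,
        FreeAbelianGroup.lift_apply_of, FreeAbelianGroup.lift_apply_of,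
        FreeAbelianGroup.lift_apply_of]
      exact sub_eq_zero.mpr h)

theorem IsAdditive.ringLift_mk {A : Type*} [CommRing A] {φ : FDRep k H → A} (hφ : IsAdditive φ)
    (h1 : φ (𝟙_ (FDRep k H)) = 1) (hmul : ∀ M N, φ (M ⊗ N) = φ M * φ N) (M : FDRep k H) :
    hφ.ringLift h1 hmul (KAlg.mk M) = φ M :=
  FreeAbelianGroup.lift_apply_of _ _

/-- The Grothendieck group is generated by the classes of the irreducible representations. -/
theorem KAlg.closure_irreducible :
    AddSubgroup.closure {a : KAlg k H |
      ∃ M : FDRep k H, Representation.IsIrreducible M.ρ ∧ a = KAlg.mk M} = ⊤ := by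
  have key : ∀ (n : ℕ) (M : FDRep k H), Module.finrank k M = n → KAlg.mk M ∈
      AddSubgroup.closure {a : KAlg k H |
        ∃ M : FDRep k H, Representation.IsIrreducible M.ρ ∧ a = KAlg.mk M} := by
    intro n
    induction n using Nat.strong_induction_on with
    | _ n ih =>
    intro M hM
    by_cases hs : Subsingleton M
    · rw [KAlg.isAdditive_mk.eq_zero M]
      exact zero_mem _
    by_cases hi : Representation.IsIrreducible M.ρ
    · exact AddSubgroup.subset_closure ⟨M, hi, rfl⟩
    have hnt : Nontrivial M := not_subsingleton_iff_nontrivial.mp hs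
    obtain ⟨σ, hσ0, hσ1⟩ : ∃ σ : Subrepresentation M.ρ, σ.toSubmodule ≠ ⊥ ∧ σ.toSubmodule ≠ ⊤ := by
      by_contra! hcon
      refine hi { exists_pair_ne := ⟨⊥, ⊤, fun h => ?_⟩, eq_bot_or_eq_top := fun σ => ?_ }
      · have h1 : (⊥ : Submodule k M) = ⊤ := congrArg Subrepresentation.toSubmodule h
        exact bot_ne_top h1
      · by_cases h : σ.toSubmodule = ⊥
        · exact Or.inl (Subrepresentation.toSubmodule_injective h)
        · exact Or.inr (Subrepresentation.toSubmodule_injective (hcon σ h))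
    let N₁ : FDRep k H := FDRep.of σ.toRepresentation
    let N₃ : FDRep k H := FDRep.of (Representation.quotient M.ρ σ.toSubmodule
      fun g m hm => σ.apply_mem_toSubmodule g hm)
    rw [KAlg.isAdditive_mk (homOf (M := N₁) σ.toSubmodule.subtype fun _ _ => rfl)
      (homOf (N := N₃) σ.toSubmodule.mkQ fun _ _ => rfl)
      ⟨Subtype.val_injective, LinearMap.exact_subtype_mkQ σ.toSubmodule, Submodule.mkQ_surjective _⟩]
    have h := σ.toSubmodule.finrank_quotient_add_finrank
    have h1 : Module.finrank k (M ⧸ σ.toSubmodule) < n := by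
      have := Submodule.nontrivial_iff_ne_bot.mpr hσ0
      have := Module.finrank_pos (R := k) (M := σ.toSubmodule)
      omega
    have h2 : Module.finrank k σ.toSubmodule < n := hM ▸ Submodule.finrank_lt hσ1
    exact add_mem (ih _ h2 N₁ rfl) (ih _ h1 N₃ rfl)
  rw [eq_top_iff]
  intro a _
  obtain ⟨x, rfl⟩ := Ideal.Quotient.mk_surjective a
  induction x using FreeAbelianGroup.induction_on with
  | zero => rw [map_zero]; exact zero_mem _
  | of X =>
    obtain ⟨M, rfl⟩ := exists_toSkeleton_eq X
    exact key _ M rfl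
  | neg X h => rw [map_neg]; exact neg_mem (h trivial)
  | add x y hx hy => rw [map_add]; exact add_mem (hx trivial) (hy trivial)

end AdditiveFunctions


/-! ### Brauer characters -/

section Brauer

open MonoidalCategory

theorem isSemisimple_of_pow_eq_one {k V : Type} [Field k] [AddCommGroup V] [Module k V]
    [FiniteDimensional k V] {f : Module.End k V} {N : ℕ} (hN : (N : k) ≠ 0) (hf : f ^ N = 1) :
    f.IsSemisimple :=
  Module.End.isSemisimple_of_squarefree_aeval_eq_zero (p := Polynomial.X ^ N - 1)
    (Polynomial.Separable.squarefree (Polynomial.X_pow_sub_one_separable_iff.mpr hN)) (by simp [hf])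

/-- For N invertible in k, X^N - 1 is separable; the operator is semisimple, and over an
algebraically closed field it is diagonalizable. -/
theorem exists_eigenbasis {k V : Type} [Field k] [IsAlgClosed k] [AddCommGroup V] [Module k V]
    [FiniteDimensional k V] {f : Module.End k V} {N : ℕ} (hN : (N : k) ≠ 0) (hf : f ^ N = 1) :
    ∃ (ι : Type) (_ : Fintype ι) (b : Module.Basis ι k V) (mu : ι → kˣ),
      ∀ i, f (b i) = (mu i : k) • b i := by
  classical
  have hss := isSemisimple_of_pow_eq_one hN hf
  have hint := DirectSum.isInternal_submodule_of_iSupIndep_of_iSup_eq_top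
    f.eigenspaces_iSupIndep hss.iSup_eigenspace_eq_top
  let b := hint.collectedBasis fun a => Module.finBasis k (f.eigenspace a)
  have hb : ∀ i, f (b i) = i.1 • b i := by
    intro i
    have := hint.collectedBasis_mem (fun a => Module.finBasis k (f.eigenspace a)) i
    exact Module.End.mem_eigenspace_iff.mp this
  have hne : ∀ i : Σ a, Fin (Module.finrank k (f.eigenspace a)), i.1 ≠ 0 := by
    intro i h
    have h1 := hb i
    rw [h, zero_smul] at h1
    have hN0 : N ≠ 0 := by rintro rfl; exact hN Nat.cast_zero
    have h2 : (f ^ N) (b i) = 0 := by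
      obtain ⟨n, rfl⟩ := Nat.exists_eq_succ_of_ne_zero hN0
      rw [pow_succ, Module.End.mul_apply, h1, map_zero]
    rw [hf, Module.End.one_apply] at h2
    exact b.ne_zero i h2
  have : Finite (Σ a, Fin (Module.finrank k (f.eigenspace a))) := Module.Finite.finite_basis b
  exact ⟨_, Fintype.ofFinite _, b, fun i => Units.mk0 i.1 (hne i), hb⟩

variable {k H : Type} [Field k] [Group H] (κ : kˣ →* Qbarˣ)

theorem brauer_eq_sum {M : FDRep k H} {x : H} {ι : Type} [Fintype ι] (b : Module.Basis ι k M)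
    {mu : ι → kˣ} (h : ∀ i, M.ρ x (b i) = (mu i : k) • b i) :
    brauer κ M x = ∑ i, ((κ (mu i) : Qbarˣ) : Qbar) := by
  classical
  have h1 : LinearMap.toMatrix b b (M.ρ x) = Matrix.diagonal fun i => (mu i : k) := by
    ext i j
    rw [LinearMap.toMatrix_apply, h, map_smul, Finsupp.smul_apply, b.repr_self,
      Matrix.diagonal_apply, Finsupp.single_apply, smul_eq_mul]
    by_cases hij : i = j
    · subst hij; simp
    · rw [if_neg hij, if_neg fun h => hij h.symm, mul_zero]
  have h2 : (M.ρ x).charpoly.roots = Finset.univ.val.map fun i => (mu i : k) := by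
    rw [← LinearMap.charpoly_toMatrix (M.ρ x) b, h1, Matrix.charpoly_diagonal]
    have := Polynomial.roots_multiset_prod_X_sub_C (Finset.univ.val.map fun i => (mu i : k))
    rw [Multiset.map_map] at this
    exact this
  rw [brauer, h2, Multiset.map_map]
  refine congrArg Multiset.sum (Multiset.map_congr rfl fun i _ => ?_)
  rw [Function.comp_apply, dif_neg (mu i).ne_zero, Units.mk0_val]

variable [IsAlgClosed k]

theorem exists_eigenbasis_rho (M : FDRep k H) {x : H} (hx : (orderOf x : k) ≠ 0) :
    ∃ (ι : Type) (_ : Fintype ι) (b : Module.Basis ι k M) (mu : ι → kˣ),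
      ∀ i, M.ρ x (b i) = (mu i : k) • b i :=
  exists_eigenbasis (f := M.ρ x) hx (by rw [← map_pow, pow_orderOf_eq_one, map_one])

omit [IsAlgClosed k] in
theorem brauer_unit (x : H) : brauer κ (𝟙_ (FDRep k H)) x = 1 := by
  rw [brauer_eq_sum κ (M := 𝟙_ (FDRep k H)) (Module.Basis.singleton Unit k) (mu := fun _ => 1)]
  · simp
  · intro i
    rw [Units.val_one, one_smul]
    rfl

theorem brauer_tensor (M N : FDRep k H) {x : H} (hx : (orderOf x : k) ≠ 0) :
    brauer κ (M ⊗ N) x = brauer κ M x * brauer κ N x := by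
  obtain ⟨ι, _, b, mu, h⟩ := exists_eigenbasis_rho M hx
  obtain ⟨ι', _, b', mu', h'⟩ := exists_eigenbasis_rho N hx
  rw [brauer_eq_sum κ b h, brauer_eq_sum κ b' h',
    brauer_eq_sum κ (M := M ⊗ N) (b.tensorProduct b') (mu := fun i => mu i.1 * mu' i.2)]
  · rw [Fintype.sum_prod_type, Finset.sum_mul_sum]
    simp
  · intro i
    rw [Module.Basis.tensorProduct_apply']
    change TensorProduct.map (M.ρ x) (N.ρ x) (b i.1 ⊗ₜ b' i.2) = _
    rw [TensorProduct.map_tmul, h, h', TensorProduct.smul_tmul_smul, Units.val_mul]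

omit [IsAlgClosed k] in
-- A single p-regular element acts semisimply, so the kernel has a complement stable under that
-- element. The section need not be equivariant for the whole group, but the eigenvalues of x are
-- all that the Brauer character at x sees.
theorem exists_equivariant_section {M₂ M₃ : FDRep k H} {g : M₂ ⟶ M₃} {p : Submodule k M₂}
    (hp : LinearMap.ker (lin g) = p) (hg : Function.Surjective (lin g)) {x : H}
    (hx : (orderOf x : k) ≠ 0) : ∃ l : M₃ →ₗ[k] M₂, (∀ m, lin g (l m) = m) ∧
      ∀ m, M₂.ρ x (l m) = l (M₃.ρ x m) := by
  have hss : Module.End.IsSemisimple (M₂.ρ x) :=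
    isSemisimple_of_pow_eq_one hx (by rw [← map_pow, pow_orderOf_eq_one, map_one])
  obtain ⟨q, hq, hpq⟩ := Module.End.isSemisimple_iff.mp hss p (by
    intro m hm
    rw [← hp, LinearMap.mem_ker] at hm
    rw [← hp, Submodule.mem_comap, LinearMap.mem_ker, lin_rho, hm, map_zero])
  have hinj : ∀ a ∈ q, ∀ b ∈ q, lin g a = lin g b → a = b := by
    intro a ha b hb hab
    have h1 : a - b ∈ p := by rw [← hp, LinearMap.mem_ker, map_sub, hab, sub_self]
    exact sub_eq_zero.mp ((Submodule.disjoint_def.mp hpq.disjoint) _ h1 (sub_mem ha hb))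
  have hsurj : ∀ m, ∃ a ∈ q, lin g a = m := by
    intro m
    obtain ⟨v, rfl⟩ := hg m
    have hv : v ∈ p ⊔ q := hpq.sup_eq_top ▸ Submodule.mem_top
    obtain ⟨a, ha, b, hb, rfl⟩ := Submodule.mem_sup.mp hv
    rw [← hp, LinearMap.mem_ker] at ha
    exact ⟨b, hb, by rw [map_add, ha, zero_add]⟩
  choose l hl hgl using hsurj
  refine ⟨⟨⟨l, fun a b => ?_⟩, fun c a => ?_⟩, hgl, fun m => ?_⟩
  · exact hinj _ (hl _) _ (add_mem (hl _) (hl _)) (by rw [map_add, hgl, hgl, hgl])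
  · exact hinj _ (hl _) _ (Submodule.smul_mem _ _ (hl _))
      (by rw [map_smul, hgl, hgl, RingHom.id_apply])
  · exact hinj _ (hq (hl m)) _ (hl _) ((lin_rho g x _).trans (by rw [hgl]; exact (hgl _).symm))

theorem brauer_add {M₁ M₂ M₃ : FDRep k H} {f : M₁ ⟶ M₂} {g : M₂ ⟶ M₃} (h : ShortExact f g) {x : H}
    (hx : (orderOf x : k) ≠ 0) : brauer κ M₂ x = brauer κ M₁ x + brauer κ M₃ x := by
  obtain ⟨ι, _, b, mu, hb⟩ := exists_eigenbasis_rho M₁ hx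
  obtain ⟨ι', _, b', mu', hb'⟩ := exists_eigenbasis_rho M₃ hx
  obtain ⟨l, hl, hl'⟩ := exists_equivariant_section rfl h.surj hx
  let φ : (M₁ × M₃) →ₗ[k] M₂ := (lin f).coprod l
  have hgf : ∀ a, lin g (lin f a) = 0 := h.exact.apply_apply_eq_zero
  have hφ : Function.Bijective φ := by
    constructor
    · rw [injective_iff_map_eq_zero]
      rintro ⟨a, c⟩ hac
      rw [LinearMap.coprod_apply] at hac
      have h1 := congrArg (lin g) hac
      rw [map_add, hgf, hl, zero_add, map_zero] at h1
      dsimp only at h1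
      subst h1
      rw [map_zero, add_zero] at hac
      exact Prod.ext (h.inj (hac.trans (map_zero _).symm)) rfl
    · intro v
      obtain ⟨a, ha⟩ := (h.exact (v - l (lin g v))).mp (by rw [map_sub, hl, sub_self])
      exact ⟨(a, lin g v), by rw [LinearMap.coprod_apply, ha, sub_add_cancel]⟩
  rw [brauer_eq_sum κ b hb, brauer_eq_sum κ b' hb', brauer_eq_sum κ
    ((b.prod b').map (LinearEquiv.ofBijective φ hφ)) (mu := Sum.elim mu mu')]
  · rw [Fintype.sum_sum_type]
    rfl
  · rintro (i | i)
    · simp [φ, ← lin_rho, hb]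
    · simp [φ, hl', hb']

end Brauer


/-! ### Independence of the traces of irreducible representations -/

section Traces

/-- By Schur's lemma the endomorphisms of the direct sum of pairwise non-isomorphic simple modules
preserve each summand and are scalar there. Extending E by zero therefore commutes with them, and
the density theorem realizes it by a ring element on a finite basis. -/
theorem exists_smul_eq_single {k R ι : Type*} [Field k] [IsAlgClosed k] [Ring R] [Algebra k R]
    [Fintype ι] [DecidableEq ι] {M : ι → Type*} [∀ i, AddCommGroup (M i)] [∀ i, Module k (M i)]
    [∀ i, Module R (M i)] [∀ i, IsScalarTower k R (M i)] [∀ i, FiniteDimensional k (M i)]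
    [∀ i, IsSimpleModule R (M i)] (hM : ∀ i j, Nonempty (M i ≃ₗ[R] M j) → i = j) (i : ι)
    (E : M i →ₗ[k] M i) :
    ∃ a : R, (∀ v : M i, a • v = E v) ∧ ∀ j, j ≠ i → ∀ v : M j, a • v = 0 := by
  have schur : ∀ φ : Module.End R (∀ i, M i), ∃ c : k, (∀ x, φ x i = c • x i) ∧
      ∀ v, φ (Pi.single i v) = Pi.single i (c • v) := by
    intro φ
    have h0 : ∀ j l, j ≠ l → ∀ v, φ (Pi.single j v) l = 0 := by
      intro j l hjl v
      let f : M j →ₗ[R] M l := (LinearMap.proj l).comp (φ.comp (LinearMap.single R M j))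
      rcases LinearMap.bijective_or_eq_zero f with h | h
      · exact absurd (hM j l ⟨LinearEquiv.ofBijective f h⟩) hjl
      · exact LinearMap.congr_fun h v
    obtain ⟨c, hc⟩ := (IsSimpleModule.algebraMap_end_bijective_of_isAlgClosed k).2
      ((LinearMap.proj i).comp (φ.comp (LinearMap.single R M i)) : Module.End R (M i))
    have h1 : ∀ v, φ (Pi.single i v) i = c • v := fun v => (LinearMap.congr_fun hc v).symm
    refine ⟨c, fun x => ?_, fun v => ?_⟩
    · conv_lhs => rw [← Finset.univ_sum_single x]
      rw [map_sum, Finset.sum_apply, Finset.sum_eq_single i (fun j _ hj => h0 j i hj _)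
        (fun h => absurd (Finset.mem_univ i) h), h1]
    · funext l
      by_cases hl : l = i
      · subst hl
        rw [h1, Pi.single_eq_same]
      · rw [h0 i l (Ne.symm hl), Pi.single_eq_of_ne hl]
  let f : Module.End (Module.End R (∀ i, M i)) (∀ i, M i) :=
    { toFun := fun x => Pi.single i (E (x i))
      map_add' := fun x y => by rw [Pi.add_apply, map_add, Pi.single_add]
      map_smul' := fun φ x => by
        obtain ⟨c, hc, hc'⟩ := schur φ
        rw [Module.End.smul_def, hc, map_smul, RingHom.id_apply, Module.End.smul_def, hc'] }
  obtain ⟨a, ha⟩ := jacobson_density f (Set.finite_range fun jl : Σ j, Fin (Module.finrank k (M j)) =>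
    (Pi.single jl.1 (Module.finBasis k (M jl.1) jl.2) : ∀ i, M i)).toFinset
  have hs : ∀ j l, f (Pi.single j (Module.finBasis k (M j) l)) =
      a • Pi.single j (Module.finBasis k (M j) l) := 
    fun j l => ha _ ((Set.Finite.mem_toFinset _).mpr ⟨⟨j, l⟩, rfl⟩)
  refine ⟨a, fun v => ?_, fun j hj v => ?_⟩
  · have : Algebra.lsmul k k (M i) a = E := by
      refine (Module.finBasis k (M i)).ext fun l => ?_
      have h1 := congrFun (hs i l) i
      rw [Pi.smul_apply, Pi.single_eq_same] at h1
      change Pi.single (M := M) i (E (Pi.single (M := M) i _ i)) i = _ at h1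
      rw [Pi.single_eq_same, Pi.single_eq_same] at h1
      exact h1.symm
    exact LinearMap.congr_fun this v
  · have : Algebra.lsmul k k (M j) a = 0 := by
      refine (Module.finBasis k (M j)).ext fun l => ?_
      have h1 := congrFun (hs j l) j
      rw [Pi.smul_apply, Pi.single_eq_same] at h1
      change Pi.single (M := M) i (E (Pi.single (M := M) j _ i)) j = _ at h1
      rw [Pi.single_eq_of_ne hj] at h1
      exact h1.symm
    exact LinearMap.congr_fun this v

variable {k H : Type} [Field k] [IsAlgClosed k] [Group H]

omit [IsAlgClosed k] in
theorem nonempty_iso {M N : FDRep k H} (e : M ≃ₗ[k] N) (he : ∀ g m, e (M.ρ g m) = N.ρ g (e m)) :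
    Nonempty (M ≅ N) :=
  ⟨{ hom := homOf e.toLinearMap he
     inv := homOf e.symm.toLinearMap fun g m => by
       apply e.injective
       change e (e.symm _) = e (M.ρ g (e.symm m))
       rw [he, e.apply_symm_apply, e.apply_symm_apply]
     hom_inv_id := by
       ext m
       exact e.symm_apply_apply m
     inv_hom_id := by
       ext m
       exact e.apply_symm_apply m }⟩

/-- The relation extends linearly to the group algebra. Density supplies an element acting on one
module as a rank-one operator of non-zero trace and as zero on the others. Using traces of
operators, not dimensions, makes this valid in characteristic p. -/
theorem eq_zero_of_sum_trace {ι : Type} [Fintype ι] {L : ι → FDRep k H}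
    (hL : ∀ i, Representation.IsIrreducible (L i).ρ) (hiso : ∀ i j, Nonempty (L i ≅ L j) → i = j)
    (c : ι → k) (h : ∀ g, ∑ i, c i * (L i).character g = 0) (i : ι) : c i = 0 := by
  classical
  have : ∀ i, IsSimpleModule (MonoidAlgebra k H) (Representation.asModule (L i).ρ) :=
    fun i => (Representation.irreducible_iff_isSimpleModule_asModule (L i).ρ).mp (hL i)
  have hnt : Nontrivial (L i) := IsSimpleModule.nontrivial (MonoidAlgebra k H)
    (Representation.asModule (L i).ρ)
  obtain ⟨v, hv⟩ := exists_ne (0 : L i)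
  obtain ⟨ℓ, hℓ⟩ := Module.Projective.exists_dual_ne_zero k hv
  obtain ⟨a, ha, ha'⟩ := exists_smul_eq_single (k := k) (R := MonoidAlgebra k H)
    (M := fun i => Representation.asModule (L i).ρ) (fun i j ⟨e⟩ => hiso i j
      (nonempty_iso ((Representation.asModuleEquiv (L i).ρ).symm ≪≫ₗ e.restrictScalars k ≪≫ₗ
        Representation.asModuleEquiv (L j).ρ) fun g m => by
        simp only [LinearEquiv.trans_apply, LinearEquiv.restrictScalars_apply]
        rw [Representation.asModuleEquiv_symm_map_rho, map_smul,
          Representation.asModuleEquiv_map_smul, Representation.asAlgebraHom_of])) i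
    (ℓ.smulRight v)
  have key : ∀ b : MonoidAlgebra k H, ∑ j, c j * LinearMap.trace k (L j)
      (Representation.asAlgebraHom (L j).ρ b) = 0 := by
    intro b
    induction b using MonoidAlgebra.induction_linear with
    | zero => simp
    | add x y hx hy => simp only [map_add, mul_add, Finset.sum_add_distrib, hx, hy, add_zero]
    | single g t =>
      simp only [Representation.asAlgebraHom_single, map_smul, smul_eq_mul, mul_left_comm (c _) t]
      rw [← Finset.mul_sum]
      exact mul_eq_zero_of_right t (h g)
  have h1 := key a
  rw [Finset.sum_eq_single i] at h1
  · have h2 : Representation.asAlgebraHom (L i).ρ a = ℓ.smulRight v := LinearMap.ext ha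
    rw [h2, LinearMap.trace_smulRight] at h1
    exact (mul_eq_zero.mp h1).resolve_right hℓ
  · intro j _ hj
    have h2 : Representation.asAlgebraHom (L j).ρ a = 0 := LinearMap.ext (ha' j hj)
    rw [h2, map_zero, mul_zero]
  · exact fun h => absurd (Finset.mem_univ i) h

end Traces


/-! ### The number of irreducible modular representations -/

section CountIrreducible

open Matrix

/-- The homomorphism `inc` identifies `Hd` with the group of the matrices whose determinant has
trivial `r`-th power. -/
structure IsDetPowOne {F Hd : Type} [Field F] [Fintype F] [Group Hd] (inc : Hd →* GL (Fin 2) F)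
    (r : ℕ) : Prop where
  inj : Function.Injective inc
  det_pow : ∀ x, (inc x).1.det ^ r = 1
  exists_eq : ∀ g : GL (Fin 2) F, g.1.det ^ r = 1 → ∃ x, inc x = g
  cases : r = 1 ∨ r + 1 = Fintype.card F

theorem IsDetPowOne.pos {F Hd : Type} [Field F] [Fintype F] [Group Hd] {inc : Hd →* GL (Fin 2) F}
    {r : ℕ} (S : IsDetPowOne inc r) : 0 < r := by
  have := Fintype.one_lt_card (α := F)
  rcases S.cases with h | h <;> omega

variable {F : Type} [Field F] [Fintype F]

/-- In characteristic two every element is a square. Otherwise completing the square leaves a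
nondegenerate diagonal form in two variables, which represents every element of a finite field. -/
theorem exists_sq_add_eq (t d δ : F) (h : ¬ ∃ a : F, t = 2 * a ∧ d = a * a) :
    ∃ a b : F, a * a + t * a * b + d * b * b = δ := by
  by_cases h2 : ringChar F = 2
  · obtain ⟨a, ha⟩ := FiniteField.isSquare_of_char_two h2 δ
    exact ⟨a, 0, by rw [ha]; ring⟩
  · have h2' : (2 : F) ≠ 0 := Ring.two_ne_zero h2
    have hc : d - t ^ 2 / 4 ≠ 0 := fun h0 => h ⟨t / 2, by field_simp, by
      have h4 : (4 : F) = 2 * 2 := by norm_num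
      rw [h4] at h0
      field_simp at h0 ⊢
      linear_combination h0⟩
    obtain ⟨a, b, hab⟩ := FiniteField.exists_root_sum_quadratic
      (f := Polynomial.C 1 * Polynomial.X ^ 2 + Polynomial.C 0 * Polynomial.X + Polynomial.C (-δ))
      (g := Polynomial.C (d - t ^ 2 / 4) * Polynomial.X ^ 2 + Polynomial.C 0 * Polynomial.X +
        Polynomial.C 0)
      (Polynomial.degree_quadratic one_ne_zero) (Polynomial.degree_quadratic hc)
      (FiniteField.odd_card_of_char_ne_two h2)
    refine ⟨a - t * b / 2, b, ?_⟩
    simp only [map_zero, zero_mul, add_zero, map_one, one_mul, Polynomial.eval_add,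
      Polynomial.eval_mul, Polynomial.eval_pow, Polynomial.eval_X, Polynomial.eval_C] at hab
    have h4 : (4 : F) = 2 * 2 := by norm_num
    rw [h4] at hab
    field_simp at hab ⊢
    linear_combination hab

/-- The matrices a + bC commute with the companion matrix C, and their determinant is the quadratic
form of `exists_sq_add_eq`. -/
theorem exists_commute_cmp_det (t : F) (d δ : Fˣ) (h : ¬ ∃ a : F, t = 2 * a ∧ (d : F) = a * a) :
    ∃ z : GL (Fin 2) F, z * cmp t d = cmp t d * z ∧ z.1.det = δ := by
  obtain ⟨a, b, hab⟩ := exists_sq_add_eq t d δ h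
  have hdet : (!![a, -(d * b); b, a + t * b] : Matrix (Fin 2) (Fin 2) F).det = δ := by
    rw [det_fin_two_of, ← hab]
    ring
  refine ⟨Matrix.GeneralLinearGroup.mkOfDetNeZero _ (by rw [hdet]; exact δ.ne_zero), ?_, hdet⟩
  ext i j
  rw [Units.val_mul, Units.val_mul, cmp_val]
  fin_cases i <;> fin_cases j <;>
    simp [Matrix.GeneralLinearGroup.mkOfDetNeZero, Matrix.mul_apply, Fin.sum_univ_two] <;> ring

variable (p : ℕ) [Fact p.Prime] {k Hd W : Type} [Field k] [CharP k p] [Group Hd] [AddCommGroup W]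
  [Module k W] {inc : Hd →* GL (Fin 2) F} {r : ℕ}

/-- In characteristic p, (B - 1)^p = B^p - 1 = 0, so A(B - 1) is nilpotent and has trace zero. -/
theorem trace_mul_eq_of_unipotent (A B : Module.End k W) (hAB : Commute A B) (hB : B ^ p = 1) :
    LinearMap.trace k W (A * B) = LinearMap.trace k W A := by
  have h1 : IsNilpotent (B - 1) := by
    refine ⟨p, ?_⟩
    rcases subsingleton_or_nontrivial W with h | h
    · exact LinearMap.ext fun _ => Subsingleton.elim _ _
    · have : CharP (Module.End k W) p := charP_of_injective_algebraMap' k p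
      rw [sub_pow_char_of_commute p (Commute.one_right B), hB, one_pow, sub_self]
  have h2 : IsNilpotent (A * (B - 1)) :=
    (hAB.sub_right (Commute.one_right A)).isNilpotent_mul_left h1
  have h3 : A * B = A + A * (B - 1) := by rw [mul_sub, mul_one, add_sub_cancel]
  rw [h3, map_add, (LinearMap.isNilpotent_trace_of_isNilpotent h2).eq_zero, add_zero]

variable [CharP F p]

section

include p

omit [Fintype F] in
theorem pow_char_eq_one {g : GL (Fin 2) F} (ht : g.1.trace = 2) (hd : g.1.det = 1) : g ^ p = 1 := by
  have h1 : (g.1 - 1) ^ 2 = 0 := by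
    rw [trace_fin_two] at ht
    rw [det_fin_two] at hd
    ext i j
    rw [sq, Matrix.mul_apply, Fin.sum_univ_two]
    fin_cases i <;> fin_cases j <;> simp
    · linear_combination g.1 0 0 * ht - hd
    · linear_combination g.1 0 1 * ht
    · linear_combination g.1 1 0 * ht
    · linear_combination g.1 1 1 * ht - hd
  have h2 : (g.1 - 1) ^ p = 0 := by
    obtain ⟨n, hn⟩ := Nat.exists_eq_add_of_le (Fact.out : p.Prime).two_le
    rw [hn, pow_add, h1, zero_mul]
  rw [sub_pow_char_of_commute p (Commute.one_right _), one_pow, sub_eq_zero] at h2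
  exact Units.ext (by rw [Units.val_pow_eq_pow_val, h2, Units.val_one])

theorem IsDetPowOne.trace_eq_scalar (S : IsDetPowOne inc r) (ρ : Hd →* Module.End k W) {x c : Hd}
    {a : Fˣ} (hc : inc c = sc a) (ht : (inc x).1.trace = 2 * a) (hd : (inc x).1.det = a * a) :
    LinearMap.trace k W (ρ x) = LinearMap.trace k W (ρ c) := by
  have hcen : ∀ y, Commute c y := by
    intro y
    apply S.inj
    rw [map_mul, map_mul, hc]
    ext i j
    rw [Units.val_mul, Units.val_mul, sc, dg_val]
    fin_cases i <;> fin_cases j <;> simp [Matrix.mul_apply, Fin.sum_univ_two, mul_comm]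
  have hci : inc c⁻¹ = sc a⁻¹ := by
    rw [map_inv, hc, inv_eq_iff_mul_eq_one, sc, sc, dg_mul, mul_inv_cancel]
    ext i j
    fin_cases i <;> fin_cases j <;> simp [dg_val]
  have hu : (c⁻¹ * x) ^ p = 1 := by
    apply S.inj
    rw [map_pow, map_mul, map_one, hci]
    apply pow_char_eq_one p
    · rw [sc_mul_trace, ht, mul_left_comm, Units.inv_mul, mul_one]
    · rw [sc_mul_det, hd, mul_mul_mul_comm, Units.inv_mul, mul_one]
  rw [← mul_inv_cancel_left c x, map_mul]
  exact trace_mul_eq_of_unipotent p _ _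
    ((hcen _).map ρ) (by rw [← map_pow, hu, map_one])

/-- If the characteristic polynomial is a square of a linear factor over F, both traces equal that
of the scalar part, a unipotent factor being invisible. Otherwise x and y are conjugate in GL₂(F),
and a centralizing element of suitable determinant corrects the conjugator to determinant one,
bringing it into the group. -/
theorem IsDetPowOne.trace_eq (S : IsDetPowOne inc r) (ρ : Hd →* Module.End k W) {x y : Hd}
    (ht : (inc x).1.trace = (inc y).1.trace) (hd : (inc x).1.det = (inc y).1.det) :
    LinearMap.trace k W (ρ x) = LinearMap.trace k W (ρ y) := by
  by_cases h : ∃ a : F, (inc x).1.trace = 2 * a ∧ (inc x).1.det = a * a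
  · obtain ⟨a, h1, h2⟩ := h
    have ha : a ≠ 0 := by
      rintro rfl
      exact det_ne_zero_GL (inc x) (by rw [h2, zero_mul])
    obtain ⟨c, hc⟩ := S.exists_eq (sc (Units.mk0 a ha)) (by
      rw [sc_det, Units.val_mk0, ← h2, S.det_pow])
    rw [S.trace_eq_scalar p ρ hc h1 h2, 
      S.trace_eq_scalar p ρ hc (ht.symm.trans h1) (hd.symm.trans h2)]
  · have hnc : ∀ g : GL (Fin 2) F, g.1.trace = (inc x).1.trace → g.1.det = (inc x).1.det →
        g ∉ Subgroup.center (GL (Fin 2) F) := by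
      intro g h1 h2 hg
      obtain ⟨h3, h4, h5⟩ := mem_center_iff_entries.mp hg
      refine h ⟨g.1 0 0, ?_, ?_⟩
      · rw [← h1, trace_fin_two, ← h5, two_mul]
      · rw [← h2, det_fin_two, h3, h4, ← h5, mul_zero, sub_zero]
    let d : Fˣ := Units.mk0 _ (det_ne_zero_GL (inc x))
    obtain ⟨a, ha⟩ := exists_conj_cmp (hnc _ rfl rfl) (d := d) rfl
    obtain ⟨b, hb⟩ := exists_conj_cmp (hnc _ ht.symm hd.symm) (d := d) hd.symm
    rw [← ht] at hb
    obtain ⟨z, hz, hz'⟩ := exists_commute_cmp_det (inc x).1.trace d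
      (Units.mk0 _ (det_ne_zero_GL (a⁻¹ * b))) h
    have hdet : (a * z * b⁻¹).1.det = 1 := by
      rw [Units.val_mul, Units.val_mul, det_mul, det_mul, hz', Units.val_mk0, Units.val_mul,
        det_mul, ← mul_assoc, ← det_mul, ← Units.val_mul, mul_inv_cancel, Units.val_one, det_one,
        one_mul, ← det_mul, ← Units.val_mul, mul_inv_cancel, Units.val_one, det_one]
    obtain ⟨w, hw⟩ := S.exists_eq (a * z * b⁻¹) (by rw [hdet, one_pow])
    have hxy : x = w * y * w⁻¹ := by
      apply S.inj
      rw [map_mul, map_mul, map_inv, hw]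
      conv_rhs => rw [hb]
      conv_lhs => rw [ha]
      have h1 : z * cmp (inc x).1.trace d * z⁻¹ = cmp (inc x).1.trace d := by
        rw [hz, mul_inv_cancel_right]
      conv_lhs => rw [← h1]
      group
    rw [hxy, map_mul, LinearMap.trace_mul_comm, ← map_mul, inv_mul_cancel_left]

/-- Characters of non-isomorphic irreducible representations are independent functions of trace and
determinant, with q possible traces and at most r determinants. -/
theorem IsDetPowOne.card_le (S : IsDetPowOne inc r) [IsAlgClosed k] {m : ℕ}
    {L : Fin m → FDRep k Hd} (hL : ∀ i, Representation.IsIrreducible (L i).ρ)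
    (hiso : ∀ i j, Nonempty (L i ≅ L j) → i = j) : m ≤ Fintype.card F * r := by
  classical
  let Y : Type := F × {d : F // d ∈ Polynomial.nthRootsFinset r (1 : F)}
  let inv : Hd → Y := fun x => ((inc x).1.trace, ⟨(inc x).1.det,
    (Polynomial.mem_nthRootsFinset S.pos 1).mpr (S.det_pow x)⟩)
  let t : Fin m → Y → k := fun i y =>
    if h : ∃ x, inv x = y then (L i).character h.choose else 0
  have ht : ∀ i x, t i (inv x) = (L i).character x := by
    intro i x
    have h : ∃ x', inv x' = inv x := ⟨x, rfl⟩
    have h1 := h.choose_spec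
    simp only [t, dif_pos h]
    refine S.trace_eq p (L i).ρ (congrArg Prod.fst h1) ?_
    exact congrArg (fun y : Y => (y.2 : F)) h1
  have hli : LinearIndependent k t := by
    rw [Fintype.linearIndependent_iff]
    intro c hc
    refine eq_zero_of_sum_trace hL hiso c fun g => ?_
    have := congrFun hc (inv g)
    rw [Finset.sum_apply] at this
    simp only [Pi.smul_apply, ht, smul_eq_mul] at this
    exact this
  have h1 := hli.fintype_card_le_finrank
  rw [Fintype.card_fin, Module.finrank_fintype_fun_eq_card, Fintype.card_prod,
    Fintype.card_coe] at h1
  exact h1.trans (Nat.mul_le_mul_left _ (Polynomial.card_nthRoots r (1 : F) |>.trans' (by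
    exact Multiset.toFinset_card_le _)))

end

end CountIrreducible


/-! ### The Steinberg idempotent -/

section Steinberg

open Matrix

variable {F : Type} [Field F]

/-- The Weyl group element of determinant one. -/
def weylMat (F : Type) [Field F] : GL (Fin 2) F :=
  Matrix.GeneralLinearGroup.mkOfDetNeZero !![0, 1; -1, 0] (by simp [det_fin_two])

theorem weylMat_val : (weylMat F).1 = !![0, 1; -1, 0] := rfl

variable {Hd : Type} [Group Hd] {inc : Hd →* GL (Fin 2) F} {r : ℕ}

/-- The diagonal matrices in the group of matrices whose determinant has trivial `r`-th power,
parametrized by the first entry and the determinant. -/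
abbrev DetTorus (F : Type) [Field F] (r : ℕ) : Type := Fˣ × {d : Fˣ // d ^ r = 1}

variable [Fintype F]

namespace IsDetPowOne

variable (S : IsDetPowOne inc r)

/-- The upper triangular unipotent elements. -/
def uni (x : F) : Hd :=
  (S.exists_eq (GelfandGraevGLTwo.uni x) (by simp [uni_val, det_fin_two])).choose

theorem inc_uni (x : F) : inc (S.uni x) = GelfandGraevGLTwo.uni x :=
  (S.exists_eq (GelfandGraevGLTwo.uni x) (by simp [uni_val, det_fin_two])).choose_spec

/-- The diagonal elements. -/
def diag (t : DetTorus F r) : Hd :=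
  (S.exists_eq (dg t.1 (t.2.1 * t.1⁻¹)) (by
    have : (dg t.1 (t.2.1 * t.1⁻¹)).1.det = ((t.2.1 : Fˣ) : F) := by
      simp [dg_val, det_fin_two, mul_comm (t.1 : F)]
    rw [this, ← Units.val_pow_eq_pow_val, t.2.2, Units.val_one])).choose

theorem inc_diag (t : DetTorus F r) : inc (S.diag t) = dg t.1 (t.2.1 * t.1⁻¹) :=
  Exists.choose_spec (p := fun x => inc x = dg t.1 (t.2.1 * t.1⁻¹)) _

/-- The Weyl group element. -/
def weyl : Hd := (S.exists_eq (weylMat F) (by simp [weylMat_val, det_fin_two])).choose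

theorem inc_weyl : inc S.weyl = weylMat F :=
  (S.exists_eq (weylMat F) (by simp [weylMat_val, det_fin_two])).choose_spec

theorem uni_mul_uni (x y : F) : S.uni x * S.uni y = S.uni (x + y) := by
  apply S.inj
  rw [map_mul, inc_uni, inc_uni, inc_uni]
  ext i j
  rw [Units.val_mul, uni_val, uni_val, uni_val]
  fin_cases i <;> fin_cases j <;> simp [add_comm]

/-- The Weyl group action on the diagonal elements. -/
def swapTorus (t : DetTorus F r) : DetTorus F r := (t.2.1 * t.1⁻¹, t.2)

theorem weyl_mul_diag (t : DetTorus F r) :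
    S.weyl * S.diag t = S.diag (swapTorus t) * S.weyl := by
  apply S.inj
  rw [map_mul, map_mul, inc_weyl, inc_diag, inc_diag]
  ext i j
  rw [Units.val_mul, Units.val_mul, dg_val, dg_val, weylMat_val]
  fin_cases i <;> fin_cases j <;> simp [swapTorus]

theorem diag_mul_diag (t t' : DetTorus F r) :
    S.diag t * S.diag t' = S.diag (t.1 * t'.1, ⟨t.2.1 * t'.2.1, by
      rw [mul_pow, t.2.2, t'.2.2, one_mul]⟩) := by
  apply S.inj
  rw [map_mul, inc_diag, inc_diag, inc_diag, dg_mul]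
  congr 1
  rw [mul_inv, mul_mul_mul_comm]

theorem uni_mul_diag (t : DetTorus F r) (x : F) : S.uni x * S.diag t =
    S.diag t * S.uni ((t.1 : F)⁻¹ * (x * (((t.2.1 * t.1⁻¹ : Fˣ) : F)))) := by
  apply S.inj
  rw [map_mul, map_mul, inc_uni, inc_diag, inc_uni]
  ext i j
  rw [Units.val_mul, Units.val_mul, uni_val, uni_val, dg_val]
  fin_cases i <;> fin_cases j <;> simp

theorem bruhat_bijective : Function.Bijective
    (Sum.elim (fun b : DetTorus F r × F => S.diag b.1 * S.uni b.2)
      (fun b : (DetTorus F r × F) × F => S.diag b.1.1 * S.uni b.1.2 * S.weyl * S.uni b.2)) := by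
  have e1 : ∀ (a : Fˣ) (d : {d : Fˣ // d ^ r = 1}) (y : F), (inc (S.diag (a, d) * S.uni y)).1 =
      !![(a : F), a * y; 0, ((d.1 * a⁻¹ : Fˣ) : F)] := by
    intro a d y
    rw [map_mul, inc_diag, inc_uni, Units.val_mul, dg_val, uni_val]
    ext i j
    fin_cases i <;> fin_cases j <;> simp
  have e2 : ∀ (a : Fˣ) (d : {d : Fˣ // d ^ r = 1}) (y x : F),
      (inc (S.diag (a, d) * S.uni y * S.weyl * S.uni x)).1 =
      !![-(a * y : F), a - a * y * x; -((d.1 * a⁻¹ : Fˣ) : F), -((d.1 * a⁻¹ : Fˣ) : F) * x] := by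
    intro a d y x
    rw [map_mul, map_mul, Units.val_mul, Units.val_mul, e1, inc_weyl, inc_uni, uni_val,
      weylMat_val]
    ext i j
    fin_cases i <;> fin_cases j <;> simp [Matrix.mul_apply, Fin.sum_univ_two]
    ring
  constructor
  · rintro (⟨⟨a, d⟩, y⟩ | ⟨⟨⟨a, d⟩, y⟩, x⟩) (⟨⟨a', d'⟩, y'⟩ | ⟨⟨⟨a', d'⟩, y'⟩, x'⟩) h <;>
      simp only [Sum.elim_inl, Sum.elim_inr] at h <;>
      have h := congrArg (fun x => (inc x).1) h <;> simp only [e1, e2] at h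
    · have h00 := congrFun (congrFun h 0) 0
      have h01 := congrFun (congrFun h 0) 1
      have h11 := congrFun (congrFun h 1) 1
      simp only [of_apply, cons_val', cons_val_zero, cons_val_one, cons_val_fin_one] at h00 h01 h11
      have ha : a = a' := Units.ext h00
      subst ha
      have hd : d = d' := Subtype.ext (mul_right_cancel (Units.ext h11))
      subst hd
      have hy : y = y' := mul_left_cancel₀ a.ne_zero h01
      rw [hy]
    · have h10 := congrFun (congrFun h 1) 0
      simp only [of_apply, cons_val', cons_val_zero, cons_val_one, cons_val_fin_one] at h10
      exact absurd h10.symm (neg_ne_zero.mpr (Units.ne_zero _))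
    · have h10 := congrFun (congrFun h 1) 0
      simp only [of_apply, cons_val', cons_val_zero, cons_val_one, cons_val_fin_one] at h10
      exact absurd h10 (neg_ne_zero.mpr (Units.ne_zero _))
    · have h00 := congrFun (congrFun h 0) 0
      have h01 := congrFun (congrFun h 0) 1
      have h10 := congrFun (congrFun h 1) 0
      have h11 := congrFun (congrFun h 1) 1
      simp only [of_apply, cons_val', cons_val_zero, cons_val_one, cons_val_fin_one] at h00 h01 h10 h11
      have hd1 := Units.ext (neg_injective h10)
      rw [← hd1] at h11
      have hx : x = x' := mul_left_cancel₀ (neg_ne_zero.mpr (Units.ne_zero _)) h11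
      subst hx
      have ha : a = a' := Units.ext (by linear_combination h01 - x * h00)
      subst ha
      have hd : d = d' := Subtype.ext (mul_right_cancel hd1)
      subst hd
      have hy : y = y' := mul_left_cancel₀ a.ne_zero (neg_injective h00)
      rw [hy]
  · intro g
    have hdet := det_ne_zero_GL (inc g)
    let d : Fˣ := Units.mk0 _ hdet
    have hd : d ^ r = 1 := Units.ext (by
      rw [Units.val_pow_eq_pow_val, Units.val_mk0, S.det_pow, Units.val_one])
    have hdv : (inc g).1 0 0 * (inc g).1 1 1 - (inc g).1 0 1 * (inc g).1 1 0 = d :=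
      (det_fin_two _).symm
    by_cases h10 : (inc g).1 1 0 = 0
    · rw [h10, mul_zero, sub_zero] at hdv
      have ha : (inc g).1 0 0 ≠ 0 := fun h => d.ne_zero (by rw [← hdv, h, zero_mul])
      refine ⟨Sum.inl ((Units.mk0 _ ha, ⟨d, hd⟩), ((inc g).1 0 0)⁻¹ * (inc g).1 0 1), ?_⟩
      apply S.inj
      apply Units.ext
      rw [Sum.elim_inl, e1]
      ext i j
      fin_cases i <;> fin_cases j <;> simp [h10, ha, ← hdv]
      field_simp
    · let b : Fˣ := Units.mk0 _ (neg_ne_zero.mpr h10)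
      refine ⟨Sum.inr (((d * b⁻¹, ⟨d, hd⟩), -((d * b⁻¹ : Fˣ) : F)⁻¹ * (inc g).1 0 0),
        ((inc g).1 1 0)⁻¹ * (inc g).1 1 1), ?_⟩
      apply S.inj
      apply Units.ext
      rw [Sum.elim_inr, e2]
      have hb : (b : F) = -(inc g).1 1 0 := rfl
      ext i j
      fin_cases i <;> fin_cases j <;> simp [hb, ← hdv]
      · have := d.ne_zero
        rw [← hdv] at this
        field_simp
      · have := d.ne_zero
        rw [← hdv] at this
        field_simp
        ring
      · field_simp

variable {R : Type*} [Ring R] (ρ : Hd →* R)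

/-- The sum of the upper triangular elements. -/
def borelSum : R := by
  classical exact ∑ t : DetTorus F r, ∑ y : F, ρ (S.diag t * S.uni y)

theorem sum_eq_borelSum [Fintype Hd] :
    ∑ g, ρ g = S.borelSum ρ + S.borelSum ρ * ρ S.weyl * ∑ x, ρ (S.uni x) := by
  classical
  rw [← (S.bruhat_bijective).sum_comp, Fintype.sum_sum_type]
  simp only [Sum.elim_inl, Sum.elim_inr, Fintype.sum_prod_type, borelSum, Finset.sum_mul, map_mul]
  simp only [Finset.mul_sum]

theorem borelSum_mul_uni (x : F) : S.borelSum ρ * ρ (S.uni x) = S.borelSum ρ := by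
  simp only [borelSum, Finset.sum_mul]
  refine Finset.sum_congr rfl fun t _ => ?_
  refine Fintype.sum_equiv (Equiv.addRight x) _ _ fun y => ?_
  rw [← map_mul, mul_assoc, uni_mul_uni]
  rfl

theorem borelSum_mul_diag (t : DetTorus F r) : S.borelSum ρ * ρ (S.diag t) = S.borelSum ρ := by
  classical
  have h1 : ∀ t' : DetTorus F r, ∑ y, ρ (S.diag t' * S.uni y) * ρ (S.diag t) =
      ∑ y, ρ (S.diag t' * S.diag t * S.uni y) := by
    intro t'
    refine Fintype.sum_bijective
      (fun y => (t.1 : F)⁻¹ * (y * (((t.2.1 * t.1⁻¹ : Fˣ) : F)))) ?_ _ _ fun y => ?_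
    · exact ((mulLeft_bijective₀ _ (inv_ne_zero t.1.ne_zero))).comp
        (mulRight_bijective₀ _ (Units.ne_zero _))
    · rw [← map_mul, mul_assoc, uni_mul_diag, mul_assoc]
  simp only [borelSum, Finset.sum_mul, h1]
  refine Fintype.sum_equiv
    { toFun := fun t' : DetTorus F r => ((t'.1 * t.1, ⟨t'.2.1 * t.2.1, by
        rw [mul_pow, t.2.2, t'.2.2, one_mul]⟩) : DetTorus F r)
      invFun := fun t' => (t'.1 * t.1⁻¹, ⟨t'.2.1 * t.2.1⁻¹, by
        rw [mul_pow, inv_pow, t.2.2, t'.2.2, one_mul, inv_one]⟩)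
      left_inv := fun t' => by simp
      right_inv := fun t' => by simp } _ _ fun t' => ?_
  rw [diag_mul_diag]
  rfl

/-- A multiple of the idempotent of the Steinberg representation. -/
def steinberg : R := S.borelSum ρ * (1 - ρ S.weyl)

/-- Let b be the Borel sum and w the Weyl element. As q = 0 in R, b² = 0; by the Bruhat
decomposition bwb is the order of the torus times the sum over the big cell, which is the sum over
the group minus b. The sum over the group is annihilated by 1 - w. -/
theorem steinberg_mul_self [Fintype Hd] (hq : (Fintype.card F : R) = 0) :
    S.steinberg ρ * S.steinberg ρ = (Nat.card (DetTorus F r) : R) * S.steinberg ρ := by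
  classical
  have h0 : ∀ A : R, A * S.borelSum ρ = ∑ t : DetTorus F r, ∑ y, A * ρ (S.diag t) * ρ (S.uni y) := by
    intro A
    simp only [borelSum, Finset.mul_sum, map_mul, mul_assoc]
  have h1 : S.borelSum ρ * S.borelSum ρ = 0 := by
    rw [h0]
    refine Finset.sum_eq_zero fun t _ => ?_
    simp only [borelSum_mul_diag, borelSum_mul_uni, Finset.sum_const, Finset.card_univ,
      nsmul_eq_mul, hq, zero_mul]
  have h2 : S.borelSum ρ * ρ S.weyl * S.borelSum ρ =
      (Nat.card (DetTorus F r) : R) * (∑ g, ρ g - S.borelSum ρ) := by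
    rw [h0, S.sum_eq_borelSum, add_sub_cancel_left, Nat.card_eq_fintype_card, ← nsmul_eq_mul,
      ← Finset.card_univ, ← Finset.sum_const]
    refine Finset.sum_congr rfl fun t _ => ?_
    rw [Finset.mul_sum]
    refine Finset.sum_congr rfl fun y _ => ?_
    rw [mul_assoc (S.borelSum ρ), ← map_mul, weyl_mul_diag, map_mul, ← mul_assoc,
      borelSum_mul_diag]
  have h3 : (∑ g, ρ g) * (1 - ρ S.weyl) = 0 := by
    rw [mul_sub, mul_one, Finset.sum_mul, sub_eq_zero]
    simp only [← map_mul]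
    exact (Fintype.sum_equiv (Equiv.mulRight S.weyl) _ _ fun g => rfl).symm
  have h4 : S.borelSum ρ * (1 - ρ S.weyl) * S.borelSum ρ =
      (Nat.card (DetTorus F r) : R) * (S.borelSum ρ - ∑ g, ρ g) := by
    rw [mul_sub, mul_one, sub_mul, h1, zero_sub, h2, ← mul_neg, neg_sub]
  rw [steinberg, ← mul_assoc, h4, mul_assoc, sub_mul, h3, sub_zero]

end IsDetPowOne

end Steinberg


/-! ### The multiplicity of the Steinberg representation -/

section SteinbergRank

/-- Up to the invertible scalar c the operators behave like idempotents, and taking images of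
compatible idempotents is exact. -/
theorem finrank_range_add {k V₁ V₂ V₃ : Type} [Field k] [AddCommGroup V₁] [Module k V₁]
    [AddCommGroup V₂] [Module k V₂] [AddCommGroup V₃] [Module k V₃] [FiniteDimensional k V₂]
    {f : V₁ →ₗ[k] V₂} {g : V₂ →ₗ[k] V₃} (hf : Function.Injective f) (hfg : Function.Exact f g)
    (hg : Function.Surjective g) {E₁ : Module.End k V₁} {E₂ : Module.End k V₂}
    {E₃ : Module.End k V₃} (h₁ : ∀ v, f (E₁ v) = E₂ (f v)) (h₃ : ∀ v, g (E₂ v) = E₃ (g v)) {c : k}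
    (hc : c ≠ 0) (hE : E₂ * E₂ = c • E₂) :
    Module.finrank k (LinearMap.range E₂) =
      Module.finrank k (LinearMap.range E₁) + Module.finrank k (LinearMap.range E₃) := by
  have h := (g.domRestrict (LinearMap.range E₂)).finrank_range_add_finrank_ker
  have e1 : LinearMap.range (g.domRestrict (LinearMap.range E₂)) = LinearMap.range E₃ := by
    rw [LinearMap.range_domRestrict, ← LinearMap.range_comp]
    have : g ∘ₗ E₂ = E₃ ∘ₗ g := LinearMap.ext h₃
    rw [this, LinearMap.range_comp, LinearMap.range_eq_top.mpr hg, Submodule.map_top]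
  have e2 : (LinearMap.ker (g.domRestrict (LinearMap.range E₂))).map
      (LinearMap.range E₂).subtype = (LinearMap.range E₁).map f := by
    ext x
    simp only [Submodule.mem_map, LinearMap.mem_ker, LinearMap.domRestrict_apply,
      Submodule.subtype_apply, LinearMap.mem_range, exists_exists_eq_and]
    constructor
    · rintro ⟨⟨_, ⟨y, rfl⟩⟩, hy, rfl⟩
      obtain ⟨z, hz⟩ := (hfg _).mp hy
      -- An element E₂ y of the kernel of g comes from some z; applying E₂ once more multiplies it
      -- by c, which is undone here.
      refine ⟨c⁻¹ • z, ?_⟩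
      rw [h₁, map_smul, map_smul, hz]
      have := LinearMap.congr_fun hE y
      rw [Module.End.mul_apply, LinearMap.smul_apply] at this
      rw [this, inv_smul_smul₀ hc]
    · rintro ⟨y, rfl⟩
      exact ⟨⟨f (E₁ y), ⟨f y, (h₁ y).symm⟩⟩, hfg.apply_apply_eq_zero _, rfl⟩
  rw [← h, e1, (Submodule.equivMapOfInjective f hf _).finrank_eq, ← e2,
    ← (Submodule.equivMapOfInjective _ (LinearMap.range E₂).injective_subtype _).finrank_eq, add_comm]

variable {F k Hd : Type} [Field F] [Fintype F] [Field k] [Algebra F k] [Group Hd]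
  {inc : Hd →* GL (Fin 2) F} {r : ℕ} (S : IsDetPowOne inc r)

namespace IsDetPowOne

include S in
theorem sum_det_pow [Fintype {d : Fˣ // d ^ r = 1}] (b : ℕ) :
    ∑ d : {d : Fˣ // d ^ r = 1}, (d.1 : F) ^ b =
      if r ∣ b then (if r = 1 then 1 else -1) else 0 := by
  classical
  by_cases hr : r = 1
  · subst hr
    have : Unique {d : Fˣ // d ^ 1 = 1} :=
      ⟨⟨⟨1, one_pow 1⟩⟩, fun d => Subtype.ext (by simpa using d.2)⟩
    rw [Fintype.sum_unique, if_pos (one_dvd b), if_pos rfl]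
    have : ((default : {d : Fˣ // d ^ 1 = 1}).1 : Fˣ) = 1 := by
      simpa using (default : {d : Fˣ // d ^ 1 = 1}).2
    rw [this, Units.val_one, one_pow]
  · have hr' : r = Fintype.card F - 1 := by
      have := S.cases.resolve_left hr
      omega
    subst hr'
    rw [if_neg hr, ← FiniteField.sum_pow_units F b]
    refine Fintype.sum_equiv (Equiv.subtypeUnivEquiv fun d => ?_) _ _ fun d => ?_
    · rw [← Fintype.card_units, pow_card_eq_one]
    · rfl

include S in
theorem card_detTorus_ne_zero : (Nat.card (DetTorus F r) : k) ≠ 0 := by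
  classical
  have h1 := S.sum_det_pow 0
  simp only [pow_zero, Finset.sum_const, Finset.card_univ, nsmul_eq_mul, mul_one, dvd_zero,
    if_true] at h1
  have h2 : (Nat.card (DetTorus F r) : F) ≠ 0 := by
    rw [Nat.card_prod, Nat.cast_mul, Nat.card_eq_fintype_card, Nat.card_eq_fintype_card, h1,
      Fintype.card_units, Nat.cast_sub Fintype.card_pos, FiniteField.cast_card_eq_zero]
    split_ifs <;> simp
  rw [← map_natCast (algebraMap F k)]
  exact (map_ne_zero _).mpr h2

/-- The multiplicity of the Steinberg representation. -/
def stRank (M : FDRep k Hd) : ℤ :=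
  Module.finrank k (LinearMap.range (S.steinberg (R := Module.End k M) M.ρ))

omit [Algebra F k] in
theorem lin_steinberg {M N : FDRep k Hd} (f : M ⟶ N) (v : M) :
    lin f (S.steinberg (R := Module.End k M) M.ρ v) =
      S.steinberg (R := Module.End k N) N.ρ (lin f v) := by
  simp only [steinberg, borelSum, Module.End.mul_apply, LinearMap.sub_apply, Module.End.one_apply,
    LinearMap.sum_apply, map_sum, map_sub, lin_rho]

theorem isAdditive_stRank [Finite Hd] : IsAdditive (S.stRank (k := k)) := by
  intro M₁ M₂ M₃ f g h
  have := Fintype.ofFinite Hd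
  have hE := S.steinberg_mul_self (R := Module.End k M₂) M₂.ρ (by
    have : (Fintype.card F : k) = 0 := by
      rw [← map_natCast (algebraMap F k), FiniteField.cast_card_eq_zero, map_zero]
    rw [← map_natCast (algebraMap k (Module.End k M₂)), this, map_zero])
  rw [stRank, stRank, stRank, finrank_range_add h.inj h.exact h.surj (S.lin_steinberg f)
    (S.lin_steinberg g) (S.card_detTorus_ne_zero (k := k)) (hE.trans ?_), Nat.cast_add]
  rw [← map_natCast (algebraMap k (Module.End k M₂)), Algebra.smul_def]

/-- The restriction of the representation to the unipotent elements is a polynomial of degree `a`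
with leading coefficient of rank one, and `v` is a highest weight vector. -/
structure HasShape {V : Type} [AddCommGroup V] [Module k V] (ρ : Hd →* Module.End k V) (a b : ℕ)
    (N : ℕ → Module.End k V) (v : V) (l : Module.Dual k V) : Prop where
  uni : ∀ x : F, ρ (S.uni x) = ∑ m ∈ Finset.range (a + 1), algebraMap F k x ^ m • N m
  eq_zero : ∀ m, a < m → N m = 0
  lead : ∀ w, N a w = l w • v
  diag : ∀ t : DetTorus F r, ρ (S.diag t) v =
    algebraMap F k ((t.1 : F) ^ a * (t.2.1 : F) ^ b) • v
  weyl : l (ρ S.weyl v) ≠ 0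
  lead_self : 0 < a → l v = 0

/-- The unipotent sum averages a polynomial of degree at most q - 1 over F, where only the power q -
1 has a non-zero sum. So the Steinberg operator vanishes unless a = q - 1, and then it maps into the
line of v; the torus sum acts on v by a non-zero scalar exactly when r ∣ b. -/
theorem HasShape.finrank_range {V : Type} [AddCommGroup V] [Module k V] {ρ : Hd →* Module.End k V}
    {a b : ℕ} {N : ℕ → Module.End k V} {v : V} {l : Module.Dual k V} (h : S.HasShape ρ a b N v l)
    (ha : a < Fintype.card F) : Module.finrank k (LinearMap.range (S.steinberg ρ)) =
      if a + 1 = Fintype.card F ∧ r ∣ b then 1 else 0 := by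
  classical
  have hsum : ∑ x : F, ρ (S.uni x) =
      ∑ m ∈ Finset.range (a + 1), algebraMap F k (∑ x : F, x ^ m) • N m := by
    simp only [h.uni]
    rw [Finset.sum_comm]
    refine Finset.sum_congr rfl fun m _ => ?_
    rw [map_sum, Finset.sum_smul]
    simp only [map_pow]
  have hB : S.borelSum ρ = (∑ t, ρ (S.diag t)) * ∑ x, ρ (S.uni x) := by
    simp only [borelSum, map_mul, Finset.sum_mul]
    simp only [Finset.mul_sum]
  have hlt : ∀ m, m < Fintype.card F - 1 → ∑ x : F, x ^ m = 0 :=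
    fun m hm => FiniteField.sum_pow_lt_card_sub_one F m hm
  by_cases haq : a + 1 = Fintype.card F
  · have ha0 : 0 < a := by
      have := Fintype.one_lt_card (α := F)
      omega
    have hU : ∑ x : F, ρ (S.uni x) = - N a := by
      rw [hsum, Finset.sum_range_succ, Finset.sum_eq_zero, zero_add]
      · have h1 : ∑ x : F, x ^ a = -1 := by
          have h2 : ∀ x : F, x ^ a = 1 - if x = 0 then 1 else 0 := by
            intro x
            by_cases hx : x = 0
            · rw [if_pos hx, hx, zero_pow ha0.ne', sub_self]
            · rw [if_neg hx, sub_zero, show a = Fintype.card F - 1 by omega,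
                FiniteField.pow_card_sub_one_eq_one x hx]
          simp only [h2, Finset.sum_sub_distrib, Finset.sum_const, Finset.card_univ, nsmul_eq_mul,
            FiniteField.cast_card_eq_zero, Finset.sum_ite_eq', Finset.mem_univ, if_true]
          ring
        rw [h1, map_neg, map_one, neg_smul, one_smul]
      · intro m hm
        rw [hlt m (by have := Finset.mem_range.mp hm; omega), map_zero, zero_smul]
    have hT : (∑ t, ρ (S.diag t)) v =
        algebraMap F k (if r ∣ b then (if r = 1 then -1 else 1) else 0) • v := by
      have h1 : (∑ t : DetTorus F r, (t.1 : F) ^ a * (t.2.1 : F) ^ b) =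
          if r ∣ b then (if r = 1 then -1 else 1) else 0 := by
        have h2 : ∀ t : Fˣ, (t : F) ^ a = 1 := fun t => by
          rw [← Units.val_pow_eq_pow_val, show a = Fintype.card Fˣ by
            rw [Fintype.card_units, ← haq, Nat.add_sub_cancel], pow_card_eq_one, Units.val_one]
        simp only [h2, one_mul]
        rw [Fintype.sum_prod_type]
        simp only [S.sum_det_pow b, Finset.sum_const, Finset.card_univ]
        rw [Fintype.card_units, nsmul_eq_mul, Nat.cast_sub Fintype.card_pos,
          FiniteField.cast_card_eq_zero]
        split_ifs <;> simp
      rw [LinearMap.sum_apply, ← h1, map_sum, Finset.sum_smul]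
      exact Finset.sum_congr rfl fun t _ => h.diag t
    have hE : ∀ w, S.steinberg ρ w = (-(l ((1 - ρ S.weyl) w)) *
        algebraMap F k (if r ∣ b then (if r = 1 then -1 else 1) else 0)) • v := by
      intro w
      rw [steinberg, hB, hU, Module.End.mul_apply, Module.End.mul_apply, LinearMap.neg_apply,
        h.lead, ← neg_smul, map_smul, hT, smul_smul]
    by_cases hr : r ∣ b
    · rw [if_pos ⟨haq, hr⟩]
      rw [finrank_eq_one_iff']
      have hv : v ≠ 0 := by
        rintro rfl
        exact h.weyl (by rw [map_zero, map_zero])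
      have hv1 : -(l ((1 - ρ S.weyl) v)) * algebraMap F k (if r = 1 then -1 else 1) ≠ 0 := by
        refine mul_ne_zero ?_ ((map_ne_zero _).mpr ?_)
        · rw [LinearMap.sub_apply, Module.End.one_apply, map_sub, h.lead_self ha0, zero_sub, neg_neg]
          exact h.weyl
        · split_ifs
          · exact neg_ne_zero.mpr one_ne_zero
          · exact one_ne_zero
      have hE' := hE v
      rw [if_pos hr] at hE'
      refine ⟨⟨_, ⟨v, rfl⟩⟩, fun h0 => ?_, ?_⟩
      · have h1 := congrArg Subtype.val h0
        change S.steinberg ρ v = 0 at h1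
        rw [hE'] at h1
        exact (smul_ne_zero hv1 hv) h1
      · rintro ⟨_, ⟨w, rfl⟩⟩
        refine ⟨(-(l ((1 - ρ S.weyl) w)) * algebraMap F k (if r = 1 then -1 else 1)) *
          (-(l ((1 - ρ S.weyl) v)) * algebraMap F k (if r = 1 then -1 else 1))⁻¹, ?_⟩
        apply Subtype.ext
        change _ • S.steinberg ρ v = S.steinberg ρ w
        rw [hE', hE w, if_pos hr, smul_smul, inv_mul_cancel_right₀ hv1]
    · rw [if_neg fun h => hr h.2]
      have : S.steinberg ρ = 0 := LinearMap.ext fun w => by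
        rw [hE, if_neg hr, map_zero, mul_zero, zero_smul, LinearMap.zero_apply]
      rw [this, LinearMap.range_zero, finrank_bot]
  · rw [if_neg fun h => haq h.1]
    have : S.steinberg ρ = 0 := by
      have h0 : ∑ m ∈ Finset.range (a + 1), algebraMap F k (∑ x : F, x ^ m) • N m = 0 := by
        refine Finset.sum_eq_zero fun m hm => ?_
        rw [hlt m (by have := Finset.mem_range.mp hm; omega), map_zero, zero_smul]
      rw [steinberg, hB, hsum, h0, mul_zero, zero_mul]
    rw [this, LinearMap.range_zero, finrank_bot]

end IsDetPowOne

end SteinbergRank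


/-! ### Tensor powers of the natural representation -/

section NaturalRep

open MonoidalCategory

variable {F k Hd : Type} [Field F] [Fintype F] [Field k] [Algebra F k] [Group Hd]
  (inc : Hd →* GL (Fin 2) F) {r : ℕ}

/-- The natural representation on the plane. -/
def natHom : Hd →* Module.End k (Fin 2 → k) where
  toFun g := Matrix.toLin' ((inc g).1.map (algebraMap F k))
  map_one' := by
    rw [map_one, Units.val_one, Matrix.map_one _ (map_zero _) (map_one _), Matrix.toLin'_one]
    rfl
  map_mul' g h := by
    rw [map_mul, Units.val_mul, Matrix.map_mul, Matrix.toLin'_mul]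
    rfl

/-- The determinant as a representation. -/
def detHom : Hd →* Module.End k k where
  toFun g := algebraMap F k (inc g).1.det • LinearMap.id
  map_one' := by rw [map_one, Units.val_one, Matrix.det_one, map_one, one_smul]; rfl
  map_mul' g h := by
    refine LinearMap.ext fun v => ?_
    rw [map_mul, Units.val_mul, Matrix.det_mul, map_mul, mul_smul]
    rfl

variable (k) in
/-- The natural representation. -/
def natRep : FDRep k Hd := FDRep.of (natHom (k := k) inc)

variable (k) in
/-- The determinant representation. -/
def detRep : FDRep k Hd := FDRep.of (detHom (k := k) inc)

variable {inc}

omit [Fintype F] in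
theorem natHom_apply (g : Hd) (v : Fin 2 → k) : natHom inc g v =
    ![algebraMap F k ((inc g).1 0 0) * v 0 + algebraMap F k ((inc g).1 0 1) * v 1,
      algebraMap F k ((inc g).1 1 0) * v 0 + algebraMap F k ((inc g).1 1 1) * v 1] := by
  change Matrix.toLin' _ v = _
  rw [Matrix.toLin'_apply]
  ext i
  fin_cases i <;> simp [Matrix.mulVec, dotProduct, Fin.sum_univ_two]

namespace IsDetPowOne

variable (S : IsDetPowOne inc r)

theorem hasShape_unit : ∃ (N : ℕ → Module.End k k) (v : k) (l : Module.Dual k k),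
    S.HasShape (𝟙_ (FDRep k Hd)).ρ 0 0 N v l := by
  refine ⟨fun m => if m = 0 then LinearMap.id else 0, 1, LinearMap.id, fun x => ?_, fun m hm => ?_,
    fun w => ?_, fun t => ?_, ?_, fun h => absurd h (lt_irrefl 0)⟩
  · simp
    rfl
  · exact if_neg hm.ne'
  · simp
  · simp
    rfl
  · exact one_ne_zero

variable {S} {V : Type} [AddCommGroup V] [Module k V] {ρ : Hd →* Module.End k V} {a b : ℕ}
  {N : ℕ → Module.End k V} {v : V} {l : Module.Dual k V}

omit [Fintype F] [Algebra F k] [Field F] [Group Hd] in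
theorem tmul_eq_smul_one_tmul (c : k) (v : V) : c ⊗ₜ[k] v = c • ((1 : k) ⊗ₜ[k] v) := by
  rw [TensorProduct.smul_tmul', smul_eq_mul, mul_one]

theorem HasShape.det (h : S.HasShape ρ a b N v l) {ρ' : Hd →* Module.End k (k ⊗[k] V)}
    (hρ : ∀ g, ρ' g = TensorProduct.map (detHom inc g) (ρ g)) :
    S.HasShape ρ' a (b + 1) (fun m => TensorProduct.map LinearMap.id (N m)) (1 ⊗ₜ v)
      (l ∘ₗ (TensorProduct.lid k V).toLinearMap) where
  uni x := by
    refine TensorProduct.ext' fun c w => ?_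
    have h1 : (inc (S.uni x)).1.det = 1 := by
      rw [inc_uni, uni_val, Matrix.det_fin_two_of]
      ring
    rw [hρ, h.uni, TensorProduct.map_tmul, LinearMap.sum_apply, LinearMap.sum_apply,
      TensorProduct.tmul_sum]
    refine Finset.sum_congr rfl fun m _ => ?_
    rw [LinearMap.smul_apply, LinearMap.smul_apply, TensorProduct.map_tmul,
      TensorProduct.tmul_smul]
    change _ • ((algebraMap F k (inc (S.uni x)).1.det * c) ⊗ₜ[k] _) = _
    rw [h1, map_one, one_mul]
    rfl
  eq_zero m hm := by rw [h.eq_zero m hm, TensorProduct.map_zero_right]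
  lead w := by
    induction w using TensorProduct.induction_on with
    | zero => rw [map_zero, map_zero, zero_smul]
    | add x y hx hy => rw [map_add, map_add, add_smul, hx, hy]
    | tmul c w =>
      rw [TensorProduct.map_tmul, h.lead, LinearMap.comp_apply, LinearEquiv.coe_coe,
        TensorProduct.lid_tmul, map_smul, TensorProduct.tmul_smul, LinearMap.id_apply,
        tmul_eq_smul_one_tmul c v, smul_smul, smul_eq_mul, mul_comm]
  diag t := by
    have h1 : (inc (S.diag t)).1.det = t.2.1 := by
      rw [inc_diag, dg_val, Matrix.det_fin_two_of, mul_zero, sub_zero, Units.val_mul,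
        mul_comm ((t.2.1 : Fˣ) : F), Units.mul_inv_cancel_left]
    rw [hρ, TensorProduct.map_tmul, h.diag, TensorProduct.tmul_smul]
    change _ • ((algebraMap F k (inc (S.diag t)).1.det * 1) ⊗ₜ[k] _) = _
    rw [h1, mul_one, tmul_eq_smul_one_tmul, smul_smul, ← map_mul, mul_assoc, ← pow_succ]
  weyl := by
    have h1 : (inc S.weyl).1.det = 1 := by
      rw [inc_weyl, weylMat_val, Matrix.det_fin_two_of]
      ring
    rw [hρ, TensorProduct.map_tmul, LinearMap.comp_apply, LinearEquiv.coe_coe,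
        TensorProduct.lid_tmul, map_smul]
    change (algebraMap F k (inc S.weyl).1.det * 1) • _ ≠ _
    rw [h1, map_one, mul_one, one_smul]
    exact h.weyl
  lead_self ha := by
    rw [LinearMap.comp_apply, LinearEquiv.coe_coe, TensorProduct.lid_tmul, one_smul,
      h.lead_self ha]

/-- A unipotent element sends a vector c of the plane to c + x c₁ e₀. This raises the degree in x by
one, and the new leading coefficient is the rank-one map c ↦ c₁ e₀ tensored with the old one. -/
theorem HasShape.nat (h : S.HasShape ρ a b N v l) {ρ' : Hd →* Module.End k ((Fin 2 → k) ⊗[k] V)}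
    (hρ : ∀ g, ρ' g = TensorProduct.map (natHom inc g) (ρ g)) :
    S.HasShape ρ' (a + 1) b (fun m => TensorProduct.map LinearMap.id (N m) +
      if m = 0 then 0 else TensorProduct.map
        ((LinearMap.proj 1 : (Fin 2 → k) →ₗ[k] k).smulRight ![1, 0]) (N (m - 1))) (![1, 0] ⊗ₜ v)
      ((TensorProduct.lid k k).toLinearMap ∘ₗ
        TensorProduct.map (LinearMap.proj 1 : (Fin 2 → k) →ₗ[k] k) l) where
  uni x := by
    refine TensorProduct.ext' fun c w => ?_
    have h1 : natHom inc (S.uni x) c = c + (algebraMap F k x * c 1) • (![1, 0] : Fin 2 → k) := by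
      rw [natHom_apply, inc_uni, uni_val]
      ext i
      fin_cases i <;> simp
    rw [hρ, h.uni, TensorProduct.map_tmul, h1, TensorProduct.add_tmul, LinearMap.sum_apply,
      LinearMap.sum_apply]
    simp only [LinearMap.smul_apply, LinearMap.add_apply, smul_add, Finset.sum_add_distrib]
    congr 1
    · rw [Finset.sum_range_succ _ (a + 1), h.eq_zero _ (Nat.lt_succ_self a), TensorProduct.map_zero_right,
        LinearMap.zero_apply, smul_zero, add_zero, TensorProduct.tmul_sum]
      refine Finset.sum_congr rfl fun m _ => ?_
      rw [TensorProduct.map_tmul, TensorProduct.tmul_smul]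
      rfl
    · rw [Finset.sum_range_succ' _ (a + 1), if_pos rfl, LinearMap.zero_apply, smul_zero, add_zero,
        TensorProduct.tmul_sum]
      refine Finset.sum_congr rfl fun m _ => ?_
      rw [if_neg (Nat.succ_ne_zero m), Nat.add_sub_cancel, TensorProduct.map_tmul,
        TensorProduct.tmul_smul, mul_smul, ← TensorProduct.smul_tmul', smul_smul, ← pow_succ]
      rfl
  eq_zero m hm := by
    rw [h.eq_zero m (by omega), h.eq_zero (m - 1) (by omega), TensorProduct.map_zero_right,
      TensorProduct.map_zero_right, ite_self, add_zero]
  lead w := by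
    rw [if_neg (Nat.succ_ne_zero a), h.eq_zero _ (Nat.lt_succ_self a), TensorProduct.map_zero_right,
      zero_add, Nat.add_sub_cancel]
    induction w using TensorProduct.induction_on with
    | zero => rw [map_zero, map_zero, zero_smul]
    | add x y hx hy => rw [map_add, map_add, add_smul, hx, hy]
    | tmul c w =>
      rw [TensorProduct.map_tmul, h.lead, LinearMap.comp_apply, LinearEquiv.coe_coe,
        TensorProduct.map_tmul, TensorProduct.lid_tmul, LinearMap.smulRight_apply,
        TensorProduct.smul_tmul_smul]
      rfl
  diag t := by
    have h1 : natHom inc (S.diag t) ![1, 0] = algebraMap F k t.1 • (![1, 0] : Fin 2 → k) := by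
      rw [natHom_apply, inc_diag, dg_val]
      ext i
      fin_cases i <;> simp
    rw [hρ, TensorProduct.map_tmul, h.diag, h1, TensorProduct.smul_tmul_smul, ← map_mul, pow_succ']
    congr 2
    ring
  weyl := by
    have h1 : natHom inc S.weyl ![1, 0] = (![0, -1] : Fin 2 → k) := by
      rw [natHom_apply, inc_weyl, weylMat_val]
      ext i
      fin_cases i <;> simp
    rw [hρ, TensorProduct.map_tmul, h1, LinearMap.comp_apply, LinearEquiv.coe_coe,
        TensorProduct.map_tmul, TensorProduct.lid_tmul]
    refine smul_ne_zero ?_ h.weyl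
    change (-1 : k) ≠ 0
    exact neg_ne_zero.mpr one_ne_zero
  lead_self ha := by
    rw [LinearMap.comp_apply, LinearEquiv.coe_coe, TensorProduct.map_tmul, TensorProduct.lid_tmul]
    exact zero_smul k _

variable (S k) in
theorem exists_hasShape (a b : ℕ) : ∃ M : FDRep k Hd,
    KAlg.mk M = KAlg.mk (natRep k inc) ^ a * KAlg.mk (detRep k inc) ^ b ∧
    ∃ (N : ℕ → Module.End k M) (v : M) (l : Module.Dual k M),
      S.HasShape (V := M) M.ρ a b N v l := by
  induction a with
  | zero =>
    induction b with
    | zero => exact ⟨𝟙_ _, by rw [KAlg.mk_unit, pow_zero, pow_zero, one_mul], S.hasShape_unit⟩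
    | succ b ih =>
      obtain ⟨M, hM, N, v, l, h⟩ := ih
      refine ⟨detRep k inc ⊗ M, ?_, _, _, _, HasShape.det h fun g => rfl⟩
      rw [KAlg.mk_tensor, hM, pow_succ']
      exact mul_left_comm _ _ _
  | succ a ih =>
    obtain ⟨M, hM, N, v, l, h⟩ := ih
    refine ⟨natRep k inc ⊗ M, ?_, _, _, _, HasShape.nat h fun g => rfl⟩
    rw [KAlg.mk_tensor, hM, pow_succ']
    exact (mul_assoc _ _ _).symm

variable (S) in
theorem stRank_pow_mul [Finite Hd] {a : ℕ} (b : ℕ) (ha : a < Fintype.card F) :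
    (S.isAdditive_stRank (k := k)).lift (KAlg.mk (natRep k inc) ^ a * KAlg.mk (detRep k inc) ^ b) =
      if a + 1 = Fintype.card F ∧ r ∣ b then 1 else 0 := by
  obtain ⟨M, hM, N, v, l, h⟩ := S.exists_hasShape k a b
  rw [← hM, IsAdditive.lift_mk, stRank, HasShape.finrank_range S h ha]
  split_ifs <;> rfl

end IsDetPowOne

end NaturalRep


/-! ### The structure of the Grothendieck ring -/

section KStructure

/-- The generators give a surjection from ℤ^J, and a surjective endomorphism of a finitely generated
free module is injective. -/
theorem injective_of_surjective_of_card_le {K J : Type*} [AddCommGroup K] [Fintype J] {G : Finset K}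
    (hG : AddSubgroup.closure (G : Set K) = ⊤) (hcard : G.card ≤ Fintype.card J)
    {φ : K →+ (J → ℤ)} (hφ : Function.Surjective φ) : Function.Injective φ := by
  classical
  obtain ⟨e⟩ := Function.Embedding.nonempty_of_card_le (α := G) (β := J)
    (by rwa [Fintype.card_coe])
  let v : J → K := Function.extend e Subtype.val 0
  let L : (J → ℤ) →ₗ[ℤ] K := Fintype.linearCombination ℤ v
  have hL : Function.Surjective L := by
    rw [← LinearMap.range_eq_top, Fintype.range_linearCombination, eq_top_iff]
    intro x _
    have hx : x ∈ AddSubgroup.closure (G : Set K) := hG ▸ AddSubgroup.mem_top x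
    rw [← Submodule.mem_toAddSubgroup]
    refine (AddSubgroup.closure_le _).mpr ?_ hx
    intro y hy
    exact Submodule.subset_span ⟨e ⟨y, hy⟩, e.injective.extend_apply _ _ _⟩
  have h1 : Function.Surjective (φ.toIntLinearMap ∘ₗ L) := hφ.comp hL
  have h2 := OrzechProperty.injective_of_surjective_endomorphism _ h1
  rw [injective_iff_map_eq_zero]
  intro x hx
  obtain ⟨c, rfl⟩ := hL x
  rw [(injective_iff_map_eq_zero (φ.toIntLinearMap ∘ₗ L)).mp h2 c hx, map_zero]

/-- The pairing with the qr monomials already maps their span onto ℤ^(qr), by antitriangularity.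
Since at most qr elements generate, the pairing is injective, so their span is everything. -/
theorem closure_eq_top_of_gram {K : Type*} [CommRing K] {q r : ℕ} (hr : 0 < r) {G : Finset K}
    (hG : AddSubgroup.closure (G : Set K) = ⊤) (hcard : G.card ≤ q * r) (σ : K →+ ℤ) (V D : K)
    (hσ : ∀ a b, a < q → σ (V ^ a * D ^ b) = if a + 1 = q ∧ r ∣ b then 1 else 0) :
    AddSubgroup.closure {x | ∃ i < q, ∃ j < r, x = V ^ i * D ^ j} = ⊤ := by
  classical
  let C := AddSubgroup.closure {x | ∃ i < q, ∃ j < r, x = V ^ i * D ^ j}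
  let φ : K →+ (Fin q × Fin r → ℤ) :=
    { toFun := fun x ij => σ (x * (V ^ (ij.1 : ℕ) * D ^ (ij.2 : ℕ)))
      map_zero' := funext fun ij => by rw [zero_mul, map_zero, Pi.zero_apply]
      map_add' := fun x y => funext fun ij => by rw [add_mul, map_add, Pi.add_apply] }
  have h1 : ∀ i < q, ∀ j < r, (fun ij : Fin q × Fin r =>
      if i = ij.1 ∧ j = ij.2 then (1 : ℤ) else 0) ∈ C.map φ := by
    refine mem_of_gram hr (g := fun a b => σ (V ^ a * D ^ b)) hσ _ _ fun k hk l hl => ?_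
    refine ⟨V ^ k * D ^ l, AddSubgroup.subset_closure ⟨k, hk, l, hl, rfl⟩, funext fun ij => ?_⟩
    rw [Finset.sum_apply, Finset.sum_eq_single (ij.1 : ℕ), Finset.sum_apply,
      Finset.sum_eq_single (ij.2 : ℕ)]
    · rw [Pi.smul_apply, if_pos ⟨rfl, rfl⟩, smul_eq_mul, mul_one]
      change σ (V ^ k * D ^ l * (V ^ (ij.1 : ℕ) * D ^ (ij.2 : ℕ))) = _
      congr 1
      ring
    · intro j _ hj
      rw [Pi.smul_apply, if_neg fun h => hj h.2, smul_zero]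
    · exact fun h => absurd (Finset.mem_range.mpr ij.2.2) h
    · intro i _ hi
      rw [Finset.sum_apply]
      refine Finset.sum_eq_zero fun j _ => ?_
      rw [Pi.smul_apply, if_neg fun h => hi h.1, smul_zero]
    · exact fun h => absurd (Finset.mem_range.mpr ij.1.2) h
  have h2 : C.map φ = ⊤ := by
    rw [eq_top_iff]
    intro f _
    have : f = ∑ ij : Fin q × Fin r, f ij • fun ij' : Fin q × Fin r =>
        if (ij.1 : ℕ) = ij'.1 ∧ (ij.2 : ℕ) = ij'.2 then (1 : ℤ) else 0 := by
      funext ij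
      rw [Finset.sum_apply, Finset.sum_eq_single ij]
      · simp
      · intro ij' _ hne
        rw [Pi.smul_apply, if_neg, smul_zero]
        exact fun h => hne (Prod.ext (Fin.ext h.1) (Fin.ext h.2))
      · exact fun h => absurd (Finset.mem_univ ij) h
    rw [this]
    exact sum_mem fun ij _ => zsmul_mem (h1 _ ij.1.2 _ ij.2.2) _
  have hsurj : Function.Surjective φ := by
    intro f
    obtain ⟨x, -, hx⟩ : f ∈ C.map φ := h2 ▸ AddSubgroup.mem_top f
    exact ⟨x, hx⟩
  have hinj := injective_of_surjective_of_card_le hG (by simpa using hcard) hsurj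
  rw [eq_top_iff]
  intro x _
  obtain ⟨y, hy, hxy⟩ : φ x ∈ C.map φ := h2 ▸ AddSubgroup.mem_top (φ x)
  rw [← hinj hxy]
  exact hy

theorem exists_eq_sum_of_closure {K : Type*} [CommRing K] {q r : ℕ} {V D : K}
    (h : AddSubgroup.closure {x | ∃ i < q, ∃ j < r, x = V ^ i * D ^ j} = ⊤) (x : K) :
    ∃ c : ℕ → ℕ → ℤ, x = ∑ i ∈ Finset.range q, ∑ j ∈ Finset.range r,
      (c i j : K) * (V ^ i * D ^ j) := by
  classical
  have hx : x ∈ AddSubgroup.closure {x | ∃ i < q, ∃ j < r, x = V ^ i * D ^ j} :=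
    h ▸ AddSubgroup.mem_top x
  induction hx using AddSubgroup.closure_induction with
  | mem x hx =>
    obtain ⟨i, hi, j, hj, rfl⟩ := hx
    refine ⟨fun i' j' => if i' = i ∧ j' = j then 1 else 0, ?_⟩
    rw [Finset.sum_eq_single i, Finset.sum_eq_single j]
    · simp
    · intro j' _ hne
      simp [hne]
    · exact fun h => absurd (Finset.mem_range.mpr hj) h
    · intro i' _ hne
      simp [hne]
    · exact fun h => absurd (Finset.mem_range.mpr hi) h
  | zero => exact ⟨0, by simp⟩
  | add x y _ _ hx hy =>
    obtain ⟨c, rfl⟩ := hx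
    obtain ⟨d, rfl⟩ := hy
    exact ⟨c + d, by simp [add_mul, Finset.sum_add_distrib]⟩
  | neg x _ hx =>
    obtain ⟨c, rfl⟩ := hx
    exact ⟨-c, by simp [Finset.sum_neg_distrib]⟩

theorem exists_ringEquiv {A B C : Type*} [Ring A] [Ring B] [Ring C] {f : A →+* C} {g : B →+* C}
    (hf : Function.Injective f) (hg : Function.Injective g) (hfg : ∀ a, ∃ b, g b = f a)
    (hgf : ∀ b, ∃ a, f a = g b) : ∃ e : A ≃+* B, ∀ b, f (e.symm b) = g b := by
  choose φ hφ using hfg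
  choose χ hχ using hgf
  exact ⟨{ toFun := φ
           invFun := χ
           left_inv := fun a => hf (by rw [hχ, hφ])
           right_inv := fun b => hg (by rw [hφ, hχ])
           map_mul' := fun a a' => hg (by rw [map_mul, hφ, hφ, hφ, map_mul])
           map_add' := fun a a' => hg (by rw [map_add, hφ, hφ, hφ, map_add]) }, hχ⟩

variable {F k Hd : Type} [Field F] [Fintype F] [Field k] [Algebra F k] [Group Hd]
  {inc : Hd →* GL (Fin 2) F} {r : ℕ}

theorem IsDetPowOne.closure_eq_top (p : ℕ) [Fact p.Prime] [CharP F p] [CharP k p] [IsAlgClosed k]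
    [Finite Hd] (S : IsDetPowOne inc r) :
    AddSubgroup.closure {x : KAlg k Hd | ∃ i < Fintype.card F, ∃ j < r,
      x = KAlg.mk (natRep k inc) ^ i * KAlg.mk (detRep k inc) ^ j} = ⊤ := by
  have hcard : ∀ t : Finset (KAlg k Hd), (t : Set (KAlg k Hd)) ⊆
      {a | ∃ M : FDRep k Hd, Representation.IsIrreducible M.ρ ∧ a = KAlg.mk M} →
      t.card ≤ Fintype.card F * r := by
    intro t ht
    choose L hL hL' using fun i : Fin t.card => ht (t.equivFin.symm i).2
    refine S.card_le p hL fun i j ⟨e⟩ => ?_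
    apply t.equivFin.symm.injective
    apply Subtype.ext
    rw [hL', hL', KAlg.isAdditive_mk.eq_of_iso e]
  have hfin : {a : KAlg k Hd | ∃ M : FDRep k Hd,
      Representation.IsIrreducible M.ρ ∧ a = KAlg.mk M}.Finite := by
    by_contra h
    obtain ⟨t, ht, ht'⟩ := Set.Infinite.exists_subset_card_eq h (Fintype.card F * r + 1)
    have := hcard t ht
    omega
  refine closure_eq_top_of_gram S.pos (G := hfin.toFinset)
    (by rw [Set.Finite.coe_toFinset, KAlg.closure_irreducible])
    (hcard _ (by rw [Set.Finite.coe_toFinset])) (S.isAdditive_stRank (k := k)).lift _ _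
    fun a b ha => S.stRank_pow_mul b ha

variable {κ : kˣ →* Qbarˣ}

omit [Fintype F] in
theorem brauer_natRep {x : Hd} {y : Fin 2 → kˣ} (h : HasEigenvalues (inc x).1 y) :
    brauer κ (natRep k inc) x = κ (y 0) + κ (y 1) := by
  classical
  have h1 : ((natRep k inc).ρ x).charpoly.roots = {(y 0 : k), (y 1 : k)} := by
    have h2 : LinearMap.charpoly (Matrix.toLin' ((inc x).1.map (algebraMap F k))) =
        (Polynomial.X - Polynomial.C (y 0 : k)) * (Polynomial.X - Polynomial.C (y 1 : k)) := by
      rw [Matrix.charpoly_toLin', h, Fin.prod_univ_two]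
    refine (congrArg Polynomial.roots h2).trans ?_
    rw [Polynomial.roots_mul (mul_ne_zero (Polynomial.X_sub_C_ne_zero _)
      (Polynomial.X_sub_C_ne_zero _)), Polynomial.roots_X_sub_C, Polynomial.roots_X_sub_C]
    rfl
  rw [brauer, h1]
  simp

omit [Fintype F] in
theorem brauer_detRep {x : Hd} {y : Fin 2 → kˣ} (h : HasEigenvalues (inc x).1 y) :
    brauer κ (detRep k inc) x = κ (y 0 * y 1) := by
  rw [brauer_eq_sum κ (M := detRep k inc) (Module.Basis.singleton Unit k)
    (mu := fun _ => y 0 * y 1)]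
  · simp
  · intro i
    have h1 : (detRep k inc).ρ x = algebraMap F k (inc x).1.det • (LinearMap.id : k →ₗ[k] k) := rfl
    rw [h1, (hasEigenvalues_iff.mp h).2]
    rfl

end KStructure


/-! ### The Grothendieck ring as a ring of functions -/

section Comparison

open MonoidalCategory

variable {p : ℕ} {F k : Type} [Field F] [Fintype F] [Field k]
  [Algebra F k] {H Hd : Type} [Group H] [Finite H] [Group Hd] {π : GL (Fin 2) F →* H}
  {ι : Additive kˣ ≃+ QModZ p} {inc : Hd →* GL (Fin 2) F} {κ : kˣ →* Qbarˣ}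
  {X : Type} [AddCommGroup X] {pr : (Fin 2 → ℤ) →+ X} {s : X →+ X} {W : Set (X →+ X)}
  {z : AddMonoidAlgebra ℤ X →ₗ[ℤ] MonoidAlgebra Qbar H} {ψ : AddChar F Qbar}
  {IsRho : Hd → FDRep Qbar H → Prop} {IsPoint : Hd → (Multiplicative X →* Qbarˣ) → Prop}

/-- The homomorphism from the Grothendieck ring to functions given by Brauer characters. -/
def evalK [IsAlgClosed k] (κ : kˣ →* Qbarˣ) (IsRho : Hd → FDRep Qbar H → Prop)
    (IsPoint : Hd → (Multiplicative X →* Qbarˣ) → Prop)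
    (h : ∀ {x V}, IsRho x V → (orderOf x : k) ≠ 0) :
    KAlg k Hd →+* (PointIndex IsRho IsPoint → Qbar) :=
  IsAdditive.ringLift (φ := fun M i => brauer κ M i.1.1)
    (fun _ _ _ _ _ hfg => funext fun i => brauer_add κ hfg (h i.2.2.choose_spec))
    (funext fun i => brauer_unit κ i.1.1)
    (fun M N => funext fun i => brauer_tensor κ M N (h i.2.2.choose_spec))

omit [Finite H] in
theorem evalK_mk [IsAlgClosed k] (h : ∀ {x V}, IsRho x V → (orderOf x : k) ≠ 0) (M : FDRep k Hd) :
    evalK κ IsRho IsPoint h (KAlg.mk M) = fun i => brauer κ M i.1.1 :=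
  IsAdditive.ringLift_mk _ _ _ M

theorem evalB_sym (S : Separates π ψ W IsRho IsPoint z) (D : DualDatum pr s W)
    (hpt : ∀ {x t}, IsPoint x t → ∃ y : Fin 2 → kˣ, HasEigenvalues (inc x).1 y ∧
      ∀ mu, t (Multiplicative.ofAdd (pr mu)) = κ (charVal mu y)) :
    evalB S (D.sym _) = fun i => brauer κ (natRep k inc) i.1.1 := by
  funext i
  obtain ⟨y, hy, ht⟩ := hpt i.2.1
  rw [brauer_natRep hy, DualDatum.sym, evalB_mk]
  change evalAt i.1.2 (symElt pr) = _
  rw [symElt, evalAt, map_add, AddMonoidAlgebra.lift_single, AddMonoidAlgebra.lift_single, one_smul,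
    one_smul]
  change ((i.1.2 (Multiplicative.ofAdd (pr ![1, 0])) : Qbarˣ) : Qbar) +
    ((i.1.2 (Multiplicative.ofAdd (pr ![0, 1])) : Qbarˣ) : Qbar) = _
  rw [ht, ht]
  simp [charVal, Fin.prod_univ_two]

theorem evalB_const (S : Separates π ψ W IsRho IsPoint z) (D : DualDatum pr s W)
    (hpt : ∀ {x t}, IsPoint x t → ∃ y : Fin 2 → kˣ, HasEigenvalues (inc x).1 y ∧
      ∀ mu, t (Multiplicative.ofAdd (pr mu)) = κ (charVal mu y)) :
    evalB S (D.const _ 1) = fun i => brauer κ (detRep k inc) i.1.1 := by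
  funext i
  obtain ⟨y, hy, ht⟩ := hpt i.2.1
  rw [brauer_detRep hy, DualDatum.const, evalB_mk]
  change evalAt i.1.2 (AddMonoidAlgebra.single (pr ![1, 1]) 1) = _
  rw [evalAt, AddMonoidAlgebra.lift_single, one_smul]
  change ((i.1.2 (Multiplicative.ofAdd (pr ![1, 1])) : Qbarˣ) : Qbar) = _
  rw [ht]
  simp [charVal, Fin.prod_univ_two]

/-- In B and in K every element is an integral combination of the corresponding monomials, with the
same values at the points. Independence of these functions shows that both rings embed with the same
image, which gives the integral isomorphism of B with K; the passage to E follows from the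
commensurability of B and E. -/
theorem canonicalIsosRestrict_of_isDetPowOne [Fact p.Prime] [CharP F p] [IsAlgClosed k] [Finite Hd]
    (S : Separates π ψ W IsRho IsPoint z) (D : DualDatum pr s W)
    (hz : ∀ mu, z (AddMonoidAlgebra.single (pr mu) 1) = zElt π ι mu) {r : ℕ}
    (hr : IsScalarOrder π r) (hd : D.const (Fintype.card F) r = 1) (hinc : IsDetPowOne inc r)
    (hreg : ∀ {x V}, IsRho x V → (orderOf x).Coprime p)
    (hpt : ∀ {x t}, IsPoint x t → ∃ y : Fin 2 → kˣ, HasEigenvalues (inc x).1 y ∧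
      ∀ mu, t (Multiplicative.ofAdd (pr mu)) = κ (charVal mu y)) :
    CanonicalIsosRestrict p (π.comp (uGL F)) W (Fintype.card F) κ IsRho IsPoint := by
  have hchar : CharP k p := charP_of_injective_algebraMap (algebraMap F k).injective p
  have hreg' : ∀ {x V}, IsRho x V → (orderOf x : k) ≠ 0 := by
    intro x V h h0
    rw [CharP.cast_eq_zero_iff k p] at h0
    have := Nat.Coprime.eq_one_of_dvd (hreg h).symm h0
    exact (Fact.out : p.Prime).one_lt.ne' this
  have hinj := evalB_injective S D hz hr hd
  let ηK := evalK κ IsRho IsPoint hreg'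
  have hV : ηK (KAlg.mk (natRep k inc)) = evalB S (D.sym _) := by
    rw [evalK_mk, evalB_sym S D hpt]
  have hD : ηK (KAlg.mk (detRep k inc)) = evalB S (D.const _ 1) := by
    rw [evalK_mk, evalB_const S D hpt]
  have hsum : ∀ c : ℕ → ℕ → ℤ, ηK (∑ i ∈ Finset.range (Fintype.card F), ∑ j ∈ Finset.range r,
      (c i j : KAlg k Hd) * (KAlg.mk (natRep k inc) ^ i * KAlg.mk (detRep k inc) ^ j)) =
      evalB S (∑ i ∈ Finset.range (Fintype.card F), ∑ j ∈ Finset.range r,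
        (c i j : BAlg W (Fintype.card F)) * (D.sym _ ^ i * D.const _ 1 ^ j)) := by
    intro c
    simp only [map_sum, map_mul, map_pow, map_intCast, hV, hD]
  have hK := exists_eq_sum_of_closure (hinc.closure_eq_top (k := k) p)
  have hηK : Function.Injective ηK := by
    rw [injective_iff_map_eq_zero]
    intro a ha
    obtain ⟨c, rfl⟩ := hK a
    rw [hsum] at ha
    have h0 := (injective_iff_map_eq_zero (evalB S)).mp hinj _ ha
    have hc := coeff_eq_zero_of_sum_eq_zero S D hz hr (c := c) (by rw [h0, map_zero])
    refine Finset.sum_eq_zero fun i hi => Finset.sum_eq_zero fun j hj => ?_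
    rw [hc i (Finset.mem_range.mp hi) j (Finset.mem_range.mp hj), Int.cast_zero, zero_mul]
  obtain ⟨β, hβ⟩ := exists_ringEquiv hinj hηK
    (fun b => by
      obtain ⟨c, rfl⟩ := D.exists_eq_sum Fintype.one_lt_card hr.pos hd b
      exact ⟨_, hsum c⟩)
    (fun a => by
      obtain ⟨c, rfl⟩ := hK a
      exact ⟨_, (hsum c).symm⟩)
  refine canonicalIsosRestrict_of (Fact.out : p.Prime).ne_zero S (etaB_injective S D hz hr hd)
    (exists_smul_etaB_eq S D hz) (exists_smul_etaE_eq S D hz hr) β fun M i => ?_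
  rw [hβ, evalK_mk]

end Comparison


/-! ### The groups `GL₂` and `PGL₂` -/

section Instances

variable {p : ℕ} [Fact p.Prime] {F k : Type} [Field F] [Fintype F] [CharP F p] [Field k]
  [Algebra F k] [IsAlgClosed k] {κ : kˣ →* Qbarˣ}

theorem mapDomainAlgHom_id {X : Type} [AddCommGroup X] (f : AddMonoidAlgebra ℤ X) :
    AddMonoidAlgebra.mapDomainAlgHom ℤ ℤ (AddMonoidHom.id X) f = f := by
  simp

theorem dualDatum_GL : DualDatum (AddMonoidHom.id (Fin 2 → ℤ)) swapHom weylGL where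
  surj := fun x => ⟨x, rfl⟩
  sub_eq := by
    rintro mu nu rfl
    rfl
  swap := fun _ => rfl
  mem_iff := by
    intro f
    rw [mem_invariants]
    refine ⟨fun h => h _ swapHom_mem, ?_⟩
    rintro h _ ⟨w, rfl⟩
    rcases perm_fin_two w with rfl | rfl
    · exact mapDomainAlgHom_id f
    · exact h

theorem isDetPowOne_GL : IsDetPowOne (MonoidHom.id (GL (Fin 2) F)) (Fintype.card F - 1) where
  inj := Function.injective_id
  det_pow := fun x => FiniteField.pow_card_sub_one_eq_one _ (det_ne_zero_GL x)
  exists_eq := fun g _ => ⟨g, rfl⟩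
  cases := Or.inr (Nat.sub_add_cancel Fintype.card_pos)

theorem canonicalIsosRestrict_GL (ι : Additive kˣ ≃+ QModZ p) (hκ : Function.Injective κ)
    {ψ : AddChar F Qbar} (hψ : ψ ≠ 1) :
    CanonicalIsosRestrict p (uGL F) weylGL (Fintype.card F) κ (IsRhoGL ι κ ψ)
      (IsPointGL (F := F) κ) := by
  have hq : Fintype.card F - 1 + 1 = Fintype.card F := Nat.sub_add_cancel Fintype.card_pos
  refine canonicalIsosRestrict_of_isDetPowOne (ι := ι) (π := MonoidHom.id (GL (Fin 2) F))
    (separates_GL (ι := ι) hκ hψ) dualDatum_GL ?_ (Or.inl ⟨hq, Function.injective_id⟩)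
    (dualDatum_GL.const_eq_one Fintype.one_lt_card (Or.inl hq)) isDetPowOne_GL (fun h => h.1)
    (fun h => h)
  intro mu
  exact (extendLinear_single _ _ _).trans (one_smul ℤ _)

omit [Fintype F] in
theorem toPGL_sc (c : Fˣ) : toPGL F (sc c) = 1 := by
  simpa using toPGL_sc_mul c 1

/-- The projection `ℤ² → ℤ` from the characters of the maximal torus of `GL₂` to those of the
maximal torus of `SL₂`. -/
def subHom : (Fin 2 → ℤ) →+ ℤ := Pi.evalAddMonoidHom (fun _ => ℤ) 0 - Pi.evalAddMonoidHom (fun _ => ℤ) 1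

theorem subHom_apply (mu : Fin 2 → ℤ) : subHom mu = mu 0 - mu 1 := rfl

theorem dualDatum_PGL : DualDatum subHom (-AddMonoidHom.id ℤ) weylSL where
  surj := fun n => ⟨![n, 0], sub_zero n⟩
  sub_eq := fun h => h
  swap := fun mu => (neg_sub (mu 0) (mu 1)).symm
  mem_iff := by
    intro f
    rw [mem_invariants]
    refine ⟨fun h => h _ (Or.inr rfl), ?_⟩
    rintro h _ (rfl | rfl)
    · exact mapDomainAlgHom_id f
    · exact h

omit [IsAlgClosed k] in
-- Subtracting the constant weight (mu 1, mu 1) multiplies the dual elements of both tori by the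
-- inverse of one scalar over F, and scalars become trivial in PGL₂.
theorem zElt_toPGL (ι : Additive kˣ ≃+ QModZ p) (mu : Fin 2 → ℤ) :
    zElt (toPGL F) ι ![mu 0 - mu 1, 0] = zElt (toPGL F) ι mu := by
  obtain ⟨c, hc⟩ := exists_dualElt_const (F := F) (ι := ι) (mu 1)
  have hmu : ![mu 1, mu 1] + ![mu 0 - mu 1, 0] = mu := by
    funext i
    fin_cases i <;> simp
  have key : ∀ w, push (toPGL F) (torusSum F w (dualElt ι (Fintype.card F) w mu)) =
      push (toPGL F) (torusSum F w (dualElt ι (Fintype.card F) w ![mu 0 - mu 1, 0])) := by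
    intro w
    have h1 := isDual_dualElt F ι w ![mu 0 - mu 1, 0]
    have h2 := dualElt_eq (isDual_add (isDual_dualElt F ι w ![mu 1, mu 1]) h1)
    rw [hmu] at h2
    have h3 : dualElt ι (Fintype.card F) w ![mu 1, mu 1] =
        fun _ => Units.map (algebraMap F k).toMonoidHom c :=
      funext fun i => Units.ext (hc w i)
    rw [h2, h3, ← sc_mul_torusSum (mem_torus_of_isDual ι h1), map_mul, push_single, toPGL_sc,
      Int.cast_one, ← MonoidAlgebra.one_def, one_mul]
  simp only [zElt, zTorus, map_sub, key]

theorem isDetPowOne_SL :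
    IsDetPowOne (Matrix.SpecialLinearGroup.toGL : Matrix.SpecialLinearGroup (Fin 2) F →* _) 1 where
  inj := fun _ _ h => Subtype.ext (congrArg Units.val h)
  det_pow := fun x => (pow_one _).trans x.2
  exists_eq := fun g hg => ⟨⟨g.1, (pow_one _).symm.trans hg⟩, Units.ext rfl⟩
  cases := Or.inl rfl

theorem canonicalIsosRestrict_PGL (ι : Additive kˣ ≃+ QModZ p) (hκ : Function.Injective κ)
    {ψ : AddChar F Qbar} (hψ : ψ ≠ 1) :
    CanonicalIsosRestrict p (uPGL F) weylSL (Fintype.card F) κ (IsRhoPGL ι κ ψ)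
      (IsPointSL (F := F) κ) := by
  refine canonicalIsosRestrict_of_isDetPowOne (ι := ι) (separates_PGL (ι := ι) hκ hψ) dualDatum_PGL ?_
    (Or.inr ⟨rfl, toPGL_sc, fun g hg => Matrix.ProjGenLinGroup.mk_eq_one.mp hg⟩)
    (dualDatum_PGL.const_eq_one Fintype.one_lt_card (Or.inr ⟨rfl, rfl⟩)) isDetPowOne_SL
    (fun h => h.1) ?_
  · intro mu
    exact ((extendLinear_single _ _ _).trans (one_smul ℤ _)).trans (zElt_toPGL ι mu)
  · rintro x t ⟨y, hy, ht⟩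
    refine ⟨y, hy, fun mu => (ht _).trans (congrArg κ ?_)⟩
    rw [charVal, Fin.prod_univ_two, mul_eq_one_of_hasEigenvalues hy, subHom_apply, inv_zpow',
      ← zpow_add, sub_eq_add_neg]

end Instances

end GelfandGraevGLTwo

end

theorem mainTheorem8 (p : ℕ) [Fact p.Prime] (F : Type) [Field F] [Fintype F] [CharP F p]
    (ι : Additive (AlgebraicClosure F)ˣ ≃+ GelfandGraevGLTwo.QModZ p)
    (j : GelfandGraevGLTwo.QModZ p →+ Additive GelfandGraevGLTwo.Qbarˣ)
    (hj : Function.Injective j) (ψ : AddChar F GelfandGraevGLTwo.Qbar) (hψ : ψ ≠ 1) :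
    GelfandGraevGLTwo.CanonicalIsosRestrict p (GelfandGraevGLTwo.uGL F)
        GelfandGraevGLTwo.weylGL (Fintype.card F) (GelfandGraevGLTwo.kappa ι j)
        (GelfandGraevGLTwo.IsRhoGL ι (GelfandGraevGLTwo.kappa ι j) ψ)
        (GelfandGraevGLTwo.IsPointGL (F := F) (GelfandGraevGLTwo.kappa ι j)) ∧
      GelfandGraevGLTwo.CanonicalIsosRestrict p (GelfandGraevGLTwo.uPGL F)
        GelfandGraevGLTwo.weylSL (Fintype.card F) (GelfandGraevGLTwo.kappa ι j)
        (GelfandGraevGLTwo.IsRhoPGL ι (GelfandGraevGLTwo.kappa ι j) ψ)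
        (GelfandGraevGLTwo.IsPointSL (F := F) (GelfandGraevGLTwo.kappa ι j)) := by
  have hκ : Function.Injective (GelfandGraevGLTwo.kappa ι j) := fun a b h =>
    Additive.ofMul.injective (ι.injective (hj (congrArg Additive.ofMul h)))
  exact ⟨GelfandGraevGLTwo.canonicalIsosRestrict_GL ι hκ hψ,
    GelfandGraevGLTwo.canonicalIsosRestrict_PGL ι hκ hψ⟩
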